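/- Let $\mathbb F$ be an algebraically closed field of characteristic $p>3$, let $\alpha\in\mathbb F$ with $\alpha\ne 0,-1$, and let $\mathfrak g=D(2,1;\alpha)$. Its even part is $\mathfrak{sl}_2\oplus\mathfrak{sl}_2\oplus\mathfrak{sl}_2$ with standard bases $h_i,e_i,f_i$ ($i=1,2,3$), and its odd part $V_1\otimes V_2\otimes V_3$ (natural modules, with bases $\omega_{\pm i}$ of $V_i$) has the basis $x_1=\omega_1\otimes\omega_2\otimes\omega_3$, $x_2=\omega_1\otimes\omega_2\otimes\omega_{-3}$, $x_3=\omega_1\otimes\omega_{-2}\otimes\omega_3$, $x_4=\omega_1\otimes\omega_{-2}\otimes\omega_{-3}$, together with $y_k$, obtained from $x_k$ by replacing $\omega_1$ by $\omega_{-1}$; here $e_i\omega_{-i}=\omega_i$ and $f_i\omega_i=\omega_{-i}$. The nonzero products of odd basis elements are $$\begin{aligned} &[x_1,y_2]=-2e_2,\quad [x_1,y_3]=-2\alpha e_3,\quad [x_1,y_4]=-(1+\alpha)h_1+h_2+\alpha h_3,\\ &[x_2,y_1]=2e_2,\quad [x_2,y_4]=2\alpha f_3,\quad [x_2,y_3]=(1+\alpha)h_1-h_2+\alpha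 h_3,\\ &[x_3,y_1]=2\alpha e_3,\quad [x_3,y_4]=2f_2,\quad [x_3,y_2]=(1+\alpha)h_1+h_2-\alpha h_3,\\ &[x_4,y_2]=-2\alpha f_3,\quad [x_4,y_3]=-2f_2,\quad [x_4,y_1]=-(1+\alpha)h_1-h_2-\alpha h_3,\\ &[y_2,y_3]=2(1+\alpha)f_1,\quad [y_1,y_4]=-2(1+\alpha)f_1,\quad [x_2,x_3]=-2(1+\alpha)e_1,\quad [x_1,x_4]=2(1+\alpha)e_1 \end{aligned}$$ (symmetric in the two arguments). The $p$-mapping on $\mathfrak g_{\bar 0}$ is the one with $h_i^{[p]}=h_i$ and $e_i^{[p]}=f_i^{[p]}=0$. Let $\mathfrak h=\mathrm{span}\{h_1,h_2,h_3\}$ and $\mathfrak n^+=\mathrm{span}\{e_i,x_k\}$, let $\chi\in\mathfrak g_{\bar 0}^*$ vanish on $\mathfrak n^+_{\bar 0}$, and let $\lambda\in\mathfrak h^*$ satisfy $\lambda(h)^p-\lambda(h^{[p]})=\chi(h)^p$ for all $h\in\mathfrak h$. Write $\lambda=(\lambda_1,\lambda_2,\lambda_3)$ with $\lambda_i=\lambda(h_i)$,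 and let $\epsilon_i\in\mathfrak h^*$ be given by $\epsilon_i(h_j)=\delta_{ij}$. Let $Z=Z_\chi(\lambda)=u_\chi(\mathfrak g)\otimes_{u_\chi(\mathfrak h\oplus\mathfrak n^+)}\mathbb F v$ be the baby Verma module, where $v$ is even, $hv=\lambda(h)v$ and $\mathfrak n^+v=0$; here $u_\chi$ denotes the $\chi$-reduced enveloping algebra, the quotient of the enveloping algebra by the relations $a^p-a^{[p]}=\chi(a)^p$ for even $a$. A linear map $\varphi:\mathfrak g\to Z$ that is homogeneous of parity $|\varphi|$ is a superderivation if $\varphi([x,y])=(-1)^{|\varphi||x|}x\varphi(y)-(-1)^{|y|(|\varphi|+|x|)}y\varphi(x)$ for homogeneous $x,y$. Let $\mathrm{Der}$ be the span of all of these, and let $\mathrm{Ider}$ be the span of the inner ones $\mathfrak D_m(x)=(-1)^{|x||m|}xm$ with $m\in Z$ homogeneous. The subscript $(0)$ denotes the maps with $\varphi(\mathfrak g_\beta)\subseteq Z_\beta$ for all $\beta\in\mathfrak h^*$. A superderivation is outer if it lies in $\mathrm{Der}$ but not in $\mathrm{Ider}$. For $\beta=\beta_1\epsilon_1+\beta_2\epsilon_2+\beta_3\epsilon_3$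 with integers $\beta_i$ and $\theta=(j_1,j_2,j_3,j_4)\in\{0,1\}^4$ put $$w_\beta^\theta=f_1^{n_1}f_2^{n_2}f_3^{n_3}y_1^{j_1}y_2^{j_2}y_3^{j_3}y_4^{j_4}\otimes v,$$ where $n_1,n_2,n_3\in\{0,\dots,p-1\}$ represent the classes of $\frac{\lambda_1-\beta_1-j_1-j_2-j_3-j_4}{2}$, $\frac{\lambda_2-\beta_2+j_1+j_2-j_3-j_4}{2}$, $\frac{\lambda_3-\beta_3+j_1-j_2+j_3-j_4}{2}$; put $w_\beta^\theta=0$ if one of these is not in the prime field. Below, in the formula for the image of a root vector, $w^\theta$ means $w^\theta_\beta$ with $\beta$ the root of that vector; in the formula for $\psi_1(h_i)$ it means $w_0^\theta$. Images of basis elements not listed are zero. For $a=(a_1,a_2,a_3)$ and $b=(b_1,b_2,b_3)$ in $\mathbb F^3$ write $L_{\sigma\tau}=(1+\alpha)a_1+\sigma a_2+\tau\alpha a_3$ for signs $\sigma,\tau$, and $d=(1+\alpha)b_1$. The map $\psi_1=\psi_1(a,b)$ is $$\begin{aligned} h_i&\mapsto a_iw^{1111},\qquad f_i\mapsto b_iw^{1111}\qquad(i=1,2,3),\\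 e_1&\mapsto 2b_2w^{1100}-2\alpha b_3w^{1010}+L_{-+}w^{1001}-L_{--}w^{0110}-a_1w^{1111}-8d\,w^{0000},\\ e_2&\mapsto -a_2w^{1111}+2d\,w^{1100},\qquad e_3\mapsto -a_3w^{1111},\\ x_1&\mapsto L_{--}w^{1110}+L_{-+}w^{1101}-L_{+-}w^{1011}-L_{++}w^{0111}+4d(w^{1000}+w^{0100}+w^{0010}+w^{0001}),\\ x_2&\mapsto -2\alpha b_3w^{1110}+L_{-+}w^{1101}+2\alpha b_3w^{1011}-L_{++}w^{0111}+4d(w^{0100}+w^{0001}),\\ x_3&\mapsto -2b_2w^{1110}-2b_2w^{1101}-L_{+-}w^{1011}-L_{++}w^{0111}+4d(w^{0010}+w^{0001}),\\ x_4&\mapsto -2b_2w^{1101}+2\alpha b_3w^{1011}-L_{++}w^{0111}+4d\,w^{0001},\\ y_1&\mapsto -2d(w^{1011}+w^{0111}),\quad y_2\mapsto -2d\,w^{0111},\quad y_3\mapsto -2d(w^{1011}+w^{0111}),\quad y_4\mapsto -2d\,w^{0111}. \end{aligned}$$ For $c\in\mathbb F$ the maps $\psi_j=\psi_j(c)$,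 $j=2,3,4$, are $$\begin{aligned} \psi_2:&\quad e_1\mapsto 2\alpha c\,w^{0101},\ e_3\mapsto c\,w^{1111},\ x_1\mapsto 2\alpha c(w^{0111}-w^{1101}),\ x_3\mapsto 2\alpha c\,w^{0111};\\ \psi_3:&\quad e_1\mapsto -2c\,w^{0011},\ e_2\mapsto c\,w^{1111},\ x_1\mapsto 2c(w^{1011}+w^{0111}),\ x_2\mapsto 2c\,w^{0111};\\ \psi_4:&\quad e_1\mapsto c\,w^{1110},\ x_1\mapsto -\tfrac{\lambda_2+1}{2}\tfrac{\lambda_3+1}{2}c\,w^{1111},\ x_2\mapsto \tfrac{\lambda_2+1}{2}c\,w^{1111},\ x_3\mapsto \tfrac{\lambda_3+1}{2}c\,w^{1111},\ x_4\mapsto -c\,w^{1111}. \end{aligned}$$ Say that $(\lambda,\chi)$ is $j$-special if $\chi(f_1)^p=\chi(f_2)^p=\chi(f_3)^p=0$ and $\lambda$ equals, in $\mathbb F^3$, $(2p+2,2p-2,2p-2)$ for $j=1$, $(2p+2,2p-2,2p)$ for $j=2$, $(2p+2,2p,2p-2)$ for $j=3$, and $(2p+3,2p-3,2p-3)$ for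 $j=4$. Suppose $\chi(f_1)^p=0$. Then: 1. Every $\varphi\in\mathrm{Der}(\mathfrak g,Z)_{(0)}$ is $\varphi_1+\varphi_2$ with $\varphi_1\in\mathrm{Ider}(\mathfrak g,Z)_{(0)}$ and $\varphi_2$ in the span of the maps $\psi_j$ (with arbitrary parameters) for those $j\in\{1,2,3,4\}$ for which $(\lambda,\chi)$ is $j$-special; in particular $\varphi$ is inner if there is no such $j$. 2. If $(\lambda,\chi)$ is $j$-special, then $\psi_j$ is, for all parameters, a homogeneous superderivation of weight zero, even for $j=1,2,3$ and odd for $j=4$. 3. For each $j$, the map $\psi_j$ with given parameters is outer if and only if $(\lambda,\chi)$ is $j$-special and the parameters are not all zero. -/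

import Mathlib

noncomputable section

open scoped TensorProduct

namespace D21

/-! The Lie superalgebra `D(2,1;α)` -/

/-- Labels of the 17 basis vectors.  The odd ones are
`x1 = ω₁⊗ω₂⊗ω₃`, `x2 = ω₁⊗ω₂⊗ω₋₃`, `x3 = ω₁⊗ω₋₂⊗ω₃`, `x4 = ω₁⊗ω₋₂⊗ω₋₃`, and `yₖ` is `xₖ` with
`ω₁` replaced by `ω₋₁`. -/
inductive Idx : Type
  | h1 | h2 | h3 | e1 | e2 | e3 | f1 | f2 | f3
  | x1 | x2 | x3 | x4 | y1 | y2 | y3 | y4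

open Idx

/-- Parity of a basis vector. -/
def par : Idx → ZMod 2
  | h1 | h2 | h3 | e1 | e2 | e3 | f1 | f2 | f3 => 0
  | x1 | x2 | x3 | x4 | y1 | y2 | y3 | y4 => 1

/-- The three Cartan elements `h₁, h₂, h₃`. -/
def hIdx : Fin 3 → Idx := ![h1, h2, h3]

/-- The three even positive root vectors `e₁, e₂, e₃`. -/
def eIdx : Fin 3 → Idx := ![e1, e2, e3]

/-- The three even negative root vectors `f₁, f₂, f₃`. -/
def fIdx : Fin 3 → Idx := ![f1, f2, f3]

/-- The Koszul sign `(-1)^i`. -/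
def sgn (F : Type*) [Field F] (i : ZMod 2) : F := if i = 0 then 1 else -1

/-- The underlying 17-dimensional vector space. -/
abbrev G (F : Type*) [Field F] : Type _ := Idx →₀ F

variable {F : Type*} [Field F]

/-- The basis vector with a given label. -/
def bv (b : Idx) : G F := Finsupp.single b 1

/-- The nonzero products of basis vectors, every unordered pair being listed in one order only. -/
def table (α : F) : Idx → Idx → G F
  -- the three copies of sl(2)
  | e1, f1 => bv h1
  | e2, f2 => bv h2
  | e3, f3 => bv h3
  | h1, e1 => (2 : F) • bv e1
  | h2, e2 => (2 : F) • bv e2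
  | h3, e3 => (2 : F) • bv e3
  | h1, f1 => (-2 : F) • bv f1
  | h2, f2 => (-2 : F) • bv f2
  | h3, f3 => (-2 : F) • bv f3
  -- the first copy acting on the odd part
  | h1, x1 => bv x1
  | h1, x2 => bv x2
  | h1, x3 => bv x3
  | h1, x4 => bv x4
  | h1, y1 => -bv y1
  | h1, y2 => -bv y2
  | h1, y3 => -bv y3
  | h1, y4 => -bv y4
  | e1, y1 => bv x1
  | e1, y2 => bv x2
  | e1, y3 => bv x3
  | e1, y4 => bv x4
  | f1, x1 => bv y1
  | f1, x2 => bv y2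
  | f1, x3 => bv y3
  | f1, x4 => bv y4
  -- the second copy acting on the odd part
  | h2, x1 => bv x1
  | h2, x2 => bv x2
  | h2, x3 => -bv x3
  | h2, x4 => -bv x4
  | h2, y1 => bv y1
  | h2, y2 => bv y2
  | h2, y3 => -bv y3
  | h2, y4 => -bv y4
  | e2, x3 => bv x1
  | e2, x4 => bv x2
  | e2, y3 => bv y1
  | e2, y4 => bv y2
  | f2, x1 => bv x3
  | f2, x2 => bv x4
  | f2, y1 => bv y3
  | f2, y2 => bv y4
  -- the third copy acting on the odd part
  | h3, x1 => bv x1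
  | h3, x2 => -bv x2
  | h3, x3 => bv x3
  | h3, x4 => -bv x4
  | h3, y1 => bv y1
  | h3, y2 => -bv y2
  | h3, y3 => bv y3
  | h3, y4 => -bv y4
  | e3, x2 => bv x1
  | e3, x4 => bv x3
  | e3, y2 => bv y1
  | e3, y4 => bv y3
  | f3, x1 => bv x2
  | f3, x3 => bv x4
  | f3, y1 => bv y2
  | f3, y3 => bv y4
  -- products of odd elements
  | x1, y2 => (-2 : F) • bv e2
  | x1, y3 => (-2 * α) • bv e3
  | x1, y4 => -((1 + α) • bv h1) + bv h2 + α • bv h3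
  | x2, y1 => (2 : F) • bv e2
  | x2, y4 => (2 * α) • bv f3
  | x2, y3 => (1 + α) • bv h1 - bv h2 + α • bv h3
  | x3, y1 => (2 * α) • bv e3
  | x3, y4 => (2 : F) • bv f2
  | x3, y2 => (1 + α) • bv h1 + bv h2 - α • bv h3
  | x4, y2 => (-2 * α) • bv f3
  | x4, y3 => (-2 : F) • bv f2
  | x4, y1 => -((1 + α) • bv h1) - bv h2 - α • bv h3
  | y2, y3 => (2 * (1 + α)) • bv f1
  | y1, y4 => (-2 * (1 + α)) • bv f1
  | x2, x3 => (-2 * (1 + α)) • bv e1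
  | x1, x4 => (2 * (1 + α)) • bv e1
  | _, _ => 0

/-- The bracket of two basis vectors: the super-skew-symmetric extension of the table. -/
def brBasis (α : F) (a b : Idx) : G F :=
  table α a b - sgn F (par a * par b) • table α b a

/-- The bracket of `D(2,1;α)`. -/
def bracket (α : F) : G F →ₗ[F] G F →ₗ[F] G F :=
  Finsupp.linearCombination F fun a => Finsupp.linearCombination F fun b => brBasis α a b

/-- The even part (`i = 0`) and the odd part (`i = 1`). -/
def gPart (F : Type*) [Field F] (i : ZMod 2) : Submodule F (G F) :=
  Submodule.span F {v | ∃ b, par b = i ∧ v = bv b}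

/-- The Cartan subalgebra, spanned by `h₁, h₂, h₃`. -/
def cartan (F : Type*) [Field F] : Submodule F (G F) :=
  Submodule.span F (Set.range fun i => bv (hIdx i))

/-- The labels of `𝔥 ⊕ 𝔫⁺`. -/
def borelIdx : Set Idx := {h1, h2, h3, e1, e2, e3, x1, x2, x3, x4}

/-- The subalgebra `𝔥 ⊕ 𝔫⁺`. -/
def borel (F : Type*) [Field F] : Submodule F (G F) :=
  Submodule.span F {v | ∃ b ∈ borelIdx, v = bv b}

/-- The `p`-mapping on the even basis vectors: `hᵢ ↦ hᵢ`, `eᵢ ↦ 0`, `fᵢ ↦ 0`. -/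
def pMap : Idx → G F
  | h1 => bv h1
  | h2 => bv h2
  | h3 => bv h3
  | _ => 0

theorem bv_mem_gPart (b : Idx) : (bv b : G F) ∈ gPart F (par b) :=
  Submodule.subset_span ⟨b, rfl, rfl⟩

theorem par_hIdx (i : Fin 3) : par (hIdx i) = 0 := by fin_cases i <;> rfl

theorem par_eIdx (i : Fin 3) : par (eIdx i) = 0 := by fin_cases i <;> rfl

theorem par_fIdx (i : Fin 3) : par (fIdx i) = 0 := by fin_cases i <;> rfl

/-- An even basis vector as an element of the even part. -/
def evenBv (b : Idx) (hb : par b = 0) : gPart F 0 := ⟨bv b, hb ▸ bv_mem_gPart b⟩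

/-- `hᵢ` as an element of the Cartan subalgebra. -/
def hC (i : Fin 3) : cartan F := ⟨bv (hIdx i), Submodule.subset_span ⟨i, rfl⟩⟩

/-- The value `χ(hᵢ)`. -/
def chiH (χ : Module.Dual F (gPart F 0)) (i : Fin 3) : F := χ (evenBv (hIdx i) (par_hIdx i))

/-- The value `χ(eᵢ)`. -/
def chiE (χ : Module.Dual F (gPart F 0)) (i : Fin 3) : F := χ (evenBv (eIdx i) (par_eIdx i))

/-- The value `χ(fᵢ)`. -/
def chiF (χ : Module.Dual F (gPart F 0)) (i : Fin 3) : F := χ (evenBv (fIdx i) (par_fIdx i))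

/-- `χ` vanishes on the even part of `𝔫⁺`, and `lam ∈ Λ_χ`, that is
`lam(h)^p - lam(h^[p]) = χ(h)^p` on `𝔥`; both sides being `p`-semilinear in `h` and
`hᵢ^[p] = hᵢ`, the latter is a condition on the basis `h₁, h₂, h₃`. -/
structure Admissible (p : ℕ) (χ : Module.Dual F (gPart F 0))
    (lam : Module.Dual F (cartan F)) : Prop where
  chi_nPlus : ∀ i, chiE χ i = 0
  lam_mem : ∀ i, lam (hC i) ^ p - lam (hC i) = chiH χ i ^ p

/-! Reduced enveloping algebras and baby Verma modules -/

/-- The defining relations of the `χ`-reduced enveloping algebra of a subalgebra `S` spanned by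
basis vectors: `ab - (-1)^{|a||b|} ba = [a,b]` for homogeneous `a, b`, and
`a^p - a^[p] = χ(a)^p` for even `a`.  Since `a ↦ a^p - a^[p]` is `p`-semilinear in the enveloping
algebra, the latter is imposed for the even basis vectors, on which `[p]` is given. -/
inductive URel (α : F) (p : ℕ) (χ : Module.Dual F (gPart F 0)) (S : Submodule F (G F)) :
    TensorAlgebra F S → TensorAlgebra F S → Prop
  | comm (i j : ZMod 2) (a b c : S) (ha : (a : G F) ∈ gPart F i) (hb : (b : G F) ∈ gPart F j)
      (hc : (c : G F) = bracket α a b) :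
      URel α p χ S (TensorAlgebra.ι F a * TensorAlgebra.ι F b)
        (sgn F (i * j) • (TensorAlgebra.ι F b * TensorAlgebra.ι F a) + TensorAlgebra.ι F c)
  | pow (b : Idx) (hb : par b = 0) (a c : S) (ha : (a : G F) = bv b) (hc : (c : G F) = pMap b) :
      URel α p χ S (TensorAlgebra.ι F a ^ p)
        (TensorAlgebra.ι F c + algebraMap F (TensorAlgebra F S) (χ (evenBv b hb) ^ p))

/-- The `χ`-reduced enveloping algebra `u_χ(S)`. -/
def U (α : F) (p : ℕ) (χ : Module.Dual F (gPart F 0)) (S : Submodule F (G F)) : Type _ :=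
  RingQuot (URel α p χ S)

instance (α : F) (p : ℕ) (χ : Module.Dual F (gPart F 0)) (S : Submodule F (G F)) :
    Ring (U α p χ S) := inferInstanceAs (Ring (RingQuot (URel α p χ S)))

instance (α : F) (p : ℕ) (χ : Module.Dual F (gPart F 0)) (S : Submodule F (G F)) :
    Algebra F (U α p χ S) := inferInstanceAs (Algebra F (RingQuot (URel α p χ S)))

/-- The quotient map from the tensor algebra. -/
def uMk (α : F) (p : ℕ) (χ : Module.Dual F (gPart F 0)) (S : Submodule F (G F)) :
    TensorAlgebra F S →ₐ[F] U α p χ S := RingQuot.mkAlgHom F (URel α p χ S)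

theorem uMk_rel {α : F} {p : ℕ} {χ : Module.Dual F (gPart F 0)} {S : Submodule F (G F)}
    {x y : TensorAlgebra F S} (h : URel α p χ S x y) : uMk α p χ S x = uMk α p χ S y :=
  RingQuot.mkAlgHom_rel F h

/-- The universal property of `u_χ(S)`. -/
def uLift {α : F} {p : ℕ} {χ : Module.Dual F (gPart F 0)} {S : Submodule F (G F)} {A : Type*}
    [Ring A] [Algebra F A] (g : TensorAlgebra F S →ₐ[F] A)
    (hg : ∀ ⦃x y⦄, URel α p χ S x y → g x = g y) : U α p χ S →ₐ[F] A :=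
  RingQuot.liftAlgHom F ⟨g, hg⟩

/-- The canonical map `S → u_χ(S)`. -/
def uι (α : F) (p : ℕ) (χ : Module.Dual F (gPart F 0)) (S : Submodule F (G F)) :
    S →ₗ[F] U α p χ S :=
  (uMk α p χ S).toLinearMap ∘ₗ TensorAlgebra.ι F

theorem uι_comm (α : F) (p : ℕ) (χ : Module.Dual F (gPart F 0)) (S : Submodule F (G F))
    (i j : ZMod 2) (a b c : S) (ha : (a : G F) ∈ gPart F i) (hb : (b : G F) ∈ gPart F j)
    (hc : (c : G F) = bracket α a b) :
    uι α p χ S a * uι α p χ S b =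
      sgn F (i * j) • (uι α p χ S b * uι α p χ S a) + uι α p χ S c := by
  simpa [uι] using uMk_rel (URel.comm (p := p) (χ := χ) i j a b c ha hb hc)

theorem uι_pow (α : F) (p : ℕ) (χ : Module.Dual F (gPart F 0)) (S : Submodule F (G F))
    (b : Idx) (hb : par b = 0) (a c : S) (ha : (a : G F) = bv b) (hc : (c : G F) = pMap b) :
    uι α p χ S a ^ p = uι α p χ S c + algebraMap F _ (χ (evenBv b hb) ^ p) := by
  have h := uMk_rel (URel.pow (α := α) (p := p) (χ := χ) b hb a c ha hc)
  rw [map_pow, map_add, AlgHom.commutes] at h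
  exact h

/-- The homomorphism `u_χ(S) → u_χ(T)` for `S ⊆ T`. -/
def uMap (α : F) (p : ℕ) (χ : Module.Dual F (gPart F 0)) {S T : Submodule F (G F)} (h : S ≤ T) :
    U α p χ S →ₐ[F] U α p χ T :=
  uLift (TensorAlgebra.lift F (uι α p χ T ∘ₗ Submodule.inclusion h)) (by
    intro x y hxy
    cases hxy with
    | comm i j a b c ha hb hc =>
      simpa using uι_comm α p χ T i j (Submodule.inclusion h a) (Submodule.inclusion h b)
        (Submodule.inclusion h c) ha hb hc
    | pow b hb a c ha hc =>
      rw [map_pow, map_add, AlgHom.commutes]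
      simpa using uι_pow α p χ T b hb (Submodule.inclusion h a) (Submodule.inclusion h c) ha hc)

/-- The linear form on `D(2,1;α)` equal to `lam` on `𝔥` and to zero on all root vectors. -/
def lamExt (lam : Module.Dual F (cartan F)) : G F →ₗ[F] F :=
  Finsupp.linearCombination F fun b => match b with
    | h1 => lam (hC 0)
    | h2 => lam (hC 1)
    | h3 => lam (hC 2)
    | _ => 0

theorem lamExt_bv (lam : Module.Dual F (cartan F)) (b : Idx) :
    lamExt lam (bv b) = match b with
      | h1 => lam (hC 0)
      | h2 => lam (hC 1)
      | h3 => lam (hC 2)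
      | _ => 0 := by
  simp [lamExt, bv]

theorem lamExt_odd (lam : Module.Dual F (cartan F)) {a : G F} (ha : a ∈ gPart F 1) :
    lamExt lam a = 0 := by
  induction ha using Submodule.span_induction with
  | mem v hv =>
    obtain ⟨b, hb, rfl⟩ := hv
    rw [lamExt_bv]
    cases b <;> first | rfl | exact absurd hb (by decide)
  | zero => simp
  | add v w _ _ hv hw => simp [hv, hw]
  | smul c v _ hv => simp [hv]

theorem bracket_bv (α : F) (a b : Idx) : bracket α (bv a) (bv b) = brBasis α a b := by
  simp [bracket, bv]

theorem lamExt_bracket (α : F) (lam : Module.Dual F (cartan F)) {a b : G F} (ha : a ∈ borel F)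
    (hb : b ∈ borel F) : lamExt lam (bracket α a b) = 0 := by
  induction ha using Submodule.span_induction with
  | mem v hv =>
    obtain ⟨s, hs, rfl⟩ := hv
    induction hb using Submodule.span_induction with
    | mem w hw =>
      obtain ⟨t, ht, rfl⟩ := hw
      rw [bracket_bv]
      simp only [borelIdx, Set.mem_insert_iff, Set.mem_singleton_iff] at hs ht
      rcases hs with rfl | rfl | rfl | rfl | rfl | rfl | rfl | rfl | rfl | rfl <;>
      rcases ht with rfl | rfl | rfl | rfl | rfl | rfl | rfl | rfl | rfl | rfl <;>
      simp [brBasis, table, lamExt_bv]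
    | zero => simp
    | add v w _ _ hv hw => simp [hv, hw]
    | smul c v _ hv => simp [hv]
  | zero => simp
  | add v w _ _ hv hw => simp [hv, hw]
  | smul c v _ hv => simp [hv]

theorem borel_coord {a : G F} (ha : a ∈ borel F) {b : Idx} (hb : b ∉ borelIdx) : a b = 0 := by
  induction ha using Submodule.span_induction with
  | mem v hv =>
    obtain ⟨s, hs, rfl⟩ := hv
    exact Finsupp.single_eq_of_ne (fun h => hb (h ▸ hs))
  | zero => simp
  | add v w _ _ hv hw => simp [hv, hw]
  | smul c v _ hv => simp [hv]

theorem lamExt_pow {p : ℕ} {χ : Module.Dual F (gPart F 0)}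
    {lam : Module.Dual F (cartan F)} (hl : Admissible p χ lam) (b : Idx) (hb : par b = 0)
    (hm : (bv b : G F) ∈ borel F) :
    lamExt lam (bv b) ^ p = lamExt lam (pMap b) + χ (evenBv b hb) ^ p := by
  have hB : b ∈ borelIdx := by
    by_contra h
    have := borel_coord hm h
    simp [bv] at this
  have hH : ∀ i, lam (hC i) ^ p = lam (hC i) + chiH χ i ^ p := fun i => by
    rw [← hl.lam_mem i]; ring
  have hE : ∀ i, (0 : F) ^ p = 0 + chiE χ i ^ p := fun i => by
    rw [hl.chi_nPlus i]; simp
  simp only [borelIdx, Set.mem_insert_iff, Set.mem_singleton_iff] at hB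
  rcases hB with rfl | rfl | rfl | rfl | rfl | rfl | rfl | rfl | rfl | rfl
  · simp only [lamExt_bv, pMap]
    exact hH 0
  · simp only [lamExt_bv, pMap]
    exact hH 1
  · simp only [lamExt_bv, pMap]
    exact hH 2
  · simp only [lamExt_bv, pMap, map_zero]
    exact hE 0
  · simp only [lamExt_bv, pMap, map_zero]
    exact hE 1
  · simp only [lamExt_bv, pMap, map_zero]
    exact hE 2
  all_goals exact absurd hb (by decide)

theorem zmod2_cases (i : ZMod 2) : i = 0 ∨ i = 1 := by
  revert i; decide

/-- The action of `u_χ(𝔥 ⊕ 𝔫⁺)` on the one-dimensional module `K_lam = F v`, as a character: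
`h ∈ 𝔥` acts by `lam(h)` and `𝔫⁺` by zero. -/
def character (α : F) (p : ℕ) (χ : Module.Dual F (gPart F 0))
    (lam : Module.Dual F (cartan F)) (hl : Admissible p χ lam) : U α p χ (borel F) →ₐ[F] F :=
  uLift (TensorAlgebra.lift F (lamExt lam ∘ₗ (borel F).subtype)) (by
    intro x y hxy
    cases hxy with
    | comm i j a b c ha hb hc =>
      have hz : lamExt lam c = 0 := by rw [hc]; exact lamExt_bracket α lam a.2 b.2
      simp only [map_mul, map_add, map_smul, TensorAlgebra.lift_ι_apply, LinearMap.comp_apply,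
        Submodule.subtype_apply, hz, add_zero, smul_eq_mul]
      rcases zmod2_cases i with rfl | rfl
      · simp [sgn, mul_comm]
      · simp [lamExt_odd lam ha]
    | pow b hb a c ha hc =>
      have hm : (bv b : G F) ∈ borel F := ha ▸ a.2
      rw [map_pow, map_add, AlgHom.commutes]
      simp only [TensorAlgebra.lift_ι_apply, LinearMap.comp_apply, Submodule.subtype_apply,
        ha, hc, Algebra.algebraMap_self, RingHom.id_apply]
      exact lamExt_pow hl b hb hm)

section Verma

variable (α : F) (p : ℕ) (χ : Module.Dual F (gPart F 0))
  (lam : Module.Dual F (cartan F)) (hl : Admissible p χ lam)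

/-- The elements `(u b) ⊗ k - u ⊗ (b k)` with `u ∈ u_χ(𝔤)`, `b ∈ u_χ(𝔥 ⊕ 𝔫⁺)`, `k ∈ K_lam`. -/
def balancing : Submodule (U α p χ (⊤ : Submodule F (G F)))
    (U α p χ (⊤ : Submodule F (G F)) ⊗[F] F) :=
  Submodule.span _ {t | ∃ (u : U α p χ ⊤) (b : U α p χ (borel F)) (k : F),
    t = (u * uMap α p χ le_top b) ⊗ₜ[F] k - u ⊗ₜ[F] (character α p χ lam hl b * k)}

/-- The baby Verma module `Z_χ(lam) = u_χ(𝔤) ⊗_{u_χ(𝔥 ⊕ 𝔫⁺)} K_lam`. -/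
abbrev Verma : Type _ :=
  (U α p χ (⊤ : Submodule F (G F)) ⊗[F] F) ⧸ balancing α p χ lam hl

/-- An element of `𝔤` in `u_χ(𝔤)`. -/
def inU (x : G F) : U α p χ (⊤ : Submodule F (G F)) := uι α p χ ⊤ ⟨x, Submodule.mem_top⟩

/-- The element `u ⊗ v` of the baby Verma module, where `v` is the basis vector of `K_lam`. -/
def tens (u : U α p χ (⊤ : Submodule F (G F))) : Verma α p χ lam hl :=
  Submodule.Quotient.mk (u ⊗ₜ[F] (1 : F))

/-- The action of `𝔤` on the baby Verma module. -/
def act (x : G F) (m : Verma α p χ lam hl) : Verma α p χ lam hl := inU α p χ x • m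

/-- The even and the odd part of the baby Verma module (`v` being even): the span of the elements
`b₁ ⋯ bₙ ⊗ v` with basis vectors `bᵢ` of total parity `i`. -/
def zPart (i : ZMod 2) : Submodule F (Verma α p χ lam hl) :=
  Submodule.span F {m | ∃ l : List Idx, (l.map par).sum = i ∧
    m = tens α p χ lam hl ((l.map fun b => inU α p χ (bv b)).prod)}

/-- The weight space `𝔤_β`. -/
def gWeight (β : Module.Dual F (cartan F)) : Set (G F) :=
  {x | ∀ h : cartan F, bracket α h x = β h • x}

/-- The weight space `Z_χ(lam)_β`. -/
def zWeight (β : Module.Dual F (cartan F)) : Set (Verma α p χ lam hl) :=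
  {m | ∀ h : cartan F, act α p χ lam hl h m = β h • m}

/-! Superderivations -/

/-- `φ` is a homogeneous superderivation `𝔤 → Z_χ(lam)` of parity `i`. -/
structure IsHomDer (i : ZMod 2) (φ : G F →ₗ[F] Verma α p χ lam hl) : Prop where
  parity : ∀ j, ∀ x ∈ gPart F j, φ x ∈ zPart α p χ lam hl (i + j)
  leibniz : ∀ j k, ∀ x ∈ gPart F j, ∀ y ∈ gPart F k,
    φ (bracket α x y) = sgn F (i * j) • act α p χ lam hl x (φ y) -
      sgn F (k * (i + j)) • act α p χ lam hl y (φ x)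

/-- `φ` is the inner superderivation `𝔇_m`, `𝔇_m(x) = (-1)^{|x||m|} x m`, of an element `m` of
parity `i`. -/
def IsHomInner (i : ZMod 2) (m : Verma α p χ lam hl) (φ : G F →ₗ[F] Verma α p χ lam hl) : Prop :=
  m ∈ zPart α p χ lam hl i ∧
    ∀ j, ∀ x ∈ gPart F j, φ x = sgn F (j * i) • act α p χ lam hl x m

/-- `Der(𝔤, Z_χ(lam))`. -/
def Der : Submodule F (G F →ₗ[F] Verma α p χ lam hl) :=
  Submodule.span F {φ | ∃ i, IsHomDer α p χ lam hl i φ}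

/-- `Ider(𝔤, Z_χ(lam))`. -/
def Ider : Submodule F (G F →ₗ[F] Verma α p χ lam hl) :=
  Submodule.span F {φ | ∃ i m, IsHomInner α p χ lam hl i m φ}

/-- `φ` has weight zero: `φ(𝔤_β) ⊆ Z_χ(lam)_β` for all `β ∈ 𝔥^*`. -/
def WeightZero (φ : G F →ₗ[F] Verma α p χ lam hl) : Prop :=
  ∀ β : Module.Dual F (cartan F), ∀ x ∈ gWeight α β, φ x ∈ zWeight α p χ lam hl β

/-- An outer superderivation: one that is not inner. -/
def IsOuter (φ : G F →ₗ[F] Verma α p χ lam hl) : Prop :=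
  φ ∈ Der α p χ lam hl ∧ φ ∉ Ider α p χ lam hl

/-! The maps `ψ₁, ψ₂, ψ₃, ψ₄` -/

/-- `c` lies in the prime field. -/
def IsPrimeElt (c : F) : Prop := ∃ n : ℕ, (n : F) = c

/-- The smallest nonnegative integer in the residue class `c` (for `c` in the prime field). -/
def resid (c : F) : ℕ := sInf {n : ℕ | (n : F) = c}

/-- The exponent class `(lam₁ - β₁ - θ₁ - θ₂ - θ₃ - θ₄) / 2` of `f₁`. -/
def expo1 (β : Fin 3 → ℤ) (θ : Fin 4 → ℕ) : F :=
  (lam (hC 0) - (β 0 : F) - (θ 0 : F) - (θ 1 : F) - (θ 2 : F) - (θ 3 : F)) / 2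

/-- The exponent class `(lam₂ - β₂ + θ₁ + θ₂ - θ₃ - θ₄) / 2` of `f₂`. -/
def expo2 (β : Fin 3 → ℤ) (θ : Fin 4 → ℕ) : F :=
  (lam (hC 1) - (β 1 : F) + (θ 0 : F) + (θ 1 : F) - (θ 2 : F) - (θ 3 : F)) / 2

/-- The exponent class `(lam₃ - β₃ + θ₁ - θ₂ + θ₃ - θ₄) / 2` of `f₃`. -/
def expo3 (β : Fin 3 → ℤ) (θ : Fin 4 → ℕ) : F :=
  (lam (hC 2) - (β 2 : F) + (θ 0 : F) - (θ 1 : F) + (θ 2 : F) - (θ 3 : F)) / 2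

open Classical in
/-- The vector `w_β^θ = f₁^{a₁} f₂^{a₂} f₃^{a₃} y₁^{θ₁} y₂^{θ₂} y₃^{θ₃} y₄^{θ₄} ⊗ v` of weight
`β`, where `aᵢ` is the smallest nonnegative integer in its exponent class.  If some class lies
outside the prime field, no monomial has weight `β`, and `w_β^θ = 0`. -/
def w (β : Fin 3 → ℤ) (θ : Fin 4 → ℕ) : Verma α p χ lam hl :=
  if IsPrimeElt (expo1 lam β θ) ∧ IsPrimeElt (expo2 lam β θ) ∧ IsPrimeElt (expo3 lam β θ) then
    tens α p χ lam hl
      (inU α p χ (bv f1) ^ resid (expo1 lam β θ) * inU α p χ (bv f2) ^ resid (expo2 lam β θ) *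
        inU α p χ (bv f3) ^ resid (expo3 lam β θ) * inU α p χ (bv y1) ^ θ 0 *
        inU α p χ (bv y2) ^ θ 1 * inU α p χ (bv y3) ^ θ 2 * inU α p χ (bv y4) ^ θ 3)
  else 0

/-- `ψ₁`, depending linearly on `a = (a₁, a₂, a₃)` and `b = (a_{-2ε₁}, a_{-2ε₂}, a_{-2ε₃})`. -/
def psi1 (a b : Fin 3 → F) : G F →ₗ[F] Verma α p χ lam hl :=
  let W := w α p χ lam hl
  Finsupp.linearCombination F fun t => match t with
    | h1 => a 0 • W ![0, 0, 0] ![1, 1, 1, 1]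
    | h2 => a 1 • W ![0, 0, 0] ![1, 1, 1, 1]
    | h3 => a 2 • W ![0, 0, 0] ![1, 1, 1, 1]
    | f1 => b 0 • W ![-2, 0, 0] ![1, 1, 1, 1]
    | f2 => b 1 • W ![0, -2, 0] ![1, 1, 1, 1]
    | f3 => b 2 • W ![0, 0, -2] ![1, 1, 1, 1]
    | e1 => (2 * b 1) • W ![2, 0, 0] ![1, 1, 0, 0] - (2 * α * b 2) • W ![2, 0, 0] ![1, 0, 1, 0]
        + ((1 + α) * a 0 - a 1 + α * a 2) • W ![2, 0, 0] ![1, 0, 0, 1]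
        - ((1 + α) * a 0 - a 1 - α * a 2) • W ![2, 0, 0] ![0, 1, 1, 0]
        - a 0 • W ![2, 0, 0] ![1, 1, 1, 1]
        - (8 * (1 + α) * b 0) • W ![2, 0, 0] ![0, 0, 0, 0]
    | e2 => -(a 1 • W ![0, 2, 0] ![1, 1, 1, 1])
        + (2 * (1 + α) * b 0) • W ![0, 2, 0] ![1, 1, 0, 0]
    | e3 => -(a 2 • W ![0, 0, 2] ![1, 1, 1, 1])
    | x1 => ((1 + α) * a 0 - a 1 - α * a 2) • W ![1, 1, 1] ![1, 1, 1, 0]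
        + ((1 + α) * a 0 - a 1 + α * a 2) • W ![1, 1, 1] ![1, 1, 0, 1]
        - ((1 + α) * a 0 + a 1 - α * a 2) • W ![1, 1, 1] ![1, 0, 1, 1]
        - ((1 + α) * a 0 + a 1 + α * a 2) • W ![1, 1, 1] ![0, 1, 1, 1]
        + (4 * (1 + α) * b 0) • (W ![1, 1, 1] ![1, 0, 0, 0] + W ![1, 1, 1] ![0, 1, 0, 0]
          + W ![1, 1, 1] ![0, 0, 1, 0] + W ![1, 1, 1] ![0, 0, 0, 1])
    | x2 => -((2 * α * b 2) • W ![1, 1, -1] ![1, 1, 1, 0])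
        + ((1 + α) * a 0 - a 1 + α * a 2) • W ![1, 1, -1] ![1, 1, 0, 1]
        + (2 * α * b 2) • W ![1, 1, -1] ![1, 0, 1, 1]
        - ((1 + α) * a 0 + a 1 + α * a 2) • W ![1, 1, -1] ![0, 1, 1, 1]
        + (4 * (1 + α) * b 0) • (W ![1, 1, -1] ![0, 1, 0, 0] + W ![1, 1, -1] ![0, 0, 0, 1])
    | x3 => -((2 * b 1) • W ![1, -1, 1] ![1, 1, 1, 0])
        - (2 * b 1) • W ![1, -1, 1] ![1, 1, 0, 1]
        - ((1 + α) * a 0 + a 1 - α * a 2) • W ![1, -1, 1] ![1, 0, 1, 1]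
        - ((1 + α) * a 0 + a 1 + α * a 2) • W ![1, -1, 1] ![0, 1, 1, 1]
        + (4 * (1 + α) * b 0) • (W ![1, -1, 1] ![0, 0, 1, 0] + W ![1, -1, 1] ![0, 0, 0, 1])
    | x4 => -((2 * b 1) • W ![1, -1, -1] ![1, 1, 0, 1])
        + (2 * α * b 2) • W ![1, -1, -1] ![1, 0, 1, 1]
        - ((1 + α) * a 0 + a 1 + α * a 2) • W ![1, -1, -1] ![0, 1, 1, 1]
        + (4 * (1 + α) * b 0) • W ![1, -1, -1] ![0, 0, 0, 1]
    | y1 => -((2 * (1 + α) * b 0) • (W ![-1, 1, 1] ![1, 0, 1, 1] + W ![-1, 1, 1] ![0, 1, 1, 1]))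
    | y2 => -((2 * (1 + α) * b 0) • W ![-1, 1, -1] ![0, 1, 1, 1])
    | y3 => -((2 * (1 + α) * b 0) •
        (W ![-1, -1, 1] ![1, 0, 1, 1] + W ![-1, -1, 1] ![0, 1, 1, 1]))
    | y4 => -((2 * (1 + α) * b 0) • W ![-1, -1, -1] ![0, 1, 1, 1])

/-- `ψ₂`, with parameter `c = a_{2ε₃}`. -/
def psi2 (c : F) : G F →ₗ[F] Verma α p χ lam hl :=
  let W := w α p χ lam hl
  Finsupp.linearCombination F fun t => match t with
    | e1 => (2 * α * c) • W ![2, 0, 0] ![0, 1, 0, 1]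
    | e3 => c • W ![0, 0, 2] ![1, 1, 1, 1]
    | x1 => -((2 * α * c) • W ![1, 1, 1] ![1, 1, 0, 1]) + (2 * α * c) • W ![1, 1, 1] ![0, 1, 1, 1]
    | x3 => (2 * α * c) • W ![1, -1, 1] ![0, 1, 1, 1]
    | _ => 0

/-- `ψ₃`, with parameter `c = a_{2ε₂}`. -/
def psi3 (c : F) : G F →ₗ[F] Verma α p χ lam hl :=
  let W := w α p χ lam hl
  Finsupp.linearCombination F fun t => match t with
    | e1 => -((2 * c) • W ![2, 0, 0] ![0, 0, 1, 1])
    | e2 => c • W ![0, 2, 0] ![1, 1, 1, 1]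
    | x1 => (2 * c) • W ![1, 1, 1] ![1, 0, 1, 1] + (2 * c) • W ![1, 1, 1] ![0, 1, 1, 1]
    | x2 => (2 * c) • W ![1, 1, -1] ![0, 1, 1, 1]
    | _ => 0

/-- `ψ₄`, with parameter `c = a_{2ε₁}^{(1,1,1,0)}`. -/
def psi4 (c : F) : G F →ₗ[F] Verma α p χ lam hl :=
  let W := w α p χ lam hl
  let u := (lam (hC 1) + 1) / 2
  let v := (lam (hC 2) + 1) / 2
  Finsupp.linearCombination F fun t => match t with
    | e1 => c • W ![2, 0, 0] ![1, 1, 1, 0]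
    | x1 => -((u * v * c) • W ![1, 1, 1] ![1, 1, 1, 1])
    | x2 => (u * c) • W ![1, 1, -1] ![1, 1, 1, 1]
    | x3 => (v * c) • W ![1, -1, 1] ![1, 1, 1, 1]
    | x4 => -(c • W ![1, -1, -1] ![1, 1, 1, 1])
    | _ => 0

/-- `lam = (l₁, l₂, l₃)` and `χ(fᵢ)^p = 0` for `i = 1, 2, 3`. -/
def Special (l : Fin 3 → ℤ) : Prop :=
  (∀ i, lam (hC i) = (l i : F)) ∧ ∀ i, chiF χ i ^ p = 0

/-- The maps `ψ₁, ψ₂, ψ₃, ψ₄`, each only for its special weight. -/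
def psiFamily : Set (G F →ₗ[F] Verma α p χ lam hl) :=
  {φ | (Special p χ lam ![2 * p + 2, 2 * p - 2, 2 * p - 2] ∧ ∃ a b, φ = psi1 α p χ lam hl a b) ∨
    (Special p χ lam ![2 * p + 2, 2 * p - 2, 2 * p] ∧ ∃ c, φ = psi2 α p χ lam hl c) ∨
    (Special p χ lam ![2 * p + 2, 2 * p, 2 * p - 2] ∧ ∃ c, φ = psi3 α p χ lam hl c) ∨
    (Special p χ lam ![2 * p + 3, 2 * p - 3, 2 * p - 3] ∧ ∃ c, φ = psi4 α p χ lam hl c)}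

end Verma

end D21

end

set_option linter.unusedSimpArgs false
set_option linter.unusedVariables false
set_option linter.unusedTactic false
set_option linter.unreachableTactic false
set_option linter.unnecessarySeqFocus false
set_option linter.unusedSectionVars false

noncomputable section
namespace D21
open Idx
variable {F : Type*} [Field F]

/-! Write Z for the baby Verma module. After its values are twisted by the sign (-1)^(i|b|), a
superderivation of parity i is a cocycle (`Coc`, `isHomDer_iff`), and a cocycle φ is the same thing
as an action on Z × F extending the action on Z (`extAct`). Every identity in the enveloping algebra
can therefore be evaluated at the extra vector (0,1) to give an identity for φ. The first use of
this concerns the central elements fᵢ^p, central because (ad fᵢ)³ = 0 and p > 3: on the extension,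
centrality reads b·(fᵢ^(p-1) φ(fᵢ)) = fᵢ^p φ(b). If χ(fᵢ)^p ≠ 0 for some i, division by this scalar
shows that φ is inner (`mem_Ider_of_chi_ne`). So all three scalars may be taken to be zero.

The structural input is a PBW theorem. The algebra 𝔤 acts on UN = u_χ(𝔫⁻) by the recursion that
moves 𝔤 past 𝔫⁻ (`exists_isInduced`, `IsInduced.rel`, `IsInduced.pow`), and this identifies Z with
UN as an 𝔫⁻-module (`vermaEquiv`). When all χ(fᵢ)^p vanish, UN is the tensor product of truncated
polynomials in three variables with an exterior algebra in four (`exists_modelEquiv`). There one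
sees that the 𝔫⁻-invariants of Z form a line, spanned by the lowest monomial `bot`. A module with
such a socle and of the dimension of UN is the dual of UN, hence injective: an 𝔫⁻-cocycle with
fᵢ^(p-1) φ(fᵢ) = 0 for all i is inner (`Coc.exists_inner_neg`). These facts are collected in `Core`.

Let μ = (λ₁ - 2, λ₂ + 2, λ₃ + 2) be the weight of `bot`. For a cocycle φ the vector fᵢ^(p-1) φ(fᵢ)
is killed by 𝔤, so it is a multiple of `bot`, and zero if μ ≠ 0. Once these obstructions are gone,
an inner cocycle can be subtracted so that φ vanishes on 𝔫⁻; then φ(hᵢ) is a multiple of `bot`, with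
coefficients proportional to μ if μ ≠ 0, and another inner cocycle removes it. What is left is
determined by its values at the simple root vectors e₂, e₃, x₄, which are 𝔫⁻-invariants and so
multiples of `bot`, of the weight of the root. Hence φ is inner unless μ is 0 or a simple root. For
μ = 0 the six free scalars, three from the fᵢ and three from the hᵢ, are the parameters of ψ₁; for
the simple roots 2ε₃, 2ε₂, ε₁ - ε₂ - ε₃ the one free scalar is the parameter of ψ₂, ψ₃, ψ₄. Modulo p
these are exactly the special weights (`Core.classify`).

That the ψⱼ are cocycles is again checked economically. The failure of the cocycle identity
satisfies a cocycle identity of its own (`mul_defect`), so vanishing against y₁, f₂, f₃, which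
generate 𝔫⁻, gives vanishing against 𝔫⁻; that much is an explicit reordering of monomials. For a
simple and a positive root vector the defect is then 𝔫⁻-invariant, of a weight different from μ,
hence zero (`Core.coc_of_generators`).

The scalars used in the classification also detect outer maps. At its special weight ψⱼ is inner
only if the parameters vanish. At other weights ψ₂, ψ₃, ψ₄, if superderivations at all, are zero by
the simple root argument. The map ψ₁ could still differ from an inner one by a multiple of ψ₂, ψ₃ or
ψ₄; parity excludes ψ₄, and for λ = (2,-2,0) and (2,0,-2) a vector of weight zero annihilated by all
of 𝔥 ⊕ 𝔫⁻ but one fᵢ forces the multiple to be zero (`Core.psi2c_coeff_eq_zero`,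
`Core.psi3c_coeff_eq_zero`). -/

/-- A numbering of the basis vectors. -/
def Idx.num : Idx → ℕ
  | h1 => 0 | h2 => 1 | h3 => 2 | e1 => 3 | e2 => 4 | e3 => 5 | f1 => 6 | f2 => 7 | f3 => 8
  | x1 => 9 | x2 => 10 | x3 => 11 | x4 => 12 | y1 => 13 | y2 => 14 | y3 => 15 | y4 => 16

/-- The list of all basis vectors. -/
def Idx.all : List Idx := [h1, h2, h3, e1, e2, e3, f1, f2, f3, x1, x2, x3, x4, y1, y2, y3, y4]

theorem Idx.mem_all (b : Idx) : b ∈ Idx.all := by cases b <;> simp [Idx.all]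

theorem Idx.num_injective : Function.Injective Idx.num := by
  have h : Function.LeftInverse (fun n => Idx.all.getD n h1) Idx.num := fun b => by cases b <;> rfl
  exact h.injective

/-- Equality goes through the numbering so that the kernel computations over all triples of basis
vectors only compare natural numbers. -/
instance : DecidableEq Idx := fun a b =>
  if h : a.num = b.num then isTrue (Idx.num_injective h) else isFalse fun h' => h (h' ▸ rfl)

instance : Fintype Idx := ⟨⟨Idx.all, by decide⟩, Idx.mem_all⟩

/-! ### Structure constants over ℤ[α] and the Jacobi identity -/

/-- Integral form of `table`: an entry `(c, u, v)` stands for `(u + v α) c`. -/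
def tableZ : Idx → Idx → List (Idx × ℤ × ℤ)
  | e1, f1 => [(h1, 1, 0)]
  | e2, f2 => [(h2, 1, 0)]
  | e3, f3 => [(h3, 1, 0)]
  | h1, e1 => [(e1, 2, 0)]
  | h2, e2 => [(e2, 2, 0)]
  | h3, e3 => [(e3, 2, 0)]
  | h1, f1 => [(f1, -2, 0)]
  | h2, f2 => [(f2, -2, 0)]
  | h3, f3 => [(f3, -2, 0)]
  | h1, x1 => [(x1, 1, 0)]
  | h1, x2 => [(x2, 1, 0)]
  | h1, x3 => [(x3, 1, 0)]
  | h1, x4 => [(x4, 1, 0)]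
  | h1, y1 => [(y1, -1, 0)]
  | h1, y2 => [(y2, -1, 0)]
  | h1, y3 => [(y3, -1, 0)]
  | h1, y4 => [(y4, -1, 0)]
  | e1, y1 => [(x1, 1, 0)]
  | e1, y2 => [(x2, 1, 0)]
  | e1, y3 => [(x3, 1, 0)]
  | e1, y4 => [(x4, 1, 0)]
  | f1, x1 => [(y1, 1, 0)]
  | f1, x2 => [(y2, 1, 0)]
  | f1, x3 => [(y3, 1, 0)]
  | f1, x4 => [(y4, 1, 0)]
  | h2, x1 => [(x1, 1, 0)]
  | h2, x2 => [(x2, 1, 0)]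
  | h2, x3 => [(x3, -1, 0)]
  | h2, x4 => [(x4, -1, 0)]
  | h2, y1 => [(y1, 1, 0)]
  | h2, y2 => [(y2, 1, 0)]
  | h2, y3 => [(y3, -1, 0)]
  | h2, y4 => [(y4, -1, 0)]
  | e2, x3 => [(x1, 1, 0)]
  | e2, x4 => [(x2, 1, 0)]
  | e2, y3 => [(y1, 1, 0)]
  | e2, y4 => [(y2, 1, 0)]
  | f2, x1 => [(x3, 1, 0)]
  | f2, x2 => [(x4, 1, 0)]
  | f2, y1 => [(y3, 1, 0)]
  | f2, y2 => [(y4, 1, 0)]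
  | h3, x1 => [(x1, 1, 0)]
  | h3, x2 => [(x2, -1, 0)]
  | h3, x3 => [(x3, 1, 0)]
  | h3, x4 => [(x4, -1, 0)]
  | h3, y1 => [(y1, 1, 0)]
  | h3, y2 => [(y2, -1, 0)]
  | h3, y3 => [(y3, 1, 0)]
  | h3, y4 => [(y4, -1, 0)]
  | e3, x2 => [(x1, 1, 0)]
  | e3, x4 => [(x3, 1, 0)]
  | e3, y2 => [(y1, 1, 0)]
  | e3, y4 => [(y3, 1, 0)]
  | f3, x1 => [(x2, 1, 0)]
  | f3, x3 => [(x4, 1, 0)]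
  | f3, y1 => [(y2, 1, 0)]
  | f3, y3 => [(y4, 1, 0)]
  | x1, y2 => [(e2, -2, 0)]
  | x1, y3 => [(e3, 0, -2)]
  | x1, y4 => [(h1, -1, -1), (h2, 1, 0), (h3, 0, 1)]
  | x2, y1 => [(e2, 2, 0)]
  | x2, y4 => [(f3, 0, 2)]
  | x2, y3 => [(h1, 1, 1), (h2, -1, 0), (h3, 0, 1)]
  | x3, y1 => [(e3, 0, 2)]
  | x3, y4 => [(f2, 2, 0)]
  | x3, y2 => [(h1, 1, 1), (h2, 1, 0), (h3, 0, -1)]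
  | x4, y2 => [(f3, 0, -2)]
  | x4, y3 => [(f2, -2, 0)]
  | x4, y1 => [(h1, -1, -1), (h2, -1, 0), (h3, 0, -1)]
  | y2, y3 => [(f1, 2, 2)]
  | y1, y4 => [(f1, -2, -2)]
  | x2, x3 => [(e1, -2, -2)]
  | x1, x4 => [(e1, 2, 2)]
  | _, _ => []

/-- The Koszul sign as an integer. -/
def sgnZ (i : ZMod 2) : ℤ := if i = 0 then 1 else -1

theorem sgn_eq_cast (i : ZMod 2) : sgn F i = (sgnZ i : F) := by
  unfold sgn sgnZ; split <;> simp

/-- Structure constants: the list of terms of a product of two basis vectors. -/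
def structZ (a b : Idx) : List (Idx × ℤ × ℤ) :=
  tableZ a b ++ (tableZ b a).map fun t =>
    (t.1, -sgnZ (par a * par b) * t.2.1, -sgnZ (par a * par b) * t.2.2)

/-- The vector given by a list of terms. -/
def evalZ (α : F) (l : List (Idx × ℤ × ℤ)) : G F :=
  (l.map fun t => ((t.2.1 : F) + t.2.2 * α) • bv t.1).sum

theorem table_eq (α : F) (a b : Idx) : table α a b = evalZ α (tableZ a b) := by
  cases a <;> cases b <;> first
    | rfl
    | (simp [table, tableZ, evalZ]; done)
    | (simp only [table, tableZ, evalZ, List.map_cons, List.map_nil, List.sum_cons, List.sum_nil]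
       push_cast
       module)

theorem brBasis_eq (α : F) (a b : Idx) : brBasis α a b = evalZ α (structZ a b) := by
  rw [brBasis, table_eq, table_eq, sgn_eq_cast, structZ, evalZ, evalZ, evalZ, List.map_append,
    List.sum_append, sub_eq_add_neg]
  congr 1
  induction tableZ b a with
  | nil => simp
  | cons t l ih =>
    simp only [List.map_cons, List.sum_cons, smul_add, neg_add, ih]
    congr 1
    push_cast
    module

/-- Terms `(c, r, s, t)` stand for `(r + s α + t α²) c`. -/
def evalZ₂ (α : F) (l : List (Idx × ℤ × ℤ × ℤ)) : G F :=
  (l.map fun t => ((t.2.1 : F) + t.2.2.1 * α + t.2.2.2 * α ^ 2) • bv t.1).sum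

/-- Product of two linear coefficients. -/
def mulTerm (s t : Idx × ℤ × ℤ) : Idx × ℤ × ℤ × ℤ :=
  (t.1, s.2.1 * t.2.1, s.2.1 * t.2.2 + s.2.2 * t.2.1, s.2.2 * t.2.2)

/-- Left bracket with a basis vector on lists of terms. -/
def brLeft (a : Idx) (l : List (Idx × ℤ × ℤ)) : List (Idx × ℤ × ℤ × ℤ) :=
  l.flatMap fun s => (structZ a s.1).map (mulTerm s)

/-- Right bracket with a basis vector on lists of terms. -/
def brRight (l : List (Idx × ℤ × ℤ)) (a : Idx) : List (Idx × ℤ × ℤ × ℤ) :=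
  l.flatMap fun s => (structZ s.1 a).map (mulTerm s)

theorem evalZ₂_append (α : F) (l m : List (Idx × ℤ × ℤ × ℤ)) :
    evalZ₂ α (l ++ m) = evalZ₂ α l + evalZ₂ α m := by
  simp [evalZ₂]

theorem evalZ₂_map_mulTerm (α : F) (s : Idx × ℤ × ℤ) (l : List (Idx × ℤ × ℤ)) :
    evalZ₂ α (l.map (mulTerm s)) = ((s.2.1 : F) + s.2.2 * α) • evalZ α l := by
  induction l with
  | nil => simp [evalZ₂, evalZ]
  | cons t l ih =>
    simp only [evalZ₂, evalZ, List.map_cons, List.sum_cons, smul_add] at ih ⊢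
    rw [ih]
    congr 1
    simp only [mulTerm]
    push_cast
    module

theorem bracket_evalZ (α : F) (a : Idx) (l : List (Idx × ℤ × ℤ)) :
    bracket α (bv a) (evalZ α l) = evalZ₂ α (brLeft a l) := by
  induction l with
  | nil => simp [evalZ, evalZ₂, brLeft]
  | cons s l ih =>
    have : evalZ α (s :: l) = ((s.2.1 : F) + s.2.2 * α) • bv s.1 + evalZ α l := by simp [evalZ]
    rw [this, map_add, map_smul, ih, bracket_bv, brBasis_eq, brLeft, brLeft, List.flatMap_cons,
      evalZ₂_append, evalZ₂_map_mulTerm]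

theorem evalZ_bracket (α : F) (a : Idx) (l : List (Idx × ℤ × ℤ)) :
    bracket α (evalZ α l) (bv a) = evalZ₂ α (brRight l a) := by
  induction l with
  | nil => simp [evalZ, evalZ₂, brRight]
  | cons s l ih =>
    have : evalZ α (s :: l) = ((s.2.1 : F) + s.2.2 * α) • bv s.1 + evalZ α l := by simp [evalZ]
    rw [this, map_add, LinearMap.add_apply, map_smul, LinearMap.smul_apply, ih, bracket_bv,
      brBasis_eq, brRight, brRight, List.flatMap_cons, evalZ₂_append, evalZ₂_map_mulTerm]

/-- Scaling of a list of terms by an integer. -/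
def scaleZ (n : ℤ) (l : List (Idx × ℤ × ℤ × ℤ)) : List (Idx × ℤ × ℤ × ℤ) :=
  l.map fun t => (t.1, n * t.2.1, n * t.2.2.1, n * t.2.2.2)

theorem evalZ₂_scaleZ (α : F) (n : ℤ) (l : List (Idx × ℤ × ℤ × ℤ)) :
    evalZ₂ α (scaleZ n l) = (n : F) • evalZ₂ α l := by
  induction l with
  | nil => simp [evalZ₂, scaleZ]
  | cons t l ih =>
    simp only [evalZ₂, scaleZ, List.map_cons, List.sum_cons, smul_add] at ih ⊢
    rw [ih]
    congr 1
    push_cast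
    module

/-- The total coefficient of a basis vector in a list of terms. -/
def coeffZ (n : ℕ) : List (Idx × ℤ × ℤ × ℤ) → ℤ × ℤ × ℤ
  | [] => (0, 0, 0)
  | t :: l => if Nat.beq t.1.num n then
      (t.2.1 + (coeffZ n l).1, t.2.2.1 + (coeffZ n l).2.1, t.2.2.2 + (coeffZ n l).2.2)
      else coeffZ n l

/-- All coefficients vanish. -/
def vanishes (l : List (Idx × ℤ × ℤ × ℤ)) : Bool :=
  l.all fun t => decide (coeffZ t.1.num l = (0, 0, 0))

theorem evalZ₂_apply (α : F) (l : List (Idx × ℤ × ℤ × ℤ)) (b : Idx) :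
    evalZ₂ α l b = (coeffZ b.num l).1 + (coeffZ b.num l).2.1 * α
      + (coeffZ b.num l).2.2 * α ^ 2 := by
  induction l with
  | nil => simp [evalZ₂, coeffZ]
  | cons t l ih =>
    simp only [evalZ₂, List.map_cons, List.sum_cons, Finsupp.add_apply] at ih ⊢
    rw [ih]
    by_cases h : t.1 = b
    · subst h
      simp [coeffZ, bv]
      ring
    · have h' : t.1.num ≠ b.num := fun h' => h (Idx.num_injective h')
      simp [coeffZ, bv, Finsupp.single_eq_of_ne' h, h']

theorem coeffZ_eq_zero {l : List (Idx × ℤ × ℤ × ℤ)} {n : ℕ} (h : ∀ t ∈ l, t.1.num ≠ n) :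
    coeffZ n l = (0, 0, 0) := by
  induction l with
  | nil => rfl
  | cons t l ih =>
    have h1 := h t (by simp)
    rw [coeffZ, if_neg (by simpa using h1)]
    exact ih fun t ht => h t (by simp [ht])

theorem evalZ₂_eq_zero (α : F) {l : List (Idx × ℤ × ℤ × ℤ)} (h : vanishes l = true) :
    evalZ₂ α l = 0 := by
  ext b
  rw [evalZ₂_apply]
  have : coeffZ b.num l = (0, 0, 0) := by
    by_cases hb : ∃ t ∈ l, t.1.num = b.num
    · obtain ⟨t, ht, htb⟩ := hb
      have := List.all_eq_true.1 h t ht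
      rw [decide_eq_true_eq, htb] at this
      exact this
    · push Not at hb
      exact coeffZ_eq_zero hb
  simp [this]

/-- The terms of the Jacobi identity. -/
def jacobiTerms (a b c : Idx) : List (Idx × ℤ × ℤ × ℤ) :=
  brLeft a (structZ b c) ++ (scaleZ (-1) (brRight (structZ a b) c) ++
    scaleZ (-sgnZ (par a * par b)) (brLeft b (structZ a c)))

/-- Each coefficient in the Jacobi identity is an integral polynomial in α of degree at most two, so
the identity can be checked coefficientwise in ℤ[α] for the 17³ triples, once for all fields and all
α. -/
theorem jacobiTerms_vanishes :
    (Idx.all.all fun a => Idx.all.all fun b => Idx.all.all fun c =>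
      vanishes (jacobiTerms a b c)) = true := by
  decide +kernel

/-- The super Jacobi identity. -/
theorem jacobi (α : F) (a b c : Idx) :
    bracket α (bv a) (brBasis α b c) = bracket α (brBasis α a b) (bv c) +
      sgn F (par a * par b) • bracket α (bv b) (brBasis α a c) := by
  have h := jacobiTerms_vanishes
  simp only [List.all_eq_true] at h
  have h0 := evalZ₂_eq_zero α (h a a.mem_all b b.mem_all c c.mem_all)
  rw [jacobiTerms, evalZ₂_append, evalZ₂_append, evalZ₂_scaleZ, evalZ₂_scaleZ, ← bracket_evalZ,
    ← bracket_evalZ, ← evalZ_bracket, ← brBasis_eq, ← brBasis_eq, ← brBasis_eq] at h0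
  rw [sgn_eq_cast, ← sub_eq_zero, ← h0]
  push_cast
  module

/-! ### Weights and nilpotency of root vectors -/

/-- The weight of a basis vector. -/
def wt : Idx → Fin 3 → ℤ
  | h1 | h2 | h3 => 0
  | e1 => ![2, 0, 0] | e2 => ![0, 2, 0] | e3 => ![0, 0, 2]
  | f1 => ![-2, 0, 0] | f2 => ![0, -2, 0] | f3 => ![0, 0, -2]
  | x1 => ![1, 1, 1] | x2 => ![1, 1, -1] | x3 => ![1, -1, 1] | x4 => ![1, -1, -1]
  | y1 => ![-1, 1, 1] | y2 => ![-1, 1, -1] | y3 => ![-1, -1, 1] | y4 => ![-1, -1, -1]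

theorem brBasis_h (α : F) (i : Fin 3) (b : Idx) :
    brBasis α (hIdx i) b = (wt b i : F) • bv b := by
  fin_cases i <;> cases b <;> simp [brBasis, hIdx, table, wt, par, sgn, neg_smul]

theorem brBasis_skew (α : F) (b c : Idx) :
    brBasis α b c = -(sgn F (par b * par c) • brBasis α c b) := by
  have h : sgn F (par b * par c) * sgn F (par c * par b) = 1 := by
    rw [mul_comm (par c)]; unfold sgn; split <;> simp
  rw [brBasis, brBasis, smul_sub, smul_smul, h]
  simp

/-- The even root vectors. -/
def evenRoots : List Idx := [e1, e2, e3, f1, f2, f3]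

theorem par_of_mem_evenRoots {f : Idx} (hf : f ∈ evenRoots) : par f = 0 := by
  revert f; decide

/-- Each of the three copies of sl(2) acts on 𝔤 with irreducible constituents of dimension at most
three. Since p > 3, this makes the p-th power of the adjoint action vanish. -/
theorem ad_cube (α : F) {f : Idx} (hf : f ∈ evenRoots) (b : Idx) :
    bracket α (bv f) (bracket α (bv f) (brBasis α f b)) = 0 := by
  simp only [evenRoots, List.mem_cons, List.not_mem_nil, or_false] at hf
  rcases hf with rfl | rfl | rfl | rfl | rfl | rfl <;> cases b <;>
    simp [brBasis, table, par, sgn, bracket_bv]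

/-! ### Commutation relations in an algebra and central p-th powers -/

/-- The commutation relations among the images `a b`, `b ∈ J`, of basis vectors in an algebra. -/
def Rel (α : F) (J : Set Idx) {A : Type*} [Ring A] [Algebra F A] (a : Idx → A) : Prop :=
  ∀ b ∈ J, ∀ c ∈ J, a b * a c =
    sgn F (par b * par c) • (a c * a b) + Finsupp.linearCombination F a (brBasis α b c)

theorem Rel.mono {α : F} {J K : Set Idx} {A : Type*} [Ring A] [Algebra F A] {a : Idx → A}
    (h : Rel α K a) (hJ : J ⊆ K) : Rel α J a :=
  fun b hb c hc => h b (hJ hb) c (hJ hc)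

section Central

variable {α : F} {A : Type*} [Ring A] [Algebra F A] {a : Idx → A}

theorem Rel.ad_linear (h : Rel α Set.univ a) {f : Idx} (hf : par f = 0) (g : G F) :
    a f * Finsupp.linearCombination F a g - Finsupp.linearCombination F a g * a f =
      Finsupp.linearCombination F a (bracket α (bv f) g) := by
  induction g using Finsupp.induction_linear with
  | zero => simp
  | add g k hg hk => rw [map_add, map_add, map_add, ← hg, ← hk]; noncomm_ring
  | single b r =>
    have hb : (Finsupp.single b r : G F) = r • bv b := by simp [bv]
    have h1 := h f trivial b trivial
    rw [hf, zero_mul] at h1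
    simp only [sgn, if_true, one_smul] at h1
    rw [hb, map_smul, map_smul, map_smul, bracket_bv, bv, Finsupp.linearCombination_single, one_smul,
      mul_smul_comm, smul_mul_assoc, ← smul_sub, h1, add_sub_cancel_left]

/-- The commutator with `a f` is L - R for the commuting operators of left and right multiplication,
so in characteristic p its p-th power is L^p - R^p, the commutator with `a f ^ p`. It kills `a b`
because its cube already does. -/
theorem Rel.commute_pow (h : Rel α Set.univ a) {p : ℕ} [Fact p.Prime] [CharP F p] (hp : 3 < p)
    {f : Idx} (hf : f ∈ evenRoots) (b : Idx) : Commute (a f ^ p) (a b) := by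
  rcases subsingleton_or_nontrivial A with _ | _
  · exact Subsingleton.elim _ _
  have : CharP (Module.End F A) p :=
    charP_of_injective_algebraMap (algebraMap F (Module.End F A)).injective p
  have hpar := par_of_mem_evenRoots hf
  set D : Module.End F A := LinearMap.mulLeft F (a f) - LinearMap.mulRight F (a f) with hD
  have hD1 : ∀ g, D (Finsupp.linearCombination F a g) =
      Finsupp.linearCombination F a (bracket α (bv f) g) := fun g => h.ad_linear hpar g
  have hab : a b = Finsupp.linearCombination F a (bv b) := by simp [bv]
  have h3 : (D ^ 3) (a b) = 0 := by
    rw [pow_succ, pow_two, Module.End.mul_apply, Module.End.mul_apply, hab, hD1, hD1, hD1,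
      bracket_bv, ad_cube α hf, map_zero]
  have hDp : (D ^ p) (a b) = 0 := by
    obtain ⟨k, rfl⟩ : ∃ k, p = k + 3 := ⟨p - 3, by omega⟩
    rw [pow_add, Module.End.mul_apply, h3, map_zero]
  have hc : Commute (LinearMap.mulLeft F (a f)) (LinearMap.mulRight F (a f)) :=
    LinearMap.commute_mulLeft_right (a f) (a f)
  rw [hD, sub_pow_char_of_commute p hc, LinearMap.pow_mulLeft, LinearMap.pow_mulRight] at hDp
  simp only [LinearMap.sub_apply, LinearMap.mulLeft_apply, LinearMap.mulRight_apply] at hDp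
  exact sub_eq_zero.1 hDp

theorem intCast_pow_char (p : ℕ) [Fact p.Prime] [CharP F p] (n : ℤ) : (n : F) ^ p = n := by
  have := congrArg (ZMod.castHom (dvd_refl p) F) (ZMod.pow_card (n : ZMod p))
  rwa [map_pow, map_intCast] at this

theorem Rel.h_mul (h : Rel α Set.univ a) (i : Fin 3) (b : Idx) :
    a (hIdx i) * a b = a b * (a (hIdx i) + algebraMap F A (wt b i)) := by
  have h1 := h (hIdx i) trivial b trivial
  rw [par_hIdx, zero_mul, brBasis_h] at h1
  simp only [sgn, if_true, one_smul, map_smul, bv, Finsupp.linearCombination_single] at h1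
  rw [h1, mul_add, Algebra.smul_def, Algebra.commutes]

theorem Rel.h_pow_mul (h : Rel α Set.univ a) (i : Fin 3) (b : Idx) (n : ℕ) :
    a (hIdx i) ^ n * a b = a b * (a (hIdx i) + algebraMap F A (wt b i)) ^ n := by
  induction n with
  | zero => simp
  | succ n ih => rw [pow_succ', mul_assoc, ih, ← mul_assoc, h.h_mul, mul_assoc, ← pow_succ']

/-- Moving h past a root vector shifts h by an integer n, and (h + n)^p - (h + n) = h^p - h because
n^p = n in characteristic p. -/
theorem Rel.commute_h_pow (h : Rel α Set.univ a) {p : ℕ} [Fact p.Prime] [CharP F p]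
    (i : Fin 3) (b : Idx) : Commute (a (hIdx i) ^ p - a (hIdx i)) (a b) := by
  rcases subsingleton_or_nontrivial A with _ | _
  · exact Subsingleton.elim _ _
  have : CharP A p := charP_of_injective_algebraMap (algebraMap F A).injective p
  have h1 := h.h_pow_mul i b p
  rw [add_pow_char_of_commute p (Algebra.commutes _ _).symm, ← map_pow, intCast_pow_char] at h1
  rw [Commute, SemiconjBy, sub_mul, h1, h.h_mul]
  noncomm_ring

end Central

/-! ### Cocycles as extensions of the trivial module -/

section Extension

variable {Z : Type*} [AddCommGroup Z] [Module F Z]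

/-- Superderivations up to a twist by signs: cocycles on the basis vectors in `J`. -/
def Coc (α : F) (J : Set Idx) (a : Idx → Module.End F Z) (φ : Idx → Z) : Prop :=
  ∀ b ∈ J, ∀ c ∈ J, Finsupp.linearCombination F φ (brBasis α b c) =
    a b (φ c) - sgn F (par b * par c) • a c (φ b)

/-- The extension of the trivial module by `Z` given by a cocycle. -/
def extAct (a : Idx → Module.End F Z) (φ : Idx → Z) (b : Idx) : Module.End F (Z × F) :=
  LinearMap.inl F Z F ∘ₗ (a b ∘ₗ LinearMap.fst F Z F +
    (LinearMap.toSpanSingleton F Z (φ b)) ∘ₗ LinearMap.snd F Z F)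

@[simp] theorem extAct_apply (a : Idx → Module.End F Z) (φ : Idx → Z) (b : Idx) (z : Z × F) :
    extAct a φ b z = (a b z.1 + z.2 • φ b, 0) := by
  simp [extAct]

theorem linearCombination_extAct (a : Idx → Module.End F Z) (φ : Idx → Z) (g : G F) (z : Z × F) :
    Finsupp.linearCombination F (extAct a φ) g z =
      (Finsupp.linearCombination F a g z.1 + z.2 • Finsupp.linearCombination F φ g, 0) := by
  induction g using Finsupp.induction_linear with
  | zero => simp [← Prod.zero_eq_mk]
  | add g k hg hk =>
    simp only [map_add, LinearMap.add_apply, hg, hk, Prod.mk_add_mk, smul_add, add_zero]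
    congr 1; abel
  | single b r =>
    simp only [Finsupp.linearCombination_single, LinearMap.smul_apply, extAct_apply, Prod.smul_mk,
      smul_zero, smul_add]
    rw [smul_comm]

/-- The cocycle identity is precisely the commutation relation at the extra vector (0,1).
Consequences of the commutation relations can therefore be applied to the extension and read off for
φ. -/
theorem Rel.extAct {α : F} {J : Set Idx} {a : Idx → Module.End F Z} {φ : Idx → Z}
    (h : Rel α J a) (hφ : Coc α J a φ) : Rel α J (extAct a φ) := by
  intro b hb c hc
  refine LinearMap.ext fun z => ?_
  have h1 := LinearMap.congr_fun (h b hb c hc) z.1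
  simp only [Module.End.mul_apply, LinearMap.add_apply, LinearMap.smul_apply] at h1
  simp only [Module.End.mul_apply, LinearMap.add_apply, LinearMap.smul_apply, extAct_apply,
    linearCombination_extAct, hφ b hb c hc, map_add, map_smul, h1, zero_smul, add_zero,
    Prod.smul_mk, smul_zero, Prod.mk_add_mk]
  congr 1
  module

/-- At (0,1) the p-th power of f contributes f^(p-1) φ(f). This vector is the obstruction to
extending the p-structure, and the source of the parameters b of ψ₁. -/
theorem extAct_pow_succ (a : Idx → Module.End F Z) (φ : Idx → Z) (b : Idx) (n : ℕ) (z : Z × F) :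
    (extAct a φ b ^ (n + 1)) z = ((a b ^ (n + 1)) z.1 + z.2 • (a b ^ n) (φ b), 0) := by
  induction n generalizing z with
  | zero => simp
  | succ n ih =>
    rw [pow_succ, Module.End.mul_apply, ih]
    simp [pow_succ]

variable {α : F} {a : Idx → Module.End F Z} {φ : Idx → Z}

/-- Central elements of the enveloping algebra act on cocycles through inner ones. -/
theorem Coc.pow_apply (h : Rel α Set.univ a) (hφ : Coc α Set.univ a φ) {p : ℕ} [Fact p.Prime]
    [CharP F p] (hp : 3 < p) {f : Idx} (hf : f ∈ evenRoots) (b : Idx) :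
    a b ((a f ^ (p - 1)) (φ f)) = (a f ^ p) (φ b) := by
  -- Centrality of f^p in the extension, evaluated at the extra vector (0,1).
  have h1 := LinearMap.congr_fun ((h.extAct hφ).commute_pow hp hf b) (0, 1)
  obtain ⟨k, rfl⟩ : ∃ k, p = k + 1 := ⟨p - 1, by omega⟩
  simp only [Module.End.mul_apply, extAct_pow_succ, extAct_apply] at h1
  simpa using (congrArg Prod.fst h1).symm

theorem Coc.h_pow_apply (h : Rel α Set.univ a) (hφ : Coc α Set.univ a φ) {p : ℕ} [Fact p.Prime]
    [CharP F p] (i : Fin 3) (b : Idx) :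
    a b ((a (hIdx i) ^ (p - 1)) (φ (hIdx i)) - φ (hIdx i)) =
      (a (hIdx i) ^ p - a (hIdx i)) (φ b) := by
  have h1 := LinearMap.congr_fun ((h.extAct hφ).commute_h_pow (p := p) i b) (0, 1)
  obtain ⟨k, rfl⟩ : ∃ k, p = k + 1 := ⟨p - 1, by have := (Fact.out : p.Prime).pos; omega⟩
  simp only [Module.End.mul_apply, LinearMap.sub_apply, extAct_pow_succ, extAct_apply] at h1
  simpa using (congrArg Prod.fst h1).symm

end Extension

/-! ### Supports and parities of brackets -/

theorem gPart_coord {i : ZMod 2} {g : G F} (hg : g ∈ gPart F i) {b : Idx} (hb : par b ≠ i) :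
    g b = 0 := by
  induction hg using Submodule.span_induction with
  | mem v hv =>
    obtain ⟨c, hc, rfl⟩ := hv
    exact Finsupp.single_eq_of_ne fun h => hb (h ▸ hc)
  | zero => simp
  | add v w _ _ hv hw => simp [hv, hw]
  | smul c v _ hv => simp [hv]

theorem structZ_par :
    (Idx.all.all fun a => Idx.all.all fun b => (structZ a b).all fun t =>
      decide (par t.1 = par a + par b)) = true := by
  decide +kernel

/-- Facts about which basis vectors occur in a bracket (parity, weight, height, triangular parts)
are decided on the integral lists; this transfers them to every field and every α. -/
theorem exists_of_brBasis_ne_zero {α : F} {b c d : Idx} (h : brBasis α b c d ≠ 0) :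
    ∃ t ∈ structZ b c, t.1 = d := by
  by_contra! hd
  apply h
  rw [brBasis_eq, evalZ]
  generalize structZ b c = l at hd
  induction l with
  | nil => rfl
  | cons t l ih =>
    rw [List.map_cons, List.sum_cons, Finsupp.add_apply, ih fun t ht => hd t (by simp [ht])]
    simp [bv, Finsupp.single_eq_of_ne' (hd t (by simp))]

theorem brBasis_mem_gPart (α : F) (a b : Idx) : brBasis α a b ∈ gPart F (par a + par b) := by
  have h := structZ_par
  simp only [List.all_eq_true, decide_eq_true_eq] at h
  rw [brBasis_eq, evalZ]
  refine list_sum_mem fun v hv => ?_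
  obtain ⟨t, ht, rfl⟩ := List.mem_map.1 hv
  exact Submodule.smul_mem _ _ (h a a.mem_all b b.mem_all t ht ▸ bv_mem_gPart t.1)

theorem sgn_mul_self (i : ZMod 2) : sgn F i * sgn F i = 1 := by
  unfold sgn; split <;> simp

theorem bracket_skew (α : F) (a : Idx) {i : ZMod 2} {g : G F} (hg : g ∈ gPart F i) :
    bracket α (bv a) g = -(sgn F (par a * i) • bracket α g (bv a)) := by
  induction hg using Submodule.span_induction with
  | mem v hv =>
    obtain ⟨c, rfl, rfl⟩ := hv
    rw [bracket_bv, bracket_bv, brBasis_skew]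
  | zero => simp
  | add v w _ _ hv hw => rw [map_add, hv, hw, map_add, LinearMap.add_apply]; module
  | smul c v _ hv => rw [map_smul, hv, map_smul, LinearMap.smul_apply]; module

theorem jacobi_right (α : F) (x a b : Idx) :
    bracket α (bv x) (brBasis α a b) = bracket α (brBasis α x a) (bv b) -
      sgn F (par a * par b) • bracket α (brBasis α x b) (bv a) := by
  rw [jacobi, bracket_skew α a (brBasis_mem_gPart α x b)]
  rcases zmod2_cases (par x) with h1 | h1 <;> rcases zmod2_cases (par a) with h2 | h2 <;>
    rcases zmod2_cases (par b) with h3 | h3 <;> simp [h1, h2, h3, sgn, sub_eq_add_neg] <;>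
    (try simp [show (1 + 1 : ZMod 2) = 0 from rfl])

/-- A linear combination of operators applied to a vector. -/
theorem linearCombination_apply_apply {Z : Type*} [AddCommGroup Z] [Module F Z]
    (a : Idx → Module.End F Z) (g : G F) (z : Z) :
    Finsupp.linearCombination F a g z = Finsupp.linearCombination F (fun c => a c z) g := by
  simp [Finsupp.linearCombination_apply, Finsupp.sum, LinearMap.sum_apply]

/-! Generators of reduced enveloping algebras -/

section Generators

variable (α : F) (p : ℕ) (χ : Module.Dual F (gPart F 0))

open Classical in
/-- The image of a basis vector in `u_χ(S)`, or zero if it does not lie in `S`. -/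
def ug (S : Submodule F (G F)) (b : Idx) : U α p χ S :=
  if h : (bv b : G F) ∈ S then uι α p χ S ⟨bv b, h⟩ else 0

variable {α p χ} {S : Submodule F (G F)}

theorem ug_of_mem {b : Idx} (h : (bv b : G F) ∈ S) : ug α p χ S b = uι α p χ S ⟨bv b, h⟩ :=
  dif_pos h

/-- A subspace spanned by basis vectors. -/
def IsCoordinate (S : Submodule F (G F)) : Prop := ∀ x ∈ S, ∀ b, x b ≠ 0 → (bv b : G F) ∈ S

theorem linearCombination_bv (g : G F) : Finsupp.linearCombination F (bv : Idx → G F) g = g := by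
  simp [Finsupp.linearCombination_apply, bv, Finsupp.sum_single]

theorem eq_sum_bv (g : G F) : g = ∑ b ∈ g.support, g b • bv b :=
  (linearCombination_bv g).symm

theorem uι_eq (hS : IsCoordinate S) (x : S) :
    uι α p χ S x = Finsupp.linearCombination F (ug α p χ S) x := by
  have hx : x = ∑ b ∈ (x : G F).support.attach,
      (x : G F) b.1 • (⟨bv b.1, hS x x.2 b.1 (Finsupp.mem_support_iff.1 b.2)⟩ : S) := by
    apply Subtype.ext
    rw [AddSubmonoidClass.coe_finsetSum]
    simp only [Submodule.coe_smul]
    rw [Finset.sum_attach (x : G F).support fun b => (x : G F) b • (bv b : G F)]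
    exact eq_sum_bv _
  conv_lhs => rw [hx]
  rw [map_sum, Finsupp.linearCombination_apply, Finsupp.sum,
    ← Finset.sum_attach (x : G F).support]
  refine Finset.sum_congr rfl fun b _ => ?_
  rw [map_smul, ug_of_mem]

theorem rel_ug (hS : IsCoordinate S)
    (hcl : ∀ b c, (bv b : G F) ∈ S → (bv c : G F) ∈ S → brBasis α b c ∈ S) :
    Rel α {b | (bv b : G F) ∈ S} (ug α p χ S) := by
  intro b hb c hc
  have hcl' := hcl b c hb hc
  rw [ug_of_mem hb, ug_of_mem hc, uι_comm α p χ S (par b) (par c) ⟨bv b, hb⟩ ⟨bv c, hc⟩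
    ⟨brBasis α b c, hcl'⟩ (bv_mem_gPart b) (bv_mem_gPart c) (bracket_bv α b c).symm,
    uι_eq hS ⟨brBasis α b c, hcl'⟩]

theorem ug_pow (hS : IsCoordinate S) {b : Idx} (hb : (bv b : G F) ∈ S) (hpar : par b = 0) :
    ug α p χ S b ^ p = Finsupp.linearCombination F (ug α p χ S) (pMap b) +
      algebraMap F _ (χ (evenBv b hpar) ^ p) := by
  have hm : pMap b ∈ S := by
    cases b <;> simp only [pMap] <;> first | exact hb | exact S.zero_mem
  rw [ug_of_mem hb, uι_pow α p χ S b hpar ⟨bv b, hb⟩ ⟨pMap b, hm⟩ rfl rfl, uι_eq hS]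

theorem U_induction (hS : IsCoordinate S) (W : Submodule F (U α p χ S)) (h1 : 1 ∈ W)
    (hW : ∀ b, (bv b : G F) ∈ S → ∀ u ∈ W, ug α p χ S b * u ∈ W) (u : U α p χ S) : u ∈ W := by
  -- Stability of `W` under left multiplication by every tensor, rather than mere membership, is
  -- what passes to products.
  have key : ∀ t : TensorAlgebra F S, ∀ u ∈ W, uMk α p χ S t * u ∈ W := by
    intro t
    induction t using TensorAlgebra.induction with
    | algebraMap r =>
      intro u hu
      rw [AlgHom.commutes, ← Algebra.smul_def]
      exact W.smul_mem r hu
    | ι x =>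
      intro u hu
      change uι α p χ S x * u ∈ W
      rw [uι_eq hS, Finsupp.linearCombination_apply, Finsupp.sum, Finset.sum_mul]
      refine W.sum_mem fun b hb => ?_
      rw [smul_mul_assoc]
      exact W.smul_mem _ (hW b (hS x x.2 b (Finsupp.mem_support_iff.1 hb)) u hu)
    | mul s t hs ht =>
      intro u hu
      rw [map_mul, mul_assoc]
      exact hs _ (ht u hu)
    | add s t hs ht =>
      intro u hu
      rw [map_add, add_mul]
      exact W.add_mem (hs u hu) (ht u hu)
  obtain ⟨t, rfl⟩ := RingQuot.mkAlgHom_surjective F (URel α p χ S) u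
  exact mul_one (uMk α p χ S t) ▸ key t 1 h1

theorem rel_linear {J : Set Idx} {A : Type*} [Ring A] [Algebra F A] {a : Idx → A}
    (h : Rel α J a) {i j : ZMod 2} {x y : G F} (hx : x ∈ gPart F i) (hy : y ∈ gPart F j)
    (hxJ : ∀ b, x b ≠ 0 → b ∈ J) (hyJ : ∀ b, y b ≠ 0 → b ∈ J) :
    Finsupp.linearCombination F a x * Finsupp.linearCombination F a y =
      sgn F (i * j) • (Finsupp.linearCombination F a y * Finsupp.linearCombination F a x) +
        Finsupp.linearCombination F a (bracket α x y) := by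
  have hbr : bracket α x y = ∑ b ∈ x.support, ∑ c ∈ y.support,
      (x b * y c) • brBasis α b c := by
    conv_lhs => rw [eq_sum_bv x, eq_sum_bv y]
    simp only [map_sum, LinearMap.sum_apply, map_smul, LinearMap.smul_apply, bracket_bv,
      Finset.smul_sum]
    rw [Finset.sum_comm]
    refine Finset.sum_congr rfl fun b _ => Finset.sum_congr rfl fun c _ => ?_
    rw [smul_smul, mul_comm]
  rw [hbr]
  simp only [map_sum, map_smul]
  rw [Finsupp.linearCombination_apply, Finsupp.linearCombination_apply, Finsupp.sum, Finsupp.sum,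
    Finset.sum_mul_sum, Finset.sum_mul_sum, Finset.sum_comm (s := y.support), Finset.smul_sum,
    ← Finset.sum_add_distrib]
  refine Finset.sum_congr rfl fun b hb => ?_
  rw [Finset.smul_sum, ← Finset.sum_add_distrib]
  refine Finset.sum_congr rfl fun c hc => ?_
  have hb' := Finsupp.mem_support_iff.1 hb
  have hc' := Finsupp.mem_support_iff.1 hc
  have hbi : par b = i := by by_contra h'; exact hb' (gPart_coord hx h')
  have hci : par c = j := by by_contra h'; exact hc' (gPart_coord hy h')
  rw [smul_mul_smul_comm, h b (hxJ b hb') c (hyJ c hc'), hbi, hci, smul_mul_smul_comm, smul_add,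
    mul_comm (y c)]
  congr 1
  rw [smul_comm]

/-- The universal property of `u_χ(S)` in terms of basis vectors. -/
theorem exists_lift (hS : IsCoordinate S) {A : Type*} [Ring A] [Algebra F A] {a : Idx → A}
    (h : Rel α {b | (bv b : G F) ∈ S} a)
    (hpow : ∀ b, (bv b : G F) ∈ S → ∀ hb : par b = 0, a b ^ p =
      Finsupp.linearCombination F a (pMap b) + algebraMap F A (χ (evenBv b hb) ^ p)) :
    ∃ g : U α p χ S →ₐ[F] A, ∀ b, (bv b : G F) ∈ S → g (ug α p χ S b) = a b := by
  refine ⟨uLift (TensorAlgebra.lift F (Finsupp.linearCombination F a ∘ₗ S.subtype)) ?_, ?_⟩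
  · intro x y hxy
    cases hxy with
    | comm i j x y z hx hy hz =>
      simp only [map_mul, map_add, map_smul, TensorAlgebra.lift_ι_apply, LinearMap.comp_apply,
        Submodule.subtype_apply, hz]
      exact rel_linear h hx hy (fun b hb => hS x x.2 b hb) fun b hb => hS y y.2 b hb
    | pow b hb x z hx hz =>
      have hm : (bv b : G F) ∈ S := hx ▸ x.2
      rw [map_pow, map_add, AlgHom.commutes]
      simp only [TensorAlgebra.lift_ι_apply, LinearMap.comp_apply, Submodule.subtype_apply, hx, hz]
      rw [← hpow b hm hb]
      simp [bv]
  · intro b hb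
    rw [ug_of_mem hb]
    change uLift _ _ (uMk α p χ S (TensorAlgebra.ι F _)) = _
    have : ∀ (g : TensorAlgebra F S →ₐ[F] A) (hg : ∀ ⦃x y⦄, URel α p χ S x y → g x = g y) t,
        uLift g hg (uMk α p χ S t) = g t := fun g hg t =>
      RingQuot.liftAlgHom_mkAlgHom_apply F g hg t
    rw [this]
    simp [bv]

end Generators

/-! ### The subalgebra 𝔫⁻ and its complement -/

/-- The labels of `𝔫⁻`. -/
def negIdx : Set Idx := {f1, f2, f3, y1, y2, y3, y4}

instance : DecidablePred (· ∈ negIdx) := fun b => by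
  unfold negIdx; simp only [Set.mem_insert_iff, Set.mem_singleton_iff]; infer_instance

theorem mem_borelIdx_iff {b : Idx} : b ∈ borelIdx ↔ b ∉ negIdx := by
  cases b <;> simp [borelIdx, negIdx]

/-- The subalgebra `𝔫⁻`. -/
def nMinus (F : Type*) [Field F] : Submodule F (G F) := Finsupp.supported F F negIdx

theorem bv_mem_nMinus {b : Idx} : (bv b : G F) ∈ nMinus F ↔ b ∈ negIdx := by
  constructor
  · intro h
    by_contra hb
    have := (Finsupp.mem_supported' F _).1 h b hb
    simp [bv] at this
  · exact fun h => Finsupp.single_mem_supported F 1 h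

theorem isCoordinate_nMinus : IsCoordinate (nMinus F) := fun x hx b hb => by
  rw [bv_mem_nMinus]
  by_contra h
  exact hb ((Finsupp.mem_supported' F _).1 hx b h)

theorem isCoordinate_top : IsCoordinate (⊤ : Submodule F (G F)) := fun _ _ _ _ => trivial

theorem brBasis_mem_nMinus (α : F) {b c : Idx} (hb : b ∈ negIdx) (hc : c ∈ negIdx) :
    brBasis α b c ∈ nMinus F := by
  have hf1 : (bv f1 : G F) ∈ nMinus F := bv_mem_nMinus.2 (by decide)
  have hy2 : (bv y2 : G F) ∈ nMinus F := bv_mem_nMinus.2 (by decide)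
  have hy3 : (bv y3 : G F) ∈ nMinus F := bv_mem_nMinus.2 (by decide)
  have hy4 : (bv y4 : G F) ∈ nMinus F := bv_mem_nMinus.2 (by decide)
  simp only [negIdx, Set.mem_insert_iff, Set.mem_singleton_iff] at hb hc
  rcases hb with rfl | rfl | rfl | rfl | rfl | rfl | rfl <;>
    rcases hc with rfl | rfl | rfl | rfl | rfl | rfl | rfl <;>
    simp [brBasis, table, par, Submodule.smul_mem, hf1, hy2, hy3, hy4]

theorem pMap_of_mem_negIdx {b : Idx} (hb : b ∈ negIdx) : (pMap b : G F) = 0 := by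
  simp only [negIdx, Set.mem_insert_iff, Set.mem_singleton_iff] at hb
  rcases hb with rfl | rfl | rfl | rfl | rfl | rfl | rfl <;> rfl

theorem lamExt_bracket_bv (α : F) (lam : Module.Dual F (cartan F)) {b c : Idx} (hb : b ∉ negIdx)
    (hc : c ∉ negIdx) : lamExt lam (brBasis α b c) = 0 := by
  rw [← bracket_bv]
  exact lamExt_bracket α lam (Submodule.subset_span ⟨b, mem_borelIdx_iff.2 hb, rfl⟩)
    (Submodule.subset_span ⟨c, mem_borelIdx_iff.2 hc, rfl⟩)

theorem structZ_borel :
    (Idx.all.all fun b => Idx.all.all fun c => (structZ b c).all fun t =>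
      decide (t.1 ∈ negIdx → b ∈ negIdx ∨ c ∈ negIdx)) = true := by
  decide +kernel

theorem brBasis_borel (α : F) {b c : Idx} (hb : b ∉ negIdx) (hc : c ∉ negIdx) {d : Idx}
    (hd : brBasis α b c d ≠ 0) : d ∉ negIdx := by
  obtain ⟨t, ht, rfl⟩ := exists_of_brBasis_ne_zero hd
  have h := structZ_borel
  simp only [List.all_eq_true, decide_eq_true_eq] at h
  intro h'
  exact (h b b.mem_all c c.mem_all t ht h').elim hb hc

/-! ### The module Hom(𝔤, u_χ(𝔫⁻)) -/

section Model

variable (α : F) (p : ℕ) (χ : Module.Dual F (gPart F 0)) (lam : Module.Dual F (cartan F))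

/-- The reduced enveloping algebra of `𝔫⁻`. -/
abbrev UN : Type _ := U α p χ (nMinus F)

/-- The generators of `UN`. -/
abbrev ng (b : Idx) : UN α p χ := ug α p χ (nMinus F) b

theorem rel_ng : Rel α negIdx (ng α p χ) := by
  have h : negIdx = {b | (bv b : G F) ∈ nMinus F} := by ext b; exact bv_mem_nMinus.symm
  rw [h]
  exact rel_ug isCoordinate_nMinus fun b c hb hc =>
    brBasis_mem_nMinus α (bv_mem_nMinus.1 hb) (bv_mem_nMinus.1 hc)

theorem ng_pow {b : Idx} (hb : b ∈ negIdx) (hpar : par b = 0) :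
    ng α p χ b ^ p = algebraMap F _ (χ (evenBv b hpar) ^ p) := by
  rw [ug_pow isCoordinate_nMinus (bv_mem_nMinus.2 hb) hpar, pMap_of_mem_negIdx hb, map_zero,
    zero_add]

/-- The action of a basis vector of `𝔫⁻` on `Hom(𝔤, UN)`:
`(b q)(x) = ± b q(x) + q([x, b])`. -/
def homAct (b : Idx) : Module.End F (Idx → UN α p χ) where
  toFun q x := sgn F (par b * par x) • (ng α p χ b * q x) +
    Finsupp.linearCombination F q (brBasis α x b)
  map_add' q r := by
    funext x
    simp only [Pi.add_apply, mul_add, smul_add, Finsupp.linearCombination_apply, Finsupp.sum,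
      Finset.sum_add_distrib]
    abel
  map_smul' c q := by
    funext x
    simp only [Pi.smul_apply, mul_smul_comm, smul_add, Finsupp.linearCombination_apply, Finsupp.sum,
      Finset.smul_sum, RingHom.id_apply]
    congr 1
    · rw [smul_comm]
    · exact Finset.sum_congr rfl fun _ _ => by rw [smul_comm]

theorem homAct_apply (b x : Idx) (q : Idx → UN α p χ) : homAct α p χ b q x =
    sgn F (par b * par x) • (ng α p χ b * q x) +
      Finsupp.linearCombination F q (brBasis α x b) := rfl

theorem linearCombination_homAct (b : Idx) (q : Idx → UN α p χ) {i : ZMod 2} {g : G F}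
    (hg : g ∈ gPart F i) : Finsupp.linearCombination F (homAct α p χ b q) g =
      sgn F (par b * i) • (ng α p χ b * Finsupp.linearCombination F q g) +
        Finsupp.linearCombination F q (bracket α g (bv b)) := by
  induction hg using Submodule.span_induction with
  | mem v hv =>
    obtain ⟨c, rfl, rfl⟩ := hv
    rw [bracket_bv, bv, Finsupp.linearCombination_single, Finsupp.linearCombination_single,
      one_smul, one_smul, homAct_apply]
  | zero => simp
  | add v w _ _ hv hw =>
    simp only [map_add, hv, hw, LinearMap.add_apply, mul_add, smul_add]
    abel
  | smul c v _ hv =>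
    simp only [map_smul, hv, LinearMap.smul_apply, mul_smul_comm, smul_add]
    rw [smul_comm]

theorem linearCombination_homAct_apply (x : Idx) (q : Idx → UN α p χ) {i : ZMod 2} {g : G F}
    (hg : g ∈ gPart F i) : Finsupp.linearCombination F (homAct α p χ) g q x =
      sgn F (i * par x) • (Finsupp.linearCombination F (ng α p χ) g * q x) +
        Finsupp.linearCombination F q (bracket α (bv x) g) := by
  induction hg using Submodule.span_induction with
  | mem v hv =>
    obtain ⟨c, rfl, rfl⟩ := hv
    rw [bracket_bv, bv, Finsupp.linearCombination_single, Finsupp.linearCombination_single,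
      one_smul, one_smul, homAct_apply]
  | zero => simp
  | add v w _ _ hv hw =>
    simp only [map_add, hv, hw, LinearMap.add_apply, add_mul, smul_add, Pi.add_apply]
    abel
  | smul c v _ hv =>
    simp only [map_smul, hv, LinearMap.smul_apply, smul_mul_assoc, smul_add, Pi.smul_apply]
    rw [smul_comm]

/-- The operator attached to b is left multiplication in `UN` plus the transpose of bracketing with
b. The commutation relations of `UN` take care of the first part and the Jacobi identity, bracketing
on the right, of the second. -/
theorem rel_homAct : Rel α negIdx (homAct α p χ) := by
  intro a ha b hb
  refine LinearMap.ext fun q => funext fun x => ?_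
  have hab := rel_ng α p χ a ha b hb
  simp only [Module.End.mul_apply, LinearMap.add_apply, LinearMap.smul_apply, Pi.add_apply,
    Pi.smul_apply]
  rw [linearCombination_homAct_apply α p χ x q (brBasis_mem_gPart α a b), jacobi_right,
    homAct_apply α p χ a, homAct_apply α p χ b x, homAct_apply α p χ b, homAct_apply α p χ a x,
    linearCombination_homAct α p χ b q (brBasis_mem_gPart α x a),
    linearCombination_homAct α p χ a q (brBasis_mem_gPart α x b), map_sub, map_smul]
  simp only [mul_add, mul_smul_comm, ← mul_assoc, hab, add_mul, smul_mul_assoc]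
  rcases zmod2_cases (par x) with h1 | h1 <;> rcases zmod2_cases (par a) with h2 | h2 <;>
    rcases zmod2_cases (par b) with h3 | h3 <;>
    simp only [h1, h2, h3, sgn, mul_zero, mul_one, add_zero, zero_add,
      show (1 + 1 : ZMod 2) = 0 from rfl, if_true, one_ne_zero, if_false] <;> module

theorem bracket_cube_right (α : F) {f : Idx} (hf : f ∈ evenRoots) (b : Idx) :
    bracket α (bracket α (brBasis α b f) (bv f)) (bv f) = 0 := by
  have h := ad_cube α hf b
  have hp := par_of_mem_evenRoots hf
  have hs : ∀ {g : G F} {i}, g ∈ gPart F i → bracket α g (bv f) = -bracket α (bv f) g := by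
    intro g i hg
    rw [bracket_skew α f hg, hp, zero_mul]
    simp [sgn]
  have hm : ∀ {g : G F} {i}, g ∈ gPart F i → bracket α (bv f) g ∈ gPart F i := by
    intro g i hg
    induction hg using Submodule.span_induction with
    | mem v hv =>
      obtain ⟨c, rfl, rfl⟩ := hv
      have := brBasis_mem_gPart α f c
      rwa [hp, zero_add, ← bracket_bv] at this
    | zero => simp
    | add v w _ _ hv hw => rw [map_add]; exact Submodule.add_mem _ hv hw
    | smul c v _ hv => rw [map_smul]; exact Submodule.smul_mem _ _ hv
  have hb := bv_mem_gPart (F := F) b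
  rw [← bracket_bv] at h ⊢
  rw [hs hb, map_neg, LinearMap.neg_apply, hs (hm hb), neg_neg, hs (hm (hm hb)), h, neg_zero]

/-- Left multiplication L and precomposition R with the bracket commute, and R³ = 0; hence (L + R)^p
= L^p, which is the scalar χ(f)^p. -/
theorem homAct_pow [Fact p.Prime] [CharP F p] (hp : 3 < p) {f : Idx} (hf : f ∈ evenRoots)
    (hn : f ∈ negIdx) : homAct α p χ f ^ p =
      algebraMap F _ (χ (evenBv f (par_of_mem_evenRoots hf)) ^ p) := by
  rcases subsingleton_or_nontrivial (Module.End F (Idx → UN α p χ)) with _ | _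
  · exact Subsingleton.elim _ _
  have : CharP (Module.End F (Idx → UN α p χ)) p :=
    charP_of_injective_algebraMap (algebraMap F (Module.End F (Idx → UN α p χ))).injective p
  have hpar := par_of_mem_evenRoots hf
  set L : Module.End F (Idx → UN α p χ) := LinearMap.compLeft (LinearMap.mulLeft F (ng α p χ f)) Idx
    with hL
  set R : Module.End F (Idx → UN α p χ) := homAct α p χ f - L with hR
  have hLa : ∀ q x, L q x = ng α p χ f * q x := fun q x => rfl
  have hRa : ∀ q x, R q x = Finsupp.linearCombination F q (brBasis α x f) := by
    intro q x
    rw [hR, LinearMap.sub_apply, Pi.sub_apply, homAct_apply, hLa, hpar, zero_mul]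
    simp [sgn]
  have hRl : ∀ q g, Finsupp.linearCombination F (R q) g =
      Finsupp.linearCombination F q (bracket α g (bv f)) := by
    intro q g
    induction g using Finsupp.induction_linear with
    | zero => simp
    | add g k hg hk => rw [map_add, hg, hk, map_add, LinearMap.add_apply, map_add]
    | single b r =>
      have hb : (Finsupp.single b r : G F) = r • bv b := by simp [bv]
      rw [hb, map_smul, map_smul, LinearMap.smul_apply, map_smul, bracket_bv, bv,
        Finsupp.linearCombination_single, one_smul, hRa]
  have hR3 : R ^ 3 = 0 := by
    refine LinearMap.ext fun q => funext fun x => ?_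
    rw [pow_succ, pow_two, Module.End.mul_apply, Module.End.mul_apply, hRa, hRl, hRl,
      bracket_cube_right α hf, map_zero]
    rfl
  have hLn : ∀ n : ℕ, ∀ q x, (L ^ n) q x = ng α p χ f ^ n * q x := by
    intro n
    induction n with
    | zero => intro q x; simp
    | succ n ih => intro q x; rw [pow_succ, Module.End.mul_apply, ih, hLa, pow_succ, mul_assoc]
  have hc : Commute L R := by
    refine LinearMap.ext fun q => funext fun x => ?_
    rw [Module.End.mul_apply, Module.End.mul_apply, hLa, hRa, hRa, Finsupp.linearCombination_apply,
      Finsupp.linearCombination_apply, Finsupp.sum, Finsupp.sum, Finset.mul_sum]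
    exact Finset.sum_congr rfl fun c _ => by rw [hLa, mul_smul_comm]
  have hsum : homAct α p χ f = L + R := by rw [hR]; abel
  have hRp : R ^ p = 0 := pow_eq_zero_of_le hp.le hR3
  rw [hsum, add_pow_char_of_commute p hc, hRp, add_zero]
  refine LinearMap.ext fun q => funext fun x => ?_
  rw [hLn, ng_pow α p χ hn hpar, ← Algebra.smul_def]
  rfl

theorem even_neg_mem_evenRoots {b : Idx} (hb : b ∈ negIdx) (hpar : par b = 0) : b ∈ evenRoots := by
  revert b; decide

theorem exists_homRep [Fact p.Prime] [CharP F p] (hp : 3 < p) :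
    ∃ g : UN α p χ →ₐ[F] Module.End F (Idx → UN α p χ),
      ∀ b ∈ negIdx, g (ng α p χ b) = homAct α p χ b := by
  have h : negIdx = {b | (bv b : G F) ∈ nMinus F} := by ext b; exact bv_mem_nMinus.symm
  obtain ⟨g, hg⟩ := exists_lift (p := p) (χ := χ) isCoordinate_nMinus (h ▸ rel_homAct α p χ) (by
    intro b hb hpar
    have hb' := bv_mem_nMinus.1 hb
    rw [homAct_pow α p χ hp (even_neg_mem_evenRoots hb' hpar) hb', pMap_of_mem_negIdx hb', map_zero,
      zero_add])
  exact ⟨g, fun b hb => hg b (bv_mem_nMinus.2 hb)⟩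

end Model

/-! ### The action of 𝔤 on u_χ(𝔫⁻) -/

section Model

variable (α : F) (p : ℕ) (χ : Module.Dual F (gPart F 0)) (lam : Module.Dual F (cartan F))

/-- A family of operators on `UN` is induced from `lam` if it satisfies the recursion that
determines the action of `𝔤` on the baby Verma module, identified with `UN`. -/
structure IsInduced (ρ : Idx → Module.End F (UN α p χ)) : Prop where
  one_neg : ∀ x ∈ negIdx, ρ x 1 = ng α p χ x
  one_borel : ∀ x ∉ negIdx, ρ x 1 = algebraMap F _ (lamExt lam (bv x))
  mul : ∀ b ∈ negIdx, ∀ x u, ρ x (ng α p χ b * u) =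
    sgn F (par b * par x) • (ng α p χ b * ρ x u) + Finsupp.linearCombination F ρ (brBasis α x b) u

/-- Read for the map u ↦ (x ↦ ρ x u) from `UN` to Hom(𝔤, `UN`), the recursion says that this map is
𝔫⁻-equivariant. It is therefore the orbit map of the prescribed value q at 1, and it exists because
`UN` acts on Hom(𝔤, `UN`). -/
theorem exists_isInduced [Fact p.Prime] [CharP F p] (hp : 3 < p) :
    ∃ ρ, IsInduced α p χ lam ρ := by
  obtain ⟨g, hg⟩ := exists_homRep α p χ hp
  let q : Idx → UN α p χ := fun x =>
    if x ∈ negIdx then ng α p χ x else algebraMap F _ (lamExt lam (bv x))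
  let ρ : Idx → Module.End F (UN α p χ) := fun x =>
    LinearMap.proj x ∘ₗ LinearMap.applyₗ q ∘ₗ g.toLinearMap
  have hρ : ∀ x u, ρ x u = g u q x := fun x u => rfl
  refine ⟨ρ, ⟨fun x hx => ?_, fun x hx => ?_, fun b hb x u => ?_⟩⟩
  · rw [hρ, map_one, Module.End.one_apply]; exact if_pos hx
  · rw [hρ, map_one, Module.End.one_apply]; exact if_neg hx
  · rw [hρ, map_mul, hg b hb, Module.End.mul_apply, homAct_apply, hρ,
      linearCombination_apply_apply]
    rfl

variable {α p χ lam} {ρ : Idx → Module.End F (UN α p χ)}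

theorem UN_induction (W : Submodule F (UN α p χ)) (h1 : 1 ∈ W)
    (hW : ∀ b ∈ negIdx, ∀ u ∈ W, ng α p χ b * u ∈ W) (u : UN α p χ) : u ∈ W :=
  U_induction isCoordinate_nMinus W h1 (fun b hb => hW b (bv_mem_nMinus.1 hb)) u

theorem IsInduced.linear_neg_aux {g : G F} (hg : g ∈ nMinus F) {u : UN α p χ}
    (h : ∀ x ∈ negIdx, ρ x u = ng α p χ x * u) : Finsupp.linearCombination F ρ g u =
      Finsupp.linearCombination F (ng α p χ) g * u := by
  rw [Finsupp.linearCombination_apply, Finsupp.linearCombination_apply, Finsupp.sum, Finsupp.sum,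
    LinearMap.sum_apply, Finset.sum_mul]
  refine Finset.sum_congr rfl fun b hb => ?_
  rw [LinearMap.smul_apply, smul_mul_assoc, h b (bv_mem_nMinus.1
    (isCoordinate_nMinus g hg b (Finsupp.mem_support_iff.1 hb)))]

theorem IsInduced.neg (h : IsInduced α p χ lam ρ) {x : Idx} (hx : x ∈ negIdx) (u : UN α p χ) :
    ρ x u = ng α p χ x * u := by
  let W : Submodule F (UN α p χ) :=
    { carrier := {u | ∀ x ∈ negIdx, ρ x u = ng α p χ x * u}
      zero_mem' := fun x _ => by simp
      add_mem' := fun ha hb x hx => by rw [map_add, ha x hx, hb x hx, mul_add]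
      smul_mem' := fun c u hu x hx => by rw [map_smul, hu x hx, mul_smul_comm] }
  refine UN_induction W (fun x hx => ?_) (fun b hb u hu x hx => ?_) u x hx
  · rw [h.one_neg x hx, mul_one]
  · rw [h.mul b hb, hu x hx, IsInduced.linear_neg_aux (brBasis_mem_nMinus α hx hb) hu, ← mul_assoc,
      ← mul_assoc, rel_ng α p χ x hx b hb, add_mul, smul_mul_assoc, mul_comm (par b)]

theorem IsInduced.mul_linear (h : IsInduced α p χ lam ρ) {b : Idx} (hb : b ∈ negIdx) {i : ZMod 2}
    {g : G F} (hg : g ∈ gPart F i) (u : UN α p χ) :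
    Finsupp.linearCombination F ρ g (ng α p χ b * u) =
      sgn F (par b * i) • (ng α p χ b * Finsupp.linearCombination F ρ g u) +
        Finsupp.linearCombination F ρ (bracket α g (bv b)) u := by
  induction hg using Submodule.span_induction with
  | mem v hv =>
    obtain ⟨c, rfl, rfl⟩ := hv
    rw [bracket_bv, bv, Finsupp.linearCombination_single, one_smul, h.mul b hb]
  | zero => simp
  | add v w _ _ hv hw =>
    simp only [map_add, hv, hw, LinearMap.add_apply, mul_add, smul_add]
    abel
  | smul c v _ hv =>
    simp only [map_smul, hv, LinearMap.smul_apply, mul_smul_comm, smul_add]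
    rw [smul_comm]

theorem IsInduced.linear_one (h : IsInduced α p χ lam ρ) {g : G F}
    (hg : ∀ b, g b ≠ 0 → b ∉ negIdx) :
    Finsupp.linearCombination F ρ g 1 = algebraMap F _ (lamExt lam g) := by
  conv_rhs => rw [eq_sum_bv g]
  rw [map_sum, map_sum, Finsupp.linearCombination_apply, Finsupp.sum, LinearMap.sum_apply]
  refine Finset.sum_congr rfl fun b hb => ?_
  rw [LinearMap.smul_apply, h.one_borel b (hg b (Finsupp.mem_support_iff.1 hb)), map_smul,
    smul_eq_mul, map_mul, Algebra.smul_def]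

/-- The commutator rule on a fixed vector, with the first factor homogeneous. -/
theorem comm_linear_left {Z : Type*} [AddCommGroup Z] [Module F Z] {ρ : Idx → Module.End F Z}
    {u : Z} (hu : ∀ x y, ρ x (ρ y u) = sgn F (par x * par y) • ρ y (ρ x u) +
      Finsupp.linearCombination F ρ (brBasis α x y) u) (y : Idx) {i : ZMod 2} {g : G F}
    (hg : g ∈ gPart F i) : Finsupp.linearCombination F ρ g (ρ y u) =
      sgn F (i * par y) • ρ y (Finsupp.linearCombination F ρ g u) +
        Finsupp.linearCombination F ρ (bracket α g (bv y)) u := by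
  induction hg using Submodule.span_induction with
  | mem v hv =>
    obtain ⟨c, rfl, rfl⟩ := hv
    rw [bracket_bv, bv, Finsupp.linearCombination_single, one_smul, hu]
  | zero => simp
  | add v w _ _ hv hw =>
    simp only [map_add, hv, hw, LinearMap.add_apply, smul_add]
    abel
  | smul c v _ hv =>
    simp only [map_smul, hv, LinearMap.smul_apply, smul_add]
    rw [smul_comm]

/-- The commutator rule on a fixed vector, with the second factor homogeneous. -/
theorem comm_linear_right {Z : Type*} [AddCommGroup Z] [Module F Z] {ρ : Idx → Module.End F Z}
    {u : Z} (hu : ∀ x y, ρ x (ρ y u) = sgn F (par x * par y) • ρ y (ρ x u) +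
      Finsupp.linearCombination F ρ (brBasis α x y) u) (x : Idx) {i : ZMod 2} {g : G F}
    (hg : g ∈ gPart F i) : ρ x (Finsupp.linearCombination F ρ g u) =
      sgn F (par x * i) • Finsupp.linearCombination F ρ g (ρ x u) +
        Finsupp.linearCombination F ρ (bracket α (bv x) g) u := by
  induction hg using Submodule.span_induction with
  | mem v hv =>
    obtain ⟨c, rfl, rfl⟩ := hv
    rw [bracket_bv, bv, Finsupp.linearCombination_single, one_smul, hu]
  | zero => simp
  | add v w _ _ hv hw =>
    simp only [map_add, hv, hw, LinearMap.add_apply, smul_add]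
    abel
  | smul c v _ hv =>
    simp only [map_smul, hv, LinearMap.smul_apply, smul_add]
    rw [smul_comm]

theorem IsInduced.rel_one (h : IsInduced α p χ lam ρ) (x y : Idx) :
    ρ x (ρ y 1) = sgn F (par x * par y) • ρ y (ρ x 1) +
      Finsupp.linearCombination F ρ (brBasis α x y) 1 := by
  have hs : sgn F (par x * par y) * sgn F (par x * par y) = 1 := sgn_mul_self _
  by_cases hx : x ∈ negIdx
  · rw [h.one_neg x hx, ← mul_one (ng α p χ x), h.mul x hx, h.neg hx, brBasis_skew α x y, map_neg,
      map_smul, LinearMap.neg_apply, LinearMap.smul_apply, smul_add, smul_smul, hs, one_smul]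
    abel
  by_cases hy : y ∈ negIdx
  · rw [h.one_neg y hy, ← mul_one (ng α p χ y), h.mul y hy, h.neg hy, mul_comm (par x)]
  · have hl : ∀ x y : Idx, x ∉ negIdx → y ∉ negIdx → ρ x (ρ y 1) =
        algebraMap F _ (lamExt lam (bv y) * lamExt lam (bv x)) := by
      intro x y hx hy
      rw [h.one_borel y hy, Algebra.algebraMap_eq_smul_one, map_smul, h.one_borel x hx,
        map_mul, Algebra.smul_def]
    rw [hl x y hx hy, hl y x hy hx, h.linear_one fun d hd => brBasis_borel α hx hy hd,
      lamExt_bracket_bv α lam hx hy, map_zero, add_zero]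
    rcases zmod2_cases (par x) with h1 | h1
    · simp [h1, sgn, mul_comm]
    · have : (bv x : G F) ∈ gPart F 1 := h1 ▸ bv_mem_gPart x
      simp [lamExt_odd lam this]

/-- The vectors on which all commutators are correct form a subspace. It contains 1, since the
character of 𝔥 ⊕ 𝔫⁺ vanishes on brackets, and it is stable under 𝔫⁻ by the Jacobi identity. -/
theorem IsInduced.rel (h : IsInduced α p χ lam ρ) : Rel α Set.univ ρ := by
  let W : Submodule F (UN α p χ) :=
    { carrier := {u | ∀ x y, ρ x (ρ y u) = sgn F (par x * par y) • ρ y (ρ x u) +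
        Finsupp.linearCombination F ρ (brBasis α x y) u}
      zero_mem' := fun x y => by simp
      add_mem' := fun ha hb x y => by simp only [map_add, ha x y, hb x y, smul_add]; abel
      smul_mem' := fun c u hu x y => by
        simp only [map_smul, hu x y, smul_add]
        rw [smul_comm] }
  have key : ∀ u : UN α p χ, u ∈ W := by
    refine UN_induction W h.rel_one fun b hb u hu x y => ?_
    have hu' : ∀ x y, ρ x (ρ y u) = sgn F (par x * par y) • ρ y (ρ x u) +
        Finsupp.linearCombination F ρ (brBasis α x y) u := hu
    rw [h.mul b hb y, h.mul b hb x, h.mul_linear hb (brBasis_mem_gPart α x y)]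
    simp only [map_add, map_smul]
    rw [h.mul b hb x, h.mul b hb y, hu' x y,
      comm_linear_left hu' y (brBasis_mem_gPart α x b),
      comm_linear_right hu' x (brBasis_mem_gPart α y b), jacobi_right]
    simp only [map_sub, map_smul, LinearMap.sub_apply, LinearMap.smul_apply, mul_add,
      mul_smul_comm]
    rcases zmod2_cases (par x) with h1 | h1 <;> rcases zmod2_cases (par y) with h2 | h2 <;>
      rcases zmod2_cases (par b) with h3 | h3 <;>
      simp only [h1, h2, h3, sgn, mul_zero, mul_one, add_zero, zero_add,
        show (1 + 1 : ZMod 2) = 0 from rfl, if_true, one_ne_zero, if_false] <;> module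
  intro x _ y _
  exact LinearMap.ext fun u => key u x y

/-- Since 1 generates `UN` over 𝔫⁻, an operator commuting with 𝔫⁻ is determined by its value at 1.
-/
theorem IsInduced.eq_algebraMap (h : IsInduced α p χ lam ρ) {T : Module.End F (UN α p χ)}
    (hT : ∀ b ∈ negIdx, Commute T (ρ b)) {r : F} (h1 : T 1 = algebraMap F _ r) :
    T = algebraMap F _ r := by
  let W : Submodule F (UN α p χ) := LinearMap.ker (T - algebraMap F _ r)
  have key : ∀ u : UN α p χ, u ∈ W := by
    refine UN_induction W ?_ fun b hb u hu => ?_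
    · rw [LinearMap.mem_ker, LinearMap.sub_apply, h1, Module.algebraMap_end_apply,
        Algebra.algebraMap_eq_smul_one, sub_self]
    · rw [LinearMap.mem_ker, LinearMap.sub_apply, sub_eq_zero, Module.algebraMap_end_apply] at hu ⊢
      rw [← h.neg hb, ← Module.End.mul_apply, hT b hb, Module.End.mul_apply, hu, map_smul]
  refine LinearMap.ext fun u => ?_
  have := key u
  rwa [LinearMap.mem_ker, LinearMap.sub_apply, sub_eq_zero] at this

theorem IsInduced.pow_one (h : IsInduced α p χ lam ρ) {b : Idx} (hb : b ∉ negIdx) (n : ℕ) :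
    (ρ b ^ n) 1 = algebraMap F _ (lamExt lam (bv b) ^ n) := by
  induction n with
  | zero => simp
  | succ n ih =>
    rw [pow_succ', Module.End.mul_apply, ih, Algebra.algebraMap_eq_smul_one, map_smul,
      h.one_borel b hb, pow_succ, map_mul, ← Algebra.smul_def]

/-- The elements hᵢ^p - hᵢ and eᵢ^p commute with 𝔫⁻, so they act by the scalars by which they act on
1; admissibility of λ and χ says that these are the required ones. For fᵢ the relation already holds
in `UN`. -/
theorem IsInduced.pow [Fact p.Prime] [CharP F p] (hp : 3 < p) (h : IsInduced α p χ lam ρ)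
    (hl : Admissible p χ lam) (b : Idx) (hpar : par b = 0) :
    ρ b ^ p = Finsupp.linearCombination F ρ (pMap b) + algebraMap F _ (χ (evenBv b hpar) ^ p) := by
  have hp0 : p ≠ 0 := by omega
  have hlc : ∀ b, Finsupp.linearCombination F ρ (bv b) = ρ b := fun b => by simp [bv]
  have hh : ∀ i, ρ (hIdx i) ^ p = ρ (hIdx i) + algebraMap F _ (chiH χ i ^ p) := by
    intro i
    have hi : hIdx i ∉ negIdx := by fin_cases i <;> decide
    rw [← sub_eq_iff_eq_add']
    refine h.eq_algebraMap (fun b _ => h.rel.commute_h_pow i b) ?_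
    rw [LinearMap.sub_apply, h.pow_one hi, h.one_borel _ hi, ← map_sub, ← hl.lam_mem i]
    fin_cases i <;> simp [hIdx, lamExt_bv]
  have he : ∀ i, ρ (eIdx i) ^ p = algebraMap F _ (chiE χ i ^ p) := by
    intro i
    have hi : eIdx i ∉ negIdx := by fin_cases i <;> decide
    have hi' : eIdx i ∈ evenRoots := by fin_cases i <;> decide
    refine h.eq_algebraMap (fun b _ => h.rel.commute_pow hp hi' b) ?_
    rw [h.pow_one hi, hl.chi_nPlus i]
    fin_cases i <;> simp [eIdx, lamExt_bv]
  by_cases hn : b ∈ negIdx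
  · rw [pMap_of_mem_negIdx hn, map_zero, zero_add]
    have hm : ρ b = LinearMap.mulLeft F (ng α p χ b) := LinearMap.ext fun u => h.neg hn u
    rw [hm, LinearMap.pow_mulLeft, ng_pow α p χ hn hpar]
    refine LinearMap.ext fun u => ?_
    rw [LinearMap.mulLeft_apply, ← Algebra.smul_def]
    rfl
  · cases b <;> first
      | exact absurd hpar (by decide)
      | exact absurd (by decide) hn
      | skip
    · simp only [pMap, hlc]; exact hh 0
    · simp only [pMap, hlc]; exact hh 1
    · simp only [pMap, hlc]; exact hh 2
    · simp only [pMap, map_zero, zero_add]; exact he 0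
    · simp only [pMap, map_zero, zero_add]; exact he 1
    · simp only [pMap, map_zero, zero_add]; exact he 2

end Model

open scoped TensorProduct

/-! ### Identification of the baby Verma module with u_χ(𝔫⁻) -/

section VermaBasis

variable (α : F) (p : ℕ) (χ : Module.Dual F (gPart F 0))
  (lam : Module.Dual F (cartan F)) (hl : Admissible p χ lam)

theorem inU_bv (b : Idx) : inU α p χ (bv b) = ug α p χ ⊤ b :=
  (ug_of_mem (S := ⊤) Submodule.mem_top).symm

theorem inU_eq (g : G F) : inU α p χ g = Finsupp.linearCombination F (ug α p χ ⊤) g :=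
  uι_eq isCoordinate_top ⟨g, trivial⟩

/-- The operators by which the basis vectors of `𝔤` act on the baby Verma module. -/
def zact (b : Idx) : Module.End F (Verma α p χ lam hl) :=
  Algebra.lsmul F F (Verma α p χ lam hl) (inU α p χ (bv b))

theorem zact_apply (b : Idx) (z : Verma α p χ lam hl) :
    zact α p χ lam hl b z = inU α p χ (bv b) • z := rfl

theorem zact_linear (g : G F) (z : Verma α p χ lam hl) :
    Finsupp.linearCombination F (zact α p χ lam hl) g z = act α p χ lam hl g z := by
  rw [act, inU_eq, Finsupp.linearCombination_apply, Finsupp.linearCombination_apply, Finsupp.sum,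
    Finsupp.sum, LinearMap.sum_apply, Finset.sum_smul]
  refine Finset.sum_congr rfl fun b _ => ?_
  rw [LinearMap.smul_apply, zact_apply, inU_bv, smul_assoc]

theorem rel_zact : Rel α Set.univ (zact α p χ lam hl) := by
  intro b _ c _
  have h := rel_ug (p := p) (χ := χ) (α := α) isCoordinate_top (fun _ _ _ _ => trivial) b trivial
    c trivial
  refine LinearMap.ext fun z => ?_
  rw [LinearMap.add_apply, zact_linear, act, inU_eq, LinearMap.smul_apply, Module.End.mul_apply,
    Module.End.mul_apply, zact_apply, zact_apply, zact_apply, zact_apply, inU_bv, inU_bv,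
    ← mul_smul, h, add_smul, smul_assoc, mul_smul]

/-- The generating vector of the baby Verma module. -/
def vac : Verma α p χ lam hl := tens α p χ lam hl 1

theorem tens_eq (u : U α p χ ⊤) : tens α p χ lam hl u = u • vac α p χ lam hl := by
  rw [vac, tens, tens, ← Submodule.Quotient.mk_smul, TensorProduct.smul_tmul', smul_eq_mul, mul_one]

theorem zact_pow_apply (b : Idx) (n : ℕ) (z : Verma α p χ lam hl) :
    (zact α p χ lam hl b ^ n) z = inU α p χ (bv b) ^ n • z := by
  rw [zact, ← map_pow]
  rfl

theorem zact_pow (b : Idx) (hpar : par b = 0) : zact α p χ lam hl b ^ p =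
    Finsupp.linearCombination F (zact α p χ lam hl) (pMap b) +
      algebraMap F _ (χ (evenBv b hpar) ^ p) := by
  refine LinearMap.ext fun z => ?_
  rw [zact_pow_apply, inU_bv, ug_pow isCoordinate_top trivial hpar, LinearMap.add_apply, zact_linear,
    act, inU_eq, add_smul, Module.algebraMap_end_apply, algebraMap_smul]

theorem uMap_ug {S T : Submodule F (G F)} (h : S ≤ T) {b : Idx} (hb : (bv b : G F) ∈ S) :
    uMap α p χ h (ug α p χ S b) = ug α p χ T b := by
  rw [ug_of_mem hb, ug_of_mem (h hb)]
  change uLift _ _ (uMk α p χ S (TensorAlgebra.ι F _)) = _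
  refine (RingQuot.liftAlgHom_mkAlgHom_apply F _ _ _).trans ?_
  rw [TensorAlgebra.lift_ι_apply]
  rfl

theorem bv_mem_borel {b : Idx} (hb : b ∉ negIdx) : (bv b : G F) ∈ borel F :=
  Submodule.subset_span ⟨b, mem_borelIdx_iff.2 hb, rfl⟩

theorem isCoordinate_borel : IsCoordinate (borel F) := fun x hx b hb => by
  refine bv_mem_borel fun h => hb (borel_coord hx ?_)
  rw [mem_borelIdx_iff, not_not]
  exact h

theorem bv_mem_borel_iff {b : Idx} : (bv b : G F) ∈ borel F ↔ b ∉ negIdx := by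
  refine ⟨fun h hb => ?_, bv_mem_borel⟩
  have := borel_coord h (b := b) (by rw [mem_borelIdx_iff, not_not]; exact hb)
  simp [bv] at this

theorem character_ug {b : Idx} (hb : b ∉ negIdx) :
    character α p χ lam hl (ug α p χ (borel F) b) = lamExt lam (bv b) := by
  rw [ug_of_mem (bv_mem_borel hb)]
  refine (RingQuot.liftAlgHom_mkAlgHom_apply F _ _ _).trans ?_
  rw [TensorAlgebra.lift_ι_apply]
  rfl

theorem zact_vac {b : Idx} (hb : b ∉ negIdx) :
    zact α p χ lam hl b (vac α p χ lam hl) = lamExt lam (bv b) • vac α p χ lam hl := by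
  rw [zact_apply, ← tens_eq, tens, vac, tens, ← Submodule.Quotient.mk_smul, Submodule.Quotient.eq]
  refine Submodule.subset_span ⟨1, ug α p χ (borel F) b, 1, ?_⟩
  rw [uMap_ug α p χ le_top (bv_mem_borel hb), character_ug α p χ lam hl hb, one_mul, inU_bv,
    mul_one, ← TensorProduct.tmul_smul, smul_eq_mul, mul_one]

/-- The action of `UN` on the baby Verma module. -/
def nact : UN α p χ →ₐ[F] Module.End F (Verma α p χ lam hl) :=
  (Algebra.lsmul F F (Verma α p χ lam hl)).comp (uMap α p χ le_top)

theorem nact_ng {b : Idx} (hb : b ∈ negIdx) :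
    nact α p χ lam hl (ng α p χ b) = zact α p χ lam hl b := by
  rw [nact, AlgHom.comp_apply, uMap_ug α p χ le_top (bv_mem_nMinus.2 hb), zact, inU_bv]

variable {α p χ lam hl}

/-- The operators ρ and the action on the baby Verma module obey the same recursion along 𝔫⁻ and
agree on the generating vector, so u ↦ u v intertwines them. -/
theorem IsInduced.nact_vac {ρ : Idx → Module.End F (UN α p χ)} (h : IsInduced α p χ lam ρ) (x : Idx)
    (u : UN α p χ) : nact α p χ lam hl (ρ x u) (vac α p χ lam hl) =
      zact α p χ lam hl x (nact α p χ lam hl u (vac α p χ lam hl)) := by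
  let W : Submodule F (UN α p χ) :=
    { carrier := {u | ∀ x, nact α p χ lam hl (ρ x u) (vac α p χ lam hl) =
        zact α p χ lam hl x (nact α p χ lam hl u (vac α p χ lam hl))}
      zero_mem' := fun x => by simp
      add_mem' := fun ha hb x => by simp only [map_add, LinearMap.add_apply, ha x, hb x]
      smul_mem' := fun c u hu x => by simp only [map_smul, LinearMap.smul_apply, hu x] }
  refine UN_induction W (fun x => ?_) (fun b hb u hu x => ?_) u x
  · have h1 : nact α p χ lam hl 1 = 1 := map_one _
    rw [h1, Module.End.one_apply]
    by_cases hx : x ∈ negIdx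
    · rw [h.one_neg x hx, nact_ng α p χ lam hl hx]
    · rw [h.one_borel x hx, AlgHom.commutes, Module.algebraMap_end_apply, zact_vac α p χ lam hl hx]
  · have hu' : ∀ g : G F, nact α p χ lam hl (Finsupp.linearCombination F ρ g u)
        (vac α p χ lam hl) = Finsupp.linearCombination F (zact α p χ lam hl) g
          (nact α p χ lam hl u (vac α p χ lam hl)) := by
      intro g
      rw [linearCombination_apply_apply, linearCombination_apply_apply,
        Finsupp.linearCombination_apply, Finsupp.linearCombination_apply, Finsupp.sum, Finsupp.sum,
        map_sum, LinearMap.sum_apply]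
      refine Finset.sum_congr rfl fun c _ => ?_
      rw [map_smul, LinearMap.smul_apply, hu c]
    rw [h.mul b hb, map_add, LinearMap.add_apply, hu', map_smul, map_mul, map_mul,
      LinearMap.smul_apply, Module.End.mul_apply, Module.End.mul_apply, hu x,
      nact_ng α p χ lam hl hb, mul_comm (par b)]
    have hc := LinearMap.congr_fun (rel_zact α p χ lam hl x trivial b trivial)
      (nact α p χ lam hl u (vac α p χ lam hl))
    rw [LinearMap.add_apply, LinearMap.smul_apply] at hc
    exact hc.symm

variable (α p χ lam hl)

/-- The subspace u_χ(𝔫⁻) v is stable under all of 𝔤, because `IsInduced.nact_vac` writes the action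
of any x on it as ρ x. -/
theorem nact_vac_surjective [Fact p.Prime] [CharP F p] (hp : 3 < p) (z : Verma α p χ lam hl) :
    ∃ u, nact α p χ lam hl u (vac α p χ lam hl) = z := by
  obtain ⟨ρ, hρ⟩ := exists_isInduced α p χ lam hp
  let W : Submodule F (Verma α p χ lam hl) := LinearMap.range
    (LinearMap.applyₗ (vac α p χ lam hl) ∘ₗ (nact α p χ lam hl).toLinearMap)
  change z ∈ W
  have h1 : vac α p χ lam hl ∈ W := ⟨1, by simp⟩
  have hW : ∀ b, ∀ w ∈ W, zact α p χ lam hl b w ∈ W := by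
    rintro b _ ⟨u, rfl⟩
    exact ⟨ρ b u, hρ.nact_vac b u⟩
  have hu : ∀ u : U α p χ ⊤, u • vac α p χ lam hl ∈ W := by
    intro u
    refine U_induction isCoordinate_top
      (W.comap (LinearMap.toSpanSingleton (U α p χ ⊤) _ (vac α p χ lam hl) |>.restrictScalars F))
      (by simpa using h1) (fun b _ u hu => ?_) u
    have := hW b _ hu
    rw [zact_apply, inU_bv] at this
    simpa [mul_smul] using this
  obtain ⟨t, rfl⟩ := Submodule.Quotient.mk_surjective _ z
  induction t using TensorProduct.induction_on with
  | zero => exact W.zero_mem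
  | tmul u k =>
    have : (Submodule.Quotient.mk (u ⊗ₜ[F] k) : Verma α p χ lam hl) = k • (u • vac α p χ lam hl) := by
      rw [← tens_eq, tens, ← Submodule.Quotient.mk_smul, ← TensorProduct.tmul_smul, smul_eq_mul,
        mul_one]
    rw [this]
    exact W.smul_mem k (hu u)
  | add s t hs ht => exact W.add_mem hs ht

/-- Through ρ the algebra u_χ(𝔤) acts on `UN`, and 𝔥 ⊕ 𝔫⁺ acts on 1 by the character. So w ⊗ k ↦ k
(w · 1) kills the balancing relations and provides a left inverse of u ↦ u v. -/
theorem nact_vac_injective [Fact p.Prime] [CharP F p] (hp : 3 < p) {u : UN α p χ}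
    (hu : nact α p χ lam hl u (vac α p χ lam hl) = 0) : u = 0 := by
  obtain ⟨ρ, hρ⟩ := exists_isInduced α p χ lam hp
  obtain ⟨r, hr⟩ := exists_lift (S := (⊤ : Submodule F (G F))) (p := p) (χ := χ) isCoordinate_top
    (a := ρ) (hρ.rel.mono (Set.subset_univ _)) (fun b _ hb => hρ.pow hp hl b hb)
  have hr' : ∀ b, r (ug α p χ ⊤ b) = ρ b := fun b => hr b trivial
  have hneg : ∀ w : UN α p χ, r (uMap α p χ le_top w) 1 = w := by
    intro w
    refine UN_induction (LinearMap.eqLocus (LinearMap.applyₗ (1 : UN α p χ) ∘ₗ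
      (r.comp (uMap α p χ le_top)).toLinearMap) LinearMap.id) (by simp) (fun b hb u hu => ?_) w
    simp only [LinearMap.mem_eqLocus, LinearMap.comp_apply, LinearMap.applyₗ_apply_apply,
      AlgHom.toLinearMap_apply, AlgHom.comp_apply, LinearMap.id_apply] at hu ⊢
    rw [map_mul, map_mul, Module.End.mul_apply, hu, uMap_ug α p χ le_top (bv_mem_nMinus.2 hb), hr',
      hρ.neg hb]
  have hbor : ∀ w : U α p χ (borel F), r (uMap α p χ le_top w) 1 =
      character α p χ lam hl w • (1 : UN α p χ) := by
    intro w
    refine U_induction isCoordinate_borel (LinearMap.eqLocus (LinearMap.applyₗ (1 : UN α p χ) ∘ₗ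
      (r.comp (uMap α p χ le_top)).toLinearMap) (LinearMap.toSpanSingleton F _ 1 ∘ₗ
        (character α p χ lam hl).toLinearMap)) (by simp) (fun b hb u hu => ?_) w
    have hb' := bv_mem_borel_iff.1 hb
    simp only [LinearMap.mem_eqLocus, LinearMap.comp_apply, LinearMap.applyₗ_apply_apply,
      AlgHom.toLinearMap_apply, AlgHom.comp_apply, LinearMap.toSpanSingleton_apply] at hu ⊢
    rw [map_mul, map_mul, Module.End.mul_apply, hu, uMap_ug α p χ le_top hb, hr', map_smul,
      hρ.one_borel b hb', map_mul, character_ug α p χ lam hl hb', Algebra.algebraMap_eq_smul_one,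
      smul_smul, mul_comm]
  let q : U α p χ (⊤ : Submodule F (G F)) ⊗[F] F →ₗ[F] UN α p χ :=
    TensorProduct.lift ((LinearMap.lsmul F (UN α p χ)).flip.comp
      (LinearMap.applyₗ (1 : UN α p χ) ∘ₗ r.toLinearMap))
  have hq : ∀ w k, q (w ⊗ₜ k) = k • r w 1 := fun w k => rfl
  have hqs : ∀ (w : U α p χ ⊤) t, q (w • t) = r w (q t) := by
    intro w t
    induction t using TensorProduct.induction_on with
    | zero => simp
    | tmul u k =>
      rw [TensorProduct.smul_tmul', hq, hq, smul_eq_mul, map_mul, Module.End.mul_apply, map_smul]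
    | add s t hs ht => rw [smul_add, map_add, hs, ht, map_add, map_add]
  have hker : ∀ t ∈ balancing α p χ lam hl, q t = 0 := by
    intro t ht
    induction ht using Submodule.span_induction with
    | mem t ht =>
      obtain ⟨w, b, k, rfl⟩ := ht
      rw [map_sub, hq, hq, map_mul, Module.End.mul_apply, hbor, map_smul, smul_smul, mul_comm,
        sub_self]
    | zero => simp
    | add s t _ _ hs ht => rw [map_add, hs, ht, add_zero]
    | smul w t _ ht => rw [hqs, ht, map_zero]
  have h0 : (uMap α p χ le_top u) ⊗ₜ[F] (1 : F) ∈ balancing α p χ lam hl := by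
    rw [← Submodule.Quotient.mk_eq_zero, ← hu]
    exact tens_eq α p χ lam hl _
  have := hker _ h0
  rwa [hq, one_smul, hneg] at this

end VermaBasis

/-! ### Truncated polynomials in three variables -/

section Shift

variable (F) (p : ℕ) (M : Type*) [AddCommGroup M] [Module F M]

/-- Multiplication by the variable on truncated polynomials with coefficients in `M`. -/
def shift : Module.End F (Fin p → M) where
  toFun u a := if 0 < a.val then u ⟨a.val - 1, by omega⟩ else 0
  map_add' u v := by funext a; simp only [Pi.add_apply]; split <;> simp
  map_smul' c u := by funext a; simp only [Pi.smul_apply]; split <;> simp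

variable {F p M}

theorem shift_apply (u : Fin p → M) (a : Fin p) :
    shift F p M u a = if 0 < a.val then u ⟨a.val - 1, by omega⟩ else 0 := rfl

theorem shift_pow_apply (n : ℕ) (u : Fin p → M) (a : Fin p) :
    (shift F p M ^ n) u a = if n ≤ a.val then u ⟨a.val - n, by omega⟩ else 0 := by
  induction n generalizing a with
  | zero => simp
  | succ n ih =>
    rw [pow_succ', Module.End.mul_apply, shift_apply]
    by_cases h : 0 < a.val
    · rw [if_pos h, ih]
      by_cases h' : n + 1 ≤ a.val
      · rw [if_pos h', if_pos (by simp; omega)]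
        congr 1; ext; simp; omega
      · rw [if_neg h', if_neg (by simp; omega)]
    · rw [if_neg h, if_neg (by omega)]

theorem shift_pow_self : shift F p M ^ p = 0 := by
  refine LinearMap.ext fun u => funext fun a => ?_
  rw [shift_pow_apply, if_neg (by omega)]
  rfl

theorem shift_pow_single [NeZero p] (n : Fin p) (m : M) :
    (shift F p M ^ n.val) (Pi.single 0 m) = Pi.single n m := by
  funext a
  rw [shift_pow_apply]
  by_cases h : a = n
  · subst h
    simp only [le_refl, if_true, Nat.sub_self, Pi.single_eq_same]
    exact Pi.single_eq_same (M := fun _ : Fin p => M) 0 m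
  · rw [Pi.single_eq_of_ne h]
    split
    · refine Pi.single_eq_of_ne (M := fun _ : Fin p => M) (fun h' => h ?_) m
      have := congrArg Fin.val h'
      ext
      simp at this
      omega
    · rfl

theorem eq_single_of_shift_eq_zero [NeZero p] {u : Fin p → M} (h : shift F p M u = 0) :
    ∃ m, u = Pi.single ⟨p - 1, by have := NeZero.pos p; omega⟩ m := by
  refine ⟨u ⟨p - 1, by have := NeZero.pos p; omega⟩, funext fun a => ?_⟩
  by_cases ha : a.val = p - 1
  · have : a = ⟨p - 1, by have := NeZero.pos p; omega⟩ := Fin.ext ha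
    rw [this, Pi.single_eq_same]
  · rw [Pi.single_eq_of_ne (fun h' => ha (by rw [h']))]
    have h1 := congrFun h ⟨a.val + 1, by omega⟩
    rw [shift_apply, if_pos (by simp)] at h1
    exact h1

theorem compLeft_pow {K : Type*} (f : Module.End F M) (n : ℕ) :
    (f.compLeft K : Module.End F (K → M)) ^ n = (f ^ n).compLeft K := by
  induction n with
  | zero => rfl
  | succ n ih => rw [pow_succ, ih, pow_succ]; rfl

theorem compLeft_single {K : Type*} [DecidableEq K] (f : Module.End F M) (k : K) (m : M) :
    f.compLeft K (Pi.single k m) = Pi.single k (f m) := by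
  funext a
  rw [LinearMap.compLeft_apply]
  exact Pi.apply_single (fun _ => f) (fun _ => map_zero f) k m a

end Shift

section Truncated

variable (F) (p : ℕ)

/-- Truncated polynomials in three variables. -/
abbrev TP : Type _ := Fin p → Fin p → Fin p → F

/-- Multiplication by the three variables. -/
def tmul : Fin 3 → Module.End F (TP F p)
  | 0 => shift F p _
  | 1 => (shift F p _ : Module.End F (Fin p → Fin p → F)).compLeft (Fin p)
  | 2 => ((shift F p F).compLeft (Fin p) : Module.End F (Fin p → Fin p → F)).compLeft (Fin p)

theorem compLeft_shift_comm {M : Type*} [AddCommGroup M] [Module F M] (f : Module.End F M)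
    (u : Fin p → M) : f.compLeft (Fin p) (shift F p M u) = shift F p M (f.compLeft (Fin p) u) := by
  funext a
  simp only [LinearMap.compLeft_apply, shift_apply, Function.comp_apply]
  split <;> simp

theorem tmul_comm (i j : Fin 3) (r : TP F p) :
    tmul F p i (tmul F p j r) = tmul F p j (tmul F p i r) := by
  have h12 : tmul F p 1 (tmul F p 2 r) = tmul F p 2 (tmul F p 1 r) :=
    funext fun a => (compLeft_shift_comm F p (shift F p F) (r a)).symm
  fin_cases i <;> fin_cases j <;> first
    | rfl
    | exact (compLeft_shift_comm F p _ r).symm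
    | exact compLeft_shift_comm F p _ r
    | exact h12
    | exact h12.symm

theorem tmul_pow (i : Fin 3) : tmul F p i ^ p = 0 := by
  fin_cases i
  · exact shift_pow_self
  · change (LinearMap.compLeft _ _) ^ p = _
    rw [compLeft_pow, shift_pow_self]; rfl
  · change (LinearMap.compLeft _ _) ^ p = _
    rw [compLeft_pow, compLeft_pow, shift_pow_self]; rfl

variable [NeZero p]

/-- The constant polynomial `1`. -/
def tone : TP F p := Pi.single 0 (Pi.single 0 (Pi.single 0 1))

theorem tmul_monomial (a b c : Fin p) : (tmul F p 0 ^ a.val) ((tmul F p 1 ^ b.val)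
    ((tmul F p 2 ^ c.val) (tone F p))) = Pi.single a (Pi.single b (Pi.single c 1)) := by
  have h2 : (tmul F p 2 ^ c.val) (tone F p) = Pi.single 0 (Pi.single 0 (Pi.single c 1)) := by
    change ((LinearMap.compLeft _ _) ^ c.val) _ = _
    rw [compLeft_pow, compLeft_pow, tone, compLeft_single, compLeft_single, shift_pow_single]
  have h1 : (tmul F p 1 ^ b.val) (Pi.single 0 (Pi.single 0 (Pi.single c 1))) =
      Pi.single 0 (Pi.single b (Pi.single c 1)) := by
    change ((LinearMap.compLeft _ _) ^ b.val) _ = _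
    rw [compLeft_pow, compLeft_single, shift_pow_single]
  rw [h2, h1]
  exact shift_pow_single a _

theorem TP_induction (W : Submodule F (TP F p)) (h1 : tone F p ∈ W)
    (hW : ∀ i, ∀ r ∈ W, tmul F p i r ∈ W) (r : TP F p) : r ∈ W := by
  have hpow : ∀ i (n : ℕ), ∀ r ∈ W, (tmul F p i ^ n) r ∈ W := by
    intro i n
    induction n with
    | zero => exact fun r hr => hr
    | succ n ih => intro r hr; rw [pow_succ', Module.End.mul_apply]; exact hW i _ (ih r hr)
  have hs : r = ∑ a, ∑ b, ∑ c, r a b c • Pi.single a (Pi.single b (Pi.single c 1)) := by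
    funext a b c
    simp [Finset.sum_apply, Pi.single_apply, ite_apply]
  rw [hs]
  refine W.sum_mem fun a _ => W.sum_mem fun b _ => W.sum_mem fun c _ => W.smul_mem _ ?_
  rw [← tmul_monomial]
  exact hpow _ _ _ (hpow _ _ _ (hpow _ _ _ h1))

/-- The product of the highest powers of the variables. -/
def ttop : TP F p :=
  (tmul F p 0 ^ (p - 1)) ((tmul F p 1 ^ (p - 1)) ((tmul F p 2 ^ (p - 1)) (tone F p)))

theorem ttop_eq : ttop F p = Pi.single ⟨p - 1, Nat.sub_one_lt (NeZero.ne p)⟩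
    (Pi.single ⟨p - 1, Nat.sub_one_lt (NeZero.ne p)⟩
      (Pi.single ⟨p - 1, Nat.sub_one_lt (NeZero.ne p)⟩ 1)) :=
  tmul_monomial F p ⟨p - 1, Nat.sub_one_lt (NeZero.ne p)⟩ ⟨p - 1, Nat.sub_one_lt (NeZero.ne p)⟩
    ⟨p - 1, Nat.sub_one_lt (NeZero.ne p)⟩

theorem ttop_ne_zero : ttop F p ≠ 0 := by
  rw [ttop_eq]
  simp

/-- The kernel of one variable is the span of its top power over the remaining ones; intersecting
the three kernels leaves a line. This is the source of the one-dimensional socle of the baby Verma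
module. -/
theorem exists_eq_smul_ttop {r : TP F p} (h : ∀ i, tmul F p i r = 0) :
    ∃ c : F, r = c • ttop F p := by
  obtain ⟨m, rfl⟩ := eq_single_of_shift_eq_zero (h 0)
  have h1 : (shift F p _).compLeft (Fin p) _ = 0 := h 1
  rw [compLeft_single, Pi.single_eq_zero_iff] at h1
  obtain ⟨m, rfl⟩ := eq_single_of_shift_eq_zero h1
  have h2 : ((shift F p F).compLeft (Fin p)).compLeft (Fin p) _ = 0 := h 2
  rw [compLeft_single, compLeft_single, Pi.single_eq_zero_iff, Pi.single_eq_zero_iff] at h2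
  obtain ⟨m, rfl⟩ := eq_single_of_shift_eq_zero h2
  refine ⟨m, ?_⟩
  rw [ttop_eq, ← Pi.single_smul, ← Pi.single_smul, ← Pi.single_smul, smul_eq_mul, mul_one]

theorem tmul_ttop (i : Fin 3) : tmul F p i (ttop F p) = 0 := by
  have hp : p - 1 + 1 = p := Nat.sub_add_cancel (NeZero.pos p)
  have hc : ∀ i j, Commute (tmul F p i) (tmul F p j) := fun i j =>
    LinearMap.ext fun r => tmul_comm F p i j r
  have hz : tmul F p i * tmul F p i ^ (p - 1) = 0 := by rw [← pow_succ', hp, tmul_pow]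
  have key : tmul F p i * (tmul F p 0 ^ (p - 1) * (tmul F p 1 ^ (p - 1) *
      tmul F p 2 ^ (p - 1))) = 0 := by
    obtain rfl | rfl | rfl : i = 0 ∨ i = 1 ∨ i = 2 := by fin_cases i <;> simp
    · rw [← mul_assoc, hz, zero_mul]
    · rw [← mul_assoc, ((hc 1 0).pow_right _).eq, mul_assoc, ← mul_assoc (tmul F p 1), hz, zero_mul,
        mul_zero]
    · rw [← mul_assoc, ((hc 2 0).pow_right _).eq, mul_assoc, ← mul_assoc (tmul F p 2),
        ((hc 2 1).pow_right _).eq, mul_assoc, hz, mul_zero, mul_zero]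
  exact LinearMap.congr_fun key (tone F p)

end Truncated

theorem lc_bv {M : Type*} [AddCommGroup M] [Module F M] (f : Idx → M) (b : Idx) :
    Finsupp.linearCombination F f (bv b) = f b := by
  simp [bv]

/-! ### Reordering in 𝔫⁻ and ordered monomials -/

section NegRules

variable {α : F} {Z : Type*} [AddCommGroup Z] [Module F Z] {a : Idx → Module.End F Z}

theorem Rel.apply {J : Set Idx} (h : Rel α J a) {b c : Idx} (hb : b ∈ J) (hc : c ∈ J) (z : Z) :
    a b (a c z) = sgn F (par b * par c) • a c (a b z) +
      Finsupp.linearCombination F (fun d => a d z) (brBasis α b c) := by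
  rw [← linearCombination_apply_apply]
  exact LinearMap.congr_fun (h b hb c hc) z

theorem Rel.apply_even {J : Set Idx} (h : Rel α J a) {b c : Idx} (hb : b ∈ J) (hc : c ∈ J)
    (hpar : par b = 0 ∨ par c = 0) (z : Z) : a b (a c z) = a c (a b z) +
      Finsupp.linearCombination F (fun d => a d z) (brBasis α b c) := by
  rw [h.apply hb hc]
  rcases hpar with h | h <;> simp [h, sgn]

theorem Rel.apply_odd {J : Set Idx} (h : Rel α J a) {b c : Idx} (hb : b ∈ J) (hc : c ∈ J)
    (hb1 : par b = 1) (hc1 : par c = 1) (z : Z) : a b (a c z) = -a c (a b z) +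
      Finsupp.linearCombination F (fun d => a d z) (brBasis α b c) := by
  rw [h.apply hb hc, hb1, hc1]
  simp [sgn]

/-- For an odd element the anticommutation relation with itself reads 2b² = [b,b] = 0. -/
theorem Rel.odd_sq {J : Set Idx} (h : Rel α J a) (h2 : (2 : F) ≠ 0) {b : Idx} (hb : b ∈ J)
    (hb1 : par b = 1) (h0 : brBasis α b b = 0) (z : Z) : a b (a b z) = 0 := by
  have h1 := h.apply_odd hb hb hb1 hb1 z
  rw [h0, map_zero, add_zero] at h1
  have h3 : (2 : F) • a b (a b z) = 0 := by
    rw [two_smul]; nth_rewrite 1 [h1]; exact neg_add_cancel _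
  exact (smul_eq_zero.1 h3).resolve_left h2

/-- The rules for reordering the generators of `𝔫⁻`. -/
structure NegRules (α : F) (a : Idx → Module.End F Z) : Prop where
  f21 : ∀ z, a f2 (a f1 z) = a f1 (a f2 z)
  f31 : ∀ z, a f3 (a f1 z) = a f1 (a f3 z)
  f32 : ∀ z, a f3 (a f2 z) = a f2 (a f3 z)
  y1f1 : ∀ z, a y1 (a f1 z) = a f1 (a y1 z)
  y2f1 : ∀ z, a y2 (a f1 z) = a f1 (a y2 z)
  y3f1 : ∀ z, a y3 (a f1 z) = a f1 (a y3 z)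
  y4f1 : ∀ z, a y4 (a f1 z) = a f1 (a y4 z)
  y1f2 : ∀ z, a y1 (a f2 z) = a f2 (a y1 z) - a y3 z
  y2f2 : ∀ z, a y2 (a f2 z) = a f2 (a y2 z) - a y4 z
  y3f2 : ∀ z, a y3 (a f2 z) = a f2 (a y3 z)
  y4f2 : ∀ z, a y4 (a f2 z) = a f2 (a y4 z)
  y1f3 : ∀ z, a y1 (a f3 z) = a f3 (a y1 z) - a y2 z
  y2f3 : ∀ z, a y2 (a f3 z) = a f3 (a y2 z)
  y3f3 : ∀ z, a y3 (a f3 z) = a f3 (a y3 z) - a y4 z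
  y4f3 : ∀ z, a y4 (a f3 z) = a f3 (a y4 z)
  y11 : ∀ z, a y1 (a y1 z) = 0
  y22 : ∀ z, a y2 (a y2 z) = 0
  y33 : ∀ z, a y3 (a y3 z) = 0
  y44 : ∀ z, a y4 (a y4 z) = 0
  y21 : ∀ z, a y2 (a y1 z) = -a y1 (a y2 z)
  y31 : ∀ z, a y3 (a y1 z) = -a y1 (a y3 z)
  y41 : ∀ z, a y4 (a y1 z) = -a y1 (a y4 z) - (2 * (1 + α)) • a f1 z
  y32 : ∀ z, a y3 (a y2 z) = -a y2 (a y3 z) + (2 * (1 + α)) • a f1 z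
  y42 : ∀ z, a y4 (a y2 z) = -a y2 (a y4 z)
  y43 : ∀ z, a y4 (a y3 z) = -a y3 (a y4 z)

theorem Rel.negRules (h : Rel α negIdx a) (h2 : (2 : F) ≠ 0) : NegRules α a := by
  have m1 : f1 ∈ negIdx := by decide
  have m2 : f2 ∈ negIdx := by decide
  have m3 : f3 ∈ negIdx := by decide
  have n1 : y1 ∈ negIdx := by decide
  have n2 : y2 ∈ negIdx := by decide
  have n3 : y3 ∈ negIdx := by decide
  have n4 : y4 ∈ negIdx := by decide
  constructor <;> intro z
  · rw [h.apply_even m2 m1 (.inl rfl)]; simp [brBasis, table]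
  · rw [h.apply_even m3 m1 (.inl rfl)]; simp [brBasis, table]
  · rw [h.apply_even m3 m2 (.inl rfl)]; simp [brBasis, table]
  · rw [h.apply_even n1 m1 (.inr rfl)]; simp [brBasis, table]
  · rw [h.apply_even n2 m1 (.inr rfl)]; simp [brBasis, table]
  · rw [h.apply_even n3 m1 (.inr rfl)]; simp [brBasis, table]
  · rw [h.apply_even n4 m1 (.inr rfl)]; simp [brBasis, table]
  · rw [h.apply_even n1 m2 (.inr rfl)]; simp [brBasis, table, par, sgn, lc_bv, sub_eq_add_neg]
  · rw [h.apply_even n2 m2 (.inr rfl)]; simp [brBasis, table, par, sgn, lc_bv, sub_eq_add_neg]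
  · rw [h.apply_even n3 m2 (.inr rfl)]; simp [brBasis, table]
  · rw [h.apply_even n4 m2 (.inr rfl)]; simp [brBasis, table]
  · rw [h.apply_even n1 m3 (.inr rfl)]; simp [brBasis, table, par, sgn, lc_bv, sub_eq_add_neg]
  · rw [h.apply_even n2 m3 (.inr rfl)]; simp [brBasis, table]
  · rw [h.apply_even n3 m3 (.inr rfl)]; simp [brBasis, table, par, sgn, lc_bv, sub_eq_add_neg]
  · rw [h.apply_even n4 m3 (.inr rfl)]; simp [brBasis, table]
  · exact h.odd_sq h2 n1 rfl (by simp [brBasis, table]) z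
  · exact h.odd_sq h2 n2 rfl (by simp [brBasis, table]) z
  · exact h.odd_sq h2 n3 rfl (by simp [brBasis, table]) z
  · exact h.odd_sq h2 n4 rfl (by simp [brBasis, table]) z
  · rw [h.apply_odd n2 n1 rfl rfl]; simp [brBasis, table]
  · rw [h.apply_odd n3 n1 rfl rfl]; simp [brBasis, table]
  · rw [h.apply_odd n4 n1 rfl rfl]; simp [brBasis, table, par, sgn, lc_bv, sub_eq_add_neg]
  · rw [h.apply_odd n3 n2 rfl rfl]; simp [brBasis, table, par, sgn, lc_bv]
  · rw [h.apply_odd n4 n2 rfl rfl]; simp [brBasis, table]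
  · rw [h.apply_odd n4 n3 rfl rfl]; simp [brBasis, table]

end NegRules

section Span

variable {α : F} {Z : Type*} [AddCommGroup Z] [Module F Z] (a : Idx → Module.End F Z) (v : Z)

/-- The vectors `y₁^i y₂^j y₃^k y₄^l v`. -/
def yvec (i j k l : ℕ) : Z := (a y1 ^ i) ((a y2 ^ j) ((a y3 ^ k) ((a y4 ^ l) v)))

/-- The operators `f₁^m f₂^n f₃^q`. -/
def fpow (m n q : ℕ) (z : Z) : Z := (a f1 ^ m) ((a f2 ^ n) ((a f3 ^ q) z))

variable {a}

theorem NegRules.f_fpow (h : NegRules α a) (m n q : ℕ) (z : Z) :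
    a f1 (fpow a m n q z) = fpow a (m + 1) n q z ∧
    a f2 (fpow a m n q z) = fpow a m (n + 1) q z ∧
    a f3 (fpow a m n q z) = fpow a m n (q + 1) z := by
  have c21 : Commute (a f2) (a f1) := LinearMap.ext h.f21
  have c31 : Commute (a f3) (a f1) := LinearMap.ext h.f31
  have c32 : Commute (a f3) (a f2) := LinearMap.ext h.f32
  have e21 := fun z => LinearMap.congr_fun (c21.pow_right m).eq z
  have e31 := fun z => LinearMap.congr_fun (c31.pow_right m).eq z
  have e32 := fun z => LinearMap.congr_fun (c32.pow_right n).eq z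
  simp only [Module.End.mul_apply] at e21 e31 e32
  refine ⟨?_, ?_, ?_⟩
  · rw [fpow, fpow, pow_succ', Module.End.mul_apply]
  · rw [fpow, fpow, e21, pow_succ', Module.End.mul_apply]
  · rw [fpow, fpow, e31, e32, pow_succ', Module.End.mul_apply]

/-- Among the yₖ only the pairs (y₁,y₄) and (y₂,y₃) have nonzero bracket, a multiple of f₁. Sorting
one further y into an ordered product therefore produces at most one monomial and one f₁-multiple of
a monomial. -/
theorem y_mul_yvec (h : NegRules α a) {b : Idx} (hb : b ∈ negIdx) (hb1 : par b = 1)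
    (i j k l : Bool) : ∃ (c d : F) (i' j' k' l' i'' j'' k'' l'' : Bool),
      a b (yvec a v i.toNat j.toNat k.toNat l.toNat) =
        c • yvec a v i'.toNat j'.toNat k'.toNat l'.toNat +
          d • a f1 (yvec a v i''.toNat j''.toNat k''.toNat l''.toNat) := by
  let s : Bool → F := fun b => bif b then -1 else 1
  simp only [negIdx, Set.mem_insert_iff, Set.mem_singleton_iff] at hb
  rcases hb with rfl | rfl | rfl | rfl | rfl | rfl | rfl
  iterate 3 exact absurd hb1 (by decide)
  · refine ⟨bif i then 0 else 1, 0, true, j, k, l, i, j, k, l, ?_⟩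
    cases i <;> simp [yvec, h.y11]
  · refine ⟨bif j then 0 else s i, 0, i, true, k, l, i, j, k, l, ?_⟩
    cases i <;> cases j <;> simp [yvec, h.y21, h.y22, s]
  · refine ⟨bif k then 0 else s i * s j, bif j then s i * (2 * (1 + α)) else 0, i, j, true, l,
      i, false, k, l, ?_⟩
    cases i <;> cases j <;> cases k <;>
      simp [yvec, h.y31, h.y32, h.y33, h.y1f1, s, add_comm]
  · refine ⟨bif l then 0 else s i * s j * s k, bif i then -(2 * (1 + α)) else 0, i, j, k, true,
      false, j, k, l, ?_⟩
    cases i <;> cases j <;> cases k <;> cases l <;>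
      simp [yvec, h.y41, h.y42, h.y43, h.y44, s, sub_eq_add_neg]

/-- The span of the ordered monomials is stable under `𝔫⁻`. -/
theorem pbw_stable (h : Rel α negIdx a) (h2 : (2 : F) ≠ 0) {S : Submodule F Z}
    (hS : ∀ m n q (i j k l : Bool),
      fpow a m n q (yvec a v i.toNat j.toNat k.toNat l.toNat) ∈ S)
    (hS' : ∀ W : Submodule F Z, (∀ m n q (i j k l : Bool),
      fpow a m n q (yvec a v i.toNat j.toNat k.toNat l.toNat) ∈ W) → S ≤ W)
    {b : Idx} (hb : b ∈ negIdx) {z : Z} (hz : z ∈ S) : a b z ∈ S := by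
  have hr := h.negRules h2
  have m1 : f1 ∈ negIdx := by decide
  have m2 : f2 ∈ negIdx := by decide
  have m3 : f3 ∈ negIdx := by decide
  have hf1 : ∀ z ∈ S, a f1 z ∈ S := hS' (S.comap (a f1)) fun m n q i j k l => by
    rw [Submodule.mem_comap, (hr.f_fpow m n q _).1]; exact hS _ _ _ _ _ _ _
  have hf2 : ∀ z ∈ S, a f2 z ∈ S := hS' (S.comap (a f2)) fun m n q i j k l => by
    rw [Submodule.mem_comap, (hr.f_fpow m n q _).2.1]; exact hS _ _ _ _ _ _ _
  have hf3 : ∀ z ∈ S, a f3 z ∈ S := hS' (S.comap (a f3)) fun m n q i j k l => by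
    rw [Submodule.mem_comap, (hr.f_fpow m n q _).2.2]; exact hS _ _ _ _ _ _ _
  by_cases hpar : par b = 0
  · have := even_neg_mem_evenRoots hb hpar
    simp only [evenRoots, List.mem_cons, List.not_mem_nil, or_false] at this
    rcases this with rfl | rfl | rfl | rfl | rfl | rfl
    iterate 3 exact absurd hb (by decide)
    · exact hf1 z hz
    · exact hf2 z hz
    · exact hf3 z hz
  have hb1 : par b = 1 := (zmod2_cases _).resolve_left hpar
  -- `K` consists of the vectors of `S` that all yₖ map into `S`. It is stable under the fᵢ, because
  -- bracketing with fᵢ keeps the span of the yₖ, and it contains the products of the yₖ; by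
  -- minimality it is all of `S`.
  let K : Submodule F Z := S ⊓ ⨅ b : {b : Idx // b ∈ negIdx ∧ par b = 1}, S.comap (a b.1)
  have hK : ∀ z, z ∈ K ↔ z ∈ S ∧ ∀ b, b ∈ negIdx → par b = 1 → a b z ∈ S := by
    intro z
    simp only [K, Submodule.mem_inf, Submodule.mem_iInf, Submodule.mem_comap, Subtype.forall,
      and_imp]
  have hKf : ∀ f ∈ negIdx, par f = 0 → (∀ z ∈ S, a f z ∈ S) → ∀ z ∈ K, a f z ∈ K := by
    intro f hf hf0 hfS z hz
    rw [hK] at hz ⊢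
    refine ⟨hfS z hz.1, fun b hb hb1 => ?_⟩
    rw [h.apply_even hb hf (.inr hf0), Finsupp.linearCombination_apply]
    refine S.add_mem (hfS _ (hz.2 b hb hb1)) (S.sum_mem fun d hd => S.smul_mem _ (hz.2 d ?_ ?_))
    · exact bv_mem_nMinus.1 (isCoordinate_nMinus _ (brBasis_mem_nMinus α hb hf) d
        (Finsupp.mem_support_iff.1 hd))
    · by_contra hd'
      refine Finsupp.mem_support_iff.1 hd (gPart_coord (brBasis_mem_gPart α b f) ?_)
      rw [hb1, hf0]
      exact hd'
  have hKy : ∀ i j k l : Bool, yvec a v i.toNat j.toNat k.toNat l.toNat ∈ K := by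
    intro i j k l
    rw [hK]
    refine ⟨hS 0 0 0 i j k l, fun b hb hb1 => ?_⟩
    obtain ⟨c, d, i', j', k', l', i'', j'', k'', l'', e⟩ := y_mul_yvec v hr hb hb1 i j k l
    rw [e]
    exact S.add_mem (S.smul_mem _ (hS 0 0 0 _ _ _ _))
      (S.smul_mem _ (hf1 _ (hS 0 0 0 _ _ _ _)))
  have hpow : ∀ f : Idx, (∀ z ∈ K, a f z ∈ K) → ∀ n : ℕ, ∀ z ∈ K, (a f ^ n) z ∈ K := by
    intro f hf n
    induction n with
    | zero => exact fun z hz => hz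
    | succ n ih => intro z hz; rw [pow_succ', Module.End.mul_apply]; exact hf _ (ih z hz)
  have hSK : S ≤ K := hS' K fun m n q i j k l =>
    hpow f1 (hKf f1 m1 rfl hf1) m _ (hpow f2 (hKf f2 m2 rfl hf2) n _
      (hpow f3 (hKf f3 m3 rfl hf3) q _ (hKy i j k l)))
  exact ((hK z).1 (hSK hz)).2 b hb hb1

end Span

/-! ### An exterior algebra model of u_χ(𝔫⁻) with nilpotent fᵢ -/

section QModel

variable (R : Type*) [AddCommGroup R] [Module F R]

/-- Tensor products with an exterior algebra in four variables `ξ₁, …, ξ₄`; the value at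
`(i, j, k, l)` is the coefficient of `ξ₁^i ξ₂^j ξ₃^k ξ₄^l`. -/
abbrev QM : Type _ := Bool → Bool → Bool → Bool → R

variable {R}

/-- A coefficient as a linear map. -/
def qcoeff (i j k l : Bool) : QM R →ₗ[F] R where
  toFun q := q i j k l
  map_add' _ _ := rfl
  map_smul' _ _ := rfl

/-- An operator given by its coefficients. -/
def qmk (c : Bool → Bool → Bool → Bool → QM R →ₗ[F] R) : Module.End F (QM R) where
  toFun q i j k l := c i j k l q
  map_add' q r := by funext i j k l; exact map_add (c i j k l) q r
  map_smul' x q := by funext i j k l; exact map_smul (c i j k l) x q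

theorem qmk_apply (c : Bool → Bool → Bool → Bool → QM R →ₗ[F] R) (q : QM R)
    (i j k l : Bool) : qmk c q i j k l = c i j k l q := rfl

theorem qcoeff_apply (i j k l : Bool) (q : QM R) : qcoeff (F := F) i j k l q = q i j k l := rfl

/-- The sign attached to an exponent. -/
def bsgn (F : Type*) [Field F] (b : Bool) : F := bif b then -1 else 1

variable (T : Fin 3 → Module.End F R)

/-- The action of `𝔫⁻` on the model: `f₁` is a variable `t₁`, `f₂ = t₂ + ξ₃∂₁ + ξ₄∂₂`,
`f₃ = t₃ + ξ₂∂₁ + ξ₄∂₃`, and `y₁, …, y₄` act by Clifford multiplication. -/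
def qop (α : F) : Idx → Module.End F (QM R)
  | f1 => qmk fun i j k l => T 0 ∘ₗ qcoeff i j k l
  | f2 => qmk fun i j k l => T 1 ∘ₗ qcoeff i j k l +
      (bif k && !i then bsgn F j • qcoeff true j false l else 0) +
      (bif l && !j then bsgn F k • qcoeff i true k false else 0)
  | f3 => qmk fun i j k l => T 2 ∘ₗ qcoeff i j k l +
      (bif j && !i then qcoeff true false k l else 0) +
      (bif l && !k then qcoeff i j true false else 0)
  -- Each y is multiplication by its ξ plus half of the structure constant times t₁ and a
  -- contraction with the partner, so that {y₁,y₄} = -2(1+α)t₁ and {y₂,y₃} = 2(1+α)t₁.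
  | y1 => qmk fun i j k l => (bif i then qcoeff false j k l else 0) -
      (bif l then 0 else ((1 + α) * bsgn F i * bsgn F j * bsgn F k) •
        T 0 ∘ₗ qcoeff i j k true)
  | y2 => qmk fun i j k l => (bif j then bsgn F i • qcoeff i false k l else 0) +
      (bif k then 0 else ((1 + α) * bsgn F i * bsgn F j) • T 0 ∘ₗ qcoeff i j true l)
  | y3 => qmk fun i j k l => (bif k then (bsgn F i * bsgn F j) • qcoeff i j false l else 0) +
      (bif j then 0 else ((1 + α) * bsgn F i) • T 0 ∘ₗ qcoeff i true k l)
  | y4 => qmk fun i j k l => (bif l then (bsgn F i * bsgn F j * bsgn F k) • qcoeff i j k false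
      else 0) - (bif i then 0 else (1 + α) • T 0 ∘ₗ qcoeff true j k l)
  | _ => 0

variable {T}

theorem rel_symm {α : F} {A : Type*} [Ring A] [Algebra F A] {a : Idx → A} {b c : Idx}
    (h : a b * a c = sgn F (par b * par c) • (a c * a b) +
      Finsupp.linearCombination F a (brBasis α b c)) :
    a c * a b = sgn F (par c * par b) • (a b * a c) +
      Finsupp.linearCombination F a (brBasis α c b) := by
  rw [h, brBasis_skew α c b, map_neg, map_smul, smul_add, smul_smul, mul_comm (par c), sgn_mul_self,
    one_smul]
  abel

set_option maxHeartbeats 2000000 in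
theorem rel_qop (α : F) (hT : ∀ i j r, T i (T j r) = T j (T i r)) : Rel α negIdx (qop T α) := by
  have tmul10 := hT 1 0
  have tmul20 := hT 2 0
  have tmul21 := hT 2 1
  have key : ∀ b ∈ negIdx, ∀ c ∈ negIdx, b.num ≤ c.num → qop T α b * qop T α c =
      sgn F (par b * par c) • (qop T α c * qop T α b) +
        Finsupp.linearCombination F (qop T α) (brBasis α b c) := by
    intro b hb c hc hbc
    refine LinearMap.ext fun q => ?_
    rw [LinearMap.add_apply, LinearMap.smul_apply, Module.End.mul_apply, Module.End.mul_apply]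
    simp only [negIdx, Set.mem_insert_iff, Set.mem_singleton_iff] at hb hc
    rcases hb with rfl | rfl | rfl | rfl | rfl | rfl | rfl <;>
      rcases hc with rfl | rfl | rfl | rfl | rfl | rfl | rfl <;>
      first
        | exact absurd hbc (by decide)
        | (funext i j k l
           simp only [brBasis, table, par, sgn, mul_zero, mul_one, if_true, one_ne_zero,
             if_false, sub_zero, smul_zero, map_zero, map_smul,
             lc_bv, LinearMap.zero_apply, LinearMap.smul_apply, add_zero, one_smul, sub_self]
           all_goals
             simp only [qop, qmk_apply, Pi.add_apply, Pi.smul_apply,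
               LinearMap.add_apply, LinearMap.sub_apply, LinearMap.comp_apply, qcoeff_apply]
             cases i <;> cases j <;> cases k <;> cases l <;>
             simp only [cond_true, cond_false, Bool.and_true, Bool.and_false, Bool.not_true,
               Bool.not_false, LinearMap.zero_apply, LinearMap.smul_apply, LinearMap.comp_apply,
               qcoeff_apply, qmk_apply, LinearMap.add_apply, LinearMap.sub_apply, map_add, map_sub,
               map_smul, map_zero, tmul10, tmul20, tmul21, bsgn] <;> (try module))
  intro b hb c hc
  rcases le_total b.num c.num with h | h
  · exact key b hb c hc h
  · exact rel_symm (key c hc b hb h)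

/-- Besides its variable, each of f₂ and f₃ contains an even derivation of the exterior algebra. It
commutes with the variable and has vanishing cube, so it does not contribute to the p-th power. -/
theorem qop_pow (α : F) {p : ℕ} [Fact p.Prime] [CharP F p] (hp : 3 < p)
    (hTp : ∀ i, T i ^ p = 0) {b : Idx} (hb : b ∈ negIdx)
    (hpar : par b = 0) : qop T α b ^ p = 0 := by
  rcases subsingleton_or_nontrivial (Module.End F (QM R)) with _ | _
  · exact Subsingleton.elim _ _
  have : CharP (Module.End F (QM R)) p :=
    charP_of_injective_algebraMap (algebraMap F (Module.End F (QM R))).injective p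
  have hTn : ∀ i, ∀ n : ℕ, ∀ q : QM R,
      ((qmk fun a b c d => T i ∘ₗ qcoeff a b c d) ^ n) q =
        fun a b c d => (T i ^ n) (q a b c d) := by
    intro i n
    induction n with
    | zero => intro q; rfl
    | succ n ih => intro q; rw [pow_succ, Module.End.mul_apply, ih, pow_succ]; rfl
  have hT0 : ∀ i, (qmk fun a b c d => T i ∘ₗ qcoeff a b c d) ^ p = 0 := by
    intro i
    refine LinearMap.ext fun q => ?_
    rw [hTn, hTp]
    rfl
  have hD : ∀ i, ∀ c : Bool → Bool → Bool → Bool → QM R →ₗ[F] R, qmk c ^ 3 = 0 →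
      (∀ q i' j k l, c i' j k l (fun a b c d => T i (q a b c d)) =
        T i (c i' j k l q)) →
      (qmk fun i' j k l => T i ∘ₗ qcoeff i' j k l + c i' j k l) ^ p = 0 := by
    intro i c h3 hc
    have hsum : (qmk fun i' j k l => T i ∘ₗ qcoeff i' j k l + c i' j k l) =
      (qmk fun a b c d => T i ∘ₗ qcoeff a b c d) + qmk c := rfl
    have hcm : Commute (qmk fun a b c d => T i ∘ₗ qcoeff a b c d) (qmk c) :=
      LinearMap.ext fun q => funext fun i' => funext fun j => funext fun k => funext fun l =>
        (hc q i' j k l).symm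
    rw [hsum, add_pow_char_of_commute p hcm, hT0, pow_eq_zero_of_le hp.le h3, add_zero]
  simp only [negIdx, Set.mem_insert_iff, Set.mem_singleton_iff] at hb
  rcases hb with rfl | rfl | rfl | rfl | rfl | rfl | rfl
  · exact hT0 0
  · simp only [qop, add_assoc]
    refine hD 1 _ ?_ ?_
    · refine LinearMap.ext fun q => ?_
      rw [pow_succ, pow_two, Module.End.mul_apply, Module.End.mul_apply]
      funext i j k l
      cases i <;> cases j <;> cases k <;> cases l <;> simp [qmk_apply, qcoeff_apply]
    · intro q i j k l
      cases i <;> cases j <;> cases k <;> cases l <;> simp [qcoeff_apply]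
  · simp only [qop, add_assoc]
    refine hD 2 _ ?_ ?_
    · refine LinearMap.ext fun q => ?_
      rw [pow_succ, pow_two, Module.End.mul_apply, Module.End.mul_apply]
      funext i j k l
      cases i <;> cases j <;> cases k <;> cases l <;> simp [qmk_apply, qcoeff_apply]
    · intro q i j k l
      cases i <;> cases j <;> cases k <;> cases l <;> simp [qcoeff_apply]
  all_goals exact absurd hpar (by decide)

/-- The element `r ξ₁^i ξ₂^j ξ₃^k ξ₄^l`. -/
def qsingle (i j k l : Bool) (r : R) : QM R := fun i' j' k' l' =>
  bif i' == i && (j' == j && (k' == k && l' == l)) then r else 0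

theorem qsum (q : QM R) : q =
    qsingle false false false false (q false false false false) +
    qsingle false false false true (q false false false true) +
    qsingle false false true false (q false false true false) +
    qsingle false false true true (q false false true true) +
    qsingle false true false false (q false true false false) +
    qsingle false true false true (q false true false true) +
    qsingle false true true false (q false true true false) +
    qsingle false true true true (q false true true true) +
    qsingle true false false false (q true false false false) +
    qsingle true false false true (q true false false true) +
    qsingle true false true false (q true false true false) +
    qsingle true false true true (q true false true true) +
    qsingle true true false false (q true true false false) +
    qsingle true true false true (q true true false true) +
    qsingle true true true false (q true true true false) +
    qsingle true true true true (q true true true true) := by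
  funext i j k l
  cases i <;> cases j <;> cases k <;> cases l <;>
    simp only [qsingle, Pi.add_apply, beq_self_eq_true, Bool.and_true, cond_true,
      Bool.and_false, cond_false, add_zero, zero_add, show (true == false) = false from rfl,
      show (false == true) = false from rfl]

theorem qsingle_add (i j k l : Bool) (r s : R) :
    qsingle i j k l (r + s) = qsingle i j k l r + qsingle i j k l s := by
  funext i' j' k' l'
  simp only [qsingle, Pi.add_apply]
  cases (i' == i && (j' == j && (k' == k && l' == l))) <;> simp

theorem qsingle_smul (i j k l : Bool) (c : F) (r : R) :
    qsingle i j k l (c • r) = c • qsingle i j k l r := by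
  funext i' j' k' l'
  simp only [qsingle, Pi.smul_apply]
  cases (i' == i && (j' == j && (k' == k && l' == l))) <;> simp

theorem qsingle_y1 (α : F) (j k l : Bool) (r : R) : qsingle true j k l r =
    qop T α y1 (qsingle false j k l r) + (bif l then ((1 + α) * bsgn F j * bsgn F k) •
      qsingle false j k false (T 0 r) else 0) := by
  funext i' j' k' l'
  cases i' <;> cases j' <;> cases k' <;> cases l' <;> cases j <;> cases k <;> cases l <;>
    simp [qsingle, qop, qmk_apply, qcoeff_apply, bsgn]

theorem qsingle_y2 (α : F) (k l : Bool) (r : R) : qsingle false true k l r =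
    qop T α y2 (qsingle false false k l r) - (bif k then (1 + α) •
      qsingle false false false l (T 0 r) else 0) := by
  funext i' j' k' l'
  cases i' <;> cases j' <;> cases k' <;> cases l' <;> cases k <;> cases l <;>
    simp [qsingle, qop, qmk_apply, qcoeff_apply, bsgn]

theorem qsingle_y3 (α : F) (l : Bool) (r : R) : qsingle false false true l r =
    qop T α y3 (qsingle false false false l r) := by
  funext i' j' k' l'
  cases i' <;> cases j' <;> cases k' <;> cases l' <;> cases l <;>
    simp [qsingle, qop, qmk_apply, qcoeff_apply, bsgn]

theorem qsingle_y4 (α : F) (r : R) : qsingle false false false true r =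
    qop T α y4 (qsingle false false false false r) := by
  funext i' j' k' l'
  cases i' <;> cases j' <;> cases k' <;> cases l' <;>
    simp [qsingle, qop, qmk_apply, qcoeff_apply, bsgn]

theorem qop_f (α : F) (r : R) :
    qop T α f1 (qsingle false false false false r) =
      qsingle false false false false (T 0 r) ∧
    qop T α f2 (qsingle false false false false r) =
      qsingle false false false false (T 1 r) ∧
    qop T α f3 (qsingle false false false false r) =
      qsingle false false false false (T 2 r) := by
  refine ⟨?_, ?_, ?_⟩ <;> funext i j k l <;> cases i <;> cases j <;> cases k <;> cases l <;>
    simp [qsingle, qop, qmk_apply, qcoeff_apply, bsgn]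

/-- The model is generated by `1`. -/
theorem QM_induction (α : F) {one : R}
    (hone : ∀ W : Submodule F R, one ∈ W → (∀ i, ∀ r ∈ W, T i r ∈ W) → ∀ r, r ∈ W) (W : Submodule F (QM R))
    (h1 : qsingle false false false false one ∈ W)
    (hW : ∀ b ∈ negIdx, ∀ q ∈ W, qop T α b q ∈ W) (q : QM R) : q ∈ W := by
  have h0 : ∀ r, qsingle false false false false r ∈ W := by
    let W0 : Submodule F (R) := W.comap (σ₁₂ := RingHom.id F)
      { toFun := qsingle false false false false
        map_add' := qsingle_add _ _ _ _
        map_smul' := qsingle_smul _ _ _ _ }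
    refine hone W0 h1 fun i r hr => ?_
    obtain rfl | rfl | rfl : i = 0 ∨ i = 1 ∨ i = 2 := by fin_cases i <;> simp
    · have := hW f1 (by decide) _ hr
      change qsingle false false false false (T 0 r) ∈ W
      rw [← (qop_f α r).1]
      exact this
    · have := hW f2 (by decide) _ hr
      change qsingle false false false false (T 1 r) ∈ W
      rw [← (qop_f α r).2.1]
      exact this
    · have := hW f3 (by decide) _ hr
      change qsingle false false false false (T 2 r) ∈ W
      rw [← (qop_f α r).2.2]
      exact this
  have h4 : ∀ l r, qsingle false false false l r ∈ W := by
    intro l r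
    cases l
    · exact h0 r
    · rw [qsingle_y4 α]; exact hW y4 (by decide) _ (h0 r)
  have h3 : ∀ k l r, qsingle false false k l r ∈ W := by
    intro k l r
    cases k
    · exact h4 l r
    · rw [qsingle_y3 α]; exact hW y3 (by decide) _ (h4 l r)
  have h2 : ∀ j k l r, qsingle false j k l r ∈ W := by
    intro j k l r
    cases j
    · exact h3 k l r
    · rw [qsingle_y2 α]
      refine W.sub_mem (hW y2 (by decide) _ (h3 k l r)) ?_
      cases k
      · exact W.zero_mem
      · exact W.smul_mem _ (h3 _ _ _)
  have h1 : ∀ i j k l r, qsingle i j k l r ∈ W := by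
    intro i j k l r
    cases i
    · exact h2 j k l r
    · rw [qsingle_y1 α]
      refine W.add_mem (hW y1 (by decide) _ (h2 j k l r)) ?_
      cases l
      · exact W.zero_mem
      · exact W.smul_mem _ (h2 _ _ _ _)
  rw [qsum q]
  repeat' apply W.add_mem
  all_goals exact h1 _ _ _ _ _

/-- The invariants of `𝔫⁻` in the model. -/
theorem QM_socle (α : F) {top : R} (htop : ∀ r, (∀ i, T i r = 0) → ∃ c : F, r = c • top) {q : QM R} (h : ∀ b ∈ negIdx, qop T α b q = 0) :
    ∃ c : F, q = c • qsingle true true true true top := by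
  have hf1 : ∀ i j k l, T 0 (q i j k l) = 0 := fun i j k l => by
    have := congrFun (congrFun (congrFun (congrFun (h f1 (by decide)) i) j) k) l
    simpa [qop, qmk_apply, qcoeff_apply] using this
  -- Once `T 0` kills all coefficients the contraction terms drop out and each y is multiplication
  -- by its ξ; the common kernel of the four is the top exterior degree.
  have e1 : ∀ j k l, q false j k l = 0 := fun j k l => by
    have := congrFun (congrFun (congrFun (congrFun (h y1 (by decide)) true) j) k) l
    cases l <;> simpa [qop, qmk_apply, qcoeff_apply, hf1] using this
  have e2 : ∀ i k l, q i false k l = 0 := fun i k l => by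
    have := congrFun (congrFun (congrFun (congrFun (h y2 (by decide)) i) true) k) l
    cases i <;> cases k <;> simpa [qop, qmk_apply, qcoeff_apply, hf1, bsgn] using this
  have e3 : ∀ i j l, q i j false l = 0 := fun i j l => by
    have := congrFun (congrFun (congrFun (congrFun (h y3 (by decide)) i) j) true) l
    cases i <;> cases j <;> simpa [qop, qmk_apply, qcoeff_apply, hf1, bsgn] using this
  have e4 : ∀ i j k, q i j k false = 0 := fun i j k => by
    have := congrFun (congrFun (congrFun (congrFun (h y4 (by decide)) i) j) k) true
    cases i <;> cases j <;> cases k <;>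
      simpa [qop, qmk_apply, qcoeff_apply, hf1, bsgn] using this
  have hr : ∀ i, T i (q true true true true) = 0 := by
    intro i
    obtain rfl | rfl | rfl : i = 0 ∨ i = 1 ∨ i = 2 := by fin_cases i <;> simp
    · exact hf1 _ _ _ _
    · have := congrFun (congrFun (congrFun (congrFun (h f2 (by decide)) true) true) true) true
      simpa [qop, qmk_apply, qcoeff_apply] using this
    · have := congrFun (congrFun (congrFun (congrFun (h f3 (by decide)) true) true) true) true
      simpa [qop, qmk_apply, qcoeff_apply] using this
  obtain ⟨c, hc⟩ := htop _ hr
  refine ⟨c, ?_⟩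
  rw [← qsingle_smul, ← hc]
  funext i j k l
  cases i <;> cases j <;> cases k <;> cases l <;> simp [qsingle, e1, e2, e3, e4]

/-- The lowest monomial in the model. -/
theorem QM_top (α : F) {p : ℕ} [Fact p.Prime] [CharP F p] (hp : 3 < p)
    (hT : ∀ i j r, T i (T j r) = T j (T i r)) (hTp : ∀ i, T i ^ p = 0) (one : R) :
    fpow (qop T α) (p - 1) (p - 1) (p - 1)
      (yvec (qop T α) (qsingle false false false false one) 1 1 1 1) =
    qsingle true true true true
      ((T 0 ^ (p - 1)) ((T 1 ^ (p - 1)) ((T 2 ^ (p - 1)) one))) := by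
  have h2 : (2 : F) ≠ 0 := by
    intro h
    have := (CharP.cast_eq_zero_iff F p 2).1 (by exact_mod_cast h)
    exact absurd (Nat.le_of_dvd (by omega) this) (by omega)
  have hr := (rel_qop α hT).negRules h2
  have c21 : Commute (qop T α f2) (qop T α f1) := LinearMap.ext hr.f21
  have c31 : Commute (qop T α f3) (qop T α f1) := LinearMap.ext hr.f31
  have h0 : ∀ z, fpow (qop T α) (p - 1) (p - 1) (p - 1) (qop T α f1 z) = 0 := by
    intro z
    have : qop T α f1 ^ (p - 1) * (qop T α f2 ^ (p - 1) * (qop T α f3 ^ (p - 1) * qop T α f1)) =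
        0 := by
      rw [(c31.pow_left _).eq, ← mul_assoc (qop T α f2 ^ _), (c21.pow_left _).eq, mul_assoc,
        ← mul_assoc, ← pow_succ, Nat.sub_add_cancel (by omega),
        qop_pow α hp hTp (by decide) rfl, zero_mul]
    exact LinearMap.congr_fun this z
  -- The witness collects the terms of y₁y₂y₃y₄·1 that involve a contraction. All of them carry a
  -- factor t₁, and f₁^(p-1) f₁ = 0 removes them.
  have hy : ∃ z, yvec (qop T α) (qsingle false false false false one) 1 1 1 1 =
      qsingle true true true true one + qop T α f1 z := by
    refine ⟨(1 + α) • qsingle true false false true one -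
      (1 + α) • qsingle false true true false one -
      ((1 + α) * (1 + α)) • qsingle false false false false (T 0 one), ?_⟩
    simp only [yvec, pow_one]
    funext i j k l
    cases i <;> cases j <;> cases k <;> cases l <;>
      simp [qsingle, qop, qmk_apply, qcoeff_apply, bsgn, smul_smul]
  have hf : ∀ r, qop T α f1 (qsingle true true true true r) = qsingle true true true true (T 0 r) ∧
      qop T α f2 (qsingle true true true true r) = qsingle true true true true (T 1 r) ∧
      qop T α f3 (qsingle true true true true r) = qsingle true true true true (T 2 r) := by
    intro r
    refine ⟨?_, ?_, ?_⟩ <;> funext i j k l <;> cases i <;> cases j <;> cases k <;> cases l <;>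
      simp [qsingle, qop, qmk_apply, qcoeff_apply]
  have hfn : ∀ (b : Idx) (i : Fin 3), (∀ r, qop T α b (qsingle true true true true r) =
      qsingle true true true true (T i r)) → ∀ n : ℕ, ∀ r,
      (qop T α b ^ n) (qsingle true true true true r) =
        qsingle true true true true ((T i ^ n) r) := by
    intro b i h n
    induction n with
    | zero => intro r; rfl
    | succ n ih =>
      intro r
      rw [pow_succ', Module.End.mul_apply, ih, h, pow_succ', Module.End.mul_apply]
  obtain ⟨z, hz⟩ := hy
  have hadd : ∀ u w, fpow (qop T α) (p - 1) (p - 1) (p - 1) (u + w) =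
      fpow (qop T α) (p - 1) (p - 1) (p - 1) u + fpow (qop T α) (p - 1) (p - 1) (p - 1) w := by
    intro u w
    simp [fpow]
  rw [hz, hadd, h0, add_zero, fpow, hfn f3 2 fun r => (hf r).2.2, hfn f2 1 fun r => (hf r).2.1,
    hfn f1 0 fun r => (hf r).1]

end QModel

theorem natCast_ne_zero_of_lt {p : ℕ} [CharP F p] {n : ℕ} (h0 : 0 < n) (h : n < p) :
    (n : F) ≠ 0 := fun h' =>
  absurd (Nat.le_of_dvd h0 ((CharP.cast_eq_zero_iff F p n).1 h')) (by omega)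

section Span

variable {Z : Type*} [AddCommGroup Z] [Module F Z] {a : Idx → Module.End F Z}

theorem fpow_eq_zero {p : ℕ} (hp : ∀ i, a (fIdx i) ^ p = 0) {m n q : ℕ} (z : Z)
    (hm : p ≤ m ∨ p ≤ n ∨ p ≤ q) : fpow a m n q z = 0 := by
  have h1 : ∀ i k, p ≤ k → a (fIdx i) ^ k = 0 := fun i k hk => pow_eq_zero_of_le hk (hp i)
  rcases hm with hm | hm | hm
  · rw [fpow, show a f1 ^ m = 0 from h1 0 m hm]; rfl
  · rw [fpow, show a f2 ^ n = 0 from h1 1 n hm]; simp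
  · rw [fpow, show a f3 ^ q = 0 from h1 2 q hm]; simp

end Span

/-! ### Comparison of u_χ(𝔫⁻) with the model -/

section Iso

variable {α : F} {p : ℕ} {χ : Module.Dual F (gPart F 0)} [CharP F p]

/-- The ordered monomials in the generators of `UN`. -/
def monom (α : F) (p : ℕ) (χ : Module.Dual F (gPart F 0))
    (t : (Fin p × Fin p × Fin p) × (Bool × Bool × Bool × Bool)) : UN α p χ :=
  fpow (fun b => LinearMap.mulLeft F (ng α p χ b)) t.1.1 t.1.2.1 t.1.2.2
    (yvec (fun b => LinearMap.mulLeft F (ng α p χ b)) 1 t.2.1.toNat t.2.2.1.toNat t.2.2.2.1.toNat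
      t.2.2.2.2.toNat)

theorem rel_mulLeft {A : Type*} [Ring A] [Algebra F A] {J : Set Idx} {a : Idx → A}
    (h : Rel α J a) : Rel α J fun b => LinearMap.mulLeft F (a b) := by
  intro b hb c hc
  have e : Finsupp.linearCombination F (fun b => LinearMap.mulLeft F (a b)) (brBasis α b c) =
      LinearMap.mulLeft F (Finsupp.linearCombination F a (brBasis α b c)) := by
    exact (Finsupp.apply_linearCombination F (LinearMap.mul F A) a _).symm
  rw [e]
  refine LinearMap.ext fun u => ?_
  have := congrArg (· * u) (h b hb c hc)
  simpa [mul_assoc, add_mul] using this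

/-- Ordered monomials with arbitrary exponents span by `pbw_stable`, and those with an exponent of
at least p vanish because fᵢ^p = 0. This is the spanning half of PBW; the dimension of the model
supplies the rest. -/
theorem span_monom (hp : 3 < p) (hχ : ∀ i, chiF χ i ^ p = 0) :
    Submodule.span F (Set.range (monom α p χ)) = ⊤ := by
  have h2 : (2 : F) ≠ 0 := by exact_mod_cast natCast_ne_zero_of_lt (F := F) (p := p) (n := 2) (by omega) (by omega)
  set a : Idx → Module.End F (UN α p χ) := fun b => LinearMap.mulLeft F (ng α p χ b) with ha
  have hr : Rel α negIdx a := rel_mulLeft (rel_ng α p χ)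
  have hpow : ∀ i, a (fIdx i) ^ p = 0 := by
    intro i
    have hi : fIdx i ∈ negIdx := by fin_cases i <;> decide
    have := ng_pow α p χ hi (par_fIdx i)
    rw [ha, LinearMap.pow_mulLeft, this, show χ (evenBv (fIdx i) (par_fIdx i)) = chiF χ i from rfl,
      hχ i, map_zero]
    exact LinearMap.ext fun u => zero_mul u
  have hS : ∀ m n q (i j k l : Bool), fpow a m n q
      (yvec a 1 i.toNat j.toNat k.toNat l.toNat) ∈ Submodule.span F (Set.range (monom α p χ)) := by
    intro m n q i j k l
    by_cases h : m < p ∧ n < p ∧ q < p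
    · exact Submodule.subset_span ⟨((⟨m, h.1⟩, ⟨n, h.2.1⟩, ⟨q, h.2.2⟩), (i, j, k, l)), rfl⟩
    · rw [fpow_eq_zero hpow _ (by omega)]
      exact Submodule.zero_mem _
  refine eq_top_iff.2 fun u _ => UN_induction _ ?_ (fun b hb u hu => ?_) u
  · exact hS 0 0 0 false false false false
  · refine pbw_stable (a := a) (1 : UN α p χ) hr h2 hS (fun W hW => ?_) hb hu
    rw [Submodule.span_le]
    rintro _ ⟨t, rfl⟩
    exact hW _ _ _ _ _ _ _

/-- `UN` is isomorphic to the model when `χ(fᵢ)^p = 0`. -/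
theorem exists_modelEquiv [Fact p.Prime] (α : F) (hp : 3 < p) (hχ : ∀ i, chiF χ i ^ p = 0) {R : Type*}
    [AddCommGroup R] [Module F R] [Module.Finite F R] (hR : Module.finrank F R = p ^ 3)
    {T : Fin 3 → Module.End F R} (hT : ∀ i j r, T i (T j r) = T j (T i r))
    (hTp : ∀ i, T i ^ p = 0) {one : R}
    (hone : ∀ W : Submodule F R, one ∈ W → (∀ i, ∀ r ∈ W, T i r ∈ W) → ∀ r, r ∈ W) :
    ∃ Ψ : UN α p χ ≃ₗ[F] QM R, Ψ 1 = qsingle false false false false one ∧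
      ∀ b ∈ negIdx, ∀ u, Ψ (ng α p χ b * u) = qop T α b (Ψ u) := by
  have h : negIdx = {b | (bv b : G F) ∈ nMinus F} := by ext b; exact bv_mem_nMinus.symm
  obtain ⟨g, hg⟩ := exists_lift (p := p) (χ := χ) isCoordinate_nMinus
    (h ▸ rel_qop α hT) (by
      intro b hb hpar
      have hb' := bv_mem_nMinus.1 hb
      rw [qop_pow α hp hTp hb' hpar, pMap_of_mem_negIdx hb', map_zero, zero_add]
      have : ∃ i, b = fIdx i := by
        simp only [negIdx, Set.mem_insert_iff, Set.mem_singleton_iff] at hb'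
        rcases hb' with rfl | rfl | rfl | rfl | rfl | rfl | rfl
        · exact ⟨0, rfl⟩
        · exact ⟨1, rfl⟩
        · exact ⟨2, rfl⟩
        all_goals exact absurd hpar (by decide)
      obtain ⟨i, rfl⟩ := this
      rw [show χ (evenBv (fIdx i) hpar) = chiF χ i from rfl, hχ i, map_zero])
  let e : UN α p χ →ₗ[F] QM R :=
    LinearMap.applyₗ (qsingle false false false false one) ∘ₗ g.toLinearMap
  have he : ∀ b ∈ negIdx, ∀ u, e (ng α p χ b * u) = qop T α b (e u) := by
    intro b hb u
    change g _ _ = _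
    rw [map_mul, hg b (bv_mem_nMinus.2 hb), Module.End.mul_apply]
    rfl
  have he1 : e 1 = qsingle false false false false one := by
    change g 1 _ = _
    rw [map_one]; rfl
  have hsurj : Function.Surjective e := by
    rw [← LinearMap.range_eq_top, eq_top_iff]
    refine fun q _ => QM_induction α hone (LinearMap.range e) ⟨1, he1⟩ ?_ q
    rintro b hb _ ⟨u, rfl⟩
    exact ⟨_, he b hb u⟩
  have hspan := span_monom (α := α) hp hχ
  have hfin : Module.Finite F (UN α p χ) :=
    ⟨by rw [← hspan]; exact Submodule.fg_span (Set.finite_range _)⟩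
  -- At most 16 p³ monomials span `UN`, and the model has exactly this dimension, so the surjection
  -- onto the model is bijective.
  have hle : Module.finrank F (UN α p χ) ≤ Module.finrank F (QM R) := by
    have h1 := finrank_range_le_card (R := F) (monom α p χ)
    rw [Set.finrank, hspan, finrank_top] at h1
    refine h1.trans (le_of_eq ?_)
    simp [Module.finrank_pi_fintype, hR]
    ring
  have hinj : Function.Injective e := by
    have h1 := LinearMap.finrank_range_add_finrank_ker e
    rw [LinearMap.range_eq_top.2 hsurj, finrank_top] at h1
    rw [← LinearMap.ker_eq_bot, ← Submodule.finrank_eq_zero (R := F)]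
    omega
  exact ⟨LinearEquiv.ofBijective e ⟨hinj, hsurj⟩, he1, he⟩

end Iso

theorem fIdx_mem_negIdx (i : Fin 3) : fIdx i ∈ negIdx := by fin_cases i <;> decide

theorem eq_fIdx_of_even {b : Idx} (hb : b ∈ negIdx) (hpar : par b = 0) : ∃ i, b = fIdx i := by
  simp only [negIdx, Set.mem_insert_iff, Set.mem_singleton_iff] at hb
  rcases hb with rfl | rfl | rfl | rfl | rfl | rfl | rfl
  · exact ⟨0, rfl⟩
  · exact ⟨1, rfl⟩
  · exact ⟨2, rfl⟩
  all_goals exact absurd hpar (by decide)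

/-! ### Invariants of 𝔫⁻ and injectivity -/

section Invariants

variable {α : F} {Z : Type*} [AddCommGroup Z] [Module F Z] {a : Idx → Module.End F Z}

theorem inf_ker_ne_bot {T : Module.End F Z} {n : ℕ} (hT : T ^ n = 0) {W : Submodule F Z}
    (hW : ∀ w ∈ W, T w ∈ W) (hne : W ≠ ⊥) : W ⊓ LinearMap.ker T ≠ ⊥ := by
  obtain ⟨w, hw, hw0⟩ := W.ne_bot_iff.1 hne
  have key : ∀ k, ∀ w ∈ W, w ≠ 0 → (T ^ k) w = 0 → ∃ u ∈ W, u ≠ 0 ∧ T u = 0 := by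
    intro k
    induction k with
    | zero => exact fun w _ h0 h => absurd h h0
    | succ k ih =>
      intro w hw h0 h
      by_cases h1 : T w = 0
      · exact ⟨w, hw, h0, h1⟩
      · exact ih _ (hW w hw) h1 (by rwa [pow_succ, Module.End.mul_apply] at h)
  obtain ⟨u, hu, hu0, hTu⟩ := key n w hw hw0 (by rw [hT]; rfl)
  exact (Submodule.ne_bot_iff _).2 ⟨u, ⟨hu, hTu⟩, hu0⟩

/-- Every nonzero `𝔫⁻`-submodule contains a nonzero invariant if the `fᵢ` act nilpotently. -/
theorem NegRules.exists_invariant (h : NegRules α a) {p : ℕ} (hp : ∀ i, a (fIdx i) ^ p = 0)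
    {W : Submodule F Z} (hW : ∀ b ∈ negIdx, ∀ w ∈ W, a b w ∈ W) (hne : W ≠ ⊥) :
    ∃ w ∈ W, w ≠ 0 ∧ ∀ b ∈ negIdx, a b w = 0 := by
  have hf : ∀ w ∈ W, a f1 w ∈ W ∧ a f2 w ∈ W ∧ a f3 w ∈ W ∧ a y1 w ∈ W ∧ a y2 w ∈ W ∧
      a y3 w ∈ W ∧ a y4 w ∈ W := fun w hw =>
    ⟨hW _ (by decide) w hw, hW _ (by decide) w hw, hW _ (by decide) w hw, hW _ (by decide) w hw,
      hW _ (by decide) w hw, hW _ (by decide) w hw, hW _ (by decide) w hw⟩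
  have sq : ∀ b, (∀ z, a b (a b z) = 0) → a b ^ 2 = 0 := fun b hb => by
    rw [pow_two]; exact LinearMap.ext hb
  -- Kernels are taken in the order f₁, y₄, y₃, y₂, y₁, f₂, f₃. In this order each nilpotent
  -- generator preserves the common kernel of the preceding ones.
  have n1 := inf_ker_ne_bot (hp 0) (fun w hw => (hf w hw).1) hne
  have n2 := inf_ker_ne_bot (sq y4 h.y44) (fun w hw => by
    have h1 : a f1 w = 0 := hw.2
    refine ⟨(hf w hw.1).2.2.2.2.2.2, ?_⟩
    change a f1 _ = 0
    rw [← h.y4f1, h1, map_zero]) n1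
  have n3 := inf_ker_ne_bot (sq y3 h.y33) (fun w hw => by
    have h1 : a f1 w = 0 := hw.1.2
    have h4 : a y4 w = 0 := hw.2
    refine ⟨⟨(hf w hw.1.1).2.2.2.2.2.1, ?_⟩, ?_⟩
    · change a f1 _ = 0
      rw [← h.y3f1, h1, map_zero]
    · change a y4 _ = 0
      rw [h.y43, h4, map_zero, neg_zero]) n2
  have n4 := inf_ker_ne_bot (sq y2 h.y22) (fun w hw => by
    have h1 : a f1 w = 0 := hw.1.1.2
    have h4 : a y4 w = 0 := hw.1.2
    have h3 : a y3 w = 0 := hw.2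
    refine ⟨⟨⟨(hf w hw.1.1.1).2.2.2.2.1, ?_⟩, ?_⟩, ?_⟩
    · change a f1 _ = 0
      rw [← h.y2f1, h1, map_zero]
    · change a y4 _ = 0
      rw [h.y42, h4, map_zero, neg_zero]
    · change a y3 _ = 0
      rw [h.y32, h3, h1, map_zero, smul_zero, neg_zero, add_zero]) n3
  have n5 := inf_ker_ne_bot (sq y1 h.y11) (fun w hw => by
    have h1 : a f1 w = 0 := hw.1.1.1.2
    have h4 : a y4 w = 0 := hw.1.1.2
    have h3 : a y3 w = 0 := hw.1.2
    have h2 : a y2 w = 0 := hw.2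
    refine ⟨⟨⟨⟨(hf w hw.1.1.1.1).2.2.2.1, ?_⟩, ?_⟩, ?_⟩, ?_⟩
    · change a f1 _ = 0
      rw [← h.y1f1, h1, map_zero]
    · change a y4 _ = 0
      rw [h.y41, h4, h1, map_zero, smul_zero, neg_zero, sub_zero]
    · change a y3 _ = 0
      rw [h.y31, h3, map_zero, neg_zero]
    · change a y2 _ = 0
      rw [h.y21, h2, map_zero, neg_zero]) n4
  have n6 := inf_ker_ne_bot (hp 1) (fun w hw => by
    have h1 : a f1 w = 0 := hw.1.1.1.1.2
    have h4 : a y4 w = 0 := hw.1.1.1.2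
    have h3 : a y3 w = 0 := hw.1.1.2
    have h2 : a y2 w = 0 := hw.1.2
    have h0 : a y1 w = 0 := hw.2
    refine ⟨⟨⟨⟨⟨(hf w hw.1.1.1.1.1).2.1, ?_⟩, ?_⟩, ?_⟩, ?_⟩, ?_⟩
    · change a f1 (a f2 w) = 0
      rw [← h.f21, h1, map_zero]
    · change a y4 (a f2 w) = 0
      rw [h.y4f2, h4, map_zero]
    · change a y3 (a f2 w) = 0
      rw [h.y3f2, h3, map_zero]
    · change a y2 (a f2 w) = 0
      rw [h.y2f2, h2, h4, map_zero, sub_zero]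
    · change a y1 (a f2 w) = 0
      rw [h.y1f2, h0, h3, map_zero, sub_zero]) n5
  have n7 := inf_ker_ne_bot (hp 2) (fun w hw => by
    have h1 : a f1 w = 0 := hw.1.1.1.1.1.2
    have h4 : a y4 w = 0 := hw.1.1.1.1.2
    have h3 : a y3 w = 0 := hw.1.1.1.2
    have h2 : a y2 w = 0 := hw.1.1.2
    have h0 : a y1 w = 0 := hw.1.2
    have hf2 : a f2 w = 0 := hw.2
    refine ⟨⟨⟨⟨⟨⟨(hf w hw.1.1.1.1.1.1).2.2.1, ?_⟩, ?_⟩, ?_⟩, ?_⟩, ?_⟩, ?_⟩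
    · change a f1 (a f3 w) = 0
      rw [← h.f31, h1, map_zero]
    · change a y4 (a f3 w) = 0
      rw [h.y4f3, h4, map_zero]
    · change a y3 (a f3 w) = 0
      rw [h.y3f3, h3, h4, map_zero, sub_zero]
    · change a y2 (a f3 w) = 0
      rw [h.y2f3, h2, map_zero]
    · change a y1 (a f3 w) = 0
      rw [h.y1f3, h0, h2, map_zero, sub_zero]
    · change a f2 (a f3 w) = 0
      rw [← h.f32, hf2, map_zero]) n6
  obtain ⟨w, hw, hw0⟩ := (Submodule.ne_bot_iff _).1 n7
  refine ⟨w, hw.1.1.1.1.1.1.1, hw0, fun b hb => ?_⟩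
  simp only [negIdx, Set.mem_insert_iff, Set.mem_singleton_iff] at hb
  rcases hb with rfl | rfl | rfl | rfl | rfl | rfl | rfl
  · exact hw.1.1.1.1.1.1.2
  · exact hw.1.2
  · exact hw.2
  · exact hw.1.1.2
  · exact hw.1.1.1.2
  · exact hw.1.1.1.1.2
  · exact hw.1.1.1.1.1.2

theorem exists_negRep {p : ℕ} {χ : Module.Dual F (gPart F 0)} (hχ : ∀ i, chiF χ i ^ p = 0)
    (hr : Rel α negIdx a) (hpow : ∀ i, a (fIdx i) ^ p = 0) :
    ∃ g : UN α p χ →ₐ[F] Module.End F Z, ∀ b ∈ negIdx, g (ng α p χ b) = a b := by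
  have h : negIdx = {b | (bv b : G F) ∈ nMinus F} := by ext b; exact bv_mem_nMinus.symm
  obtain ⟨g, hg⟩ := exists_lift (p := p) (χ := χ) isCoordinate_nMinus (h ▸ hr) (by
    intro b hb hpar
    have hb' := bv_mem_nMinus.1 hb
    obtain ⟨i, rfl⟩ := eq_fIdx_of_even hb' hpar
    rw [hpow, pMap_of_mem_negIdx hb', map_zero, zero_add,
      show χ (evenBv (fIdx i) hpar) = chiF χ i from rfl, hχ i, map_zero])
  exact ⟨g, fun b hb => hg b (bv_mem_nMinus.2 hb)⟩

/-- A module with one-dimensional socle of the dimension of `UN` is injective: cocycles on `𝔫⁻`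
that satisfy the condition coming from the `p`-structure are inner. -/
theorem Coc.exists_inner_neg {p : ℕ} {χ : Module.Dual F (gPart F 0)}
    (hχ : ∀ i, chiF χ i ^ p = 0) (h2 : (2 : F) ≠ 0) (hp0 : p ≠ 0) (hr : Rel α negIdx a)
    (hpow : ∀ i, a (fIdx i) ^ p = 0) [Module.Finite F Z] [Module.Finite F (UN α p χ)]
    (hdim : Module.finrank F Z = Module.finrank F (UN α p χ)) {s : Z} (hs : s ≠ 0)
    (hsoc : ∀ z, (∀ b ∈ negIdx, a b z = 0) → ∃ c : F, z = c • s) {φ : Idx → Z}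
    (hφ : Coc α negIdx a φ) (hφp : ∀ i, (a (fIdx i) ^ (p - 1)) (φ (fIdx i)) = 0) :
    ∃ m, ∀ b ∈ negIdx, φ b = a b m := by
  obtain ⟨g, hg⟩ := exists_negRep hχ hr hpow
  -- The hypothesis fᵢ^(p-1) φ(fᵢ) = 0 is what makes fᵢ^p vanish on the extension, which thereby
  -- becomes a module over `UN`.
  obtain ⟨gE, hgE⟩ := exists_negRep hχ (hr.extAct hφ) (fun i => by
    obtain ⟨k, rfl⟩ : ∃ k, p = k + 1 := ⟨p - 1, by omega⟩
    refine LinearMap.ext fun z => ?_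
    rw [extAct_pow_succ, hpow i]
    simpa [← Prod.zero_eq_mk] using Or.inr (hφp i))
  have hgE1 : ∀ u : UN α p χ, ∀ z, gE u (z, 0) = (g u z, 0) := by
    intro u
    let W : Submodule F (UN α p χ) :=
      { carrier := {u | ∀ z, gE u (z, 0) = (g u z, 0)}
        zero_mem' := fun z => by simp [← Prod.zero_eq_mk]
        add_mem' := fun ha hb z => by simp [map_add, LinearMap.add_apply, ha z, hb z]
        smul_mem' := fun c u hu z => by simp [map_smul, LinearMap.smul_apply, hu z] }
    refine UN_induction W (fun z => by simp) (fun b hb u hu z => ?_) u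
    rw [map_mul, map_mul, hg b hb, hgE b hb, Module.End.mul_apply, Module.End.mul_apply, hu z,
      extAct_apply, zero_smul, add_zero]
  obtain ⟨τ, hτ⟩ : ∃ τ : Module.Dual F Z, τ s ≠ 0 := by
    by_contra! hh
    exact hs ((Module.forall_dual_apply_eq_zero_iff F s).1 hh)
  -- Θ sends z to u ↦ τ(u z). Its kernel is a submodule; if nonzero it would contain an invariant, a
  -- multiple of `s`, on which τ does not vanish. Equality of dimensions then makes Θ an isomorphism
  -- of `Z` with the dual of `UN`.
  let Θ : Z →ₗ[F] Module.Dual F (UN α p χ) := (LinearMap.flip g.toLinearMap).compr₂ τ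
  have hΘ : ∀ z u, Θ z u = τ (g u z) := fun _ _ => rfl
  have hinj : Function.Injective Θ := by
    rw [← LinearMap.ker_eq_bot]
    by_contra hne
    obtain ⟨w, hw, hw0, hinv⟩ := (hr.negRules h2).exists_invariant hpow (W := LinearMap.ker Θ)
      (fun b hb w hw => by
        rw [LinearMap.mem_ker] at hw ⊢
        refine LinearMap.ext fun u => ?_
        have := LinearMap.congr_fun hw (u * ng α p χ b)
        rwa [hΘ, map_mul, hg b hb] at this) hne
    obtain ⟨c, rfl⟩ := hsoc w hinv
    have := LinearMap.congr_fun (LinearMap.mem_ker.1 hw) 1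
    rw [hΘ, map_one, Module.End.one_apply, map_smul, LinearMap.zero_apply, smul_eq_mul] at this
    rcases mul_eq_zero.1 this with h | h
    · exact hw0 (by rw [h, zero_smul])
    · exact hτ h
  have hsurj : Function.Surjective Θ :=
    (LinearMap.injective_iff_surjective_of_finrank_eq_finrank
      (by rw [hdim, Subspace.dual_finrank_eq])).1 hinj
  -- The functional u ↦ τ(u·(0,1)) is represented by some m. Comparison at u b gives τ(u φ(b)) = τ(u
  -- b m) for all u, hence φ(b) = b m by injectivity of Θ.
  obtain ⟨m, hm⟩ := hsurj
    (τ ∘ₗ LinearMap.fst F Z F ∘ₗ LinearMap.applyₗ ((0 : Z), (1 : F)) ∘ₗ gE.toLinearMap)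
  refine ⟨m, fun b hb => hinj (LinearMap.ext fun u => ?_)⟩
  have h1 := LinearMap.congr_fun hm (u * ng α p χ b)
  change τ (g _ m) = τ (gE _ _).1 at h1
  rw [map_mul, map_mul, hg b hb, hgE b hb, Module.End.mul_apply, Module.End.mul_apply, extAct_apply,
    map_zero, zero_add, one_smul, hgE1] at h1
  rw [hΘ, hΘ, h1]

end Invariants

/-! ### The properties of the baby Verma module used below -/

section Core

variable {Z : Type*} [AddCommGroup Z] [Module F Z]

/-- The lowest monomial `f₁^(p-1) f₂^(p-1) f₃^(p-1) y₁ y₂ y₃ y₄ v`. -/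
def bot (p : ℕ) (a : Idx → Module.End F Z) (v : Z) : Z :=
  fpow a (p - 1) (p - 1) (p - 1) (yvec a v 1 1 1 1)

/-- The labels of `𝔫⁺`. -/
def posIdx : List Idx := [e1, e2, e3, x1, x2, x3, x4]

/-- The properties of the baby Verma module with `χ(fᵢ)^p = 0` on which the computation of
superderivations rests. -/
structure Core (p : ℕ) (α : F) (μ : Fin 3 → F) (a : Idx → Module.End F Z) (v : Z) : Prop where
  rel : Rel α Set.univ a
  pow_f : ∀ i, a (fIdx i) ^ p = 0
  h_vac : ∀ i, a (hIdx i) v = μ i • v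
  pos_vac : ∀ b ∈ posIdx, a b v = 0
  bot_ne_zero : bot p a v ≠ 0
  socle : ∀ z, (∀ b ∈ negIdx, a b z = 0) → ∃ c : F, z = c • bot p a v
  bot_inv : ∀ b ∈ negIdx, a b (bot p a v) = 0
  exists_inner_neg : ∀ φ : Idx → Z, Coc α negIdx a φ →
    (∀ i, (a (fIdx i) ^ (p - 1)) (φ (fIdx i)) = 0) → ∃ m, ∀ b ∈ negIdx, φ b = a b m

end Core

theorem map_pow_apply {Z W : Type*} [AddCommGroup Z] [Module F Z] [AddCommGroup W] [Module F W]
    (f : Z →ₗ[F] W) {S : Module.End F Z} {T : Module.End F W} (h : ∀ z, f (S z) = T (f z)) (n : ℕ)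
    (z : Z) : f ((S ^ n) z) = (T ^ n) (f z) := by
  induction n generalizing z with
  | zero => rfl
  | succ n ih => rw [pow_succ, pow_succ, Module.End.mul_apply, Module.End.mul_apply, ih, h]

theorem map_fpow_yvec {Z W : Type*} [AddCommGroup Z] [Module F Z] [AddCommGroup W] [Module F W]
    (f : Z →ₗ[F] W) {a : Idx → Module.End F Z} {a' : Idx → Module.End F W}
    (h : ∀ b ∈ negIdx, ∀ z, f (a b z) = a' b (f z)) (m n q i j k l : ℕ) (z : Z) :
    f (fpow a m n q (yvec a z i j k l)) = fpow a' m n q (yvec a' (f z) i j k l) := by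
  simp only [fpow, yvec]
  rw [map_pow_apply f (h f1 (by decide)), map_pow_apply f (h f2 (by decide)),
    map_pow_apply f (h f3 (by decide)), map_pow_apply f (h y1 (by decide)),
    map_pow_apply f (h y2 (by decide)), map_pow_apply f (h y3 (by decide)),
    map_pow_apply f (h y4 (by decide))]

theorem QM_top_inv {R : Type*} [AddCommGroup R] [Module F R] {T : Fin 3 → Module.End F R} (α : F)
    {top : R} (htop : ∀ i, T i top = 0) {b : Idx} (hb : b ∈ negIdx) :
    qop T α b (qsingle true true true true top) = 0 := by
  simp only [negIdx, Set.mem_insert_iff, Set.mem_singleton_iff] at hb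
  have h0 := htop 0
  have h1 := htop 1
  have h2 := htop 2
  rcases hb with rfl | rfl | rfl | rfl | rfl | rfl | rfl <;>
    funext i j k l <;> cases i <;> cases j <;> cases k <;> cases l <;>
    simp [qsingle, qop, qmk_apply, qcoeff_apply, bsgn, h0, h1, h2]

variable {α : F} {p : ℕ} {χ : Module.Dual F (gPart F 0)} {lam : Module.Dual F (cartan F)}
  {hl : Admissible p χ lam}

/-- `UN` and the baby Verma module. -/
def vermaEquiv [Fact p.Prime] [CharP F p] (hp : 3 < p) (hl : Admissible p χ lam) :
    UN α p χ ≃ₗ[F] Verma α p χ lam hl :=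
  LinearEquiv.ofBijective
    (LinearMap.applyₗ (vac α p χ lam hl) ∘ₗ (nact α p χ lam hl).toLinearMap)
    ⟨(injective_iff_map_eq_zero _).2 fun _ hu => nact_vac_injective α p χ lam hl hp hu,
      nact_vac_surjective α p χ lam hl hp⟩

theorem vermaEquiv_apply [Fact p.Prime] [CharP F p] (hp : 3 < p) (u : UN α p χ) :
    vermaEquiv hp hl u = nact α p χ lam hl u (vac α p χ lam hl) := rfl

theorem vermaEquiv_ng [Fact p.Prime] [CharP F p] (hp : 3 < p) {b : Idx} (hb : b ∈ negIdx)
    (u : UN α p χ) :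
    vermaEquiv hp hl (ng α p χ b * u) = zact α p χ lam hl b (vermaEquiv hp hl u) := by
  rw [vermaEquiv_apply, vermaEquiv_apply, map_mul, nact_ng α p χ lam hl hb, Module.End.mul_apply]

/-- The isomorphism with the model commutes with 𝔫⁻ and sends v to the constant 1, so socle and
lowest monomial are read off in the model. Injectivity is `Coc.exists_inner_neg`, available because
Z has the dimension of `UN`. -/
theorem core_verma [Fact p.Prime] [CharP F p] (hp : 3 < p) (hχ : ∀ i, chiF χ i ^ p = 0) :
    Core p α (fun i => lam (hC i)) (zact α p χ lam hl) (vac α p χ lam hl) := by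
  have h2 : (2 : F) ≠ 0 := by
    exact_mod_cast natCast_ne_zero_of_lt (F := F) (p := p) (n := 2) (by omega) (by omega)
  have hfin : Module.Finite F (UN α p χ) :=
    ⟨by rw [← span_monom (α := α) hp hχ]; exact Submodule.fg_span (Set.finite_range _)⟩
  have hfinZ : Module.Finite F (Verma α p χ lam hl) := Module.Finite.equiv (vermaEquiv hp hl)
  have hpow : ∀ i, zact α p χ lam hl (fIdx i) ^ p = 0 := by
    intro i
    have hi := fIdx_mem_negIdx i
    rw [← nact_ng α p χ lam hl hi, ← map_pow, ng_pow α p χ hi (par_fIdx i),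
      show χ (evenBv (fIdx i) (par_fIdx i)) = chiF χ i from rfl, hχ i, map_zero, map_zero]
  obtain ⟨Ψ, hΨ1, hΨ⟩ := exists_modelEquiv (χ := χ) α hp hχ (R := TP F p)
    (by simp [Module.finrank_pi_fintype]; ring) (tmul_comm F p) (tmul_pow F p) (TP_induction F p)
  let Φ : Verma α p χ lam hl ≃ₗ[F] QM (TP F p) := (vermaEquiv hp hl).symm.trans Ψ
  have hΦ : ∀ b ∈ negIdx, ∀ z, Φ (zact α p χ lam hl b z) = qop (tmul F p) α b (Φ z) := by
    intro b hb z
    obtain ⟨u, rfl⟩ := (vermaEquiv hp hl).surjective z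
    rw [← vermaEquiv_ng hp hb]
    simp only [Φ, LinearEquiv.trans_apply, LinearEquiv.symm_apply_apply, hΨ b hb]
  have hΦv : Φ (vac α p χ lam hl) = qsingle false false false false (tone F p) := by
    have : vermaEquiv hp hl (1 : UN α p χ) = vac α p χ lam hl := by
      rw [vermaEquiv_apply, map_one]; rfl
    rw [← this]
    simp only [Φ, LinearEquiv.trans_apply, LinearEquiv.symm_apply_apply, hΨ1]
  have hbot : Φ (bot p (zact α p χ lam hl) (vac α p χ lam hl)) =
      qsingle true true true true (ttop F p) := by
    have h1 := map_fpow_yvec Φ.toLinearMap hΦ (p - 1) (p - 1) (p - 1) 1 1 1 1 (vac α p χ lam hl)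
    have h3 := QM_top α hp (tmul_comm F p) (tmul_pow F p) (tone F p)
    rw [← hΦv] at h3
    exact h1.trans h3
  have hne : bot p (zact α p χ lam hl) (vac α p χ lam hl) ≠ 0 := by
    intro h
    rw [h, map_zero] at hbot
    have := congrFun (congrFun (congrFun (congrFun hbot true) true) true) true
    exact ttop_ne_zero F p this.symm
  have hsoc : ∀ z, (∀ b ∈ negIdx, zact α p χ lam hl b z = 0) →
      ∃ c : F, z = c • bot p (zact α p χ lam hl) (vac α p χ lam hl) := by
    intro z hz
    obtain ⟨c, hc⟩ := QM_socle α (T := tmul F p) (fun r => exists_eq_smul_ttop F p) (q := Φ z)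
      (fun b hb => by rw [← hΦ b hb, hz b hb, map_zero])
    refine ⟨c, Φ.injective ?_⟩
    rw [hc, map_smul, hbot]
  refine ⟨rel_zact α p χ lam hl, hpow, fun i => ?_, fun b hb => ?_, hne, hsoc, fun b hb => ?_,
    fun φ hφ hφp => ?_⟩
  · rw [zact_vac α p χ lam hl (by fin_cases i <;> decide)]
    congr 1
    fin_cases i <;> simp [hIdx, lamExt_bv]
  · have hb' : b ∉ negIdx := by revert b; decide
    rw [zact_vac α p χ lam hl hb']
    simp only [posIdx, List.mem_cons, List.not_mem_nil, or_false] at hb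
    rcases hb with rfl | rfl | rfl | rfl | rfl | rfl | rfl <;> simp [lamExt_bv]
  · apply Φ.injective
    rw [hΦ b hb, hbot, map_zero]
    exact QM_top_inv α (tmul_ttop F p) hb
  · exact hφ.exists_inner_neg hχ h2 (by omega) ((rel_zact α p χ lam hl).mono (Set.subset_univ _))
      hpow (LinearEquiv.finrank_eq (vermaEquiv hp hl)).symm hne hsoc hφp

theorem sgn_add (i j : ZMod 2) : sgn F (i + j) = sgn F i * sgn F j := by
  rcases zmod2_cases i with rfl | rfl <;> rcases zmod2_cases j with rfl | rfl <;>
    simp [sgn, show (1 + 1 : ZMod 2) = 0 from rfl]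

theorem linearCombination_sgn {M : Type*} [AddCommGroup M] [Module F M] (f : Idx → M)
    (k : ZMod 2) {i : ZMod 2} {g : G F} (hg : g ∈ gPart F i) :
    Finsupp.linearCombination F (fun b => sgn F (k * par b) • f b) g =
      sgn F (k * i) • Finsupp.linearCombination F f g := by
  induction hg using Submodule.span_induction with
  | mem v hv => obtain ⟨b, rfl, rfl⟩ := hv; simp [bv]
  | zero => simp
  | add v w _ _ hv hw => rw [map_add, map_add, hv, hw, smul_add]
  | smul c v _ hv => rw [map_smul, map_smul, hv, smul_comm]

/-! ### The ℤ/2-grading -/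

section Parity

variable (α : F) (p : ℕ) (χ : Module.Dual F (gPart F 0)) (lam : Module.Dual F (cartan F))
  (hl : Admissible p χ lam)

/-- Changing the sign of the odd generators respects the defining relations, which are homogeneous.
The resulting automorphism will separate the even from the odd part. -/
theorem exists_parityUN : ∃ θ : UN α p χ →ₐ[F] UN α p χ,
    ∀ b ∈ negIdx, θ (ng α p χ b) = sgn F (par b) • ng α p χ b := by
  have h : negIdx = {b | (bv b : G F) ∈ nMinus F} := by ext b; exact bv_mem_nMinus.symm
  have hs : ∀ b, sgn F (par b) • ng α p χ b = sgn F (1 * par b) • ng α p χ b := fun b => by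
    rw [one_mul]
  have hrel : Rel α negIdx fun b => sgn F (par b) • ng α p χ b := by
    intro b hb c hc
    simp only [hs]
    rw [linearCombination_sgn _ _ (brBasis_mem_gPart α b c)]
    simp only [one_mul, sgn_add, smul_mul_smul_comm, rel_ng α p χ b hb c hc, smul_add]
    rw [smul_comm (sgn F (par b * par c)), mul_comm (sgn F (par c))]
  obtain ⟨g, hg⟩ := exists_lift (p := p) (χ := χ) isCoordinate_nMinus (h ▸ hrel) (by
    intro b hb hpar
    have hb' := bv_mem_nMinus.1 hb
    rw [hpar, show sgn F 0 = 1 by simp [sgn], one_smul, ng_pow α p χ hb' hpar,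
      pMap_of_mem_negIdx hb', map_zero, zero_add])
  exact ⟨g, fun b hb => hg b (bv_mem_nMinus.2 hb)⟩

variable {α p χ lam hl}

theorem IsInduced.parity {ρ : Idx → Module.End F (UN α p χ)} (h : IsInduced α p χ lam ρ)
    {θ : UN α p χ →ₐ[F] UN α p χ}
    (hθ : ∀ b ∈ negIdx, θ (ng α p χ b) = sgn F (par b) • ng α p χ b) (x : Idx) (u : UN α p χ) :
    θ (ρ x u) = sgn F (par x) • ρ x (θ u) := by
  let W : Submodule F (UN α p χ) :=
    { carrier := {u | ∀ x, θ (ρ x u) = sgn F (par x) • ρ x (θ u)}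
      zero_mem' := fun x => by simp
      add_mem' := fun ha hb x => by simp only [map_add, ha x, hb x, smul_add]
      smul_mem' := fun c u hu x => by simp only [map_smul, hu x]; rw [smul_comm] }
  refine UN_induction W (fun x => ?_) (fun b hb u hu x => ?_) u x
  · have h1 : θ 1 = 1 := map_one θ
    rw [h1]
    by_cases hx : x ∈ negIdx
    · rw [h.one_neg x hx, hθ x hx]
    · rw [h.one_borel x hx, AlgHom.commutes]
      rcases zmod2_cases (par x) with h1 | h1
      · simp [h1, sgn]
      · have : (bv x : G F) ∈ gPart F 1 := h1 ▸ bv_mem_gPart x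
        simp [lamExt_odd lam this]
  · have hu' : ∀ (i : ZMod 2) (g : G F), g ∈ gPart F i → θ (Finsupp.linearCombination F ρ g u) =
        sgn F i • Finsupp.linearCombination F ρ g (θ u) := by
      intro i g hg
      have h1 := linearCombination_sgn (fun c => ρ c (θ u)) 1 hg
      rw [one_mul] at h1
      rw [linearCombination_apply_apply, linearCombination_apply_apply, ← h1,
        ← AlgHom.toLinearMap_apply, Finsupp.apply_linearCombination]
      simp only [Function.comp_def, AlgHom.toLinearMap_apply, one_mul]
      simp only [hu _]
    rw [h.mul b hb, map_add, map_smul, map_mul, hθ b hb, hu x, hu' _ _ (brBasis_mem_gPart α x b),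
      map_mul, hθ b hb, smul_mul_assoc, smul_mul_assoc, mul_smul_comm, map_smul, h.mul b hb, sgn_add]
    module

theorem exists_parity [Fact p.Prime] [CharP F p] (hp : 3 < p) :
    ∃ σ : Module.End F (Verma α p χ lam hl), σ (vac α p χ lam hl) = vac α p χ lam hl ∧
      ∀ b z, σ (zact α p χ lam hl b z) = sgn F (par b) • zact α p χ lam hl b (σ z) := by
  obtain ⟨ρ, hρ⟩ := exists_isInduced α p χ lam hp
  obtain ⟨θ, hθ⟩ := exists_parityUN α p χ
  let E := vermaEquiv (α := α) hp hl
  refine ⟨E.toLinearMap ∘ₗ θ.toLinearMap ∘ₗ E.symm.toLinearMap, ?_, fun b z => ?_⟩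
  · have : E (1 : UN α p χ) = vac α p χ lam hl := by
      change vermaEquiv hp hl 1 = _
      rw [vermaEquiv_apply, map_one]; rfl
    rw [← this]
    simp
  · obtain ⟨u, rfl⟩ := E.surjective z
    have h1 : ∀ b u, E (ρ b u) = zact α p χ lam hl b (E u) := fun b u => hρ.nact_vac b u
    rw [← h1]
    simp only [LinearMap.comp_apply, LinearEquiv.coe_coe, LinearEquiv.symm_apply_apply,
      AlgHom.toLinearMap_apply, hρ.parity hθ, map_smul]
    rw [h1]

theorem tens_list (l : List Idx) : tens α p χ lam hl ((l.map fun b => inU α p χ (bv b)).prod) =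
    l.foldr (fun b z => zact α p χ lam hl b z) (vac α p χ lam hl) := by
  induction l with
  | nil => rfl
  | cons b l ih =>
    rw [List.map_cons, List.prod_cons, tens_eq, mul_smul, ← tens_eq, ih]
    rfl

theorem vac_mem_zPart : vac α p χ lam hl ∈ zPart α p χ lam hl 0 :=
  Submodule.subset_span ⟨[], rfl, rfl⟩

theorem zact_mem_zPart (b : Idx) {i : ZMod 2} {z : Verma α p χ lam hl}
    (hz : z ∈ zPart α p χ lam hl i) : zact α p χ lam hl b z ∈ zPart α p χ lam hl (par b + i) := by
  induction hz using Submodule.span_induction with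
  | mem z hz =>
    obtain ⟨l, rfl, rfl⟩ := hz
    refine Submodule.subset_span ⟨b :: l, rfl, ?_⟩
    rw [tens_list, tens_list]
    rfl
  | zero => simp
  | add v w _ _ hv hw => rw [map_add]; exact Submodule.add_mem _ hv hw
  | smul c v _ hv => rw [map_smul]; exact Submodule.smul_mem _ _ hv

/-- The parity operator acts by 1 and -1 on the two parts, so they meet in zero. Their sum contains
v and is stable under 𝔫⁻, so it is everything. -/
theorem isCompl_zPart [Fact p.Prime] [CharP F p] (hp : 3 < p) :
    IsCompl (zPart α p χ lam hl 0) (zPart α p χ lam hl 1) := by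
  obtain ⟨σ, hσv, hσ⟩ := exists_parity (α := α) (hl := hl) hp
  have h2 : (2 : F) ≠ 0 := by
    exact_mod_cast natCast_ne_zero_of_lt (F := F) (p := p) (n := 2) (by omega) (by omega)
  have hpart : ∀ i, ∀ z ∈ zPart α p χ lam hl i, σ z = sgn F i • z := by
    intro i z hz
    induction hz using Submodule.span_induction with
    | mem z hz =>
      obtain ⟨l, rfl, rfl⟩ := hz
      rw [tens_list]
      induction l with
      | nil => simp [hσv, sgn]
      | cons b l ih =>
        rw [List.foldr_cons, hσ, ih, map_smul, smul_smul, List.map_cons, List.sum_cons, sgn_add]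
    | zero => simp
    | add v w _ _ hv hw => rw [map_add, hv, hw, smul_add]
    | smul c v _ hv => rw [map_smul, hv, smul_comm]
  refine ⟨?_, ?_⟩
  · rw [Submodule.disjoint_def]
    intro z h0 h1
    have e0 := hpart 0 z h0
    have e1 := hpart 1 z h1
    simp only [sgn, if_true, one_smul, one_ne_zero, if_false, neg_smul] at e0 e1
    rw [e0] at e1
    have : (2 : F) • z = 0 := by rw [two_smul]; nth_rewrite 1 [e1]; exact neg_add_cancel z
    exact (smul_eq_zero.1 this).resolve_left h2
  · rw [codisjoint_iff, eq_top_iff]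
    rintro z -
    obtain ⟨u, rfl⟩ := (vermaEquiv (α := α) hp hl).surjective z
    refine UN_induction (Submodule.comap (vermaEquiv hp hl).toLinearMap
      (zPart α p χ lam hl 0 ⊔ zPart α p χ lam hl 1)) ?_ (fun b hb u hu => ?_) u
    · refine Submodule.mem_sup_left ?_
      change vermaEquiv hp hl 1 ∈ _
      rw [vermaEquiv_apply, map_one]
      exact vac_mem_zPart
    · change vermaEquiv hp hl (_ * _) ∈ zPart α p χ lam hl 0 ⊔ zPart α p χ lam hl 1
      change vermaEquiv hp hl u ∈ zPart α p χ lam hl 0 ⊔ zPart α p χ lam hl 1 at hu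
      rw [vermaEquiv_ng hp hb]
      obtain ⟨z0, h0, z1, h1, e⟩ := Submodule.mem_sup.1 hu
      rw [← e, map_add]
      have k0 := zact_mem_zPart b h0
      have k1 := zact_mem_zPart b h1
      rcases zmod2_cases (par b) with h | h <;> rw [h] at k0 k1
      · exact Submodule.add_mem_sup k0 k1
      · rw [add_comm]
        exact Submodule.add_mem_sup k1 k0

/-- The projection of the baby Verma module to the part of parity `i`. -/
theorem exists_zProj [Fact p.Prime] [CharP F p] (hp : 3 < p) :
    ∃ π : ZMod 2 → Module.End F (Verma α p χ lam hl),
      (∀ i z, π i z ∈ zPart α p χ lam hl i) ∧ (∀ i, ∀ z ∈ zPart α p χ lam hl i, π i z = z) ∧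
      (∀ i j, i ≠ j → ∀ z ∈ zPart α p χ lam hl j, π i z = 0) ∧ (∀ z, π 0 z + π 1 z = z) ∧
      ∀ i b z, π (i + par b) (zact α p χ lam hl b z) = zact α p χ lam hl b (π i z) := by
  have h := isCompl_zPart (α := α) (hl := hl) hp
  let π : ZMod 2 → Module.End F (Verma α p χ lam hl) := fun i => if i = 0 then
    (zPart α p χ lam hl 0).subtype ∘ₗ Submodule.projectionOnto _ _ h else
    (zPart α p χ lam hl 1).subtype ∘ₗ Submodule.projectionOnto _ _ h.symm
  have h0 : ∀ z, π 0 z = Submodule.projectionOnto _ _ h z := fun z => rfl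
  have h1 : ∀ z, π 1 z = Submodule.projectionOnto _ _ h.symm z := fun z => rfl
  have hmem : ∀ i z, π i z ∈ zPart α p χ lam hl i := by
    intro i z
    rcases zmod2_cases i with rfl | rfl
    · rw [h0]; exact Subtype.mem _
    · rw [h1]; exact Subtype.mem _
  have hid : ∀ i, ∀ z ∈ zPart α p χ lam hl i, π i z = z := by
    intro i z hz
    rcases zmod2_cases i with rfl | rfl
    · rw [h0, Submodule.projectionOnto_apply_left h ⟨z, hz⟩]
    · rw [h1, Submodule.projectionOnto_apply_left h.symm ⟨z, hz⟩]
  have hzero : ∀ i j, i ≠ j → ∀ z ∈ zPart α p χ lam hl j, π i z = 0 := by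
    intro i j hij z hz
    rcases zmod2_cases i with rfl | rfl <;> rcases zmod2_cases j with rfl | rfl
    · exact absurd rfl hij
    · rw [h0, (Submodule.projectionOnto_apply_eq_zero_iff h).2 hz]; rfl
    · rw [h1, (Submodule.projectionOnto_apply_eq_zero_iff h.symm).2 hz]; rfl
    · exact absurd rfl hij
  have hsum : ∀ z, π 0 z + π 1 z = z := by
    intro z
    have hz : z ∈ zPart α p χ lam hl 0 ⊔ zPart α p χ lam hl 1 := by rw [h.sup_eq_top]; trivial
    obtain ⟨z0, k0, z1, k1, rfl⟩ := Submodule.mem_sup.1 hz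
    rw [map_add, map_add, hid 0 z0 k0, hid 1 z1 k1, hzero 0 1 (by decide) z1 k1,
      hzero 1 0 (by decide) z0 k0, add_zero, zero_add]
  refine ⟨π, hmem, hid, hzero, hsum, fun i b z => ?_⟩
  have hj : ∀ j, ∀ z ∈ zPart α p χ lam hl j,
      π (i + par b) (zact α p χ lam hl b z) = zact α p χ lam hl b (π i z) := by
    intro j z hz
    by_cases hij : i = j
    · subst hij
      rw [hid i z hz, hid _ _ (by rw [add_comm]; exact zact_mem_zPart b hz)]
    · rw [hzero i j hij z hz, map_zero, hzero _ (par b + j) _ _ (zact_mem_zPart b hz)]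
      rw [add_comm]
      exact fun e => hij (add_left_cancel e)
  conv_lhs => rw [← hsum z]
  conv_rhs => rw [← hsum z]
  simp only [map_add]
  rw [hj 0 _ (hmem 0 z), hj 1 _ (hmem 1 z)]

/-! Superderivations and cocycles -/

/-- The homogeneity of a linear map can be tested on basis vectors. -/
theorem parity_iff {i : ZMod 2} {φ : G F →ₗ[F] Verma α p χ lam hl} :
    (∀ j, ∀ x ∈ gPart F j, φ x ∈ zPart α p χ lam hl (i + j)) ↔
      ∀ b, φ (bv b) ∈ zPart α p χ lam hl (i + par b) := by
  refine ⟨fun h b => h _ _ (bv_mem_gPart b), fun h j x hx => ?_⟩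
  induction hx using Submodule.span_induction with
  | mem v hv => obtain ⟨b, rfl, rfl⟩ := hv; exact h b
  | zero => simp
  | add v w _ _ hv hw => rw [map_add]; exact Submodule.add_mem _ hv hw
  | smul c v _ hv => rw [map_smul]; exact Submodule.smul_mem _ _ hv

theorem eq_linearCombination_bv {M : Type*} [AddCommGroup M] [Module F M] (φ : G F →ₗ[F] M)
    (g : G F) : φ g = Finsupp.linearCombination F (fun b => φ (bv b)) g := by
  conv_lhs => rw [eq_sum_bv g]
  rw [map_sum, Finsupp.linearCombination_apply, Finsupp.sum]
  simp only [map_smul]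

theorem act_bv (b : Idx) (z : Verma α p χ lam hl) :
    act α p χ lam hl (bv b) z = zact α p χ lam hl b z := rfl

theorem act_add_left (x y : G F) (z : Verma α p χ lam hl) :
    act α p χ lam hl (x + y) z = act α p χ lam hl x z + act α p χ lam hl y z := by
  rw [← zact_linear, ← zact_linear, ← zact_linear, map_add, LinearMap.add_apply]

theorem act_smul_left (c : F) (x : G F) (z : Verma α p χ lam hl) :
    act α p χ lam hl (c • x) z = c • act α p χ lam hl x z := by
  rw [← zact_linear, ← zact_linear, map_smul, LinearMap.smul_apply]

theorem act_zero_left (z : Verma α p χ lam hl) : act α p χ lam hl (0 : G F) z = 0 := by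
  rw [← zact_linear, map_zero, LinearMap.zero_apply]

theorem act_add_right (x : G F) (z w : Verma α p χ lam hl) :
    act α p χ lam hl x (z + w) = act α p χ lam hl x z + act α p χ lam hl x w := smul_add _ _ _

theorem act_smul_right (c : F) (x : G F) (z : Verma α p χ lam hl) :
    act α p χ lam hl x (c • z) = c • act α p χ lam hl x z := by
  rw [← zact_linear, ← zact_linear, map_smul]

theorem act_zero_right (x : G F) : act α p χ lam hl x (0 : Verma α p χ lam hl) = 0 := smul_zero _

/-- The sign (-1)^(i|b|) absorbs the parity of φ in the Leibniz rule, so even and odd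
superderivations are both governed by the one cocycle condition. -/
theorem isHomDer_iff {i : ZMod 2} {φ : G F →ₗ[F] Verma α p χ lam hl} :
    IsHomDer α p χ lam hl i φ ↔ (∀ b, φ (bv b) ∈ zPart α p χ lam hl (i + par b)) ∧
      Coc α Set.univ (zact α p χ lam hl) fun b => sgn F (i * par b) • φ (bv b) := by
  have key : ∀ b c, (φ (brBasis α b c) = sgn F (i * par b) • zact α p χ lam hl b (φ (bv c)) -
      sgn F (par c * (i + par b)) • zact α p χ lam hl c (φ (bv b))) ↔
      Finsupp.linearCombination F (fun b => sgn F (i * par b) • φ (bv b)) (brBasis α b c) =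
        zact α p χ lam hl b (sgn F (i * par c) • φ (bv c)) -
          sgn F (par b * par c) • zact α p χ lam hl c (sgn F (i * par b) • φ (bv b)) := by
    intro b c
    rw [linearCombination_sgn _ _ (brBasis_mem_gPart α b c), ← eq_linearCombination_bv]
    generalize φ (brBasis α b c) = w
    simp only [map_smul]
    generalize zact α p χ lam hl b (φ (bv c)) = u
    generalize zact α p χ lam hl c (φ (bv b)) = v
    rcases zmod2_cases i with rfl | rfl <;> rcases zmod2_cases (par b) with h1 | h1 <;>
      rcases zmod2_cases (par c) with h2 | h2 <;>
      simp only [h1, h2, sgn, mul_zero, mul_one, add_zero, zero_add,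
        show (1 + 1 : ZMod 2) = 0 from rfl, if_true, one_ne_zero, if_false, one_smul, neg_smul,
        smul_neg, neg_neg, sub_neg_eq_add] <;>
      constructor <;> intro h <;>
      first
        | exact h
        | rw [h]; abel
        | (have := congrArg Neg.neg h; rw [neg_neg] at this; rw [this]; abel)
  constructor
  · intro h
    refine ⟨parity_iff.1 h.parity, fun b _ c _ => ?_⟩
    rw [← key, ← bracket_bv, h.leibniz _ _ _ (bv_mem_gPart b) _ (bv_mem_gPart c)]
    rfl
  · rintro ⟨h1, h2⟩
    refine ⟨parity_iff.2 h1, fun j k x hx y hy => ?_⟩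
    induction hx using Submodule.span_induction with
    | mem v hv =>
      obtain ⟨b, rfl, rfl⟩ := hv
      induction hy using Submodule.span_induction with
      | mem w hw =>
        obtain ⟨c, rfl, rfl⟩ := hw
        rw [bracket_bv, act_bv, act_bv]
        exact (key b c).2 (h2 b trivial c trivial)
      | zero => simp [act_zero_left, act_zero_right]
      | add v w _ _ hv hw =>
        simp only [map_add, hv, hw, act_add_left, act_add_right, smul_add]; abel
      | smul c v _ hv =>
        simp only [map_smul, hv, act_smul_left, act_smul_right, smul_sub]
        rw [smul_comm c, smul_comm c]
    | zero => simp [act_zero_left, act_zero_right]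
    | add v w _ _ hv hw =>
      simp only [map_add, LinearMap.add_apply, hv, hw, act_add_left, act_add_right, smul_add]; abel
    | smul c v _ hv =>
      simp only [map_smul, LinearMap.smul_apply, hv, act_smul_left, act_smul_right, smul_sub]
      rw [smul_comm c, smul_comm c]

theorem isHomInner_iff {i : ZMod 2} {m : Verma α p χ lam hl} {φ : G F →ₗ[F] Verma α p χ lam hl} :
    IsHomInner α p χ lam hl i m φ ↔ m ∈ zPart α p χ lam hl i ∧
      ∀ b, φ (bv b) = sgn F (i * par b) • zact α p χ lam hl b m := by
  refine and_congr_right fun _ => ⟨fun h b => ?_, fun h j x hx => ?_⟩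
  · rw [h _ _ (bv_mem_gPart b), mul_comm]; rfl
  · induction hx using Submodule.span_induction with
    | mem v hv => obtain ⟨b, rfl, rfl⟩ := hv; rw [h, mul_comm]; rfl
    | zero => simp [act_zero_left]
    | add v w _ _ hv hw => rw [map_add, hv, hw, act_add_left, smul_add]
    | smul c v _ hv => rw [map_smul, hv, act_smul_left, smul_comm]

end Parity

/-! ### Homogeneous components of superderivations -/

section DerIder

variable {α : F} {p : ℕ} {χ : Module.Dual F (gPart F 0)} {lam : Module.Dual F (cartan F)}
  {hl : Admissible p χ lam}

theorem linearMap_eq_of_bv {M : Type*} [AddCommGroup M] [Module F M] {φ ψ : G F →ₗ[F] M}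
    (h : ∀ b, φ (bv b) = ψ (bv b)) : φ = ψ :=
  LinearMap.ext fun g => by
    rw [eq_linearCombination_bv φ, eq_linearCombination_bv ψ]; simp only [h]

theorem isHomDer_zero (i : ZMod 2) : IsHomDer α p χ lam hl i 0 :=
  ⟨fun _ _ _ => Submodule.zero_mem _, fun _ _ _ _ _ _ => by simp [act_zero_right]⟩

theorem IsHomDer.add {i : ZMod 2} {φ ψ : G F →ₗ[F] Verma α p χ lam hl}
    (h : IsHomDer α p χ lam hl i φ) (k : IsHomDer α p χ lam hl i ψ) :
    IsHomDer α p χ lam hl i (φ + ψ) :=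
  ⟨fun j x hx => Submodule.add_mem _ (h.parity j x hx) (k.parity j x hx), fun j l x hx y hy => by
    simp only [LinearMap.add_apply, h.leibniz j l x hx y hy, k.leibniz j l x hx y hy, act_add_right,
      smul_add]
    abel⟩

theorem IsHomDer.smul {i : ZMod 2} {φ : G F →ₗ[F] Verma α p χ lam hl} (c : F)
    (h : IsHomDer α p χ lam hl i φ) : IsHomDer α p χ lam hl i (c • φ) :=
  ⟨fun j x hx => Submodule.smul_mem _ _ (h.parity j x hx), fun j l x hx y hy => by
    simp only [LinearMap.smul_apply, h.leibniz j l x hx y hy, act_smul_right, smul_sub]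
    rw [smul_comm c, smul_comm c]⟩

theorem exists_of_mem_Der {φ : G F →ₗ[F] Verma α p χ lam hl} (h : φ ∈ Der α p χ lam hl) :
    ∃ φ₀ φ₁, IsHomDer α p χ lam hl 0 φ₀ ∧ IsHomDer α p χ lam hl 1 φ₁ ∧ φ = φ₀ + φ₁ := by
  induction h using Submodule.span_induction with
  | mem φ h =>
    obtain ⟨i, h⟩ := h
    rcases zmod2_cases i with rfl | rfl
    · exact ⟨φ, 0, h, isHomDer_zero 1, (add_zero φ).symm⟩
    · exact ⟨0, φ, isHomDer_zero 0, h, (zero_add φ).symm⟩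
  | zero => exact ⟨0, 0, isHomDer_zero 0, isHomDer_zero 1, (add_zero 0).symm⟩
  | add φ ψ _ _ h k =>
    obtain ⟨φ₀, φ₁, h0, h1, rfl⟩ := h
    obtain ⟨ψ₀, ψ₁, k0, k1, rfl⟩ := k
    exact ⟨_, _, h0.add k0, h1.add k1, by abel⟩
  | smul c φ _ h =>
    obtain ⟨φ₀, φ₁, h0, h1, rfl⟩ := h
    exact ⟨_, _, h0.smul c, h1.smul c, smul_add c φ₀ φ₁⟩

theorem exists_of_mem_Ider {φ : G F →ₗ[F] Verma α p χ lam hl} (h : φ ∈ Ider α p χ lam hl) :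
    ∃ m₀ ∈ zPart α p χ lam hl 0, ∃ m₁ ∈ zPart α p χ lam hl 1, ∀ b, φ (bv b) =
      zact α p χ lam hl b m₀ + sgn F (par b) • zact α p χ lam hl b m₁ := by
  induction h using Submodule.span_induction with
  | mem φ h =>
    obtain ⟨i, m, h⟩ := h
    rw [isHomInner_iff] at h
    rcases zmod2_cases i with rfl | rfl
    · exact ⟨m, h.1, 0, Submodule.zero_mem _, fun b => by rw [h.2]; simp [sgn]⟩
    · exact ⟨0, Submodule.zero_mem _, m, h.1, fun b => by rw [h.2]; simp⟩
  | zero => exact ⟨0, Submodule.zero_mem _, 0, Submodule.zero_mem _, by simp⟩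
  | add φ ψ _ _ h k =>
    obtain ⟨m₀, h0, m₁, h1, h⟩ := h
    obtain ⟨n₀, k0, n₁, k1, k⟩ := k
    refine ⟨_, Submodule.add_mem _ h0 k0, _, Submodule.add_mem _ h1 k1, fun b => ?_⟩
    simp only [LinearMap.add_apply, h, k, map_add, smul_add]
    abel
  | smul c φ _ h =>
    obtain ⟨m₀, h0, m₁, h1, h⟩ := h
    refine ⟨_, Submodule.smul_mem _ c h0, _, Submodule.smul_mem _ c h1, fun b => ?_⟩
    simp only [LinearMap.smul_apply, h, map_smul, smul_add]
    rw [smul_comm c]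

variable [Fact p.Prime] [CharP F p]

theorem eq_zero_of_mem_zPart (hp : 3 < p) {i j : ZMod 2} (hij : i ≠ j) {z : Verma α p χ lam hl}
    (hi : z ∈ zPart α p χ lam hl i) (hj : z ∈ zPart α p χ lam hl j) : z = 0 := by
  obtain ⟨π, -, hid, h0, -⟩ := exists_zProj (α := α) (hl := hl) hp
  rw [← hid i z hi, h0 i j hij z hj]

/-- An element of the span is an even plus an odd superderivation; if it is homogeneous, the
component of the other parity takes values in both parts of Z and is zero. -/
theorem isHomDer_of_mem_Der (hp : 3 < p) {i : ZMod 2} {φ : G F →ₗ[F] Verma α p χ lam hl}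
    (hφ : ∀ b, φ (bv b) ∈ zPart α p χ lam hl (i + par b)) (h : φ ∈ Der α p χ lam hl) :
    IsHomDer α p χ lam hl i φ := by
  obtain ⟨φ₀, φ₁, h0, h1, rfl⟩ := exists_of_mem_Der h
  have k0 := parity_iff.1 h0.parity
  have k1 := parity_iff.1 h1.parity
  rcases zmod2_cases i with rfl | rfl
  · have : φ₁ = 0 := linearMap_eq_of_bv fun b => by
      refine eq_zero_of_mem_zPart hp (i := 0 + par b) (j := 1 + par b) (by simp) ?_ (k1 b)
      have := Submodule.sub_mem _ (hφ b) (k0 b)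
      rwa [LinearMap.add_apply, add_sub_cancel_left] at this
    rw [this, add_zero]; exact h0
  · have : φ₀ = 0 := linearMap_eq_of_bv fun b => by
      refine eq_zero_of_mem_zPart hp (i := 1 + par b) (j := 0 + par b) (by simp) ?_ (k0 b)
      have := Submodule.sub_mem _ (hφ b) (k1 b)
      rwa [LinearMap.add_apply, add_sub_cancel_right] at this
    rw [this, zero_add]; exact h1

theorem exists_inner_of_mem_Ider (hp : 3 < p) {i : ZMod 2} {φ : G F →ₗ[F] Verma α p χ lam hl}
    (hφ : ∀ b, φ (bv b) ∈ zPart α p χ lam hl (i + par b)) (h : φ ∈ Ider α p χ lam hl) :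
    ∃ m, ∀ b, sgn F (i * par b) • φ (bv b) = zact α p χ lam hl b m := by
  obtain ⟨π, hmem, hid, h0, hsum, hπ⟩ := exists_zProj (α := α) (hl := hl) hp
  obtain ⟨m₀, h0', m₁, h1', h⟩ := exists_of_mem_Ider h
  rcases zmod2_cases i with rfl | rfl
  · refine ⟨m₀, fun b => ?_⟩
    have h2 := hid _ _ (hφ b)
    rw [h, map_add, map_smul, hπ, hπ, hid 0 _ h0', h0 0 1 (by decide) _ h1', map_zero, smul_zero,
      add_zero] at h2
    rw [h, ← h2]; simp [sgn]
  · refine ⟨m₁, fun b => ?_⟩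
    have h2 := hid _ _ (hφ b)
    rw [h, map_add, map_smul, hπ, hπ, hid 1 _ h1', h0 1 0 (by decide) _ h0', map_zero,
      zero_add] at h2
    rw [h, ← h2, one_mul, smul_smul, sgn_mul_self, one_smul]

/-- A homogeneous map that agrees with a homogeneous map `ψ` up to an inner cocycle. -/
theorem mem_Ider_of_plain (hp : 3 < p) {i k : ZMod 2} {φ ψ : G F →ₗ[F] Verma α p χ lam hl}
    (hφ : ∀ b, φ (bv b) ∈ zPart α p χ lam hl (i + par b))
    (hψ : ∀ b, ψ (bv b) ∈ zPart α p χ lam hl (k + par b)) {m : Verma α p χ lam hl}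
    (h : ∀ b, sgn F (i * par b) • φ (bv b) =
      zact α p χ lam hl b m + sgn F (k * par b) • ψ (bv b)) :
    φ ∈ Ider α p χ lam hl ∨ i = k ∧ φ - ψ ∈ Ider α p χ lam hl := by
  obtain ⟨π, hmem, hid, h0, hsum, hπ⟩ := exists_zProj (α := α) (hl := hl) hp
  have hs : ∀ (k : ZMod 2) (z w : Verma α p χ lam hl), sgn F k • z = w → z = sgn F k • w := by
    rintro k z w rfl
    rw [smul_smul, sgn_mul_self, one_smul]
  -- In both cases the inner element is the component of m of parity i. If the parities differ,
  -- projecting the identity to the parity of φ removes ψ.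
  by_cases hik : i = k
  · subst hik
    refine .inr ⟨rfl, Submodule.subset_span ⟨i, π i m, isHomInner_iff.2 ⟨hmem _ _, fun b => ?_⟩⟩⟩
    have h1 : sgn F (i * par b) • (φ - ψ) (bv b) = zact α p χ lam hl b m := by
      rw [LinearMap.sub_apply, smul_sub, h, add_sub_cancel_right]
    rw [hs _ _ _ h1, ← hπ, ← h1, map_smul, hid, smul_smul, sgn_mul_self, one_smul]
    exact Submodule.sub_mem _ (hφ b) (hψ b)
  · refine .inl (Submodule.subset_span ⟨i, π i m, isHomInner_iff.2 ⟨hmem _ _, fun b => ?_⟩⟩)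
    have h1 := congrArg (π (i + par b)) (h b)
    rw [map_add, map_smul, map_smul, hid _ _ (hφ b), hπ,
      h0 _ (k + par b) (fun e => hik (add_right_cancel e)) _ (hψ b), smul_zero, add_zero] at h1
    exact hs _ _ _ h1

theorem mem_Ider_of_inner (hp : 3 < p) {i : ZMod 2} {φ : G F →ₗ[F] Verma α p χ lam hl}
    (hφ : ∀ b, φ (bv b) ∈ zPart α p χ lam hl (i + par b)) {m : Verma α p χ lam hl}
    (h : ∀ b, sgn F (i * par b) • φ (bv b) = zact α p χ lam hl b m) :
    φ ∈ Ider α p χ lam hl := by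
  rcases mem_Ider_of_plain hp (ψ := 0) (k := i) hφ (fun b => Submodule.zero_mem _) (m := m)
    (fun b => by rw [h]; simp) with h | h
  · exact h
  · simpa using h.2

/-- If one of the central elements of the enveloping algebra acts by a nonzero scalar, then all
superderivations are inner. -/
theorem mem_Ider_of_chi_ne (hp : 3 < p) (h : (∃ i, chiF χ i ^ p ≠ 0) ∨ ∃ i, chiH χ i ^ p ≠ 0)
    {φ : G F →ₗ[F] Verma α p χ lam hl} (hφ : φ ∈ Der α p χ lam hl) : φ ∈ Ider α p χ lam hl := by
  have key : ∀ i (φ : G F →ₗ[F] Verma α p χ lam hl), IsHomDer α p χ lam hl i φ →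
      φ ∈ Ider α p χ lam hl := by
    intro i φ hφ
    obtain ⟨hpar, hc⟩ := isHomDer_iff.1 hφ
    have hr := rel_zact α p χ lam hl
    rcases h with ⟨j, hj⟩ | ⟨j, hj⟩
    · have hfj : fIdx j ∈ evenRoots := by fin_cases j <;> decide
      have hz : zact α p χ lam hl (fIdx j) ^ p = algebraMap F _ (chiF χ j ^ p) := by
        rw [zact_pow α p χ lam hl _ (par_fIdx j), pMap_of_mem_negIdx (fIdx_mem_negIdx j), map_zero,
          zero_add]
        rfl
      -- By `Coc.pow_apply` the vector f^(p-1) φ(f) generates χ(f)^p times the cocycle; it only has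
      -- to be divided by this scalar.
      refine mem_Ider_of_inner hp hpar (m := (chiF χ j ^ p)⁻¹ •
        ((zact α p χ lam hl (fIdx j) ^ (p - 1)) (sgn F (i * par (fIdx j)) • φ (bv (fIdx j)))))
        fun b => ?_
      have := hc.pow_apply hr hp hfj b
      rw [map_smul, this, hz, Module.algebraMap_end_apply, smul_smul, inv_mul_cancel₀ hj, one_smul]
    · have hz : zact α p χ lam hl (hIdx j) ^ p - zact α p χ lam hl (hIdx j) =
          algebraMap F _ (chiH χ j ^ p) := by
        rw [zact_pow α p χ lam hl _ (par_hIdx j)]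
        have : (pMap (hIdx j) : G F) = bv (hIdx j) := by fin_cases j <;> rfl
        rw [this, lc_bv, add_sub_cancel_left]
        rfl
      refine mem_Ider_of_inner hp hpar (m := (chiH χ j ^ p)⁻¹ •
        ((zact α p χ lam hl (hIdx j) ^ (p - 1)) (sgn F (i * par (hIdx j)) • φ (bv (hIdx j))) -
          sgn F (i * par (hIdx j)) • φ (bv (hIdx j)))) fun b => ?_
      have := hc.h_pow_apply hr (p := p) j b
      rw [map_smul, this, hz, Module.algebraMap_end_apply, smul_smul, inv_mul_cancel₀ hj, one_smul]
  obtain ⟨φ₀, φ₁, h0, h1, rfl⟩ := exists_of_mem_Der hφ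
  exact Submodule.add_mem _ (key 0 φ₀ h0) (key 1 φ₁ h1)

end DerIder

/-! ### The defect of the commutation relations -/

section Defect

variable {A : Type*} [Ring A] [Algebra F A] (α : F) (a : Idx → A)

/-- The failure of the commutation relations. -/
def defect (b c : Idx) : A :=
  a b * a c - sgn F (par b * par c) • (a c * a b) - Finsupp.linearCombination F a (brBasis α b c)

variable {α a}

/-- The defect is additive in the second argument. -/
theorem linear_right_of_defect {y : Idx} (hy : ∀ c, defect α a y c = 0) {i : ZMod 2} {g : G F}
    (hg : g ∈ gPart F i) : a y * Finsupp.linearCombination F a g =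
      sgn F (par y * i) • (Finsupp.linearCombination F a g * a y) +
        Finsupp.linearCombination F a (bracket α (bv y) g) := by
  induction hg using Submodule.span_induction with
  | mem v hv =>
    obtain ⟨c, rfl, rfl⟩ := hv
    have := hy c
    rw [defect, sub_sub, sub_eq_zero] at this
    rw [bracket_bv, lc_bv, this]
  | zero => simp
  | add v w _ _ hv hw => simp only [map_add, mul_add, add_mul, hv, hw, smul_add]; abel
  | smul c v _ hv =>
    simp only [map_smul, mul_smul_comm, smul_mul_assoc, hv, smul_add]
    rw [smul_comm c]

theorem linearCombination_defect_right (b : Idx) {i : ZMod 2} {g : G F} (hg : g ∈ gPart F i) :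
    Finsupp.linearCombination F (fun c => defect α a b c) g =
      a b * Finsupp.linearCombination F a g -
        sgn F (par b * i) • (Finsupp.linearCombination F a g * a b) -
          Finsupp.linearCombination F a (bracket α (bv b) g) := by
  induction hg using Submodule.span_induction with
  | mem v hv => obtain ⟨c, rfl, rfl⟩ := hv; rw [lc_bv, lc_bv, bracket_bv]; rfl
  | zero => simp
  | add v w _ _ hv hw => simp only [map_add, mul_add, add_mul, hv, hw, smul_add]; abel
  | smul c v _ hv =>
    simp only [map_smul, mul_smul_comm, smul_mul_assoc, hv, smul_sub]
    rw [smul_comm c]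

theorem linearCombination_defect_left (c : Idx) {i : ZMod 2} {g : G F} (hg : g ∈ gPart F i) :
    Finsupp.linearCombination F (fun b => defect α a b c) g =
      Finsupp.linearCombination F a g * a c -
        sgn F (i * par c) • (a c * Finsupp.linearCombination F a g) -
          Finsupp.linearCombination F a (bracket α g (bv c)) := by
  induction hg using Submodule.span_induction with
  | mem v hv => obtain ⟨b, rfl, rfl⟩ := hv; rw [lc_bv, lc_bv, bracket_bv]; rfl
  | zero => simp
  | add v w _ _ hv hw =>
    simp only [map_add, LinearMap.add_apply, mul_add, add_mul, hv, hw, smul_add]; abel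
  | smul c v _ hv =>
    simp only [map_smul, LinearMap.smul_apply, mul_smul_comm, smul_mul_assoc, hv, smul_sub]
    rw [smul_comm c]

/-- The cocycle identity for the defect. -/
theorem mul_defect {y : Idx} (hy : ∀ c, defect α a y c = 0) (b c : Idx) :
    a y * defect α a b c - sgn F (par y * (par b + par c)) • (defect α a b c * a y) =
      Finsupp.linearCombination F (fun d => defect α a d c) (brBasis α y b) +
        sgn F (par y * par b) • Finsupp.linearCombination F (fun d => defect α a b d)
          (brBasis α y c) := by
  have h1 : ∀ c, a y * a c = sgn F (par y * par c) • (a c * a y) +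
      Finsupp.linearCombination F a (brBasis α y c) := fun c => by
    have := hy c
    rwa [defect, sub_sub, sub_eq_zero] at this
  have h2 := linear_right_of_defect hy (brBasis_mem_gPart α b c)
  have hyb := h1 b
  have hyc := h1 c
  rw [linearCombination_defect_left c (brBasis_mem_gPart α y b),
    linearCombination_defect_right b (brBasis_mem_gPart α y c), defect]
  have hj : Finsupp.linearCombination F a (bracket α (bv y) (brBasis α b c)) =
      Finsupp.linearCombination F a (bracket α (brBasis α y b) (bv c)) +
        sgn F (par y * par b) • Finsupp.linearCombination F a (bracket α (bv b) (brBasis α y c)) := by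
    rw [jacobi, map_add, map_smul]
  rw [hj] at h2
  simp only [mul_sub, sub_mul, mul_smul_comm, smul_mul_assoc, h2]
  have e1 : a y * (a b * a c) = sgn F (par y * par b) • (a b * (a y * a c)) +
      Finsupp.linearCombination F a (brBasis α y b) * a c := by
    rw [← mul_assoc, hyb, add_mul, smul_mul_assoc, mul_assoc]
  have e2 : a y * (a c * a b) = sgn F (par y * par c) • (a c * (a y * a b)) +
      Finsupp.linearCombination F a (brBasis α y c) * a b := by
    rw [← mul_assoc, hyc, add_mul, smul_mul_assoc, mul_assoc]
  rw [e1, e2, hyb, hyc]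
  simp only [mul_add, mul_smul_comm, mul_assoc]
  rcases zmod2_cases (par y) with k1 | k1 <;> rcases zmod2_cases (par b) with k2 | k2 <;>
    rcases zmod2_cases (par c) with k3 | k3 <;>
    simp only [k1, k2, k3, sgn, mul_zero, mul_one, add_zero, zero_add,
      show (1 + 1 : ZMod 2) = 0 from rfl, if_true, one_ne_zero, if_false] <;> module

/-- If x and y have no defect against anything, all terms of the cocycle identity for the defect
vanish except the one for [x,y]. Relations thus spread from generators to everything they generate.
-/
theorem defect_eq_zero_of_bracket {x y d : Idx} {k : F} (hk : k ≠ 0) (hd : brBasis α x y = k • bv d)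
    (hx : ∀ c, defect α a x c = 0) (hy : ∀ c, defect α a y c = 0) (c : Idx) :
    defect α a d c = 0 := by
  have h := mul_defect hx y c
  have h0 : Finsupp.linearCombination F (fun d => defect α a y d) (brBasis α x c) = 0 := by
    simp only [hy]
    simp [Finsupp.linearCombination_apply]
  rw [hy c, h0, hd, map_smul, lc_bv, mul_zero, zero_mul, smul_zero, smul_zero, sub_zero,
    add_zero] at h
  exact (smul_eq_zero.1 h.symm).resolve_left hk

end Defect

/-! ### The defect of the cocycle identity -/

section ZDefect

variable {Z : Type*} [AddCommGroup Z] [Module F Z] (α : F) (a : Idx → Module.End F Z)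
  (φ : Idx → Z)

/-- The failure of the cocycle identity. -/
def zdefect (b c : Idx) : Z :=
  a b (φ c) - sgn F (par b * par c) • a c (φ b) - Finsupp.linearCombination F φ (brBasis α b c)

variable {α a φ}

theorem coc_iff_zdefect {J : Set Idx} :
    Coc α J a φ ↔ ∀ b ∈ J, ∀ c ∈ J, zdefect α a φ b c = 0 := by
  refine forall_congr' fun b => forall_congr' fun _ => forall_congr' fun c => forall_congr' fun _ => ?_
  rw [zdefect, sub_eq_zero, eq_comm]

/-- The cocycle defect of φ is the commutation defect of the extension at (0,1); it inherits in this
way the propagation rules of the latter. -/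
theorem defect_extAct (h : Rel α Set.univ a) (b c : Idx) (z : Z × F) :
    defect α (extAct a φ) b c z = (z.2 • zdefect α a φ b c, 0) := by
  have h1 := LinearMap.congr_fun (h b trivial c trivial) z.1
  simp only [Module.End.mul_apply, LinearMap.add_apply, LinearMap.smul_apply] at h1
  simp only [defect, zdefect, LinearMap.sub_apply, LinearMap.smul_apply, Module.End.mul_apply,
    extAct_apply, linearCombination_extAct, map_add, map_smul, zero_smul, add_zero, h1, Prod.smul_mk,
    smul_zero, Prod.mk_sub_mk, sub_zero]
  congr 1
  module

theorem defect_extAct_eq_zero_iff (h : Rel α Set.univ a) {b c : Idx} :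
    defect α (extAct a φ) b c = 0 ↔ zdefect α a φ b c = 0 := by
  constructor
  · intro h0
    have := LinearMap.congr_fun h0 (0, 1)
    rw [defect_extAct h] at this
    simpa using congrArg Prod.fst this
  · intro h0
    refine LinearMap.ext fun z => ?_
    rw [defect_extAct h, h0, smul_zero]
    rfl

theorem zdefect_symm (b c : Idx) : zdefect α a φ c b = -(sgn F (par b * par c) • zdefect α a φ b c) := by
  rw [zdefect, zdefect, brBasis_skew α c b, map_neg, map_smul, smul_sub, smul_sub, smul_smul,
    sgn_mul_self, one_smul, mul_comm (par c)]
  abel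

theorem zdefect_eq_zero_of_bracket (h : Rel α Set.univ a) {x y d : Idx} {k : F} (hk : k ≠ 0)
    (hd : brBasis α x y = k • bv d) (hx : ∀ c, zdefect α a φ x c = 0)
    (hy : ∀ c, zdefect α a φ y c = 0) (c : Idx) : zdefect α a φ d c = 0 := by
  rw [← defect_extAct_eq_zero_iff h]
  exact defect_eq_zero_of_bracket hk hd (fun c => (defect_extAct_eq_zero_iff h).2 (hx c))
    (fun c => (defect_extAct_eq_zero_iff h).2 (hy c)) c

theorem act_zdefect (h : Rel α Set.univ a) {y : Idx} (hy : ∀ c, zdefect α a φ y c = 0)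
    (b c : Idx) : a y (zdefect α a φ b c) =
      Finsupp.linearCombination F (fun d => zdefect α a φ d c) (brBasis α y b) +
        sgn F (par y * par b) • Finsupp.linearCombination F (fun d => zdefect α a φ b d)
          (brBasis α y c) := by
  have h1 := mul_defect (a := extAct a φ) (fun c => (defect_extAct_eq_zero_iff h).2 (hy c)) b c
  have h2 := congrArg Prod.fst (LinearMap.congr_fun h1 (0, 1))
  have e : ∀ (f : Idx → Module.End F (Z × F)) (f' : Idx → Z) (g : G F),
      (∀ d, f d (0, 1) = (f' d, 0)) → (Finsupp.linearCombination F f g (0, 1)).1 =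
        Finsupp.linearCombination F f' g := by
    intro f f' g hf
    rw [linearCombination_apply_apply]
    simp only [hf]
    rw [← LinearMap.fst_apply (R := F), Finsupp.apply_linearCombination]
    rfl
  have hd : ∀ b c, defect α (extAct a φ) b c (0, 1) = (zdefect α a φ b c, 0) := fun b c => by
    rw [defect_extAct h, one_smul]
  simp only [LinearMap.sub_apply, LinearMap.add_apply, LinearMap.smul_apply, Module.End.mul_apply,
    Prod.fst_sub, Prod.fst_add, Prod.smul_fst, hd, extAct_apply, defect_extAct h, zero_smul,
    smul_zero, sub_zero, add_zero] at h2
  rw [h2, e _ _ _ fun d => hd d c, e _ _ _ fun d => hd b d]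

end ZDefect

/-! ### Weight vectors -/

section Weights

variable {Z : Type*} [AddCommGroup Z] [Module F Z] {α : F} {a : Idx → Module.End F Z}

/-- `z` has weight `c`. -/
def IsWt (a : Idx → Module.End F Z) (c : Fin 3 → F) (z : Z) : Prop := ∀ i, a (hIdx i) z = c i • z

theorem IsWt.add {c : Fin 3 → F} {z w : Z} (hz : IsWt a c z) (hw : IsWt a c w) :
    IsWt a c (z + w) := fun i => by rw [map_add, hz, hw, smul_add]

theorem IsWt.smul {c : Fin 3 → F} {z : Z} (r : F) (hz : IsWt a c z) : IsWt a c (r • z) := fun i => by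
  rw [map_smul, hz, smul_comm]

theorem IsWt.neg {c : Fin 3 → F} {z : Z} (hz : IsWt a c z) : IsWt a c (-z) := fun i => by
  rw [map_neg, hz, smul_neg]

theorem IsWt.sub {c : Fin 3 → F} {z w : Z} (hz : IsWt a c z) (hw : IsWt a c w) :
    IsWt a c (z - w) := fun i => by rw [map_sub, hz, hw, smul_sub]

theorem isWt_zero (c : Fin 3 → F) : IsWt a c 0 := fun i => by rw [map_zero, smul_zero]

/-- The weight of a basis vector, in the field. -/
def wtF (F : Type*) [Field F] (b : Idx) (i : Fin 3) : F := wt b i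

theorem IsWt.act (h : Rel α Set.univ a) {c : Fin 3 → F} {z : Z} (hz : IsWt a c z) (b : Idx) :
    IsWt a (c + wtF F b) (a b z) := fun i => by
  have h1 := LinearMap.congr_fun (h.h_mul i b) z
  rw [Module.End.mul_apply, Module.End.mul_apply, LinearMap.add_apply, hz i,
    Module.algebraMap_end_apply, ← add_smul, map_smul] at h1
  exact h1

theorem IsWt.pow (h : Rel α Set.univ a) {c : Fin 3 → F} {z : Z} (hz : IsWt a c z) (b : Idx)
    (n : ℕ) : IsWt a (c + (n : F) • wtF F b) ((a b ^ n) z) := by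
  induction n with
  | zero => simpa using hz
  | succ n ih =>
    rw [pow_succ', Module.End.mul_apply]
    convert ih.act h b using 1
    push_cast
    module

theorem IsWt.unique {c d : Fin 3 → F} {z : Z} (hc : IsWt a c z) (hd : IsWt a d z) {i : Fin 3}
    (h : c i ≠ d i) : z = 0 := by
  have h1 := (hc i).symm.trans (hd i)
  rw [← sub_eq_zero, ← sub_smul] at h1
  exact (smul_eq_zero.1 h1).resolve_left (sub_ne_zero.2 h)

theorem IsWt.linearCombination {c : Fin 3 → F} {f : Idx → Z} {g : G F}
    (h : ∀ b, g b ≠ 0 → IsWt a c (f b)) : IsWt a c (Finsupp.linearCombination F f g) := by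
  intro i
  rw [Finsupp.linearCombination_apply, Finsupp.sum, map_sum, Finset.smul_sum]
  refine Finset.sum_congr rfl fun b hb => ?_
  rw [map_smul, h b (Finsupp.mem_support_iff.1 hb) i, smul_comm]

theorem isWt_monomial (h : Rel α Set.univ a) {c : Fin 3 → F} {v : Z} (hv : IsWt a c v)
    (m n q i j k l : ℕ) : IsWt a (fun t => c t +
      (i : F) * wtF F y1 t + (j : F) * wtF F y2 t + (k : F) * wtF F y3 t + (l : F) * wtF F y4 t +
      (m : F) * wtF F f1 t + (n : F) * wtF F f2 t + (q : F) * wtF F f3 t)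
      (fpow a m n q (yvec a v i j k l)) := by
  have := ((((((hv.pow h y4 l).pow h y3 k).pow h y2 j).pow h y1 i).pow h f3 q).pow h f2 n).pow h f1 m
  convert this using 1
  · funext t
    simp only [Pi.add_apply, Pi.smul_apply, smul_eq_mul]
    ring
  · rfl

theorem structZ_wt : (Idx.all.all fun b => Idx.all.all fun c => (structZ b c).all fun t =>
    decide (∀ i, wt t.1 i = wt b i + wt c i)) = true := by
  decide +kernel

theorem wt_of_brBasis_ne_zero {b c d : Idx} (h : brBasis α b c d ≠ 0) (i : Fin 3) :
    wt d i = wt b i + wt c i := by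
  obtain ⟨t, ht, rfl⟩ := exists_of_brBasis_ne_zero h
  have h := structZ_wt
  simp only [List.all_eq_true, decide_eq_true_eq] at h
  exact h b (Idx.mem_all b) c (Idx.mem_all c) t ht i

theorem isWt_zdefect (h : Rel α Set.univ a) {φ : Idx → Z} (hφ : ∀ b, IsWt a (wtF F b) (φ b))
    (b c : Idx) : IsWt a (wtF F b + wtF F c) (zdefect α a φ b c) := by
  refine ((?_ : IsWt a _ _).sub (IsWt.smul _ ?_)).sub (IsWt.linearCombination fun d hd => ?_)
  · rw [add_comm]; exact (hφ c).act h b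
  · exact (hφ b).act h c
  · convert hφ d using 1
    funext i
    simp only [Pi.add_apply, wtF]
    exact_mod_cast congrArg (Int.cast (R := F)) (wt_of_brBasis_ne_zero hd i).symm

end Weights

/-! ### Reduction to simple root vectors -/

section Core

variable {Z : Type*} [AddCommGroup Z] [Module F Z] {p : ℕ} {α : F} {lam : Fin 3 → F}
  {a : Idx → Module.End F Z} {v : Z}

/-- The simple root vectors. -/
def simpleIdx : List Idx := [e2, e3, x4]

/-- The weight of the lowest monomial. -/
def botWt (lam : Fin 3 → F) : Fin 3 → F := ![lam 0 - 2, lam 1 + 2, lam 2 + 2]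

theorem Core.isWt_bot [CharP F p] (hp : 3 < p) (hc : Core p α lam a v) :
    IsWt a (botWt lam) (bot p a v) := by
  have h := isWt_monomial hc.rel hc.h_vac (p - 1) (p - 1) (p - 1) 1 1 1 1
  have h1 : ((p - 1 : ℕ) : F) = -1 := by
    rw [Nat.cast_sub (by omega), CharP.cast_eq_zero]; simp
  convert h using 1
  · funext i
    rw [h1]
    fin_cases i <;> simp [botWt, wtF, wt] <;> ring
  · rfl

theorem structZ_simple : (Idx.all.all fun y => Idx.all.all fun b => (structZ y b).all fun t =>
    decide (y ∈ negIdx → b ∈ simpleIdx → t.1 ∈ negIdx ∨ ∃ i, t.1 = hIdx i)) = true := by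
  decide +kernel

/-- Lowering a simple root vector never gives a positive root vector. Only this form of simplicity
is used. -/
theorem brBasis_simple {y b d : Idx} (hy : y ∈ negIdx) (hb : b ∈ simpleIdx)
    (hd : brBasis α y b d ≠ 0) : d ∈ negIdx ∨ ∃ i, d = hIdx i := by
  obtain ⟨t, ht, rfl⟩ := exists_of_brBasis_ne_zero hd
  have h := structZ_simple
  simp only [List.all_eq_true, decide_eq_true_eq] at h
  exact h y (Idx.mem_all y) b (Idx.mem_all b) t ht hy hb

theorem linearCombination_eq_zero {M : Type*} [AddCommGroup M] [Module F M] {f : Idx → M} {g : G F}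
    (h : ∀ d, g d ≠ 0 → f d = 0) : Finsupp.linearCombination F f g = 0 := by
  rw [Finsupp.linearCombination_apply]
  exact Finset.sum_eq_zero fun d hd => by simp only [h d (Finsupp.mem_support_iff.1 hd), smul_zero]

/-- A cocycle that vanishes on `𝔥 ⊕ 𝔫⁻` takes simple root vectors to multiples of the lowest
monomial. -/
theorem Core.simple_mem_socle (hc : Core p α lam a v) {φ : Idx → Z} (hφ : Coc α Set.univ a φ)
    (hn : ∀ b ∈ negIdx, φ b = 0) (hh : ∀ i, φ (hIdx i) = 0) {b : Idx} (hb : b ∈ simpleIdx) :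
    (∃ k : F, φ b = k • bot p a v) ∧ IsWt a (wtF F b) (φ b) := by
  constructor
  · refine hc.socle _ fun y hy => ?_
    have h := hφ y trivial b trivial
    rw [hn y hy, map_zero, smul_zero, sub_zero] at h
    rw [← h]
    refine linearCombination_eq_zero fun d hd => ?_
    rcases brBasis_simple hy hb hd with h | ⟨i, rfl⟩
    · exact hn d h
    · exact hh i
  · intro i
    have h := hφ (hIdx i) trivial b trivial
    rw [hh i, map_zero, smul_zero, sub_zero, brBasis_h, map_smul, lc_bv] at h
    exact h.symm

/-- The value is a multiple of the lowest monomial and has the weight of the root; both can hold for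
a nonzero vector only if the two weights agree. -/
theorem Core.simple_eq_zero [CharP F p] (hp : 3 < p) (hc : Core p α lam a v) {φ : Idx → Z}
    (hφ : Coc α Set.univ a φ) (hn : ∀ b ∈ negIdx, φ b = 0) (hh : ∀ i, φ (hIdx i) = 0) {b : Idx}
    (hb : b ∈ simpleIdx) (hne : botWt lam ≠ wtF F b) : φ b = 0 := by
  obtain ⟨⟨k, hk⟩, hw⟩ := hc.simple_mem_socle hφ hn hh hb
  obtain ⟨i, hi⟩ := Function.ne_iff.1 hne
  have hb := (hc.isWt_bot hp).smul k
  rw [← hk] at hb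
  exact hb.unique hw hi

/-- A cocycle that vanishes on generators vanishes. -/
theorem Coc.eq_zero_of_generators (h2 : (2 : F) ≠ 0) (hα : 1 + α ≠ 0) {φ : Idx → Z}
    (hφ : Coc α Set.univ a φ) (hn : ∀ b ∈ negIdx, φ b = 0) (hh : ∀ i, φ (hIdx i) = 0)
    (hs : ∀ b ∈ simpleIdx, φ b = 0) (b : Idx) : φ b = 0 := by
  have key : ∀ {b c d : Idx} {k : F}, k ≠ 0 → brBasis α b c = k • bv d → φ b = 0 → φ c = 0 →
      φ d = 0 := by
    intro b c d k hk hd hb hc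
    have h := hφ b trivial c trivial
    rw [hb, hc, hd, map_smul, lc_bv, map_zero, map_zero, smul_zero, sub_zero] at h
    exact (smul_eq_zero.1 h).resolve_left hk
  have k2 := hs e2 (by decide)
  have k3 := hs e3 (by decide)
  have k4 := hs x4 (by decide)
  -- The remaining positive root vectors are [e₂,x₄] = x₂, [e₃,x₄] = x₃, [e₃,x₂] = x₁ and [x₂,x₃] =
  -- -2(1+α)e₁; the last needs 2(1+α) ≠ 0.
  have l2 : φ x2 = 0 := key (k := 1) one_ne_zero (by simp [brBasis, table]) k2 k4
  have l3 : φ x3 = 0 := key (k := 1) one_ne_zero (by simp [brBasis, table]) k3 k4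
  have l1 : φ x1 = 0 := key (k := 1) one_ne_zero (by simp [brBasis, table]) k3 l2
  have l0 : φ e1 = 0 := key (b := x2) (c := x3) (k := -2 * (1 + α))
    (mul_ne_zero (neg_ne_zero.2 h2) hα) (by simp [brBasis, table]) l2 l3
  by_cases hb : b ∈ negIdx
  · exact hn b hb
  cases b <;> first
    | exact absurd (by decide) hb
    | exact hh 0
    | exact hh 1
    | exact hh 2
    | assumption

/-- A height function on the roots. -/
def ht (b : Idx) : ℤ := (4 * wt b 0 + wt b 1 + wt b 2) / 2

theorem structZ_ht : (Idx.all.all fun y => Idx.all.all fun c => (structZ y c).all fun t =>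
    decide (y ∈ negIdx → t.1 ∈ posIdx → ht t.1 < ht c)) = true := by
  decide +kernel

/-- The factors 4, 1, 1 and the halving give the roots of e₂, e₃, x₄ height one, so a positive root
has as height the number of its simple summands. Lowering makes it smaller, which drives the
induction in `Core.coc_of_generators`. -/
theorem ht_lt {y c d : Idx} (hy : y ∈ negIdx) (hd : brBasis α y c d ≠ 0) (hp : d ∈ posIdx) :
    ht d < ht c := by
  obtain ⟨t, ht, rfl⟩ := exists_of_brBasis_ne_zero hd
  have h := structZ_ht
  simp only [List.all_eq_true, decide_eq_true_eq] at h
  exact h y (Idx.mem_all y) c (Idx.mem_all c) t ht hy hp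

theorem Idx.trichotomy (b : Idx) : b ∈ negIdx ∨ (∃ i, b = hIdx i) ∨ b ∈ posIdx := by
  revert b; decide

/-- The cocycle identity follows from the cases where one argument is one of certain generators
of `𝔥 ⊕ 𝔫⁻`. -/
theorem Core.coc_of_generators [CharP F p] (hp : 3 < p) (hα : 1 + α ≠ 0) (hc : Core p α lam a v)
    {φ : Idx → Z} (hw : ∀ b, IsWt a (wtF F b) (φ b)) (hh : ∀ i b, a b (φ (hIdx i)) = 0)
    (h1 : ∀ b, zdefect α a φ y1 b = 0) (h2 : ∀ b, zdefect α a φ f2 b = 0)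
    (h3 : ∀ b, zdefect α a φ f3 b = 0)
    (hμ : ∀ b ∈ simpleIdx, ∀ c ∈ posIdx, botWt lam ≠ wtF F b + wtF F c) : Coc α Set.univ a φ := by
  have h2' : (2 : F) ≠ 0 := by
    exact_mod_cast natCast_ne_zero_of_lt (F := F) (p := p) (n := 2) (by omega) (by omega)
  have hr := hc.rel
  have kh : ∀ i b, zdefect α a φ (hIdx i) b = 0 := by
    intro i b
    rw [zdefect, hw b i, hh i b, smul_zero, sub_zero, brBasis_h, map_smul, lc_bv, wtF, sub_self]
  -- The vectors y₁, f₂, f₃ generate 𝔫⁻: y₃ = [f₂,y₁], y₂ = [f₃,y₁], y₄ = [f₃,y₃] and f₁ is a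
  -- multiple of [y₁,y₄].
  have y3' := zdefect_eq_zero_of_bracket hr (x := f2) (y := y1) (d := y3) (k := 1) one_ne_zero
    (by simp [brBasis, table]) h2 h1
  have y2' := zdefect_eq_zero_of_bracket hr (x := f3) (y := y1) (d := y2) (k := 1) one_ne_zero
    (by simp [brBasis, table]) h3 h1
  have y4' := zdefect_eq_zero_of_bracket hr (x := f3) (y := y3) (d := y4) (k := 1) one_ne_zero
    (by simp [brBasis, table]) h3 y3'
  have f1' := zdefect_eq_zero_of_bracket hr (x := y1) (y := y4) (d := f1) (k := -2 * (1 + α))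
    (mul_ne_zero (neg_ne_zero.2 h2') hα) (by simp [brBasis, table]) h1 y4'
  have kn : ∀ y ∈ negIdx, ∀ b, zdefect α a φ y b = 0 := by
    intro y hy
    simp only [negIdx, Set.mem_insert_iff, Set.mem_singleton_iff] at hy
    rcases hy with rfl | rfl | rfl | rfl | rfl | rfl | rfl <;> assumption
  have sym : ∀ {b c}, zdefect α a φ b c = 0 → zdefect α a φ c b = 0 := fun h => by
    rw [zdefect_symm, h, smul_zero, neg_zero]
  -- For b simple and c positive the defect is 𝔫⁻-invariant: lowering b lands in 𝔥 ⊕ 𝔫⁻, where the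
  -- identity is known, and lowering c lands there or at smaller height. So it is a multiple of the
  -- lowest monomial, and `hμ` says that its weight does not match.
  have ks : ∀ b ∈ simpleIdx, ∀ n : ℕ, ∀ c, c ∈ posIdx → ht c ≤ n → zdefect α a φ b c = 0 := by
    intro b hb n
    have step : ∀ c ∈ posIdx, (∀ d ∈ posIdx, ht d < ht c → zdefect α a φ b d = 0) →
        zdefect α a φ b c = 0 := by
      intro c hcp ih
      obtain ⟨k, hk⟩ := hc.socle (zdefect α a φ b c) fun y hy => by
        rw [act_zdefect hr (kn y hy), linearCombination_eq_zero fun d hd => ?_,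
          linearCombination_eq_zero fun d hd => ?_, smul_zero, add_zero]
        · rcases Idx.trichotomy d with h | ⟨i, rfl⟩ | h
          · exact sym (kn d h b)
          · exact sym (kh i b)
          · exact ih d h (ht_lt hy hd h)
        · rcases brBasis_simple hy hb hd with h | ⟨i, rfl⟩
          · exact kn d h c
          · exact kh i c
      obtain ⟨i, hi⟩ := Function.ne_iff.1 (hμ b hb c hcp)
      have hb' := (hc.isWt_bot hp).smul k
      rw [← hk] at hb'
      exact hb'.unique (isWt_zdefect hr hw b c) hi
    induction n with
    | zero =>
      intro c hcp h0
      exfalso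
      revert c; decide
    | succ n ih =>
      intro c hcp hcn
      exact step c hcp fun d hd hlt => ih d hd (by push_cast at hcn; omega)
  have ks' : ∀ b ∈ simpleIdx, ∀ c, zdefect α a φ b c = 0 := by
    intro b hb c
    rcases Idx.trichotomy c with h | ⟨i, rfl⟩ | h
    · exact sym (kn c h b)
    · exact sym (kh i b)
    · exact ks b hb (ht c).toNat c h (by omega)
  have k2 := ks' e2 (by decide)
  have k3 := ks' e3 (by decide)
  have k4 := ks' x4 (by decide)
  have l2 := zdefect_eq_zero_of_bracket hr (x := e2) (y := x4) (d := x2) (k := 1) one_ne_zero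
    (by simp [brBasis, table]) k2 k4
  have l3 := zdefect_eq_zero_of_bracket hr (x := e3) (y := x4) (d := x3) (k := 1) one_ne_zero
    (by simp [brBasis, table]) k3 k4
  have l1 := zdefect_eq_zero_of_bracket hr (x := e3) (y := x2) (d := x1) (k := 1) one_ne_zero
    (by simp [brBasis, table]) k3 l2
  have l0 := zdefect_eq_zero_of_bracket hr (x := x2) (y := x3) (d := e1) (k := -2 * (1 + α))
    (mul_ne_zero (neg_ne_zero.2 h2') hα) (by simp [brBasis, table]) l2 l3
  rw [coc_iff_zdefect]
  intro b _ c _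
  rcases Idx.trichotomy b with h | ⟨i, rfl⟩ | h
  · exact kn b h c
  · exact kh i c
  · simp only [posIdx, List.mem_cons, List.not_mem_nil, or_false] at h
    rcases h with rfl | rfl | rfl | rfl | rfl | rfl | rfl
    · exact l0 c
    · exact k2 c
    · exact k3 c
    · exact l1 c
    · exact l2 c
    · exact l3 c
    · exact k4 c

/-- An invariant of `𝔫⁻` of weight zero in the absence of special weights. -/
theorem Core.bot_inv_all [CharP F p] (hp : 3 < p) (hα : 1 + α ≠ 0) (hc : Core p α lam a v)
    (h0 : botWt lam = 0) (hne : ∀ b ∈ simpleIdx, (0 : Fin 3 → F) ≠ wtF F b) (b : Idx) :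
    a b (bot p a v) = 0 := by
  have h2' : (2 : F) ≠ 0 := by
    exact_mod_cast natCast_ne_zero_of_lt (F := F) (p := p) (n := 2) (by omega) (by omega)
  -- The inner cocycle of the lowest monomial vanishes on 𝔥 ⊕ 𝔫⁻, so it is governed by its values at
  -- the simple root vectors; these vanish for reasons of weight.
  have hcoc : Coc α Set.univ a fun b => a b (bot p a v) := by
    intro b _ c _
    rw [← linearCombination_apply_apply, hc.rel.apply trivial trivial, add_sub_cancel_left,
      linearCombination_apply_apply]
  have hh : ∀ i, a (hIdx i) (bot p a v) = 0 := fun i => by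
    rw [hc.isWt_bot hp i, h0]; simp
  refine Coc.eq_zero_of_generators h2' hα hcoc hc.bot_inv hh (fun b hb => ?_) b
  exact hc.simple_eq_zero hp hcoc hc.bot_inv hh hb (by rw [h0]; exact hne b hb)

end Core

/-! ### Moving generators past high powers of the fᵢ -/

section Rules

variable {Z : Type*} [AddCommGroup Z] [Module F Z] {α : F} {a : Idx → Module.End F Z}

/-- The rules for moving `𝔥 ⊕ 𝔫⁺` past the generators of `𝔫⁻`. -/
theorem Rel.posRules (h : Rel α Set.univ a) :
    (∀ z, a h1 (a f1 z) = a f1 (a h1 z) + (-2 : F) • a f1 z) ∧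
    (∀ z, a h1 (a f2 z) = a f2 (a h1 z)) ∧
    (∀ z, a h1 (a f3 z) = a f3 (a h1 z)) ∧
    (∀ z, a h1 (a y1 z) = a y1 (a h1 z) - a y1 z) ∧
    (∀ z, a h1 (a y2 z) = a y2 (a h1 z) - a y2 z) ∧
    (∀ z, a h1 (a y3 z) = a y3 (a h1 z) - a y3 z) ∧
    (∀ z, a h1 (a y4 z) = a y4 (a h1 z) - a y4 z) ∧
    (∀ z, a h2 (a f1 z) = a f1 (a h2 z)) ∧
    (∀ z, a h2 (a f2 z) = a f2 (a h2 z) + (-2 : F) • a f2 z) ∧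
    (∀ z, a h2 (a f3 z) = a f3 (a h2 z)) ∧
    (∀ z, a h2 (a y1 z) = a y1 (a h2 z) + a y1 z) ∧
    (∀ z, a h2 (a y2 z) = a y2 (a h2 z) + a y2 z) ∧
    (∀ z, a h2 (a y3 z) = a y3 (a h2 z) - a y3 z) ∧
    (∀ z, a h2 (a y4 z) = a y4 (a h2 z) - a y4 z) ∧
    (∀ z, a h3 (a f1 z) = a f1 (a h3 z)) ∧
    (∀ z, a h3 (a f2 z) = a f2 (a h3 z)) ∧
    (∀ z, a h3 (a f3 z) = a f3 (a h3 z) + (-2 : F) • a f3 z) ∧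
    (∀ z, a h3 (a y1 z) = a y1 (a h3 z) + a y1 z) ∧
    (∀ z, a h3 (a y2 z) = a y2 (a h3 z) - a y2 z) ∧
    (∀ z, a h3 (a y3 z) = a y3 (a h3 z) + a y3 z) ∧
    (∀ z, a h3 (a y4 z) = a y4 (a h3 z) - a y4 z) ∧
    (∀ z, a e1 (a f1 z) = a f1 (a e1 z) + a h1 z) ∧
    (∀ z, a e1 (a f2 z) = a f2 (a e1 z)) ∧
    (∀ z, a e1 (a f3 z) = a f3 (a e1 z)) ∧
    (∀ z, a e1 (a y1 z) = a y1 (a e1 z) + a x1 z) ∧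
    (∀ z, a e1 (a y2 z) = a y2 (a e1 z) + a x2 z) ∧
    (∀ z, a e1 (a y3 z) = a y3 (a e1 z) + a x3 z) ∧
    (∀ z, a e1 (a y4 z) = a y4 (a e1 z) + a x4 z) ∧
    (∀ z, a e2 (a f1 z) = a f1 (a e2 z)) ∧
    (∀ z, a e2 (a f2 z) = a f2 (a e2 z) + a h2 z) ∧
    (∀ z, a e2 (a f3 z) = a f3 (a e2 z)) ∧
    (∀ z, a e2 (a y1 z) = a y1 (a e2 z)) ∧
    (∀ z, a e2 (a y2 z) = a y2 (a e2 z)) ∧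
    (∀ z, a e2 (a y3 z) = a y3 (a e2 z) + a y1 z) ∧
    (∀ z, a e2 (a y4 z) = a y4 (a e2 z) + a y2 z) ∧
    (∀ z, a e3 (a f1 z) = a f1 (a e3 z)) ∧
    (∀ z, a e3 (a f2 z) = a f2 (a e3 z)) ∧
    (∀ z, a e3 (a f3 z) = a f3 (a e3 z) + a h3 z) ∧
    (∀ z, a e3 (a y1 z) = a y1 (a e3 z)) ∧
    (∀ z, a e3 (a y2 z) = a y2 (a e3 z) + a y1 z) ∧
    (∀ z, a e3 (a y3 z) = a y3 (a e3 z)) ∧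
    (∀ z, a e3 (a y4 z) = a y4 (a e3 z) + a y3 z) ∧
    (∀ z, a x1 (a f1 z) = a f1 (a x1 z) - a y1 z) ∧
    (∀ z, a x1 (a f2 z) = a f2 (a x1 z) - a x3 z) ∧
    (∀ z, a x1 (a f3 z) = a f3 (a x1 z) - a x2 z) ∧
    (∀ z, a x1 (a y1 z) = -a y1 (a x1 z)) ∧
    (∀ z, a x1 (a y2 z) = -a y2 (a x1 z) + (-2 : F) • a e2 z) ∧
    (∀ z, a x1 (a y3 z) = -a y3 (a x1 z) + (-2 * α : F) • a e3 z) ∧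
    (∀ z, a x1 (a y4 z) = -a y4 (a x1 z) + (-(1 + α) : F) • a h1 z + a h2 z + (α : F) • a h3 z) ∧
    (∀ z, a x2 (a f1 z) = a f1 (a x2 z) - a y2 z) ∧
    (∀ z, a x2 (a f2 z) = a f2 (a x2 z) - a x4 z) ∧
    (∀ z, a x2 (a f3 z) = a f3 (a x2 z)) ∧
    (∀ z, a x2 (a y1 z) = -a y1 (a x2 z) + (2 : F) • a e2 z) ∧
    (∀ z, a x2 (a y2 z) = -a y2 (a x2 z)) ∧
    (∀ z, a x2 (a y3 z) = -a y3 (a x2 z) + (1 + α : F) • a h1 z - a h2 z + (α : F) • a h3 z) ∧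
    (∀ z, a x2 (a y4 z) = -a y4 (a x2 z) + (2 * α : F) • a f3 z) ∧
    (∀ z, a x3 (a f1 z) = a f1 (a x3 z) - a y3 z) ∧
    (∀ z, a x3 (a f2 z) = a f2 (a x3 z)) ∧
    (∀ z, a x3 (a f3 z) = a f3 (a x3 z) - a x4 z) ∧
    (∀ z, a x3 (a y1 z) = -a y1 (a x3 z) + (2 * α : F) • a e3 z) ∧
    (∀ z, a x3 (a y2 z) = -a y2 (a x3 z) + (1 + α : F) • a h1 z + a h2 z + (-α : F) • a h3 z) ∧
    (∀ z, a x3 (a y3 z) = -a y3 (a x3 z)) ∧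
    (∀ z, a x3 (a y4 z) = -a y4 (a x3 z) + (2 : F) • a f2 z) ∧
    (∀ z, a x4 (a f1 z) = a f1 (a x4 z) - a y4 z) ∧
    (∀ z, a x4 (a f2 z) = a f2 (a x4 z)) ∧
    (∀ z, a x4 (a f3 z) = a f3 (a x4 z)) ∧
    (∀ z, a x4 (a y1 z) = -a y1 (a x4 z) + (-(1 + α) : F) • a h1 z - a h2 z + (-α : F) • a h3 z) ∧
    (∀ z, a x4 (a y2 z) = -a y2 (a x4 z) + (-2 * α : F) • a f3 z) ∧
    (∀ z, a x4 (a y3 z) = -a y3 (a x4 z) + (-2 : F) • a f2 z) ∧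
    (∀ z, a x4 (a y4 z) = -a y4 (a x4 z)) := by
  and_intros
  all_goals
    intro z
    first
      | refine (h.apply_even trivial trivial (by first | exact .inl rfl | exact .inr rfl) z).trans ?_
      | refine (h.apply_odd trivial trivial rfl rfl z).trans ?_
    simp only [brBasis, table, par, sgn, mul_zero, mul_one, if_true, one_ne_zero, if_false,
      sub_zero, zero_sub, smul_zero, one_smul, neg_smul, smul_neg, neg_neg, sub_neg_eq_add, map_zero,
      map_add, map_sub, map_neg, map_smul, lc_bv, add_zero, sub_self]
    try module

theorem apply_pow_apply (f : Module.End F Z) (n : ℕ) (z : Z) : f ((f ^ n) z) = (f ^ (n + 1)) z := by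
  rw [pow_succ', Module.End.mul_apply]

theorem pow_apply_apply (f : Module.End F Z) (n : ℕ) (z : Z) : (f ^ n) (f z) = (f ^ (n + 1)) z := by
  rw [pow_succ, Module.End.mul_apply]

/-- Since d commutes with f, each of the n + 1 factors contributes the same term. -/
theorem pow_swap {f c d : Module.End F Z} {k : F} (h : ∀ z, c (f z) = f (c z) + k • d z)
    (hd : ∀ z, d (f z) = f (d z)) (n : ℕ) (z : Z) :
    c ((f ^ (n + 1)) z) = (f ^ (n + 1)) (c z) + (((n + 1 : ℕ) : F) * k) • (f ^ n) (d z) := by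
  have hdn : ∀ n z, d ((f ^ n) z) = (f ^ n) (d z) := map_pow_apply d hd
  induction n with
  | zero => simp [h]
  | succ n ih =>
    rw [← apply_pow_apply, h, ih, hdn, map_add, map_smul, apply_pow_apply, apply_pow_apply]
    push_cast
    module

/-- With p = q + 3 the exponents p - 1 and p - 2 are q + 2 and q + 1, and as coefficients they
become -1 and -2. This keeps numerals out of the normal forms of the explicit cocycles. -/
theorem pow_swap_top {q : ℕ} (hq : (q : F) = -3) {f c d : Module.End F Z} {k l : F}
    (h : ∀ z, c (f z) = f (c z) + (-k) • d z) (hd : ∀ z, d (f z) = f (d z)) (hl : l = 2 * k) :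
    (∀ z, c ((f ^ (q + 2)) z) = (f ^ (q + 2)) (c z) + k • (f ^ (q + 1)) (d z)) ∧
      ∀ z, c ((f ^ (q + 1)) z) = (f ^ (q + 1)) (c z) + l • (f ^ q) (d z) := by
  constructor <;> intro z <;> rw [pow_swap h hd] <;> push_cast <;> rw [hq] <;> congr 2
  · ring
  · rw [hl]; ring

theorem pow_swap_h {q : ℕ} (hq : (q : F) = -3) {f h : Module.End F Z}
    (hh : ∀ z, h (f z) = f (h z) + (-2 : F) • f z) :
    (∀ z, h ((f ^ (q + 2)) z) = (f ^ (q + 2)) (h z) + (2 : F) • (f ^ (q + 2)) z) ∧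
      ∀ z, h ((f ^ (q + 1)) z) = (f ^ (q + 1)) (h z) + (4 : F) • (f ^ (q + 1)) z := by
  constructor <;> intro z <;> rw [pow_swap hh fun _ => rfl, pow_apply_apply] <;> push_cast <;>
    rw [hq] <;> congr 2 <;> norm_num

/-- The sl(2) formula e f^(n+1) = f^(n+1) e + (n+1) f^n (h - n). -/
theorem pow_swap_e {e f h : Module.End F Z} (he : ∀ z, e (f z) = f (e z) + h z)
    (hh : ∀ z, h (f z) = f (h z) + (-2 : F) • f z) (n : ℕ) (z : Z) :
    e ((f ^ (n + 1)) z) = (f ^ (n + 1)) (e z) + ((n + 1 : ℕ) : F) • (f ^ n) (h z) -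
      (((n + 1 : ℕ) : F) * n) • (f ^ n) z := by
  have hn : ∀ n : ℕ, ∀ z, h ((f ^ n) z) = (f ^ n) (h z) + ((n : F) * (-2)) • (f ^ n) z := by
    intro n z
    cases n with
    | zero => simp
    | succ n => rw [pow_swap hh fun _ => rfl, pow_apply_apply]
  induction n with
  | zero => simp [he]
  | succ n ih =>
    rw [← apply_pow_apply, he, ih, hn, map_sub, map_add, map_smul, map_smul, apply_pow_apply,
      apply_pow_apply, apply_pow_apply]
    push_cast
    module

theorem pow_swap_e_top {q : ℕ} (hq : (q : F) = -3) {e f h : Module.End F Z}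
    (he : ∀ z, e (f z) = f (e z) + h z) (hh : ∀ z, h (f z) = f (h z) + (-2 : F) • f z) :
    (∀ z, e ((f ^ (q + 2)) z) = (f ^ (q + 2)) (e z) + (-1 : F) • (f ^ (q + 1)) (h z) +
        (-2 : F) • (f ^ (q + 1)) z) ∧
      ∀ z, e ((f ^ (q + 1)) z) = (f ^ (q + 1)) (e z) + (-2 : F) • (f ^ q) (h z) +
        (-6 : F) • (f ^ q) z := by
  constructor <;> intro z <;> rw [pow_swap_e he hh] <;> push_cast <;> rw [hq, sub_eq_add_neg,
    ← neg_smul] <;> congr <;> norm_num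

/-- Powers of the `fᵢ` commute with many generators. -/
theorem Rel.powCommRules (h : Rel α Set.univ a) :
    (∀ n z, a f2 ((a f1 ^ n) z) = (a f1 ^ n) (a f2 z)) ∧
    (∀ n z, a f3 ((a f1 ^ n) z) = (a f1 ^ n) (a f3 z)) ∧
    (∀ n z, a y1 ((a f1 ^ n) z) = (a f1 ^ n) (a y1 z)) ∧
    (∀ n z, a y2 ((a f1 ^ n) z) = (a f1 ^ n) (a y2 z)) ∧
    (∀ n z, a y3 ((a f1 ^ n) z) = (a f1 ^ n) (a y3 z)) ∧
    (∀ n z, a y4 ((a f1 ^ n) z) = (a f1 ^ n) (a y4 z)) ∧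
    (∀ n z, a h2 ((a f1 ^ n) z) = (a f1 ^ n) (a h2 z)) ∧
    (∀ n z, a h3 ((a f1 ^ n) z) = (a f1 ^ n) (a h3 z)) ∧
    (∀ n z, a e2 ((a f1 ^ n) z) = (a f1 ^ n) (a e2 z)) ∧
    (∀ n z, a e3 ((a f1 ^ n) z) = (a f1 ^ n) (a e3 z)) ∧
    (∀ n z, a f3 ((a f2 ^ n) z) = (a f2 ^ n) (a f3 z)) ∧
    (∀ n z, a y3 ((a f2 ^ n) z) = (a f2 ^ n) (a y3 z)) ∧
    (∀ n z, a y4 ((a f2 ^ n) z) = (a f2 ^ n) (a y4 z)) ∧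
    (∀ n z, a h1 ((a f2 ^ n) z) = (a f2 ^ n) (a h1 z)) ∧
    (∀ n z, a h3 ((a f2 ^ n) z) = (a f2 ^ n) (a h3 z)) ∧
    (∀ n z, a e1 ((a f2 ^ n) z) = (a f2 ^ n) (a e1 z)) ∧
    (∀ n z, a e3 ((a f2 ^ n) z) = (a f2 ^ n) (a e3 z)) ∧
    (∀ n z, a x3 ((a f2 ^ n) z) = (a f2 ^ n) (a x3 z)) ∧
    (∀ n z, a x4 ((a f2 ^ n) z) = (a f2 ^ n) (a x4 z)) ∧
    (∀ n z, a y2 ((a f3 ^ n) z) = (a f3 ^ n) (a y2 z)) ∧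
    (∀ n z, a y4 ((a f3 ^ n) z) = (a f3 ^ n) (a y4 z)) ∧
    (∀ n z, a h1 ((a f3 ^ n) z) = (a f3 ^ n) (a h1 z)) ∧
    (∀ n z, a h2 ((a f3 ^ n) z) = (a f3 ^ n) (a h2 z)) ∧
    (∀ n z, a e1 ((a f3 ^ n) z) = (a f3 ^ n) (a e1 z)) ∧
    (∀ n z, a e2 ((a f3 ^ n) z) = (a f3 ^ n) (a e2 z)) ∧
    (∀ n z, a x2 ((a f3 ^ n) z) = (a f3 ^ n) (a x2 z)) ∧
    (∀ n z, a x4 ((a f3 ^ n) z) = (a f3 ^ n) (a x4 z)) := by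
  and_intros
  all_goals
    refine fun n z => map_pow_apply _ (fun z => ?_) n z
    refine (h.apply_even trivial trivial (.inr rfl) z).trans ?_
    simp [brBasis, table]

/-- The rules for moving generators past the highest powers of the `fᵢ`. -/
theorem Rel.powSwapRules (h : Rel α Set.univ a) {q : ℕ} (hq : (q : F) = -3) :
    ((∀ z, a h1 ((a f1 ^ (q + 2)) z) = (a f1 ^ (q + 2)) (a h1 z) + (2 : F) • (a f1 ^ (q + 2)) z) ∧
      (∀ z, a h1 ((a f1 ^ (q + 1)) z) = (a f1 ^ (q + 1)) (a h1 z) + (4 : F) • (a f1 ^ (q + 1)) z)) ∧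
    ((∀ z, a x1 ((a f1 ^ (q + 2)) z) = (a f1 ^ (q + 2)) (a x1 z) + (1 : F) • (a f1 ^ (q + 1)) (a y1 z)) ∧
      (∀ z, a x1 ((a f1 ^ (q + 1)) z) = (a f1 ^ (q + 1)) (a x1 z) + (2 : F) • (a f1 ^ q) (a y1 z))) ∧
    ((∀ z, a x2 ((a f1 ^ (q + 2)) z) = (a f1 ^ (q + 2)) (a x2 z) + (1 : F) • (a f1 ^ (q + 1)) (a y2 z)) ∧
      (∀ z, a x2 ((a f1 ^ (q + 1)) z) = (a f1 ^ (q + 1)) (a x2 z) + (2 : F) • (a f1 ^ q) (a y2 z))) ∧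
    ((∀ z, a x3 ((a f1 ^ (q + 2)) z) = (a f1 ^ (q + 2)) (a x3 z) + (1 : F) • (a f1 ^ (q + 1)) (a y3 z)) ∧
      (∀ z, a x3 ((a f1 ^ (q + 1)) z) = (a f1 ^ (q + 1)) (a x3 z) + (2 : F) • (a f1 ^ q) (a y3 z))) ∧
    ((∀ z, a x4 ((a f1 ^ (q + 2)) z) = (a f1 ^ (q + 2)) (a x4 z) + (1 : F) • (a f1 ^ (q + 1)) (a y4 z)) ∧
      (∀ z, a x4 ((a f1 ^ (q + 1)) z) = (a f1 ^ (q + 1)) (a x4 z) + (2 : F) • (a f1 ^ q) (a y4 z))) ∧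
    ((∀ z, a y1 ((a f2 ^ (q + 2)) z) = (a f2 ^ (q + 2)) (a y1 z) + (1 : F) • (a f2 ^ (q + 1)) (a y3 z)) ∧
      (∀ z, a y1 ((a f2 ^ (q + 1)) z) = (a f2 ^ (q + 1)) (a y1 z) + (2 : F) • (a f2 ^ q) (a y3 z))) ∧
    ((∀ z, a y2 ((a f2 ^ (q + 2)) z) = (a f2 ^ (q + 2)) (a y2 z) + (1 : F) • (a f2 ^ (q + 1)) (a y4 z)) ∧
      (∀ z, a y2 ((a f2 ^ (q + 1)) z) = (a f2 ^ (q + 1)) (a y2 z) + (2 : F) • (a f2 ^ q) (a y4 z))) ∧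
    ((∀ z, a h2 ((a f2 ^ (q + 2)) z) = (a f2 ^ (q + 2)) (a h2 z) + (2 : F) • (a f2 ^ (q + 2)) z) ∧
      (∀ z, a h2 ((a f2 ^ (q + 1)) z) = (a f2 ^ (q + 1)) (a h2 z) + (4 : F) • (a f2 ^ (q + 1)) z)) ∧
    ((∀ z, a x1 ((a f2 ^ (q + 2)) z) = (a f2 ^ (q + 2)) (a x1 z) + (1 : F) • (a f2 ^ (q + 1)) (a x3 z)) ∧
      (∀ z, a x1 ((a f2 ^ (q + 1)) z) = (a f2 ^ (q + 1)) (a x1 z) + (2 : F) • (a f2 ^ q) (a x3 z))) ∧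
    ((∀ z, a x2 ((a f2 ^ (q + 2)) z) = (a f2 ^ (q + 2)) (a x2 z) + (1 : F) • (a f2 ^ (q + 1)) (a x4 z)) ∧
      (∀ z, a x2 ((a f2 ^ (q + 1)) z) = (a f2 ^ (q + 1)) (a x2 z) + (2 : F) • (a f2 ^ q) (a x4 z))) ∧
    ((∀ z, a y1 ((a f3 ^ (q + 2)) z) = (a f3 ^ (q + 2)) (a y1 z) + (1 : F) • (a f3 ^ (q + 1)) (a y2 z)) ∧
      (∀ z, a y1 ((a f3 ^ (q + 1)) z) = (a f3 ^ (q + 1)) (a y1 z) + (2 : F) • (a f3 ^ q) (a y2 z))) ∧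
    ((∀ z, a y3 ((a f3 ^ (q + 2)) z) = (a f3 ^ (q + 2)) (a y3 z) + (1 : F) • (a f3 ^ (q + 1)) (a y4 z)) ∧
      (∀ z, a y3 ((a f3 ^ (q + 1)) z) = (a f3 ^ (q + 1)) (a y3 z) + (2 : F) • (a f3 ^ q) (a y4 z))) ∧
    ((∀ z, a h3 ((a f3 ^ (q + 2)) z) = (a f3 ^ (q + 2)) (a h3 z) + (2 : F) • (a f3 ^ (q + 2)) z) ∧
      (∀ z, a h3 ((a f3 ^ (q + 1)) z) = (a f3 ^ (q + 1)) (a h3 z) + (4 : F) • (a f3 ^ (q + 1)) z)) ∧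
    ((∀ z, a x1 ((a f3 ^ (q + 2)) z) = (a f3 ^ (q + 2)) (a x1 z) + (1 : F) • (a f3 ^ (q + 1)) (a x2 z)) ∧
      (∀ z, a x1 ((a f3 ^ (q + 1)) z) = (a f3 ^ (q + 1)) (a x1 z) + (2 : F) • (a f3 ^ q) (a x2 z))) ∧
    ((∀ z, a x3 ((a f3 ^ (q + 2)) z) = (a f3 ^ (q + 2)) (a x3 z) + (1 : F) • (a f3 ^ (q + 1)) (a x4 z)) ∧
      (∀ z, a x3 ((a f3 ^ (q + 1)) z) = (a f3 ^ (q + 1)) (a x3 z) + (2 : F) • (a f3 ^ q) (a x4 z))) ∧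
    ((∀ z, a e1 ((a f1 ^ (q + 2)) z) = (a f1 ^ (q + 2)) (a e1 z) + (-1 : F) • (a f1 ^ (q + 1)) (a h1 z) + (-2 : F) • (a f1 ^ (q + 1)) z) ∧
      (∀ z, a e1 ((a f1 ^ (q + 1)) z) = (a f1 ^ (q + 1)) (a e1 z) + (-2 : F) • (a f1 ^ q) (a h1 z) + (-6 : F) • (a f1 ^ q) z)) ∧
    ((∀ z, a e2 ((a f2 ^ (q + 2)) z) = (a f2 ^ (q + 2)) (a e2 z) + (-1 : F) • (a f2 ^ (q + 1)) (a h2 z) + (-2 : F) • (a f2 ^ (q + 1)) z) ∧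
      (∀ z, a e2 ((a f2 ^ (q + 1)) z) = (a f2 ^ (q + 1)) (a e2 z) + (-2 : F) • (a f2 ^ q) (a h2 z) + (-6 : F) • (a f2 ^ q) z)) ∧
    ((∀ z, a e3 ((a f3 ^ (q + 2)) z) = (a f3 ^ (q + 2)) (a e3 z) + (-1 : F) • (a f3 ^ (q + 1)) (a h3 z) + (-2 : F) • (a f3 ^ (q + 1)) z) ∧
      (∀ z, a e3 ((a f3 ^ (q + 1)) z) = (a f3 ^ (q + 1)) (a e3 z) + (-2 : F) • (a f3 ^ q) (a h3 z) + (-6 : F) • (a f3 ^ q) z)) := by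
  have hs : ∀ {c f d : Idx} {k : F}, par f = 0 → brBasis α c f = k • bv d →
      ∀ z, a c (a f z) = a f (a c z) + k • a d z := by
    intro c f d k hf hd z
    rw [h.apply_even trivial trivial (.inr hf), hd, map_smul, lc_bv]
  have hc : ∀ {c f : Idx}, par f = 0 → brBasis α c f = 0 → ∀ z, a c (a f z) = a f (a c z) := by
    intro c f hf hd z
    rw [h.apply_even trivial trivial (.inr hf), hd, map_zero, add_zero]
  have hh : ∀ i z, a (hIdx i) (a (fIdx i) z) = a (fIdx i) (a (hIdx i) z) +
      (-2 : F) • a (fIdx i) z := fun i => hs (par_fIdx i) (by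
    rw [brBasis_h]; congr 1; fin_cases i <;> simp [fIdx, wt])
  have he : ∀ i z, a (eIdx i) (a (fIdx i) z) = a (fIdx i) (a (eIdx i) z) + a (hIdx i) z := by
    intro i z
    rw [hs (k := 1) (d := hIdx i) (par_fIdx i), one_smul]
    fin_cases i <;> simp [eIdx, fIdx, hIdx, brBasis, table]
  refine ⟨?_, ?_, ?_, ?_, ?_, ?_, ?_, ?_, ?_, ?_, ?_, ?_, ?_, ?_, ?_, ?_, ?_, ?_⟩
  all_goals
    first
      | exact pow_swap_h hq (hh 0)
      | exact pow_swap_h hq (hh 1)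
      | exact pow_swap_h hq (hh 2)
      | exact pow_swap_e_top hq (he 0) (hh 0)
      | exact pow_swap_e_top hq (he 1) (hh 1)
      | exact pow_swap_e_top hq (he 2) (hh 2)
      | exact pow_swap_top hq (hs rfl (by simp [brBasis, table, par, sgn]))
          (hc rfl (by simp [brBasis, table])) (by norm_num)

/-- Products of powers of the `fᵢ`. -/
theorem Rel.powMergeRules (h : Rel α Set.univ a) {q : ℕ} (hpow : ∀ i, a (fIdx i) ^ (q + 3) = 0) :
    (∀ z, a f1 ((a f1 ^ (q + 2)) z) = 0) ∧
    (∀ z, a f1 ((a f1 ^ (q + 1)) z) = (a f1 ^ (q + 2)) z) ∧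
    (∀ z, a f1 ((a f1 ^ q) z) = (a f1 ^ (q + 1)) z) ∧
    (∀ z, (a f1 ^ (q + 2)) (a f1 z) = 0) ∧
    (∀ z, (a f1 ^ (q + 1)) (a f1 z) = (a f1 ^ (q + 2)) z) ∧
    (∀ z, (a f1 ^ q) (a f1 z) = (a f1 ^ (q + 1)) z) ∧
    (∀ z, a f2 ((a f2 ^ (q + 2)) z) = 0) ∧
    (∀ z, a f2 ((a f2 ^ (q + 1)) z) = (a f2 ^ (q + 2)) z) ∧
    (∀ z, a f2 ((a f2 ^ q) z) = (a f2 ^ (q + 1)) z) ∧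
    (∀ z, (a f2 ^ (q + 2)) (a f2 z) = 0) ∧
    (∀ z, (a f2 ^ (q + 1)) (a f2 z) = (a f2 ^ (q + 2)) z) ∧
    (∀ z, (a f2 ^ q) (a f2 z) = (a f2 ^ (q + 1)) z) ∧
    (∀ z, a f3 ((a f3 ^ (q + 2)) z) = 0) ∧
    (∀ z, a f3 ((a f3 ^ (q + 1)) z) = (a f3 ^ (q + 2)) z) ∧
    (∀ z, a f3 ((a f3 ^ q) z) = (a f3 ^ (q + 1)) z) ∧
    (∀ z, (a f3 ^ (q + 2)) (a f3 z) = 0) ∧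
    (∀ z, (a f3 ^ (q + 1)) (a f3 z) = (a f3 ^ (q + 2)) z) ∧
    (∀ z, (a f3 ^ q) (a f3 z) = (a f3 ^ (q + 1)) z) ∧
    (∀ n z, (a f2 ^ n) (a f1 z) = a f1 ((a f2 ^ n) z)) ∧
    (∀ n z, (a f3 ^ n) (a f1 z) = a f1 ((a f3 ^ n) z)) ∧
    (∀ n z, (a f3 ^ n) (a f2 z) = a f2 ((a f3 ^ n) z)) := by
  have h3 : ∀ i, ∀ z, (a (fIdx i) ^ (q + 3)) z = 0 := fun i z => by rw [hpow]; rfl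
  have h4 : ∀ {i j : Fin 3}, i < j → ∀ (n : ℕ) z, (a (fIdx j) ^ n) (a (fIdx i) z) =
      a (fIdx i) ((a (fIdx j) ^ n) z) := by
    intro i j hij n z
    refine (map_pow_apply _ (fun z => ?_) n z).symm
    refine (h.apply_even trivial trivial (.inr (par_fIdx j)) z).trans ?_
    have : brBasis α (fIdx i) (fIdx j) = 0 := by
      revert hij
      fin_cases i <;> fin_cases j <;> simp [fIdx, brBasis, table]
    rw [this, map_zero, add_zero]
  and_intros
  all_goals
    first
      | exact h4 (i := 0) (j := 1) (by decide)
      | exact h4 (i := 0) (j := 2) (by decide)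
      | exact h4 (i := 1) (j := 2) (by decide)
      | (intro z; simp only [apply_pow_apply, pow_apply_apply]; done)
      | (intro z; simp only [apply_pow_apply, pow_apply_apply]; exact h3 0 z)
      | (intro z; simp only [apply_pow_apply, pow_apply_apply]; exact h3 1 z)
      | (intro z; simp only [apply_pow_apply, pow_apply_apply]; exact h3 2 z)

end Rules

/-! ### The explicit cocycles at the special weights -/

section Psi

variable {Z : Type*} [AddCommGroup Z] [Module F Z]

/-- `ψ₁` at its special weight. -/
def psi1c (α : F) (q : ℕ) (a : Idx → Module.End F Z) (v : Z) (A B : Fin 3 → F) : Idx → Z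
  | h1 => A 0 • fpow a (q + 2) (q + 2) (q + 2) (yvec a v 1 1 1 1)
  | h2 => A 1 • fpow a (q + 2) (q + 2) (q + 2) (yvec a v 1 1 1 1)
  | h3 => A 2 • fpow a (q + 2) (q + 2) (q + 2) (yvec a v 1 1 1 1)
  | f1 => B 0 • fpow a 0 (q + 2) (q + 2) (yvec a v 1 1 1 1)
  | f2 => B 1 • fpow a (q + 2) 0 (q + 2) (yvec a v 1 1 1 1)
  | f3 => B 2 • fpow a (q + 2) (q + 2) 0 (yvec a v 1 1 1 1)
  | e1 => (2 * B 1) • fpow a (q + 2) 0 (q + 2) (yvec a v 1 1 0 0)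
      - (2 * α * B 2) • fpow a (q + 2) (q + 2) 0 (yvec a v 1 0 1 0)
      + ((1 + α) * A 0 - A 1 + α * A 2) • fpow a (q + 2) (q + 2) (q + 2) (yvec a v 1 0 0 1)
      - ((1 + α) * A 0 - A 1 - α * A 2) • fpow a (q + 2) (q + 2) (q + 2) (yvec a v 0 1 1 0)
      - A 0 • fpow a (q + 1) (q + 2) (q + 2) (yvec a v 1 1 1 1)
      - (8 * (1 + α) * B 0) • fpow a 0 (q + 2) (q + 2) (yvec a v 0 0 0 0)
  | e2 => -(A 1 • fpow a (q + 2) (q + 1) (q + 2) (yvec a v 1 1 1 1))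
      + (2 * (1 + α) * B 0) • fpow a 0 (q + 2) (q + 2) (yvec a v 1 1 0 0)
  | e3 => -(A 2 • fpow a (q + 2) (q + 2) (q + 1) (yvec a v 1 1 1 1))
  | x1 => ((1 + α) * A 0 - A 1 - α * A 2) • fpow a (q + 2) (q + 2) (q + 2) (yvec a v 1 1 1 0)
      + ((1 + α) * A 0 - A 1 + α * A 2) • fpow a (q + 2) (q + 2) (q + 1) (yvec a v 1 1 0 1)
      - ((1 + α) * A 0 + A 1 - α * A 2) • fpow a (q + 2) (q + 1) (q + 2) (yvec a v 1 0 1 1)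
      - ((1 + α) * A 0 + A 1 + α * A 2) • fpow a (q + 2) (q + 1) (q + 1) (yvec a v 0 1 1 1)
      + (4 * (1 + α) * B 0) • (fpow a 0 (q + 2) (q + 2) (yvec a v 1 0 0 0)
      + fpow a 0 (q + 2) (q + 1) (yvec a v 0 1 0 0)
        + fpow a 0 (q + 1) (q + 2) (yvec a v 0 0 1 0)
      + fpow a 0 (q + 1) (q + 1) (yvec a v 0 0 0 1))
  | x2 => -((2 * α * B 2) • fpow a (q + 2) (q + 2) 0 (yvec a v 1 1 1 0))
      + ((1 + α) * A 0 - A 1 + α * A 2) • fpow a (q + 2) (q + 2) (q + 2) (yvec a v 1 1 0 1)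
      + (2 * α * B 2) • fpow a (q + 2) (q + 1) 0 (yvec a v 1 0 1 1)
      - ((1 + α) * A 0 + A 1 + α * A 2) • fpow a (q + 2) (q + 1) (q + 2) (yvec a v 0 1 1 1)
      + (4 * (1 + α) * B 0) • (fpow a 0 (q + 2) (q + 2) (yvec a v 0 1 0 0)
      + fpow a 0 (q + 1) (q + 2) (yvec a v 0 0 0 1))
  | x3 => -((2 * B 1) • fpow a (q + 2) 0 (q + 2) (yvec a v 1 1 1 0))
      - (2 * B 1) • fpow a (q + 2) 0 (q + 1) (yvec a v 1 1 0 1)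
      - ((1 + α) * A 0 + A 1 - α * A 2) • fpow a (q + 2) (q + 2) (q + 2) (yvec a v 1 0 1 1)
      - ((1 + α) * A 0 + A 1 + α * A 2) • fpow a (q + 2) (q + 2) (q + 1) (yvec a v 0 1 1 1)
      + (4 * (1 + α) * B 0) • (fpow a 0 (q + 2) (q + 2) (yvec a v 0 0 1 0)
      + fpow a 0 (q + 2) (q + 1) (yvec a v 0 0 0 1))
  | x4 => -((2 * B 1) • fpow a (q + 2) 0 (q + 2) (yvec a v 1 1 0 1))
      + (2 * α * B 2) • fpow a (q + 2) (q + 2) 0 (yvec a v 1 0 1 1)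
      - ((1 + α) * A 0 + A 1 + α * A 2) • fpow a (q + 2) (q + 2) (q + 2) (yvec a v 0 1 1 1)
      + (4 * (1 + α) * B 0) • fpow a 0 (q + 2) (q + 2) (yvec a v 0 0 0 1)
  | y1 => -((2 * (1 + α) * B 0) • (fpow a 0 (q + 1) (q + 2) (yvec a v 1 0 1 1)
      + fpow a 0 (q + 1) (q + 1) (yvec a v 0 1 1 1)))
  | y2 => -((2 * (1 + α) * B 0) • fpow a 0 (q + 1) (q + 2) (yvec a v 0 1 1 1))
  | y3 => -((2 * (1 + α) * B 0) •
      (fpow a 0 (q + 2) (q + 2) (yvec a v 1 0 1 1)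
      + fpow a 0 (q + 2) (q + 1) (yvec a v 0 1 1 1)))
  | y4 => -((2 * (1 + α) * B 0) • fpow a 0 (q + 2) (q + 2) (yvec a v 0 1 1 1))

/-- `ψ₂` at its special weight. -/
def psi2c (α : F) (q : ℕ) (a : Idx → Module.End F Z) (v : Z) (c : F) : Idx → Z
  | e1 => (2 * α * c) • fpow a (q + 2) (q + 2) (q + 2) (yvec a v 0 1 0 1)
  | e3 => c • fpow a (q + 2) (q + 2) (q + 2) (yvec a v 1 1 1 1)
  | x1 => -((2 * α * c) • fpow a (q + 2) (q + 2) (q + 2) (yvec a v 1 1 0 1))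
      + (2 * α * c) • fpow a (q + 2) (q + 1) (q + 2) (yvec a v 0 1 1 1)
  | x3 => (2 * α * c) • fpow a (q + 2) (q + 2) (q + 2) (yvec a v 0 1 1 1)
  | _ => 0

/-- `ψ₃` at its special weight. -/
def psi3c (q : ℕ) (a : Idx → Module.End F Z) (v : Z) (c : F) : Idx → Z
  | e1 => -((2 * c) • fpow a (q + 2) (q + 2) (q + 2) (yvec a v 0 0 1 1))
  | e2 => c • fpow a (q + 2) (q + 2) (q + 2) (yvec a v 1 1 1 1)
  | x1 => (2 * c) • fpow a (q + 2) (q + 2) (q + 2) (yvec a v 1 0 1 1)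
      + (2 * c) • fpow a (q + 2) (q + 2) (q + 1) (yvec a v 0 1 1 1)
  | x2 => (2 * c) • fpow a (q + 2) (q + 2) (q + 2) (yvec a v 0 1 1 1)
  | _ => 0

/-- `ψ₄` at its special weight, with the sign that makes it a cocycle. -/
def psi4c (q : ℕ) (a : Idx → Module.End F Z) (v : Z) (c : F) : Idx → Z
  | e1 => c • fpow a (q + 2) (q + 2) (q + 2) (yvec a v 1 1 1 0)
  | x1 => c • fpow a (q + 2) (q + 1) (q + 1) (yvec a v 1 1 1 1)
  | x2 => c • fpow a (q + 2) (q + 1) (q + 2) (yvec a v 1 1 1 1)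
  | x3 => c • fpow a (q + 2) (q + 2) (q + 1) (yvec a v 1 1 1 1)
  | x4 => c • fpow a (q + 2) (q + 2) (q + 2) (yvec a v 1 1 1 1)
  | _ => 0

variable {α : F} {lam : Fin 3 → F} {a : Idx → Module.End F Z} {v : Z} {q : ℕ}

-- By `Core.coc_of_generators` only the arguments y₁, f₂, f₃ matter. For them every term of the
-- identity is brought to the ordered form f₁f₂f₃y₁y₂y₃y₄v by the reordering rules, after which the
-- coefficients of equal monomials cancel. The same scheme serves ψ₂, ψ₃ and ψ₄.
set_option maxHeartbeats 4000000 in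
theorem Core.psi1c_zdefect [CharP F (q + 3)] (hc : Core (q + 3) α lam a v) (h2 : (2 : F) ≠ 0)
    (hl : lam = ![2, -2, -2]) (A B : Fin 3 → F) (b : Idx) :
    zdefect α a (psi1c α q a v A B) y1 b = 0 ∧ zdefect α a (psi1c α q a v A B) f2 b = 0 ∧
      zdefect α a (psi1c α q a v A B) f3 b = 0 := by
  have hq : (q : F) = -3 := by
    have := CharP.cast_eq_zero F (q + 3)
    push_cast at this
    exact eq_neg_of_add_eq_zero_left this
  obtain ⟨f21, f31, f32, y1f1, y2f1, y3f1, y4f1, y1f2, y2f2, y3f2, y4f2, y1f3, y2f3, y3f3, y4f3, y11,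
    y22, y33, y44, y21, y31, y41, y32, y42, y43⟩ := (hc.rel.mono (Set.subset_univ _)).negRules h2
  have v0 := hc.h_vac 0
  have v1 := hc.h_vac 1
  have v2 := hc.h_vac 2
  have vp : a e1 v = 0 ∧ a e2 v = 0 ∧ a e3 v = 0 ∧ a x1 v = 0 ∧ a x2 v = 0 ∧ a x3 v = 0 ∧
      a x4 v = 0 := by
    and_intros <;> exact hc.pos_vac _ (by decide)
  simp only [hIdx, hl, Matrix.cons_val] at v0 v1 v2
  cases b <;>
    simp only [zdefect, psi1c, brBasis, table, par, sgn, mul_zero, mul_one, if_true, one_ne_zero,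
      if_false, and_self, and_true, true_and, sub_zero, zero_sub, smul_zero, one_smul, map_zero, map_add, map_sub, map_neg,
      map_smul, lc_bv, add_zero, zero_add, sub_self, neg_neg, neg_zero, fpow, yvec, pow_zero, pow_one,
      Module.End.one_apply, f21, f31, f32, y1f1, y2f1, y3f1, y4f1, y1f2, y2f2, y3f2, y4f2, y1f3,
      y2f3, y3f3, y4f3, y11, y22, y33, y44, y21, y31, y41, y32, y42, y43, hc.rel.posRules,
      hc.rel.powCommRules, hc.rel.powSwapRules hq, hc.rel.powMergeRules hc.pow_f, v0, v1, v2, vp] <;>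
    and_intros <;> module

set_option maxHeartbeats 4000000 in
theorem Core.psi2c_zdefect [CharP F (q + 3)] (hc : Core (q + 3) α lam a v) (h2 : (2 : F) ≠ 0)
    (hl : lam = ![2, -2, 0]) (c : F) (b : Idx) :
    zdefect α a (psi2c α q a v c) y1 b = 0 ∧ zdefect α a (psi2c α q a v c) f2 b = 0 ∧
      zdefect α a (psi2c α q a v c) f3 b = 0 := by
  have hq : (q : F) = -3 := by
    have := CharP.cast_eq_zero F (q + 3)
    push_cast at this
    exact eq_neg_of_add_eq_zero_left this
  obtain ⟨f21, f31, f32, y1f1, y2f1, y3f1, y4f1, y1f2, y2f2, y3f2, y4f2, y1f3, y2f3, y3f3, y4f3, y11,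
    y22, y33, y44, y21, y31, y41, y32, y42, y43⟩ := (hc.rel.mono (Set.subset_univ _)).negRules h2
  have v0 := hc.h_vac 0
  have v1 := hc.h_vac 1
  have v2 := hc.h_vac 2
  have vp : a e1 v = 0 ∧ a e2 v = 0 ∧ a e3 v = 0 ∧ a x1 v = 0 ∧ a x2 v = 0 ∧ a x3 v = 0 ∧
      a x4 v = 0 := by
    and_intros <;> exact hc.pos_vac _ (by decide)
  simp only [hIdx, hl, Matrix.cons_val] at v0 v1 v2
  cases b <;>
    simp only [zdefect, psi2c, brBasis, table, par, sgn, mul_zero, mul_one, if_true, one_ne_zero,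
      if_false, and_self, and_true, true_and, sub_zero, zero_sub, smul_zero, one_smul, map_zero, map_add, map_sub, map_neg,
      map_smul, lc_bv, add_zero, zero_add, sub_self, neg_neg, neg_zero, fpow, yvec, pow_zero, pow_one,
      Module.End.one_apply, f21, f31, f32, y1f1, y2f1, y3f1, y4f1, y1f2, y2f2, y3f2, y4f2, y1f3,
      y2f3, y3f3, y4f3, y11, y22, y33, y44, y21, y31, y41, y32, y42, y43, hc.rel.posRules,
      hc.rel.powCommRules, hc.rel.powSwapRules hq, hc.rel.powMergeRules hc.pow_f, v0, v1, v2, vp] <;>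
    and_intros <;> module

set_option maxHeartbeats 4000000 in
theorem Core.psi3c_zdefect [CharP F (q + 3)] (hc : Core (q + 3) α lam a v) (h2 : (2 : F) ≠ 0)
    (hl : lam = ![2, 0, -2]) (c : F) (b : Idx) :
    zdefect α a (psi3c q a v c) y1 b = 0 ∧ zdefect α a (psi3c q a v c) f2 b = 0 ∧
      zdefect α a (psi3c q a v c) f3 b = 0 := by
  have hq : (q : F) = -3 := by
    have := CharP.cast_eq_zero F (q + 3)
    push_cast at this
    exact eq_neg_of_add_eq_zero_left this
  obtain ⟨f21, f31, f32, y1f1, y2f1, y3f1, y4f1, y1f2, y2f2, y3f2, y4f2, y1f3, y2f3, y3f3, y4f3, y11,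
    y22, y33, y44, y21, y31, y41, y32, y42, y43⟩ := (hc.rel.mono (Set.subset_univ _)).negRules h2
  have v0 := hc.h_vac 0
  have v1 := hc.h_vac 1
  have v2 := hc.h_vac 2
  have vp : a e1 v = 0 ∧ a e2 v = 0 ∧ a e3 v = 0 ∧ a x1 v = 0 ∧ a x2 v = 0 ∧ a x3 v = 0 ∧
      a x4 v = 0 := by
    and_intros <;> exact hc.pos_vac _ (by decide)
  simp only [hIdx, hl, Matrix.cons_val] at v0 v1 v2
  cases b <;>
    simp only [zdefect, psi3c, brBasis, table, par, sgn, mul_zero, mul_one, if_true, one_ne_zero,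
      if_false, and_self, and_true, true_and, sub_zero, zero_sub, smul_zero, one_smul, map_zero, map_add, map_sub, map_neg,
      map_smul, lc_bv, add_zero, zero_add, sub_self, neg_neg, neg_zero, fpow, yvec, pow_zero, pow_one,
      Module.End.one_apply, f21, f31, f32, y1f1, y2f1, y3f1, y4f1, y1f2, y2f2, y3f2, y4f2, y1f3,
      y2f3, y3f3, y4f3, y11, y22, y33, y44, y21, y31, y41, y32, y42, y43, hc.rel.posRules,
      hc.rel.powCommRules, hc.rel.powSwapRules hq, hc.rel.powMergeRules hc.pow_f, v0, v1, v2, vp] <;>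
    and_intros <;> module

set_option maxHeartbeats 4000000 in
theorem Core.psi4c_zdefect [CharP F (q + 3)] (hc : Core (q + 3) α lam a v) (h2 : (2 : F) ≠ 0)
    (hl : lam = ![3, -3, -3]) (c : F) (b : Idx) :
    zdefect α a (psi4c q a v c) y1 b = 0 ∧ zdefect α a (psi4c q a v c) f2 b = 0 ∧
      zdefect α a (psi4c q a v c) f3 b = 0 := by
  have hq : (q : F) = -3 := by
    have := CharP.cast_eq_zero F (q + 3)
    push_cast at this
    exact eq_neg_of_add_eq_zero_left this
  obtain ⟨f21, f31, f32, y1f1, y2f1, y3f1, y4f1, y1f2, y2f2, y3f2, y4f2, y1f3, y2f3, y3f3, y4f3, y11,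
    y22, y33, y44, y21, y31, y41, y32, y42, y43⟩ := (hc.rel.mono (Set.subset_univ _)).negRules h2
  have v0 := hc.h_vac 0
  have v1 := hc.h_vac 1
  have v2 := hc.h_vac 2
  have vp : a e1 v = 0 ∧ a e2 v = 0 ∧ a e3 v = 0 ∧ a x1 v = 0 ∧ a x2 v = 0 ∧ a x3 v = 0 ∧
      a x4 v = 0 := by
    and_intros <;> exact hc.pos_vac _ (by decide)
  simp only [hIdx, hl, Matrix.cons_val] at v0 v1 v2
  cases b <;>
    simp only [zdefect, psi4c, brBasis, table, par, sgn, mul_zero, mul_one, if_true, one_ne_zero,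
      if_false, and_self, and_true, true_and, sub_zero, zero_sub, smul_zero, one_smul, map_zero, map_add, map_sub, map_neg,
      map_smul, lc_bv, add_zero, zero_add, sub_self, neg_neg, neg_zero, fpow, yvec, pow_zero, pow_one,
      Module.End.one_apply, f21, f31, f32, y1f1, y2f1, y3f1, y4f1, y1f2, y2f2, y3f2, y4f2, y1f3,
      y2f3, y3f3, y4f3, y11, y22, y33, y44, y21, y31, y41, y32, y42, y43, hc.rel.posRules,
      hc.rel.powCommRules, hc.rel.powSwapRules hq, hc.rel.powMergeRules hc.pow_f, v0, v1, v2, vp] <;>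
    and_intros <;> module

end Psi

local instance (α : F) (p : ℕ) (χ : Module.Dual F (gPart F 0))
    (lam : Module.Dual F (cartan F)) (hl : Admissible p χ lam) :
    AddCommGroup (Verma α p χ lam hl) := inferInstance

local instance (α : F) (p : ℕ) (χ : Module.Dual F (gPart F 0))
    (lam : Module.Dual F (cartan F)) (hl : Admissible p χ lam) :
    Module F (Verma α p χ lam hl) := inferInstance

/-! ### Superderivations of weight zero -/

section Weights

variable {α : F} {p : ℕ} {χ : Module.Dual F (gPart F 0)} {lam : Module.Dual F (cartan F)}
  {hl : Admissible p χ lam}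

theorem coord_of_mem_gWeight {β : Module.Dual F (cartan F)} {x : G F} (hx : x ∈ gWeight α β)
    {b : Idx} (hb : x b ≠ 0) (i : Fin 3) : β (hC i) = wtF F b i := by
  have h : ∀ y : G F, bracket α (bv (hIdx i)) y b = wtF F b i * y b := by
    intro y
    induction y using Finsupp.induction_linear with
    | zero => simp
    | add y z hy hz => rw [map_add, Finsupp.add_apply, hy, hz, Finsupp.add_apply, mul_add]
    | single c r =>
      have : (Finsupp.single c r : G F) = r • bv c := by simp [bv]
      rw [this, map_smul, bracket_bv, brBasis_h, Finsupp.smul_apply, Finsupp.smul_apply,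
        Finsupp.smul_apply]
      by_cases hcb : c = b
      · subst hcb
        simp only [smul_eq_mul, wtF]
        ring_nf
      · simp [bv, hcb]
  have h1 := DFunLike.congr_fun (hx (hC i)) b
  rw [show ((hC i : cartan F) : G F) = bv (hIdx i) from rfl, h, Finsupp.smul_apply, smul_eq_mul] at h1
  exact (mul_right_cancel₀ hb h1).symm

theorem mem_zWeight {β : Module.Dual F (cartan F)} {z : Verma α p χ lam hl}
    (hz : IsWt (zact α p χ lam hl) (fun i => β (hC i)) z) : z ∈ zWeight α p χ lam hl β := by
  have key : ∀ g (hg : g ∈ cartan F), act α p χ lam hl g z = β ⟨g, hg⟩ • z := by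
    intro g hg
    induction hg using Submodule.span_induction with
    | mem g hg =>
      obtain ⟨i, rfl⟩ := hg
      exact hz i
    | zero =>
      rw [← zact_linear, map_zero, LinearMap.zero_apply,
        show (⟨0, Submodule.zero_mem _⟩ : cartan F) = 0 from rfl, map_zero, zero_smul]
    | add g k hg hk h1 h2 =>
      rw [← zact_linear, map_add, LinearMap.add_apply, zact_linear, zact_linear, h1, h2,
        ← add_smul, ← map_add]
      rfl
    | smul r g hg h1 =>
      rw [← zact_linear, map_smul, LinearMap.smul_apply, zact_linear, h1, smul_smul, ← smul_eq_mul,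
        ← map_smul]
      rfl
  exact fun h => key h h.2

theorem weightZero_of_isWt {φ : G F →ₗ[F] Verma α p χ lam hl}
    (h : ∀ b, IsWt (zact α p χ lam hl) (wtF F b) (φ (bv b))) : WeightZero α p χ lam hl φ := by
  intro β x hx
  refine mem_zWeight ?_
  rw [eq_linearCombination_bv φ]
  refine IsWt.linearCombination fun b hb => ?_
  convert h b using 1
  exact funext fun i => coord_of_mem_gWeight hx hb i

theorem WeightZero.add {φ ψ : G F →ₗ[F] Verma α p χ lam hl} (hφ : WeightZero α p χ lam hl φ)
    (hψ : WeightZero α p χ lam hl ψ) : WeightZero α p χ lam hl (φ + ψ) := by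
  intro β x hx h
  have h1 := hφ β x hx h
  have h2 := hψ β x hx h
  rw [← zact_linear] at h1 h2 ⊢
  rw [LinearMap.add_apply, map_add, h1, h2, smul_add]

theorem WeightZero.sub {φ ψ : G F →ₗ[F] Verma α p χ lam hl} (hφ : WeightZero α p χ lam hl φ)
    (hψ : WeightZero α p χ lam hl ψ) : WeightZero α p χ lam hl (φ - ψ) := by
  intro β x hx h
  have h1 := hφ β x hx h
  have h2 := hψ β x hx h
  rw [← zact_linear] at h1 h2 ⊢
  rw [LinearMap.sub_apply, map_sub, h1, h2, smul_sub]

theorem weightZero_zero : WeightZero α p χ lam hl 0 := by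
  intro β x hx h
  rw [← zact_linear, LinearMap.zero_apply, map_zero, smul_zero]

end Weights

/-! ### Weight and parity of the monomials w and of the maps ψⱼ -/

section Monomials

variable {α : F} {p : ℕ} {χ : Module.Dual F (gPart F 0)} {lam : Module.Dual F (cartan F)}
  {hl : Admissible p χ lam}

theorem zact_pow_mem_zPart (b : Idx) (n : ℕ) {i : ZMod 2} {z : Verma α p χ lam hl}
    (hz : z ∈ zPart α p χ lam hl i) :
    (zact α p χ lam hl b ^ n) z ∈ zPart α p χ lam hl (n * par b + i) := by
  induction n with
  | zero => simpa using hz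
  | succ n ih =>
    rw [pow_succ', Module.End.mul_apply]
    convert zact_mem_zPart b ih using 1
    push_cast
    ring_nf

theorem cast_resid {c : F} (h : IsPrimeElt c) : ((resid c : ℕ) : F) = c :=
  Nat.sInf_mem (s := {n : ℕ | (n : F) = c}) h

theorem resid_eq [CharP F p] {n : ℕ} (hn : n < p) {c : F} (h : (n : F) = c) : resid c = n := by
  have hc : ((resid c : ℕ) : F) = c := cast_resid ⟨n, h⟩
  have hle : resid c ≤ n := Nat.sInf_le (show (n : F) = c from h)
  have h1 := (CharP.natCast_eq_natCast F p).1 (hc.trans h.symm)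
  exact Nat.ModEq.eq_of_lt_of_lt h1 (lt_of_le_of_lt hle hn) hn

open Classical in
theorem w_eq (β : Fin 3 → ℤ) (θ : Fin 4 → ℕ) : w α p χ lam hl β θ =
    if IsPrimeElt (expo1 lam β θ) ∧ IsPrimeElt (expo2 lam β θ) ∧ IsPrimeElt (expo3 lam β θ) then
      fpow (zact α p χ lam hl) (resid (expo1 lam β θ)) (resid (expo2 lam β θ))
        (resid (expo3 lam β θ)) (yvec (zact α p χ lam hl) (vac α p χ lam hl) (θ 0) (θ 1) (θ 2) (θ 3))
    else 0 := by
  rw [w]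
  refine if_congr Iff.rfl ?_ rfl
  simp only [fpow, yvec, zact_pow_apply, tens_eq, mul_smul]

theorem w_mem_zPart (β : Fin 3 → ℤ) (θ : Fin 4 → ℕ) :
    w α p χ lam hl β θ ∈ zPart α p χ lam hl (θ 0 + θ 1 + θ 2 + θ 3 : ℕ) := by
  rw [w_eq]
  split_ifs
  · have := zact_pow_mem_zPart f1 (resid (expo1 lam β θ)) (zact_pow_mem_zPart f2
      (resid (expo2 lam β θ)) (zact_pow_mem_zPart f3 (resid (expo3 lam β θ)) (zact_pow_mem_zPart y1
      (θ 0) (zact_pow_mem_zPart y2 (θ 1) (zact_pow_mem_zPart y3 (θ 2) (zact_pow_mem_zPart y4 (θ 3)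
      (vac_mem_zPart (α := α) (hl := hl))))))))
    convert this using 1
    · simp only [par]
      push_cast
      ring_nf
    · rfl
  · exact Submodule.zero_mem _

theorem isWt_vac : IsWt (zact α p χ lam hl) (fun i => lam (hC i)) (vac α p χ lam hl) := by
  intro i
  rw [zact_vac α p χ lam hl (by fin_cases i <;> decide), lamExt_bv]
  fin_cases i <;> rfl

theorem isWt_w (h2 : (2 : F) ≠ 0) (β : Fin 3 → ℤ) (θ : Fin 4 → ℕ) :
    IsWt (zact α p χ lam hl) (fun i => (β i : F)) (w α p χ lam hl β θ) := by
  rw [w_eq]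
  split_ifs with h
  · convert isWt_monomial (rel_zact α p χ lam hl) (isWt_vac (hl := hl)) _ _ _ _ _ _ _ using 1
    funext t
    rw [cast_resid h.1, cast_resid h.2.1, cast_resid h.2.2]
    fin_cases t <;> simp [wtF, wt, expo1, expo2, expo3] <;> field_simp <;> ring_nf
  · exact isWt_zero _

theorem w_mem_zPart_of_eq {β : Fin 3 → ℤ} {θ : Fin 4 → ℕ} {i : ZMod 2}
    (h : ((θ 0 + θ 1 + θ 2 + θ 3 : ℕ) : ZMod 2) = i) :
    w α p χ lam hl β θ ∈ zPart α p χ lam hl i := h ▸ w_mem_zPart β θ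

theorem isWt_w_of_eq (h2 : (2 : F) ≠ 0) {β : Fin 3 → ℤ} {θ : Fin 4 → ℕ} {b : Idx}
    (h : ∀ t, β t = wt b t) : IsWt (zact α p χ lam hl) (wtF F b) (w α p χ lam hl β θ) := by
  convert isWt_w h2 β θ using 1
  exact funext fun t => by rw [wtF, h]

theorem psi1_mem_zPart (A B : Fin 3 → F) (b : Idx) :
    psi1 α p χ lam hl A B (bv b) ∈ zPart α p χ lam hl (0 + par b) := by
  cases b <;> simp only [psi1, lc_bv] <;>
    repeat' first
      | with_reducible exact Submodule.zero_mem _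
      | with_reducible refine Submodule.add_mem _ ?_ ?_
      | with_reducible refine Submodule.sub_mem _ ?_ ?_
      | with_reducible refine Submodule.neg_mem _ ?_
      | with_reducible refine Submodule.smul_mem _ _ ?_
      | exact w_mem_zPart_of_eq (by decide)

theorem isWt_psi1 (h2 : (2 : F) ≠ 0) (A B : Fin 3 → F) (b : Idx) :
    IsWt (zact α p χ lam hl) (wtF F b) (psi1 α p χ lam hl A B (bv b)) := by
  cases b <;> simp only [psi1, lc_bv] <;>
    repeat' first
      | with_reducible_and_instances exact isWt_zero _
      | with_reducible_and_instances refine IsWt.add ?_ ?_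
      | with_reducible_and_instances refine IsWt.sub ?_ ?_
      | with_reducible_and_instances refine IsWt.neg ?_
      | with_reducible_and_instances refine IsWt.smul _ ?_
      | exact isWt_w_of_eq h2 (by decide)

theorem psi2_mem_zPart (c : F) (b : Idx) :
    psi2 α p χ lam hl c (bv b) ∈ zPart α p χ lam hl (0 + par b) := by
  cases b <;> simp only [psi2, lc_bv] <;>
    repeat' first
      | with_reducible exact Submodule.zero_mem _
      | with_reducible refine Submodule.add_mem _ ?_ ?_
      | with_reducible refine Submodule.sub_mem _ ?_ ?_
      | with_reducible refine Submodule.neg_mem _ ?_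
      | with_reducible refine Submodule.smul_mem _ _ ?_
      | exact w_mem_zPart_of_eq (by decide)

theorem isWt_psi2 (h2 : (2 : F) ≠ 0) (c : F) (b : Idx) :
    IsWt (zact α p χ lam hl) (wtF F b) (psi2 α p χ lam hl c (bv b)) := by
  cases b <;> simp only [psi2, lc_bv] <;>
    repeat' first
      | with_reducible_and_instances exact isWt_zero _
      | with_reducible_and_instances refine IsWt.add ?_ ?_
      | with_reducible_and_instances refine IsWt.sub ?_ ?_
      | with_reducible_and_instances refine IsWt.neg ?_
      | with_reducible_and_instances refine IsWt.smul _ ?_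
      | exact isWt_w_of_eq h2 (by decide)

theorem psi3_mem_zPart (c : F) (b : Idx) :
    psi3 α p χ lam hl c (bv b) ∈ zPart α p χ lam hl (0 + par b) := by
  cases b <;> simp only [psi3, lc_bv] <;>
    repeat' first
      | with_reducible exact Submodule.zero_mem _
      | with_reducible refine Submodule.add_mem _ ?_ ?_
      | with_reducible refine Submodule.sub_mem _ ?_ ?_
      | with_reducible refine Submodule.neg_mem _ ?_
      | with_reducible refine Submodule.smul_mem _ _ ?_
      | exact w_mem_zPart_of_eq (by decide)

theorem isWt_psi3 (h2 : (2 : F) ≠ 0) (c : F) (b : Idx) :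
    IsWt (zact α p χ lam hl) (wtF F b) (psi3 α p χ lam hl c (bv b)) := by
  cases b <;> simp only [psi3, lc_bv] <;>
    repeat' first
      | with_reducible_and_instances exact isWt_zero _
      | with_reducible_and_instances refine IsWt.add ?_ ?_
      | with_reducible_and_instances refine IsWt.sub ?_ ?_
      | with_reducible_and_instances refine IsWt.neg ?_
      | with_reducible_and_instances refine IsWt.smul _ ?_
      | exact isWt_w_of_eq h2 (by decide)

theorem psi4_mem_zPart (c : F) (b : Idx) :
    psi4 α p χ lam hl c (bv b) ∈ zPart α p χ lam hl (1 + par b) := by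
  cases b <;> simp only [psi4, lc_bv] <;>
    repeat' first
      | with_reducible exact Submodule.zero_mem _
      | with_reducible refine Submodule.add_mem _ ?_ ?_
      | with_reducible refine Submodule.sub_mem _ ?_ ?_
      | with_reducible refine Submodule.neg_mem _ ?_
      | with_reducible refine Submodule.smul_mem _ _ ?_
      | exact w_mem_zPart_of_eq (by decide)

theorem isWt_psi4 (h2 : (2 : F) ≠ 0) (c : F) (b : Idx) :
    IsWt (zact α p χ lam hl) (wtF F b) (psi4 α p χ lam hl c (bv b)) := by
  cases b <;> simp only [psi4, lc_bv] <;>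
    repeat' first
      | with_reducible_and_instances exact isWt_zero _
      | with_reducible_and_instances refine IsWt.add ?_ ?_
      | with_reducible_and_instances refine IsWt.sub ?_ ?_
      | with_reducible_and_instances refine IsWt.neg ?_
      | with_reducible_and_instances refine IsWt.smul _ ?_
      | exact isWt_w_of_eq h2 (by decide)

theorem weightZero_of_mem_psiFamily (h2 : (2 : F) ≠ 0) {φ : G F →ₗ[F] Verma α p χ lam hl}
    (h : φ ∈ psiFamily α p χ lam hl) : WeightZero α p χ lam hl φ := by
  rcases h with ⟨-, A, B, rfl⟩ | ⟨-, c, rfl⟩ | ⟨-, c, rfl⟩ | ⟨-, c, rfl⟩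
  · exact weightZero_of_isWt (isWt_psi1 h2 A B)
  · exact weightZero_of_isWt (isWt_psi2 h2 c)
  · exact weightZero_of_isWt (isWt_psi3 h2 c)
  · exact weightZero_of_isWt (isWt_psi4 h2 c)

end Monomials

/-! ### The maps ψⱼ at their special weights -/

section Special

theorem natCast_of_charP_add_three (F : Type*) [Field F] (q : ℕ) [CharP F (q + 3)] :
    (q : F) = -3 := by
  have := CharP.cast_eq_zero F (q + 3)
  push_cast at this
  exact eq_neg_of_add_eq_zero_left this

/-- At its special weight the exponent classes in ψⱼ are 0, -1 and -2, whose least representatives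
are 0, p - 1 and p - 2. -/
theorem resid_small (F : Type*) [Field F] (q : ℕ) [CharP F (q + 3)] :
    (resid (0 : F) = 0 ∧ resid (-1 : F) = q + 2 ∧ resid (-2 : F) = q + 1) ∧
      IsPrimeElt (0 : F) ∧ IsPrimeElt (-1 : F) ∧ IsPrimeElt (-2 : F) := by
  have hq := natCast_of_charP_add_three F q
  have h1 : ((q + 2 : ℕ) : F) = -1 := by push_cast; rw [hq]; norm_num
  have h2 : ((q + 1 : ℕ) : F) = -2 := by push_cast; rw [hq]; norm_num
  exact ⟨⟨resid_eq (p := q + 3) (by omega) Nat.cast_zero, resid_eq (p := q + 3) (by omega) h1,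
    resid_eq (p := q + 3) (by omega) h2⟩, ⟨0, Nat.cast_zero⟩, ⟨_, h1⟩, ⟨_, h2⟩⟩

variable {α : F} {q : ℕ} {χ : Module.Dual F (gPart F 0)} {lam : Module.Dual F (cartan F)}
  {hl : Admissible (q + 3) χ lam} [CharP F (q + 3)]

theorem psi1_bv (h2 : (2 : F) ≠ 0) (hs : (fun i => lam (hC i)) = ![2, -2, -2]) (A B : Fin 3 → F) (b : Idx) :
    psi1 α (q + 3) χ lam hl A B (bv b) =
      psi1c α q (zact α (q + 3) χ lam hl) (vac α (q + 3) χ lam hl) A B b := by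
  obtain ⟨⟨r0, r1, r2⟩, p0, p1, p2⟩ := resid_small F q
  have s0 : lam (hC 0) = 2 := congrFun hs 0
  have s1 : lam (hC 1) = -2 := congrFun hs 1
  have s2 : lam (hC 2) = -2 := congrFun hs 2
  have d1 : (-2 : F) / 2 = -1 := by field_simp
  have d2 : (-4 : F) / 2 = -2 := by rw [div_eq_iff h2]; norm_num
  classical
  cases b <;>
    simp only [psi1, lc_bv, psi1c, w_eq, expo1, expo2, expo3, s0, s1, s2, Matrix.cons_val] <;>
    norm_num [d1, d2, r0, r1, r2, p0, p1, p2]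

theorem psi2_bv (h2 : (2 : F) ≠ 0) (hs : (fun i => lam (hC i)) = ![2, -2, 0]) (c : F) (b : Idx) :
    psi2 α (q + 3) χ lam hl c (bv b) =
      psi2c α q (zact α (q + 3) χ lam hl) (vac α (q + 3) χ lam hl) c b := by
  obtain ⟨⟨r0, r1, r2⟩, p0, p1, p2⟩ := resid_small F q
  have s0 : lam (hC 0) = 2 := congrFun hs 0
  have s1 : lam (hC 1) = -2 := congrFun hs 1
  have s2 : lam (hC 2) = 0 := congrFun hs 2
  have d1 : (-2 : F) / 2 = -1 := by field_simp
  have d2 : (-4 : F) / 2 = -2 := by rw [div_eq_iff h2]; norm_num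
  classical
  cases b <;>
    simp only [psi2, lc_bv, psi2c, w_eq, expo1, expo2, expo3, s0, s1, s2, Matrix.cons_val] <;>
    norm_num [d1, d2, r0, r1, r2, p0, p1, p2]

theorem psi3_bv (h2 : (2 : F) ≠ 0) (hs : (fun i => lam (hC i)) = ![2, 0, -2]) (c : F) (b : Idx) :
    psi3 α (q + 3) χ lam hl c (bv b) =
      psi3c q (zact α (q + 3) χ lam hl) (vac α (q + 3) χ lam hl) c b := by
  obtain ⟨⟨r0, r1, r2⟩, p0, p1, p2⟩ := resid_small F q
  have s0 : lam (hC 0) = 2 := congrFun hs 0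
  have s1 : lam (hC 1) = 0 := congrFun hs 1
  have s2 : lam (hC 2) = -2 := congrFun hs 2
  have d1 : (-2 : F) / 2 = -1 := by field_simp
  have d2 : (-4 : F) / 2 = -2 := by rw [div_eq_iff h2]; norm_num
  classical
  cases b <;>
    simp only [psi3, lc_bv, psi3c, w_eq, expo1, expo2, expo3, s0, s1, s2, Matrix.cons_val] <;>
    norm_num [d1, d2, r0, r1, r2, p0, p1, p2]

/-- At λ = (3,-3,-3) both (λ₂+1)/2 and (λ₃+1)/2 equal -1, so all four xₖ have coefficient -c, which
the sign twist for an odd map turns into c. -/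
theorem psi4_bv (h2 : (2 : F) ≠ 0) (hs : (fun i => lam (hC i)) = ![3, -3, -3]) (c : F) (b : Idx) :
    sgn F (1 * par b) • psi4 α (q + 3) χ lam hl c (bv b) =
      psi4c q (zact α (q + 3) χ lam hl) (vac α (q + 3) χ lam hl) c b := by
  obtain ⟨⟨r0, r1, r2⟩, p0, p1, p2⟩ := resid_small F q
  have s0 : lam (hC 0) = 3 := congrFun hs 0
  have s1 : lam (hC 1) = -3 := congrFun hs 1
  have s2 : lam (hC 2) = -3 := congrFun hs 2
  have d1 : (-2 : F) / 2 = -1 := by field_simp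
  have d2 : (-4 : F) / 2 = -2 := by rw [div_eq_iff h2]; norm_num
  classical
  cases b <;>
    simp only [psi4, lc_bv, psi4c, w_eq, expo1, expo2, expo3, s0, s1, s2, Matrix.cons_val, par, sgn] <;>
    norm_num [d1, d2, r0, r1, r2, p0, p1, p2]

end Special

theorem intCast_ne {p : ℕ} [CharP F p] {μ ν : Fin 3 → ℤ}
    (h : ∃ i, μ i ≠ ν i ∧ (μ i - ν i).natAbs < p) : (fun i => (μ i : F)) ≠ fun i => (ν i : F) := by
  obtain ⟨i, h1, h2⟩ := h
  intro he
  have h3 : (μ i : F) = ν i := congrFun he i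
  rw [← sub_eq_zero, ← Int.cast_sub, CharP.intCast_eq_zero_iff F p] at h3
  have h4 := Int.eq_zero_of_dvd_of_natAbs_lt_natAbs h3 (by simpa using h2)
  exact h1 (sub_eq_zero.1 h4)

theorem five_le {p : ℕ} [Fact p.Prime] (hp : 3 < p) : 5 ≤ p := by
  rcases Nat.lt_or_ge 4 p with h | h
  · exact h
  · obtain rfl : p = 4 := by omega
    exact absurd (Fact.out : Nat.Prime 4) (by decide)

/-- Integers that differ by less than five stay distinct modulo a prime p > 3. Comparing the
finitely many weights is thereby a decidable statement independent of p. -/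
theorem ne_wtF_add {p : ℕ} [Fact p.Prime] [CharP F p] (hp : 3 < p) {lam : Fin 3 → F} {μ : Fin 3 → ℤ}
    (hμ : botWt lam = fun i => (μ i : F))
    (h : ∀ b ∈ simpleIdx, ∀ c ∈ posIdx, ∃ i, μ i ≠ wt b i + wt c i ∧
      (μ i - (wt b i + wt c i)).natAbs < 5) :
    ∀ b ∈ simpleIdx, ∀ c ∈ posIdx, botWt lam ≠ wtF F b + wtF F c := by
  intro b hb c hc
  rw [hμ]
  obtain ⟨i, h1, h2⟩ := h b hb c hc
  convert intCast_ne (F := F) (p := p) (ν := fun i => wt b i + wt c i)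
    ⟨i, h1, h2.trans_le (five_le hp)⟩ using 1
  funext i
  simp [wtF]

theorem ne_wtF {p : ℕ} [Fact p.Prime] [CharP F p] (hp : 3 < p) {lam : Fin 3 → F} {μ : Fin 3 → ℤ}
    (hμ : botWt lam = fun i => (μ i : F)) {b : Idx}
    (h : ∃ i, μ i ≠ wt b i ∧ (μ i - wt b i).natAbs < 5) : botWt lam ≠ wtF F b := by
  rw [hμ]
  obtain ⟨i, h1, h2⟩ := h
  exact intCast_ne (F := F) (p := p) ⟨i, h1, h2.trans_le (five_le hp)⟩

/-- This explains the list of special weights: they are those for which the lowest monomial has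
weight zero or the weight of a simple root e₃, e₂, x₄. -/
theorem botWt_special {lam : Fin 3 → F} :
    (lam = ![2, -2, -2] → botWt lam = fun i => ((![0, 0, 0] : Fin 3 → ℤ) i : F)) ∧
    (lam = ![2, -2, 0] → botWt lam = fun i => ((![0, 0, 2] : Fin 3 → ℤ) i : F)) ∧
    (lam = ![2, 0, -2] → botWt lam = fun i => ((![0, 2, 0] : Fin 3 → ℤ) i : F)) ∧
    (lam = ![3, -3, -3] → botWt lam = fun i => ((![1, -1, -1] : Fin 3 → ℤ) i : F)) := by
  refine ⟨?_, ?_, ?_, ?_⟩ <;> rintro rfl <;> funext i <;> fin_cases i <;> simp [botWt] <;> norm_num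

theorem lam_of_botWt {lam : Fin 3 → F} :
    (botWt lam = wtF F e3 → lam = ![2, -2, 0]) ∧ (botWt lam = wtF F e2 → lam = ![2, 0, -2]) ∧
      (botWt lam = wtF F x4 → lam = ![3, -3, -3]) := by
  refine ⟨?_, ?_, ?_⟩ <;> intro h <;> funext i <;> have := congrFun h i <;>
    fin_cases i <;> simp [botWt, wtF, wt] at this ⊢ <;> linear_combination this

section Special

variable {α : F} {q : ℕ} {χ : Module.Dual F (gPart F 0)} {lam : Module.Dual F (cartan F)}
  {hl : Admissible (q + 3) χ lam} [Fact (q + 3).Prime] [CharP F (q + 3)]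

theorem Core.coc_psi1c (hp : 3 < q + 3) (hα : 1 + α ≠ 0)
    (hc : Core (q + 3) α (fun i => lam (hC i)) (zact α (q + 3) χ lam hl) (vac α (q + 3) χ lam hl))
    (hs : (fun i => lam (hC i)) = ![2, -2, -2]) (A B : Fin 3 → F) : Coc α Set.univ
      (zact α (q + 3) χ lam hl)
      (psi1c α q (zact α (q + 3) χ lam hl) (vac α (q + 3) χ lam hl) A B) := by
  have h2 : (2 : F) ≠ 0 := by
    exact_mod_cast natCast_ne_zero_of_lt (F := F) (p := q + 3) (n := 2) (by omega) (by omega)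
  have hμ := botWt_special.1 hs
  have hd := hc.psi1c_zdefect h2 hs A B
  refine hc.coc_of_generators hp hα (fun b => ?_) (fun i b => ?_) (fun b => (hd b).1)
    (fun b => (hd b).2.1) (fun b => (hd b).2.2) (ne_wtF_add hp hμ (by decide))
  · rw [← psi1_bv h2 hs]; exact isWt_psi1 h2 A B b
  -- Here ψ₁(hᵢ) is a multiple of the lowest monomial, which all of 𝔤 annihilates because its weight
  -- is zero and zero is not a simple root.
  · have : psi1c α q (zact α (q + 3) χ lam hl) (vac α (q + 3) χ lam hl) A B (hIdx i) =
        A i • bot (q + 3) (zact α (q + 3) χ lam hl) (vac α (q + 3) χ lam hl) := by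
      fin_cases i <;> rfl
    rw [this, map_smul, hc.bot_inv_all hp hα, smul_zero]
    · rw [hμ]; funext i; fin_cases i <;> simp
    · intro b hb
      have h := ne_wtF (b := b) hp hμ (by revert b; decide)
      convert h using 1
      rw [hμ]; funext i; fin_cases i <;> simp

theorem Core.coc_psi2c (hp : 3 < q + 3) (hα : 1 + α ≠ 0)
    (hc : Core (q + 3) α (fun i => lam (hC i)) (zact α (q + 3) χ lam hl) (vac α (q + 3) χ lam hl))
    (hs : (fun i => lam (hC i)) = ![2, -2, 0]) (c : F) : Coc α Set.univ
      (zact α (q + 3) χ lam hl)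
      (psi2c α q (zact α (q + 3) χ lam hl) (vac α (q + 3) χ lam hl) c) := by
  have h2 : (2 : F) ≠ 0 := by
    exact_mod_cast natCast_ne_zero_of_lt (F := F) (p := q + 3) (n := 2) (by omega) (by omega)
  have hd := hc.psi2c_zdefect h2 hs c
  refine hc.coc_of_generators hp hα (fun b => ?_) (fun i b => ?_) (fun b => (hd b).1)
    (fun b => (hd b).2.1) (fun b => (hd b).2.2)
    (ne_wtF_add hp (botWt_special.2.1 hs) (by decide))
  · rw [← psi2_bv h2 hs]; exact isWt_psi2 h2 c b
  · fin_cases i <;> exact map_zero _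

theorem Core.coc_psi3c (hp : 3 < q + 3) (hα : 1 + α ≠ 0)
    (hc : Core (q + 3) α (fun i => lam (hC i)) (zact α (q + 3) χ lam hl) (vac α (q + 3) χ lam hl))
    (hs : (fun i => lam (hC i)) = ![2, 0, -2]) (c : F) : Coc α Set.univ
      (zact α (q + 3) χ lam hl)
      (psi3c q (zact α (q + 3) χ lam hl) (vac α (q + 3) χ lam hl) c) := by
  have h2 : (2 : F) ≠ 0 := by
    exact_mod_cast natCast_ne_zero_of_lt (F := F) (p := q + 3) (n := 2) (by omega) (by omega)
  have hd := hc.psi3c_zdefect h2 hs c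
  refine hc.coc_of_generators hp hα (fun b => ?_) (fun i b => ?_) (fun b => (hd b).1)
    (fun b => (hd b).2.1) (fun b => (hd b).2.2)
    (ne_wtF_add hp (botWt_special.2.2.1 hs) (by decide))
  · rw [← psi3_bv h2 hs]; exact isWt_psi3 h2 c b
  · fin_cases i <;> exact map_zero _

theorem Core.coc_psi4c (hp : 3 < q + 3) (hα : 1 + α ≠ 0)
    (hc : Core (q + 3) α (fun i => lam (hC i)) (zact α (q + 3) χ lam hl) (vac α (q + 3) χ lam hl))
    (hs : (fun i => lam (hC i)) = ![3, -3, -3]) (c : F) : Coc α Set.univ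
      (zact α (q + 3) χ lam hl)
      (psi4c q (zact α (q + 3) χ lam hl) (vac α (q + 3) χ lam hl) c) := by
  have h2 : (2 : F) ≠ 0 := by
    exact_mod_cast natCast_ne_zero_of_lt (F := F) (p := q + 3) (n := 2) (by omega) (by omega)
  have hd := hc.psi4c_zdefect h2 hs c
  refine hc.coc_of_generators hp hα (fun b => ?_) (fun i b => ?_) (fun b => (hd b).1)
    (fun b => (hd b).2.1) (fun b => (hd b).2.2)
    (ne_wtF_add hp (botWt_special.2.2.2 hs) (by decide))
  · rw [← psi4_bv h2 hs]; exact (isWt_psi4 h2 c b).smul _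
  · fin_cases i <;> exact map_zero _

end Special

/-! ### Sums of cocycles and powers on ordered monomials -/

section Coc

variable {α : F} {Z : Type*} [AddCommGroup Z] [Module F Z] {a : Idx → Module.End F Z}

theorem Coc.sub {J : Set Idx} {φ ψ : Idx → Z} (hφ : Coc α J a φ) (hψ : Coc α J a ψ) :
    Coc α J a fun b => φ b - ψ b := by
  intro b hb c hc
  have h : ∀ g : G F, Finsupp.linearCombination F (fun b => φ b - ψ b) g =
      Finsupp.linearCombination F φ g - Finsupp.linearCombination F ψ g := by
    intro g
    simp only [Finsupp.linearCombination_apply, Finsupp.sum, smul_sub, Finset.sum_sub_distrib]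
  rw [h, hφ b hb c hc, hψ b hb c hc, map_sub, map_sub, smul_sub]
  abel

theorem Rel.coc_inner (h : Rel α Set.univ a) (m : Z) : Coc α Set.univ a fun b => a b m := by
  intro b _ c _
  rw [← linearCombination_apply_apply, h.apply trivial trivial, add_sub_cancel_left,
    linearCombination_apply_apply]

theorem NegRules.pow_fpow (h : NegRules α a) (k m n q : ℕ) (z : Z) :
    (a f1 ^ k) (fpow a m n q z) = fpow a (m + k) n q z ∧
    (a f2 ^ k) (fpow a m n q z) = fpow a m (n + k) q z ∧
    (a f3 ^ k) (fpow a m n q z) = fpow a m n (q + k) z := by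
  induction k with
  | zero => exact ⟨rfl, rfl, rfl⟩
  | succ k ih =>
    simp only [pow_succ', Module.End.mul_apply, ih, h.f_fpow, add_assoc, and_self]

end Coc

/-! ### Normalising a cocycle on 𝔥 ⊕ 𝔫⁻ -/

section Classify

variable {Z : Type*} [AddCommGroup Z] [Module F Z] {α : F} {lam : Fin 3 → F}
  {a : Idx → Module.End F Z} {v : Z} {φ : Idx → Z}

theorem Coc.act_h_eq_zero (hφ : Coc α Set.univ a φ) {y : Idx}
    (hy : φ y = 0) (i : Fin 3) : a y (φ (hIdx i)) = 0 := by
  have h := hφ (hIdx i) trivial y trivial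
  rw [brBasis_h, map_smul, lc_bv, hy, smul_zero, map_zero, par_hIdx, zero_mul, sgn, if_pos rfl,
    one_smul, zero_sub] at h
  exact neg_eq_zero.1 h.symm

/-- By `Coc.pow_apply` and fᵢ^p = 0 the vector fᵢ^(p-1) φ(fᵢ) is annihilated by all of 𝔤. It
therefore lies on the line of the lowest monomial, and 𝔥 forces it to be zero unless that line has
weight zero. -/
theorem Core.exists_top {p : ℕ} [Fact p.Prime] [CharP F p] (hp : 3 < p)
    (hc : Core p α lam a v) (hφ : Coc α Set.univ a φ) (i : Fin 3) :
    ∃ k : F, (a (fIdx i) ^ (p - 1)) (φ (fIdx i)) = k • bot p a v ∧ (botWt lam ≠ 0 → k = 0) := by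
  have h : ∀ b, a b ((a (fIdx i) ^ (p - 1)) (φ (fIdx i))) = 0 := fun b => by
    rw [hφ.pow_apply hc.rel hp (by fin_cases i <;> decide) b, hc.pow_f, LinearMap.zero_apply]
  obtain ⟨k, hk⟩ := hc.socle _ fun b _ => h b
  refine ⟨k, hk, fun h0 => ?_⟩
  obtain ⟨j, hj⟩ := Function.ne_iff.1 h0
  have h1 := h (hIdx j)
  rw [hk, map_smul, hc.isWt_bot hp j, smul_smul] at h1
  exact (mul_eq_zero.1 ((smul_eq_zero.1 h1).resolve_right hc.bot_ne_zero)).resolve_right hj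

/-- A cocycle is, up to an inner one, zero on `𝔫⁻` and a multiple of the lowest monomial on each
`hᵢ`. -/
theorem Core.exists_reduce {p : ℕ} (hc : Core p α lam a v) (hφ : Coc α Set.univ a φ)
    (h : ∀ i, (a (fIdx i) ^ (p - 1)) (φ (fIdx i)) = 0) :
    ∃ (m : Z) (r : Fin 3 → F), (∀ b ∈ negIdx, φ b = a b m) ∧
      ∀ i, φ (hIdx i) = a (hIdx i) m + r i • bot p a v := by
  obtain ⟨m, hm⟩ := hc.exists_inner_neg φ (fun b _ c _ => hφ b trivial c trivial) h
  have hψ := hφ.sub (hc.rel.coc_inner m)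
  have h1 : ∀ i, ∃ r : F, φ (hIdx i) - a (hIdx i) m = r • bot p a v := fun i =>
    hc.socle _ fun b hb => hψ.act_h_eq_zero (y := b) (by simp [hm b hb]) i
  choose r hr using h1
  exact ⟨m, r, hm, fun i => by rw [← hr, add_sub_cancel]⟩

/-- Since the hᵢ commute, the cocycle identity makes the coefficients of φ(hᵢ) proportional to the
weight of the lowest monomial. They are then those of the inner cocycle of a multiple of this
monomial, which does not change anything on 𝔫⁻. -/
theorem Core.exists_reduce_of_ne {p : ℕ} [Fact p.Prime] [CharP F p] (hp : 3 < p)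
    (hc : Core p α lam a v) (hφ : Coc α Set.univ a φ) (h0 : botWt lam ≠ 0) :
    ∃ m : Z, (∀ b ∈ negIdx, φ b = a b m) ∧ ∀ i, φ (hIdx i) = a (hIdx i) m := by
  obtain ⟨m, r, hm, hr⟩ := hc.exists_reduce hφ fun i => by
    obtain ⟨k, hk, hk0⟩ := hc.exists_top hp hφ i
    rw [hk, hk0 h0, zero_smul]
  obtain ⟨j, hj⟩ := Function.ne_iff.1 h0
  have hψ := hφ.sub (hc.rel.coc_inner m)
  have key : ∀ i, botWt lam j * r i = botWt lam i * r j := by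
    intro i
    have h := hψ (hIdx j) trivial (hIdx i) trivial
    have hw : wt (hIdx i) j = 0 := by fin_cases i <;> rfl
    simp only [hr, add_sub_cancel_left] at h
    rw [brBasis_h, hw, Int.cast_zero, zero_smul, map_zero, par_hIdx, zero_mul, sgn, if_pos rfl,
      one_smul, map_smul, map_smul, hc.isWt_bot hp, hc.isWt_bot hp, smul_smul, smul_smul,
      ← sub_smul] at h
    have := (smul_eq_zero.1 h.symm).resolve_right hc.bot_ne_zero
    linear_combination this
  refine ⟨m + (r j / botWt lam j) • bot p a v, fun b hb => ?_, fun i => ?_⟩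
  · rw [map_add, map_smul, hc.bot_inv b hb, smul_zero, add_zero, hm b hb]
  · rw [map_add, map_smul, hc.isWt_bot hp, hr, smul_smul]
    congr 2
    have hj' : botWt lam j ≠ 0 := hj
    field_simp
    linear_combination key i

end Classify

/-! ### Classification of cocycles -/

section PsiForms

variable {Z : Type*} [AddCommGroup Z] [Module F Z] {α : F} {lam : Fin 3 → F}
  {a : Idx → Module.End F Z} {v : Z} {q : ℕ}

theorem psi1c_add (A B A' B' : Fin 3 → F) (b : Idx) :
    psi1c α q a v (A + A') (B + B') b = psi1c α q a v A B b + psi1c α q a v A' B' b := by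
  cases b <;> simp only [psi1c, Pi.add_apply] <;> module

theorem psi1c_neg_zero (A : Fin 3 → F) {b : Idx} (hb : b ∈ negIdx) : psi1c α q a v A 0 b = 0 := by
  revert hb
  cases b <;> intro hb <;> first
    | exact absurd hb (by decide)
    | simp [psi1c]

theorem psi1c_h (A B : Fin 3 → F) (i : Fin 3) :
    psi1c α q a v A B (hIdx i) = A i • bot (q + 3) a v := by
  fin_cases i <;> rfl

/-- The parameters b of ψ₁ are its obstructions fᵢ^(p-1) φ(fᵢ), measured against the lowest
monomial. -/
theorem NegRules.pow_psi1c_f (h : NegRules α a) (A B : Fin 3 → F) (i : Fin 3) :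
    (a (fIdx i) ^ (q + 2)) (psi1c α q a v A B (fIdx i)) = B i • bot (q + 3) a v := by
  fin_cases i <;> simp [psi1c, fIdx, h.pow_fpow, bot]

theorem psi2c_eq_zero  {c : F} {b : Idx} (hb : b ∉ posIdx) : psi2c α q a v c b = 0 := by
  revert hb
  cases b <;> first | (intro _; rfl) | (intro h; exact absurd h (by decide))

theorem psi3c_eq_zero  {c : F} {b : Idx} (hb : b ∉ posIdx) : psi3c q a v c b = 0 := by
  revert hb
  cases b <;> first | (intro _; rfl) | (intro h; exact absurd h (by decide))

theorem psi4c_eq_zero  {c : F} {b : Idx} (hb : b ∉ posIdx) : psi4c q a v c b = 0 := by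
  revert hb
  cases b <;> first | (intro _; rfl) | (intro h; exact absurd h (by decide))

variable [Fact (q + 3).Prime] [CharP F (q + 3)]

/-- The superderivations of the baby Verma module up to inner ones. -/
theorem Core.classify (hp : 3 < q + 3) (hα : 1 + α ≠ 0) (hc : Core (q + 3) α lam a v) {φ : Idx → Z}
    (hφ : Coc α Set.univ a φ)
    (c1 : lam = ![2, -2, -2] → ∀ A B, Coc α Set.univ a (psi1c α q a v A B))
    (c2 : lam = ![2, -2, 0] → ∀ c, Coc α Set.univ a (psi2c α q a v c))
    (c3 : lam = ![2, 0, -2] → ∀ c, Coc α Set.univ a (psi3c q a v c))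
    (c4 : lam = ![3, -3, -3] → ∀ c, Coc α Set.univ a (psi4c q a v c)) :
    ∃ m, (∀ b, φ b = a b m) ∨
      (lam = ![2, -2, -2] ∧ ∃ A B, ∀ b, φ b = a b m + psi1c α q a v A B b) ∨
      (lam = ![2, -2, 0] ∧ ∃ c, ∀ b, φ b = a b m + psi2c α q a v c b) ∨
      (lam = ![2, 0, -2] ∧ ∃ c, ∀ b, φ b = a b m + psi3c q a v c b) ∨
      (lam = ![3, -3, -3] ∧ ∃ c, ∀ b, φ b = a b m + psi4c q a v c b) := by
  have h2 : (2 : F) ≠ 0 := by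
    exact_mod_cast natCast_ne_zero_of_lt (F := F) (p := q + 3) (n := 2) (by omega) (by omega)
  have hn := (hc.rel.mono (Set.subset_univ _)).negRules h2
  by_cases h0 : botWt lam = 0
  · have hs : lam = ![2, -2, -2] := by
      have e0 : lam 0 - 2 = 0 := congrFun h0 0
      have e1 : lam 1 + 2 = 0 := congrFun h0 1
      have e2 : lam 2 + 2 = 0 := congrFun h0 2
      funext i
      fin_cases i
      · exact sub_eq_zero.1 e0
      · exact eq_neg_of_add_eq_zero_left e1
      · exact eq_neg_of_add_eq_zero_left e2
    -- At weight zero the obstructions at the fᵢ are cancelled by ψ₁(0,B), which makes the rest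
    -- inner on 𝔫⁻; the remaining values at the hᵢ are cancelled by ψ₁(r,0). Nothing can be left at
    -- the simple roots, as none of them is zero.
    choose B hB _ using fun i => hc.exists_top hp hφ i
    have hφ1 := hφ.sub (c1 hs 0 B)
    obtain ⟨m, r, hm, hr⟩ := hc.exists_reduce hφ1 fun i => by
      rw [map_sub, hB]
      exact sub_eq_zero.2 (hn.pow_psi1c_f (q := q) (v := v) 0 B i).symm
    have hφ2 := (hφ1.sub (hc.rel.coc_inner m)).sub (c1 hs r 0)
    have z1 : ∀ b ∈ negIdx, φ b - psi1c α q a v 0 B b - a b m - psi1c α q a v r 0 b = 0 := by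
      intro b hb
      rw [hm b hb, sub_self, psi1c_neg_zero r hb, sub_zero]
    have z2 : ∀ i, φ (hIdx i) - psi1c α q a v 0 B (hIdx i) - a (hIdx i) m -
        psi1c α q a v r 0 (hIdx i) = 0 := by
      intro i
      rw [hr, psi1c_h, add_sub_cancel_left, sub_self]
    have z := Coc.eq_zero_of_generators (a := a) h2 hα hφ2 z1 z2 fun b hb =>
      hc.simple_eq_zero hp hφ2 z1 z2 hb (ne_wtF hp (botWt_special.1 hs) (by revert b; decide))
    refine ⟨m, Or.inr (Or.inl ⟨hs, r, B, fun b => ?_⟩)⟩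
    have := psi1c_add (α := α) (q := q) (a := a) (v := v) r 0 0 B b
    rw [add_zero, zero_add] at this
    rw [this, ← sub_eq_zero, ← z b]
    abel
  · obtain ⟨m, hm, hh⟩ := hc.exists_reduce_of_ne hp hφ h0
    have hφ1 := hφ.sub (hc.rel.coc_inner m)
    have z1 : ∀ b ∈ negIdx, φ b - a b m = 0 := fun b hb => by rw [hm b hb, sub_self]
    have z2 : ∀ i, φ (hIdx i) - a (hIdx i) m = 0 := fun i => by rw [hh, sub_self]
    have key : ∀ (ψ : Idx → Z), Coc α Set.univ a ψ → (∀ b ∈ negIdx, ψ b = 0) →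
        (∀ i, ψ (hIdx i) = 0) → (∀ b ∈ simpleIdx, φ b - a b m = ψ b) →
        ∀ b, φ b = a b m + ψ b := by
      intro ψ hψ k1 k2 k3 b
      have := Coc.eq_zero_of_generators (a := a) h2 hα (hφ1.sub hψ)
        (fun b hb => by rw [z1 b hb, k1 b hb, sub_self]) (fun i => by rw [z2, k2, sub_self])
        (fun b hb => by rw [k3 b hb, sub_self]) b
      rw [← sub_eq_zero, ← this]
      abel
    have hw := fun {b} hb => hc.simple_mem_socle hφ1 z1 z2 (b := b) hb
    have hw0 := fun {b} hb => hc.simple_eq_zero hp hφ1 z1 z2 (b := b) hb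
    have gen : ∀ (ψ : Idx → Z), (∀ b ∉ posIdx, ψ b = 0) → (∀ b ∈ negIdx, ψ b = 0) ∧
        ∀ i, ψ (hIdx i) = 0 := fun ψ h => ⟨fun b hb => h b (by revert b; decide),
          fun i => h _ (by fin_cases i <;> decide)⟩
    -- If the weight of the lowest monomial is a simple root, the value there is c times this
    -- monomial and the map ψ with parameter c removes it; the other two simple roots have different
    -- weights modulo p.
    by_cases b2 : botWt lam = wtF F e2
    · have hs := lam_of_botWt.2.1 b2
      obtain ⟨⟨c, hcc⟩, -⟩ := hw (b := e2) (by decide)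
      obtain ⟨g1, g2⟩ := gen (psi3c q a v c) (fun b hb => psi3c_eq_zero hb)
      refine ⟨m, Or.inr (Or.inr (Or.inr (Or.inl ⟨hs, c, key _ (c3 hs c) g1 g2 ?_⟩)))⟩
      intro b hb
      have hμ := fun h => hw0 hb (ne_wtF (b := b) hp (botWt_special.2.2.1 hs) h)
      simp only [simpleIdx, List.mem_cons, List.not_mem_nil, or_false] at hb
      rcases hb with rfl | rfl | rfl
      · exact hcc
      · exact hμ (by decide)
      · exact hμ (by decide)
    by_cases b3 : botWt lam = wtF F e3
    · have hs := lam_of_botWt.1 b3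
      obtain ⟨⟨c, hcc⟩, -⟩ := hw (b := e3) (by decide)
      obtain ⟨g1, g2⟩ := gen (psi2c α q a v c) (fun b hb => psi2c_eq_zero hb)
      refine ⟨m, Or.inr (Or.inr (Or.inl ⟨hs, c, key _ (c2 hs c) g1 g2 ?_⟩))⟩
      intro b hb
      have hμ := fun h => hw0 hb (ne_wtF (b := b) hp (botWt_special.2.1 hs) h)
      simp only [simpleIdx, List.mem_cons, List.not_mem_nil, or_false] at hb
      rcases hb with rfl | rfl | rfl
      · exact hμ (by decide)
      · exact hcc
      · exact hμ (by decide)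
    by_cases b4 : botWt lam = wtF F x4
    · have hs := lam_of_botWt.2.2 b4
      obtain ⟨⟨c, hcc⟩, -⟩ := hw (b := x4) (by decide)
      obtain ⟨g1, g2⟩ := gen (psi4c q a v c) (fun b hb => psi4c_eq_zero hb)
      refine ⟨m, Or.inr (Or.inr (Or.inr (Or.inr ⟨hs, c, key _ (c4 hs c) g1 g2 ?_⟩)))⟩
      intro b hb
      have hμ := fun h => hw0 hb (ne_wtF (b := b) hp (botWt_special.2.2.2 hs) h)
      simp only [simpleIdx, List.mem_cons, List.not_mem_nil, or_false] at hb
      rcases hb with rfl | rfl | rfl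
      · exact hμ (by decide)
      · exact hμ (by decide)
      · exact hcc
    refine ⟨m, Or.inl fun b => ?_⟩
    rw [← sub_eq_zero]
    refine Coc.eq_zero_of_generators (a := a) h2 hα hφ1 z1 z2 (fun b hb => hw0 hb ?_) b
    simp only [simpleIdx, List.mem_cons, List.not_mem_nil, or_false] at hb
    rcases hb with rfl | rfl | rfl
    exacts [b2, b3, b4]

end PsiForms

/-! ### Parameters of inner cocycles -/

section Inner

variable {Z : Type*} [AddCommGroup Z] [Module F Z] {α : F} {lam : Fin 3 → F}
  {a : Idx → Module.End F Z} {v : Z} {p q : ℕ}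

theorem Core.eq_zero_of_invariant [CharP F p] (hp : 3 < p) (hc : Core p α lam a v)
    (h0 : botWt lam ≠ 0) {m : Z} (hn : ∀ b ∈ negIdx, a b m = 0) (hh : ∀ i, a (hIdx i) m = 0) :
    m = 0 := by
  obtain ⟨k, rfl⟩ := hc.socle m hn
  obtain ⟨j, hj⟩ := Function.ne_iff.1 h0
  have h1 := hh j
  rw [map_smul, hc.isWt_bot hp j, smul_smul] at h1
  rw [(mul_eq_zero.1 ((smul_eq_zero.1 h1).resolve_right hc.bot_ne_zero)).resolve_right hj, zero_smul]

theorem Core.eq_zero_of_simple [CharP F p] (hp : 3 < p) (hα : 1 + α ≠ 0) (hc : Core p α lam a v)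
    {φ : Idx → Z} (hφ : Coc α Set.univ a φ) (hn : ∀ b ∈ negIdx, φ b = 0)
    (hh : ∀ i, φ (hIdx i) = 0) (h : ∀ b ∈ simpleIdx, φ b = 0 ∨ botWt lam ≠ wtF F b) (b : Idx) :
    φ b = 0 := by
  have h2 : (2 : F) ≠ 0 := by
    exact_mod_cast natCast_ne_zero_of_lt (F := F) (p := p) (n := 2) (by omega) (by omega)
  exact Coc.eq_zero_of_generators (a := a) h2 hα hφ hn hh
    (fun b hb => (h b hb).elim id fun h => hc.simple_eq_zero hp hφ hn hh hb h) b

/-- Inner cocycles have no obstruction at the fᵢ, because fᵢ^p = 0. -/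
theorem Core.pow_sub_one_apply {p : ℕ} (hp : 0 < p) (hc : Core p α lam a v) (i : Fin 3) (m : Z) :
    (a (fIdx i) ^ (p - 1)) (a (fIdx i) m) = 0 := by
  rw [← Module.End.mul_apply, ← pow_succ, Nat.sub_add_cancel hp, hc.pow_f, LinearMap.zero_apply]

/-- Comparing obstructions gives B = 0. The vector m is then 𝔫⁻-invariant, hence a multiple of the
lowest monomial, which 𝔥 kills at this weight; so the values at the hᵢ vanish and A = 0. -/
theorem Core.psi1c_param [CharP F (q + 3)] (hp : 3 < q + 3) (hc : Core (q + 3) α lam a v)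
    (hs : lam = ![2, -2, -2]) {A B : Fin 3 → F} {m : Z}
    (h : ∀ b, psi1c α q a v A B b = a b m) : A = 0 ∧ B = 0 := by
  have h2 : (2 : F) ≠ 0 := by
    exact_mod_cast natCast_ne_zero_of_lt (F := F) (p := q + 3) (n := 2) (by omega) (by omega)
  have hn := (hc.rel.mono (Set.subset_univ _)).negRules h2
  have hB : B = 0 := by
    funext i
    have h1 := hn.pow_psi1c_f (q := q) (v := v) A B i
    rw [h, show q + 2 = q + 3 - 1 from rfl, hc.pow_sub_one_apply (by omega)] at h1
    exact (smul_eq_zero.1 h1.symm).resolve_right hc.bot_ne_zero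
  refine ⟨funext fun i => ?_, hB⟩
  obtain ⟨k, rfl⟩ := hc.socle m fun b hb => by rw [← h, hB, psi1c_neg_zero A hb]
  have h1 := h (hIdx i)
  have h0 : botWt lam i = 0 := by
    rw [botWt_special.1 hs]; fin_cases i <;> simp
  rw [psi1c_h, map_smul, hc.isWt_bot hp, h0, zero_smul, smul_zero] at h1
  exact (smul_eq_zero.1 h1).resolve_right hc.bot_ne_zero

/-- The invariance of the vector of weight zero when `λ = (2, -2, 0)`. -/
theorem Core.weight_zero_vector₂ [CharP F (q + 3)] (h2 : (2 : F) ≠ 0)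
    (hc : Core (q + 3) α lam a v) (hs : lam = ![2, -2, 0]) :
    (a f1 (fpow a (q + 2) (q + 2) 0 (yvec a v 1 1 1 1)) = 0 ∧
      a f2 (fpow a (q + 2) (q + 2) 0 (yvec a v 1 1 1 1)) = 0 ∧
      a y1 (fpow a (q + 2) (q + 2) 0 (yvec a v 1 1 1 1)) = 0 ∧
      a y2 (fpow a (q + 2) (q + 2) 0 (yvec a v 1 1 1 1)) = 0 ∧
      a y3 (fpow a (q + 2) (q + 2) 0 (yvec a v 1 1 1 1)) = 0 ∧
      a y4 (fpow a (q + 2) (q + 2) 0 (yvec a v 1 1 1 1)) = 0) ∧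
    (∀ i, a (hIdx i) (fpow a (q + 2) (q + 2) 0 (yvec a v 1 1 1 1)) = 0) ∧
      a e3 (fpow a (q + 2) (q + 2) 0 (yvec a v 1 1 1 1)) = 0 := by
  have hq := natCast_of_charP_add_three F q
  obtain ⟨f21, f31, f32, y1f1, y2f1, y3f1, y4f1, y1f2, y2f2, y3f2, y4f2, y1f3, y2f3, y3f3, y4f3, y11,
    y22, y33, y44, y21, y31, y41, y32, y42, y43⟩ := (hc.rel.mono (Set.subset_univ _)).negRules h2
  have v2 := hc.h_vac 2
  have vp : a e3 v = 0 := hc.pos_vac _ (by decide)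
  simp only [hIdx, hs, Matrix.cons_val] at v2
  refine ⟨?_, fun i => ?_, ?_⟩
  · simp only [fpow, yvec, pow_zero, pow_one, Module.End.one_apply, map_zero, map_add, map_sub,
      map_neg, map_smul, smul_zero, add_zero, zero_add, sub_self, neg_zero, sub_zero,
      f21, f31, f32, y1f1, y2f1, y3f1, y4f1, y1f2, y2f2, y3f2, y4f2, y1f3,
      y2f3, y3f3, y4f3, y11, y22, y33, y44, y21, y31, y41, y32, y42, y43, hc.rel.posRules,
      hc.rel.powCommRules, hc.rel.powSwapRules hq, hc.rel.powMergeRules hc.pow_f, and_self]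
  · have h := isWt_monomial hc.rel hc.h_vac (q + 2) (q + 2) 0 1 1 1 1 i
    rw [h]
    convert zero_smul F _ using 2
    push_cast
    rw [hs, hq]
    fin_cases i <;> simp [wtF, wt] <;> norm_num
  · simp only [fpow, yvec, pow_zero, pow_one, Module.End.one_apply, map_zero, map_add, map_sub,
      map_neg, map_smul, smul_zero, add_zero, zero_add, sub_self, neg_zero, sub_zero,
      f21, f31, f32, y1f1, y2f1, y3f1, y4f1, y1f2, y2f2, y3f2, y4f2, y1f3,
      y2f3, y3f3, y4f3, y11, y22, y33, y44, y21, y31, y41, y32, y42, y43, hc.rel.posRules,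
      hc.rel.powCommRules, hc.rel.powSwapRules hq, hc.rel.powMergeRules hc.pow_f, v2, vp]

/-- The invariance of the vector of weight zero when `λ = (2, 0, -2)`. -/
theorem Core.weight_zero_vector₃ [CharP F (q + 3)] (h2 : (2 : F) ≠ 0)
    (hc : Core (q + 3) α lam a v) (hs : lam = ![2, 0, -2]) :
    (a f1 (fpow a (q + 2) 0 (q + 2) (yvec a v 1 1 1 1)) = 0 ∧
      a f3 (fpow a (q + 2) 0 (q + 2) (yvec a v 1 1 1 1)) = 0 ∧
      a y1 (fpow a (q + 2) 0 (q + 2) (yvec a v 1 1 1 1)) = 0 ∧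
      a y2 (fpow a (q + 2) 0 (q + 2) (yvec a v 1 1 1 1)) = 0 ∧
      a y3 (fpow a (q + 2) 0 (q + 2) (yvec a v 1 1 1 1)) = 0 ∧
      a y4 (fpow a (q + 2) 0 (q + 2) (yvec a v 1 1 1 1)) = 0) ∧
    (∀ i, a (hIdx i) (fpow a (q + 2) 0 (q + 2) (yvec a v 1 1 1 1)) = 0) ∧
      a e2 (fpow a (q + 2) 0 (q + 2) (yvec a v 1 1 1 1)) = 0 := by
  have hq := natCast_of_charP_add_three F q
  obtain ⟨f21, f31, f32, y1f1, y2f1, y3f1, y4f1, y1f2, y2f2, y3f2, y4f2, y1f3, y2f3, y3f3, y4f3, y11,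
    y22, y33, y44, y21, y31, y41, y32, y42, y43⟩ := (hc.rel.mono (Set.subset_univ _)).negRules h2
  have v2 := hc.h_vac 1
  have vp : a e2 v = 0 := hc.pos_vac _ (by decide)
  simp only [hIdx, hs, Matrix.cons_val] at v2
  refine ⟨?_, fun i => ?_, ?_⟩
  · simp only [fpow, yvec, pow_zero, pow_one, Module.End.one_apply, map_zero, map_add, map_sub,
      map_neg, map_smul, smul_zero, add_zero, zero_add, sub_self, neg_zero, sub_zero,
      f21, f31, f32, y1f1, y2f1, y3f1, y4f1, y1f2, y2f2, y3f2, y4f2, y1f3,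
      y2f3, y3f3, y4f3, y11, y22, y33, y44, y21, y31, y41, y32, y42, y43, hc.rel.posRules,
      hc.rel.powCommRules, hc.rel.powSwapRules hq, hc.rel.powMergeRules hc.pow_f, and_self]
  · have h := isWt_monomial hc.rel hc.h_vac (q + 2) 0 (q + 2) 1 1 1 1 i
    rw [h]
    convert zero_smul F _ using 2
    push_cast
    rw [hs, hq]
    fin_cases i <;> simp [wtF, wt] <;> norm_num
  · simp only [fpow, yvec, pow_zero, pow_one, Module.End.one_apply, map_zero, map_add, map_sub,
      map_neg, map_smul, smul_zero, add_zero, zero_add, sub_self, neg_zero, sub_zero,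
      f21, f31, f32, y1f1, y2f1, y3f1, y4f1, y1f2, y2f2, y3f2, y4f2, y1f3,
      y2f3, y3f3, y4f3, y11, y22, y33, y44, y21, y31, y41, y32, y42, y43, hc.rel.posRules,
      hc.rel.powCommRules, hc.rel.powSwapRules hq, hc.rel.powMergeRules hc.pow_f, v2, vp]

/-- If a cocycle of the form of `ψ₁` at `λ = (2, -2, 0)` is inner up to a multiple of `ψ₂`, then it
is inner. -/
theorem Core.psi2c_coeff_eq_zero [CharP F (q + 3)] (hp : 3 < q + 3) (hc : Core (q + 3) α lam a v)
    (hs : lam = ![2, -2, 0]) {A B : Fin 3 → F} {ψ : Idx → Z} {m : Z} {c : F}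
    (k0 : ψ f1 = B 0 • fpow a 0 (q + 2) 0 (yvec a v 1 1 1 1))
    (k2 : ψ f3 = B 2 • fpow a (q + 2) (q + 2) 1 (yvec a v 1 1 1 1))
    (k1 : ψ f2 = B 1 • fpow a (q + 2) 0 0 (yvec a v 1 1 1 1))
    (kh : ∀ i, ψ (hIdx i) = A i • fpow a (q + 2) (q + 2) 0 (yvec a v 1 1 1 1))
    (ky : B 0 = 0 → ψ y1 = 0 ∧ ψ y2 = 0 ∧ ψ y3 = 0 ∧ ψ y4 = 0)
    (ke : ψ e3 = -(A 2 • fpow a (q + 2) (q + 2) (q + 2) (yvec a v 1 1 1 1)))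
    (h : ∀ b, ψ b = a b m + psi2c α q a v c b) : c = 0 := by
  have h2 : (2 : F) ≠ 0 := by
    exact_mod_cast natCast_ne_zero_of_lt (F := F) (p := q + 3) (n := 2) (by omega) (by omega)
  have hn := (hc.rel.mono (Set.subset_univ _)).negRules h2
  obtain ⟨⟨tf1, tf2, ty1, ty2, ty3, ty4⟩, th, te⟩ := hc.weight_zero_vector₂ h2 hs
  -- The vector `t` has weight zero; 𝔥, e₃ and all of 𝔫⁻ except f₃ annihilate it, while f₃^(p-1)
  -- carries it to the lowest monomial.
  set t := fpow a (q + 2) (q + 2) 0 (yvec a v 1 1 1 1) with ht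
  have tb : (a f3 ^ (q + 2)) t = bot (q + 3) a v := by
    rw [ht, (hn.pow_fpow _ _ _ _ _).2.2, zero_add]; rfl
  have t0 : t ≠ 0 := fun h => hc.bot_ne_zero (by rw [← tb, h, map_zero])
  -- Applying f₁^(p-1) to ψ(f₁) = f₁ m gives zero on the right and `B 0 • t` on the left.
  have hB0 : B 0 = 0 := by
    have h1 := h f1
    rw [k0, show psi2c α q a v c f1 = 0 from rfl, add_zero] at h1
    have h3 := congrArg (a f1 ^ (q + 2)) h1
    rw [map_smul, (hn.pow_fpow _ _ _ _ _).1, zero_add, ← ht] at h3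
    rw [show (a f1 ^ (q + 2)) (a f1 m) = 0 from hc.pow_sub_one_apply (by omega) 0 m] at h3
    exact (smul_eq_zero.1 h3).resolve_right t0
  have hB1 : B 1 = 0 := by
    have h1 := h f2
    rw [k1, show psi2c α q a v c f2 = 0 from rfl, add_zero] at h1
    have h3 := congrArg (a f2 ^ (q + 2)) h1
    rw [map_smul, (hn.pow_fpow _ _ _ _ _).2.1, zero_add, ← ht] at h3
    rw [show (a f2 ^ (q + 2)) (a f2 m) = 0 from hc.pow_sub_one_apply (by omega) 1 m] at h3
    exact (smul_eq_zero.1 h3).resolve_right t0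
  obtain ⟨ky1, ky2, ky3, ky4⟩ := ky hB0
  -- The value at f₃ is `B 2` times f₃ t, so m - `B 2 • t` is annihilated by 𝔫⁻ and is a multiple k
  -- of the lowest monomial.
  have hm : m - B 2 • t = 0 ∧ A 2 = 0 := by
    have hneg : ∀ b ∈ negIdx, a b (m - B 2 • t) = 0 := by
      intro b hb
      have h1 := h b
      rw [map_sub, map_smul]
      revert h1
      revert hb
      cases b <;> intro hb <;> first
        | exact absurd hb (by decide)
        | (intro h1
           simp only [psi2c, add_zero, k0, k1, k2, ky1, ky2, ky3, ky4, hB0, hB1, zero_smul] at h1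
           simp only [← h1, tf1, tf2, ty1, ty2, ty3, ty4, smul_zero, sub_zero]
           try rw [ht, (hn.f_fpow _ _ _ _).2.2, sub_self])
    obtain ⟨k, hk⟩ := hc.socle _ hneg
    have hA : ∀ i, A i • t = (k * botWt lam i) • bot (q + 3) a v := by
      intro i
      have h1 := h (hIdx i)
      have h3 : psi2c α q a v c (hIdx i) = 0 := by fin_cases i <;> rfl
      rw [kh, h3, add_zero, ← sub_add_cancel m (B 2 • t), hk, map_add, map_smul, map_smul, th,
        hc.isWt_bot hp, smul_zero, add_zero, smul_smul] at h1
      exact h1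
    -- Applying f₃^(p-1) to the equation for h₃ kills the multiple of the lowest monomial. With `A 2
    -- = 0` the same equation gives k = 0, since the lowest monomial has h₃-weight 2.
    have hA2 : A 2 = 0 := by
      have h1 := congrArg (a f3 ^ (q + 2)) (hA 2)
      rw [map_smul, tb, map_smul, pow_succ, Module.End.mul_apply, hc.bot_inv f3 (by decide),
        map_zero, smul_zero] at h1
      exact (smul_eq_zero.1 h1).resolve_right hc.bot_ne_zero
    refine ⟨?_, hA2⟩
    have h1 := hA 2
    rw [hA2, zero_smul] at h1
    have h3 := (smul_eq_zero.1 h1.symm).resolve_right hc.bot_ne_zero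
    have h4 : botWt lam 2 = 2 := by rw [botWt_special.2.1 hs]; simp
    rw [h4] at h3
    rw [hk, (mul_eq_zero.1 h3).resolve_right h2, zero_smul]
  -- Now m is a multiple of `t`, so e₃ m = 0; what remains at e₃ is c times the lowest monomial,
  -- equal to its multiple by -`A 2` = 0.
  have h1 := h e3
  rw [ke, hm.2, zero_smul, neg_zero, sub_eq_zero.1 hm.1, map_smul, te, smul_zero, zero_add] at h1
  exact (smul_eq_zero.1 h1.symm).resolve_right hc.bot_ne_zero

/-- If a cocycle of the form of `ψ₁` at `λ = (2, 0, -2)` is inner up to a multiple of `ψ₃`, then it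
is inner. -/
theorem Core.psi3c_coeff_eq_zero [CharP F (q + 3)] (hp : 3 < q + 3) (hc : Core (q + 3) α lam a v)
    (hs : lam = ![2, 0, -2]) {A B : Fin 3 → F} {ψ : Idx → Z} {m : Z} {c : F}
    (k0 : ψ f1 = B 0 • fpow a 0 0 (q + 2) (yvec a v 1 1 1 1))
    (k1 : ψ f2 = B 1 • fpow a (q + 2) 1 (q + 2) (yvec a v 1 1 1 1))
    (k2 : ψ f3 = B 2 • fpow a (q + 2) 0 0 (yvec a v 1 1 1 1))
    (kh : ∀ i, ψ (hIdx i) = A i • fpow a (q + 2) 0 (q + 2) (yvec a v 1 1 1 1))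
    (ky : B 0 = 0 → ψ y1 = 0 ∧ ψ y2 = 0 ∧ ψ y3 = 0 ∧ ψ y4 = 0)
    (ke : B 0 = 0 → ψ e2 = -(A 1 • fpow a (q + 2) (q + 2) (q + 2) (yvec a v 1 1 1 1)))
    (h : ∀ b, ψ b = a b m + psi3c q a v c b) : c = 0 := by
  have h2 : (2 : F) ≠ 0 := by
    exact_mod_cast natCast_ne_zero_of_lt (F := F) (p := q + 3) (n := 2) (by omega) (by omega)
  have hn := (hc.rel.mono (Set.subset_univ _)).negRules h2
  obtain ⟨⟨tf1, tf3, ty1, ty2, ty3, ty4⟩, th, te⟩ := hc.weight_zero_vector₃ h2 hs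
  set t := fpow a (q + 2) 0 (q + 2) (yvec a v 1 1 1 1) with ht
  have tb : (a f2 ^ (q + 2)) t = bot (q + 3) a v := by
    rw [ht, (hn.pow_fpow _ _ _ _ _).2.1, zero_add]; rfl
  have t0 : t ≠ 0 := fun h => hc.bot_ne_zero (by rw [← tb, h, map_zero])
  have hB0 : B 0 = 0 := by
    have h1 := h f1
    rw [k0, show psi3c q a v c f1 = 0 from rfl, add_zero] at h1
    have h3 := congrArg (a f1 ^ (q + 2)) h1
    rw [map_smul, (hn.pow_fpow _ _ _ _ _).1, zero_add, ← ht] at h3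
    rw [show (a f1 ^ (q + 2)) (a f1 m) = 0 from hc.pow_sub_one_apply (by omega) 0 m] at h3
    exact (smul_eq_zero.1 h3).resolve_right t0
  have hB2 : B 2 = 0 := by
    have h1 := h f3
    rw [k2, show psi3c q a v c f3 = 0 from rfl, add_zero] at h1
    have h3 := congrArg (a f3 ^ (q + 2)) h1
    rw [map_smul, (hn.pow_fpow _ _ _ _ _).2.2, zero_add, ← ht] at h3
    rw [show (a f3 ^ (q + 2)) (a f3 m) = 0 from hc.pow_sub_one_apply (by omega) 2 m] at h3
    exact (smul_eq_zero.1 h3).resolve_right t0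
  obtain ⟨ky1, ky2, ky3, ky4⟩ := ky hB0
  have hm : m - B 1 • t = 0 ∧ A 1 = 0 := by
    have hneg : ∀ b ∈ negIdx, a b (m - B 1 • t) = 0 := by
      intro b hb
      have h1 := h b
      rw [map_sub, map_smul]
      revert h1
      revert hb
      cases b <;> intro hb <;> first
        | exact absurd hb (by decide)
        | (intro h1
           simp only [psi3c, add_zero, k0, k1, k2, ky1, ky2, ky3, ky4, hB0, hB2, zero_smul] at h1
           simp only [← h1, tf1, tf3, ty1, ty2, ty3, ty4, smul_zero, sub_zero]
           try rw [ht, (hn.f_fpow _ _ _ _).2.1, sub_self])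
    obtain ⟨k, hk⟩ := hc.socle _ hneg
    have hA : ∀ i, A i • t = (k * botWt lam i) • bot (q + 3) a v := by
      intro i
      have h1 := h (hIdx i)
      have h3 : psi3c q a v c (hIdx i) = 0 := by fin_cases i <;> rfl
      rw [kh, h3, add_zero, ← sub_add_cancel m (B 1 • t), hk, map_add, map_smul, map_smul, th,
        hc.isWt_bot hp, smul_zero, add_zero, smul_smul] at h1
      exact h1
    have hA2 : A 1 = 0 := by
      have h1 := congrArg (a f2 ^ (q + 2)) (hA 1)
      rw [map_smul, tb, map_smul, pow_succ, Module.End.mul_apply, hc.bot_inv f2 (by decide),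
        map_zero, smul_zero] at h1
      exact (smul_eq_zero.1 h1).resolve_right hc.bot_ne_zero
    refine ⟨?_, hA2⟩
    have h1 := hA 1
    rw [hA2, zero_smul] at h1
    have h3 := (smul_eq_zero.1 h1.symm).resolve_right hc.bot_ne_zero
    have h4 : botWt lam 1 = 2 := by rw [botWt_special.2.2.1 hs]; simp
    rw [h4] at h3
    rw [hk, (mul_eq_zero.1 h3).resolve_right h2, zero_smul]
  have h1 := h e2
  -- Unlike ψ₁(e₃), the value at e₂ has a further term with coefficient `B 0`, which is already
  -- known to vanish.
  rw [ke hB0, hm.2, zero_smul, neg_zero, sub_eq_zero.1 hm.1, map_smul, te, smul_zero, zero_add] at h1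
  exact (smul_eq_zero.1 h1.symm).resolve_right hc.bot_ne_zero

end Inner

/-! ### From cocycles back to superderivations -/

section Main

theorem special_iff {p : ℕ} [CharP F p] {χ : Module.Dual F (gPart F 0)}
    {lam : Module.Dual F (cartan F)} {l m : Fin 3 → ℤ} (h : ∀ i, ∃ k : ℤ, l i = p * k + m i) :
    Special p χ lam l ↔ (fun i => lam (hC i)) = (fun i => (m i : F)) ∧ ∀ i, chiF χ i ^ p = 0 := by
  have hlm : ∀ i, (l i : F) = m i := by
    intro i
    obtain ⟨k, hk⟩ := h i
    rw [hk]
    simp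
  simp only [Special, hlm, funext_iff]

theorem special_iffs {p : ℕ} [CharP F p] (χ : Module.Dual F (gPart F 0))
    (lam : Module.Dual F (cartan F)) :
    (Special p χ lam ![2 * p + 2, 2 * p - 2, 2 * p - 2] ↔
      (fun i => lam (hC i)) = ![2, -2, -2] ∧ ∀ i, chiF χ i ^ p = 0) ∧
    (Special p χ lam ![2 * p + 2, 2 * p - 2, 2 * p] ↔
      (fun i => lam (hC i)) = ![2, -2, 0] ∧ ∀ i, chiF χ i ^ p = 0) ∧
    (Special p χ lam ![2 * p + 2, 2 * p, 2 * p - 2] ↔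
      (fun i => lam (hC i)) = ![2, 0, -2] ∧ ∀ i, chiF χ i ^ p = 0) ∧
    (Special p χ lam ![2 * p + 3, 2 * p - 3, 2 * p - 3] ↔
      (fun i => lam (hC i)) = ![3, -3, -3] ∧ ∀ i, chiF χ i ^ p = 0) := by
  have e : ∀ x y z : ℤ, (fun i => ((![x, y, z] i : ℤ) : F)) = ![(x : F), y, z] := by
    intro x y z
    funext i
    fin_cases i <;> rfl
  refine ⟨?_, ?_, ?_, ?_⟩
  · rw [special_iff (m := ![2, -2, -2]) (fun i => ⟨2, by fin_cases i <;> simp <;> ring⟩), e]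
    norm_num
  · rw [special_iff (m := ![2, -2, 0]) (fun i => ⟨2, by fin_cases i <;> simp <;> ring⟩), e]
    norm_num
  · rw [special_iff (m := ![2, 0, -2]) (fun i => ⟨2, by fin_cases i <;> simp <;> ring⟩), e]
    norm_num
  · rw [special_iff (m := ![3, -3, -3]) (fun i => ⟨2, by fin_cases i <;> simp <;> ring⟩), e]
    norm_num

variable {α : F} {q : ℕ} {χ : Module.Dual F (gPart F 0)} {lam : Module.Dual F (cartan F)}
  {hl : Admissible (q + 3) χ lam} [Fact (q + 3).Prime] [CharP F (q + 3)]

theorem two_ne_zero_of_charP {p : ℕ} [CharP F p] (hp : 3 < p) : (2 : F) ≠ 0 := by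
  exact_mod_cast natCast_ne_zero_of_lt (F := F) (p := p) (n := 2) (by omega) (by omega)

theorem sgn_zero_mul_smul {M : Type*} [AddCommGroup M] [Module F M] (i : ZMod 2) (z : M) :
    sgn F (0 * i) • z = z := by
  rw [zero_mul, sgn, if_pos rfl, one_smul]

theorem isHomDer_psi (hp : 3 < q + 3) (hα : 1 + α ≠ 0) (hχ : ∀ i, chiF χ i ^ (q + 3) = 0) :
    ((fun i => lam (hC i)) = ![2, -2, -2] → ∀ A B,
      IsHomDer α (q + 3) χ lam hl 0 (psi1 α (q + 3) χ lam hl A B)) ∧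
    ((fun i => lam (hC i)) = ![2, -2, 0] → ∀ c,
      IsHomDer α (q + 3) χ lam hl 0 (psi2 α (q + 3) χ lam hl c)) ∧
    ((fun i => lam (hC i)) = ![2, 0, -2] → ∀ c,
      IsHomDer α (q + 3) χ lam hl 0 (psi3 α (q + 3) χ lam hl c)) ∧
    ((fun i => lam (hC i)) = ![3, -3, -3] → ∀ c,
      IsHomDer α (q + 3) χ lam hl 1 (psi4 α (q + 3) χ lam hl c)) := by
  have hc := core_verma (α := α) (hl := hl) hp hχ
  have h2 : (2 : F) ≠ 0 := two_ne_zero_of_charP hp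
  refine ⟨fun hs A B => ?_, fun hs c => ?_, fun hs c => ?_, fun hs c => ?_⟩
  · refine isHomDer_iff.2 ⟨psi1_mem_zPart A B, ?_⟩
    simpa only [sgn_zero_mul_smul, psi1_bv h2 hs] using hc.coc_psi1c hp hα hs A B
  · refine isHomDer_iff.2 ⟨psi2_mem_zPart c, ?_⟩
    simpa only [sgn_zero_mul_smul, psi2_bv h2 hs] using hc.coc_psi2c hp hα hs c
  · refine isHomDer_iff.2 ⟨psi3_mem_zPart c, ?_⟩
    simpa only [sgn_zero_mul_smul, psi3_bv h2 hs] using hc.coc_psi3c hp hα hs c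
  · refine isHomDer_iff.2 ⟨psi4_mem_zPart c, ?_⟩
    simpa only [psi4_bv h2 hs] using hc.coc_psi4c hp hα hs c

/-- A homogeneous superderivation is, up to an inner one, zero or one of the special ones. -/
theorem IsHomDer.mem_Ider_or (hp : 3 < q + 3) (hα : 1 + α ≠ 0) {i : ZMod 2}
    {φ : G F →ₗ[F] Verma α (q + 3) χ lam hl} (hφ : IsHomDer α (q + 3) χ lam hl i φ) :
    φ ∈ Ider α (q + 3) χ lam hl ∨
      ∃ ψ ∈ psiFamily α (q + 3) χ lam hl, φ - ψ ∈ Ider α (q + 3) χ lam hl := by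
  by_cases hχ : ∀ i, chiF χ i ^ (q + 3) = 0
  swap
  · push Not at hχ
    exact Or.inl (mem_Ider_of_chi_ne hp (Or.inl hχ) (Submodule.subset_span ⟨i, hφ⟩))
  have hc := core_verma (α := α) (hl := hl) hp hχ
  have h2 : (2 : F) ≠ 0 := two_ne_zero_of_charP hp
  have hd := isHomDer_iff.1 hφ
  obtain ⟨s1, s2, s3, s4⟩ := special_iffs (p := q + 3) χ lam
  obtain ⟨m, h | ⟨hs, A, B, h⟩ | ⟨hs, c, h⟩ | ⟨hs, c, h⟩ | ⟨hs, c, h⟩⟩ := hc.classify hp hα hd.2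
    (hc.coc_psi1c hp hα) (hc.coc_psi2c hp hα) (hc.coc_psi3c hp hα) (hc.coc_psi4c hp hα)
  · exact Or.inl (mem_Ider_of_inner hp hd.1 h)
  · refine (mem_Ider_of_plain hp hd.1 (psi1_mem_zPart A B) (m := m) fun b => ?_).imp_right fun k =>
      ⟨_, Or.inl ⟨s1.2 ⟨hs, hχ⟩, A, B, rfl⟩, k.2⟩
    rw [h, sgn_zero_mul_smul, psi1_bv h2 hs]
  · refine (mem_Ider_of_plain hp hd.1 (psi2_mem_zPart c) (m := m) fun b => ?_).imp_right fun k =>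
      ⟨_, Or.inr (Or.inl ⟨s2.2 ⟨hs, hχ⟩, c, rfl⟩), k.2⟩
    rw [h, sgn_zero_mul_smul, psi2_bv h2 hs]
  · refine (mem_Ider_of_plain hp hd.1 (psi3_mem_zPart c) (m := m) fun b => ?_).imp_right fun k =>
      ⟨_, Or.inr (Or.inr (Or.inl ⟨s3.2 ⟨hs, hχ⟩, c, rfl⟩)), k.2⟩
    rw [h, sgn_zero_mul_smul, psi3_bv h2 hs]
  · refine (mem_Ider_of_plain hp hd.1 (psi4_mem_zPart c) (m := m) fun b => ?_).imp_right fun k =>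
      ⟨_, Or.inr (Or.inr (Or.inr ⟨s4.2 ⟨hs, hχ⟩, c, rfl⟩)), k.2⟩
    rw [h, psi4_bv h2 hs]

/-- The decomposition holds for every superderivation, separately for its even and its odd
component. The weight condition is needed only for the inner part: it is the difference of φ and of
maps of weight zero. -/
theorem exists_decomposition (hp : 3 < q + 3) (hα : 1 + α ≠ 0)
    {φ : G F →ₗ[F] Verma α (q + 3) χ lam hl} (hφ : φ ∈ Der α (q + 3) χ lam hl)
    (hw : WeightZero α (q + 3) χ lam hl φ) :
    ∃ φ₁ ∈ Ider α (q + 3) χ lam hl, WeightZero α (q + 3) χ lam hl φ₁ ∧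
      ∃ φ₂ ∈ Submodule.span F (psiFamily α (q + 3) χ lam hl), φ = φ₁ + φ₂ := by
  have h2 : (2 : F) ≠ 0 := two_ne_zero_of_charP hp
  have key : ∀ i (φ : G F →ₗ[F] Verma α (q + 3) χ lam hl), IsHomDer α (q + 3) χ lam hl i φ →
      ∃ ψ ∈ Submodule.span F (psiFamily α (q + 3) χ lam hl), WeightZero α (q + 3) χ lam hl ψ ∧
        φ - ψ ∈ Ider α (q + 3) χ lam hl := by
    intro i φ h
    rcases h.mem_Ider_or hp hα with h | ⟨ψ, hψ, h⟩
    · exact ⟨0, Submodule.zero_mem _, weightZero_zero, by simpa using h⟩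
    · exact ⟨ψ, Submodule.subset_span hψ, weightZero_of_mem_psiFamily h2 hψ, h⟩
  obtain ⟨φ₀, φ₁, h0, h1, rfl⟩ := exists_of_mem_Der hφ
  obtain ⟨ψ₀, k0, w0, i0⟩ := key _ _ h0
  obtain ⟨ψ₁, k1, w1, i1⟩ := key _ _ h1
  refine ⟨φ₀ + φ₁ - (ψ₀ + ψ₁), ?_, ?_, ψ₀ + ψ₁, Submodule.add_mem _ k0 k1, by abel⟩
  · have := Submodule.add_mem _ i0 i1
    rwa [sub_add_sub_comm] at this
  · exact hw.sub (w0.add w1)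

theorem not_mem_Ider_psi1 (hp : 3 < q + 3) (hχ : ∀ i, chiF χ i ^ (q + 3) = 0)
    (hs : (fun i => lam (hC i)) = ![2, -2, -2]) {A B : Fin 3 → F} (h0 : A ≠ 0 ∨ B ≠ 0) :
    psi1 α (q + 3) χ lam hl A B ∉ Ider α (q + 3) χ lam hl := by
  intro h
  have hc := core_verma (α := α) (hl := hl) hp hχ
  obtain ⟨m, hm⟩ := exists_inner_of_mem_Ider hp (psi1_mem_zPart A B) h
  simp only [sgn_zero_mul_smul, psi1_bv (two_ne_zero_of_charP hp) hs] at hm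
  have := hc.psi1c_param hp hs hm
  exact h0.elim (fun h => h this.1) fun h => h this.2

/-- If an inner cocycle vanishes on 𝔥 ⊕ 𝔫⁻, its vector m is an invariant of weight zero. When the
lowest monomial has nonzero weight this forces m = 0, so the whole cocycle vanishes. -/
theorem Core.eq_zero_of_inner {Z : Type*} [AddCommGroup Z] [Module F Z] {lam : Fin 3 → F}
    {a : Idx → Module.End F Z} {v : Z} {p : ℕ} [CharP F p] (hp : 3 < p) (hc : Core p α lam a v)
    (h0 : botWt lam ≠ 0) {φ : Idx → Z} {m : Z} (h : ∀ b, φ b = a b m)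
    (hφ : ∀ b ∉ posIdx, φ b = 0) {b : Idx} {c : F} (hb : φ b = c • bot p a v) : c = 0 := by
  have := hc.eq_zero_of_invariant hp h0 (m := m)
    (fun b hb => by rw [← h]; exact hφ b (by revert b; decide))
    (fun i => by rw [← h]; exact hφ _ (by fin_cases i <;> decide))
  rw [h, this, map_zero] at hb
  exact (smul_eq_zero.1 hb.symm).resolve_right hc.bot_ne_zero

theorem botWt_special_ne_zero {p : ℕ} [Fact p.Prime] [CharP F p] (hp : 3 < p) {lam : Fin 3 → F}
    (h : lam = ![2, -2, 0] ∨ lam = ![2, 0, -2] ∨ lam = ![3, -3, -3]) : botWt lam ≠ 0 := by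
  have h0 : (0 : Fin 3 → F) = wtF F h1 := by funext i; simp [wtF, wt]
  rw [h0]
  rcases h with h | h | h
  · exact ne_wtF hp (botWt_special.2.1 h) (by decide)
  · exact ne_wtF hp (botWt_special.2.2.1 h) (by decide)
  · exact ne_wtF hp (botWt_special.2.2.2 h) (by decide)

theorem not_mem_Ider_psi2 (hp : 3 < q + 3) (hχ : ∀ i, chiF χ i ^ (q + 3) = 0)
    (hs : (fun i => lam (hC i)) = ![2, -2, 0]) {c : F} (h0 : c ≠ 0) :
    psi2 α (q + 3) χ lam hl c ∉ Ider α (q + 3) χ lam hl := by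
  intro h
  have hc := core_verma (α := α) (hl := hl) hp hχ
  obtain ⟨m, hm⟩ := exists_inner_of_mem_Ider hp (psi2_mem_zPart c) h
  simp only [sgn_zero_mul_smul, psi2_bv (two_ne_zero_of_charP hp) hs] at hm
  exact h0 (hc.eq_zero_of_inner hp (botWt_special_ne_zero hp (Or.inl hs)) hm
    (fun b hb => psi2c_eq_zero hb) (b := e3) rfl)

theorem not_mem_Ider_psi3 (hp : 3 < q + 3) (hχ : ∀ i, chiF χ i ^ (q + 3) = 0)
    (hs : (fun i => lam (hC i)) = ![2, 0, -2]) {c : F} (h0 : c ≠ 0) :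
    psi3 α (q + 3) χ lam hl c ∉ Ider α (q + 3) χ lam hl := by
  intro h
  have hc := core_verma (α := α) (hl := hl) hp hχ
  obtain ⟨m, hm⟩ := exists_inner_of_mem_Ider hp (psi3_mem_zPart c) h
  simp only [sgn_zero_mul_smul, psi3_bv (two_ne_zero_of_charP hp) hs] at hm
  exact h0 (hc.eq_zero_of_inner hp (botWt_special_ne_zero hp (Or.inr (Or.inl hs))) hm
    (fun b hb => psi3c_eq_zero hb) (b := e2) rfl)

theorem not_mem_Ider_psi4 (hp : 3 < q + 3) (hχ : ∀ i, chiF χ i ^ (q + 3) = 0)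
    (hs : (fun i => lam (hC i)) = ![3, -3, -3]) {c : F} (h0 : c ≠ 0) :
    psi4 α (q + 3) χ lam hl c ∉ Ider α (q + 3) χ lam hl := by
  intro h
  have hc := core_verma (α := α) (hl := hl) hp hχ
  obtain ⟨m, hm⟩ := exists_inner_of_mem_Ider hp (psi4_mem_zPart c) h
  simp only [psi4_bv (two_ne_zero_of_charP hp) hs] at hm
  exact h0 (hc.eq_zero_of_inner hp (botWt_special_ne_zero hp (Or.inr (Or.inr hs))) hm
    (fun b hb => psi4c_eq_zero hb) (b := x4) rfl)

end Main

/-! ### Values of ψ₁ at the special weights of ψ₂ and ψ₃ -/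

section Values

variable {α : F} {q : ℕ} {χ : Module.Dual F (gPart F 0)} {lam : Module.Dual F (cartan F)}
  {hl : Admissible (q + 3) χ lam}

set_option maxHeartbeats 1000000 in
theorem psi1_eq_zero {A B : Fin 3 → F} (hA : ∀ i, A i = 0) (hB : ∀ i, B i = 0) :
    psi1 α (q + 3) χ lam hl A B = 0 := by
  refine linearMap_eq_of_bv fun b => ?_
  rw [LinearMap.zero_apply]
  cases b <;> simp only [psi1, lc_bv, hA, hB, mul_zero, zero_smul, neg_zero, add_zero, sub_zero]

variable [CharP F (q + 3)]

/-- Values of `ψ₁` at `λ = (2, -2, 0)`. -/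
theorem psi1_values₂ (hp : 3 < q + 3) (hs : (fun i => lam (hC i)) = ![2, -2, 0])
    (A B : Fin 3 → F) :
    psi1 α (q + 3) χ lam hl A B (bv f1) = B 0 • fpow (zact α (q + 3) χ lam hl) 0 (q + 2) 0
        (yvec (zact α (q + 3) χ lam hl) (vac α (q + 3) χ lam hl) 1 1 1 1) ∧
    psi1 α (q + 3) χ lam hl A B (bv f2) = B 1 • fpow (zact α (q + 3) χ lam hl) (q + 2) 0 0
        (yvec (zact α (q + 3) χ lam hl) (vac α (q + 3) χ lam hl) 1 1 1 1) ∧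
    psi1 α (q + 3) χ lam hl A B (bv f3) = B 2 • fpow (zact α (q + 3) χ lam hl) (q + 2) (q + 2) 1
        (yvec (zact α (q + 3) χ lam hl) (vac α (q + 3) χ lam hl) 1 1 1 1) ∧
    (∀ i, psi1 α (q + 3) χ lam hl A B (bv (hIdx i)) =
      A i • fpow (zact α (q + 3) χ lam hl) (q + 2) (q + 2) 0
        (yvec (zact α (q + 3) χ lam hl) (vac α (q + 3) χ lam hl) 1 1 1 1)) ∧
    psi1 α (q + 3) χ lam hl A B (bv e3) =
      -(A 2 • fpow (zact α (q + 3) χ lam hl) (q + 2) (q + 2) (q + 2)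
        (yvec (zact α (q + 3) χ lam hl) (vac α (q + 3) χ lam hl) 1 1 1 1)) := by
  obtain ⟨⟨r0, r1, r2⟩, p0, p1, p2⟩ := resid_small F q
  have h2 : (2 : F) ≠ 0 := two_ne_zero_of_charP hp
  have r3 : resid (1 : F) = 1 := resid_eq (p := q + 3) (by omega) Nat.cast_one
  have p3 : IsPrimeElt (1 : F) := ⟨1, Nat.cast_one⟩
  have s0 : lam (hC 0) = 2 := congrFun hs 0
  have s1 : lam (hC 1) = -2 := congrFun hs 1
  have s2 : lam (hC 2) = 0 := congrFun hs 2
  have d1 : (-2 : F) / 2 = -1 := by field_simp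
  have d2 : (2 : F) / 2 = 1 := by field_simp
  classical
  refine ⟨?_, ?_, ?_, fun i => ?_, ?_⟩
  on_goal 4 => fin_cases i
  all_goals
    simp only [psi1, lc_bv, hIdx, w_eq, expo1, expo2, expo3, s0, s1, s2, Matrix.cons_val]
    norm_num [d1, d2, r0, r1, r2, r3, p0, p1, p2, p3]
    try rfl

/-- Values of `ψ₁` at `λ = (2, 0, -2)`. -/
theorem psi1_values₃ (hp : 3 < q + 3) (hs : (fun i => lam (hC i)) = ![2, 0, -2])
    (A B : Fin 3 → F) :
    psi1 α (q + 3) χ lam hl A B (bv f1) = B 0 • fpow (zact α (q + 3) χ lam hl) 0 0 (q + 2)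
        (yvec (zact α (q + 3) χ lam hl) (vac α (q + 3) χ lam hl) 1 1 1 1) ∧
    psi1 α (q + 3) χ lam hl A B (bv f2) = B 1 • fpow (zact α (q + 3) χ lam hl) (q + 2) 1 (q + 2)
        (yvec (zact α (q + 3) χ lam hl) (vac α (q + 3) χ lam hl) 1 1 1 1) ∧
    psi1 α (q + 3) χ lam hl A B (bv f3) = B 2 • fpow (zact α (q + 3) χ lam hl) (q + 2) 0 0
        (yvec (zact α (q + 3) χ lam hl) (vac α (q + 3) χ lam hl) 1 1 1 1) ∧
    (∀ i, psi1 α (q + 3) χ lam hl A B (bv (hIdx i)) =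
      A i • fpow (zact α (q + 3) χ lam hl) (q + 2) 0 (q + 2)
        (yvec (zact α (q + 3) χ lam hl) (vac α (q + 3) χ lam hl) 1 1 1 1)) ∧
    (B 0 = 0 → psi1 α (q + 3) χ lam hl A B (bv e2) =
      -(A 1 • fpow (zact α (q + 3) χ lam hl) (q + 2) (q + 2) (q + 2)
        (yvec (zact α (q + 3) χ lam hl) (vac α (q + 3) χ lam hl) 1 1 1 1))) := by
  obtain ⟨⟨r0, r1, r2⟩, p0, p1, p2⟩ := resid_small F q
  have h2 : (2 : F) ≠ 0 := two_ne_zero_of_charP hp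
  have r3 : resid (1 : F) = 1 := resid_eq (p := q + 3) (by omega) Nat.cast_one
  have p3 : IsPrimeElt (1 : F) := ⟨1, Nat.cast_one⟩
  have s0 : lam (hC 0) = 2 := congrFun hs 0
  have s1 : lam (hC 1) = 0 := congrFun hs 1
  have s2 : lam (hC 2) = -2 := congrFun hs 2
  have d1 : (-2 : F) / 2 = -1 := by field_simp
  have d2 : (2 : F) / 2 = 1 := by field_simp
  classical
  refine ⟨?_, ?_, ?_, fun i => ?_, fun hB => ?_⟩
  on_goal 4 => fin_cases i
  on_goal 7 =>
    simp only [psi1, lc_bv, hB, mul_zero, zero_smul, add_zero]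
  all_goals
    simp only [psi1, lc_bv, hIdx, w_eq, expo1, expo2, expo3, s0, s1, s2, Matrix.cons_val]
    norm_num [d1, d2, r0, r1, r2, r3, p0, p1, p2, p3]
    try rfl

end Values

/-! ### Outer maps occur only at special weights -/

section Outer

variable {α : F} {q : ℕ} {χ : Module.Dual F (gPart F 0)} {lam : Module.Dual F (cartan F)}
  {hl : Admissible (q + 3) χ lam} [Fact (q + 3).Prime] [CharP F (q + 3)]

theorem chiF_pow_of_isOuter (hp : 3 < q + 3) {φ : G F →ₗ[F] Verma α (q + 3) χ lam hl}
    (h : IsOuter α (q + 3) χ lam hl φ) (i : Fin 3) : chiF χ i ^ (q + 3) = 0 := by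
  by_contra h0
  exact h.2 (mem_Ider_of_chi_ne hp (Or.inl ⟨i, h0⟩) h.1)

/-- This treats ψ₂, ψ₃, ψ₄ away from their special weights: a superderivation that vanishes on 𝔥 ⊕
𝔫⁻ and cannot be nonzero at a simple root is zero. -/
theorem mem_Ider_of_vanishing (hp : 3 < q + 3) (hα : 1 + α ≠ 0)
    (hχ : ∀ i, chiF χ i ^ (q + 3) = 0) {i : ZMod 2} {φ : G F →ₗ[F] Verma α (q + 3) χ lam hl}
    (hφ : ∀ b, φ (bv b) ∈ zPart α (q + 3) χ lam hl (i + par b)) (hd : φ ∈ Der α (q + 3) χ lam hl)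
    (h0 : ∀ b ∉ posIdx, φ (bv b) = 0)
    (h : ∀ b ∈ simpleIdx, φ (bv b) = 0 ∨ botWt (fun i => lam (hC i)) ≠ wtF F b) :
    φ ∈ Ider α (q + 3) χ lam hl := by
  have hc := core_verma (α := α) (hl := hl) hp hχ
  have hz := hc.eq_zero_of_simple hp hα (isHomDer_iff.1 (isHomDer_of_mem_Der hp hφ hd)).2
    (fun b hb => by rw [h0 b (by revert b; decide), smul_zero])
    (fun j => by rw [h0 _ (by fin_cases j <;> decide), smul_zero])
    (fun b hb => (h b hb).imp_left fun h => by rw [h, smul_zero])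
  exact mem_Ider_of_inner hp hφ (m := 0) fun b => by rw [hz, map_zero]

theorem isOuter_psi2 (hp : 3 < q + 3) (hα : 1 + α ≠ 0) {c : F}
    (h : IsOuter α (q + 3) χ lam hl (psi2 α (q + 3) χ lam hl c)) :
    (fun i => lam (hC i)) = ![2, -2, 0] ∧ c ≠ 0 := by
  constructor
  · by_contra hs
    refine h.2 (mem_Ider_of_vanishing hp hα (chiF_pow_of_isOuter hp h) (psi2_mem_zPart c) h.1 ?_ ?_)
    · intro b hb
      revert hb
      cases b <;> intro hb <;> first
        | exact absurd hb (by decide)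
        | simp only [psi2, lc_bv]
    · intro b hb
      simp only [simpleIdx, List.mem_cons, List.not_mem_nil, or_false] at hb
      rcases hb with rfl | rfl | rfl
      · left; simp only [psi2, lc_bv]
      · right; exact fun h => hs (lam_of_botWt.1 h)
      · left; simp only [psi2, lc_bv]
  · rintro rfl
    refine h.2 ?_
    convert Submodule.zero_mem _
    refine linearMap_eq_of_bv fun b => ?_
    cases b <;> simp [psi2, lc_bv]

theorem isOuter_psi3 (hp : 3 < q + 3) (hα : 1 + α ≠ 0) {c : F}
    (h : IsOuter α (q + 3) χ lam hl (psi3 α (q + 3) χ lam hl c)) :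
    (fun i => lam (hC i)) = ![2, 0, -2] ∧ c ≠ 0 := by
  constructor
  · by_contra hs
    refine h.2 (mem_Ider_of_vanishing hp hα (chiF_pow_of_isOuter hp h) (psi3_mem_zPart c) h.1 ?_ ?_)
    · intro b hb
      revert hb
      cases b <;> intro hb <;> first
        | exact absurd hb (by decide)
        | simp only [psi3, lc_bv]
    · intro b hb
      simp only [simpleIdx, List.mem_cons, List.not_mem_nil, or_false] at hb
      rcases hb with rfl | rfl | rfl
      · right; exact fun h => hs (lam_of_botWt.2.1 h)
      · left; simp only [psi3, lc_bv]
      · left; simp only [psi3, lc_bv]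
  · rintro rfl
    refine h.2 ?_
    convert Submodule.zero_mem _
    refine linearMap_eq_of_bv fun b => ?_
    cases b <;> simp [psi3, lc_bv]

theorem isOuter_psi4 (hp : 3 < q + 3) (hα : 1 + α ≠ 0) {c : F}
    (h : IsOuter α (q + 3) χ lam hl (psi4 α (q + 3) χ lam hl c)) :
    (fun i => lam (hC i)) = ![3, -3, -3] ∧ c ≠ 0 := by
  constructor
  · by_contra hs
    refine h.2 (mem_Ider_of_vanishing hp hα (chiF_pow_of_isOuter hp h) (psi4_mem_zPart c) h.1 ?_ ?_)
    · intro b hb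
      revert hb
      cases b <;> intro hb <;> first
        | exact absurd hb (by decide)
        | simp only [psi4, lc_bv]
    · intro b hb
      simp only [simpleIdx, List.mem_cons, List.not_mem_nil, or_false] at hb
      rcases hb with rfl | rfl | rfl
      · left; simp only [psi4, lc_bv]
      · left; simp only [psi4, lc_bv]
      · right; exact fun h => hs (lam_of_botWt.2.2 h)
  · rintro rfl
    refine h.2 ?_
    convert Submodule.zero_mem _
    refine linearMap_eq_of_bv fun b => ?_
    cases b <;> simp [psi4, lc_bv]

/-- Away from λ = (2,-2,-2) the classification makes ψ₁ inner up to a map ψ₂, ψ₃ or ψ₄. The multiple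
of ψ₂ or ψ₃ is zero by the computation with the vector of weight zero, and ψ₄ has the wrong parity,
so ψ₁ would be inner. -/
theorem isOuter_psi1 (hp : 3 < q + 3) (hα : 1 + α ≠ 0) {A B : Fin 3 → F}
    (h : IsOuter α (q + 3) χ lam hl (psi1 α (q + 3) χ lam hl A B)) :
    (fun i => lam (hC i)) = ![2, -2, -2] ∧ (A ≠ 0 ∨ B ≠ 0) := by
  constructor
  · have hχ := chiF_pow_of_isOuter hp h
    have hc := core_verma (α := α) (hl := hl) hp hχ
    have hd := isHomDer_iff.1 (isHomDer_of_mem_Der hp (psi1_mem_zPart A B) h.1)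
    have ky : B 0 = 0 → psi1 α (q + 3) χ lam hl A B (bv y1) = 0 ∧
        psi1 α (q + 3) χ lam hl A B (bv y2) = 0 ∧ psi1 α (q + 3) χ lam hl A B (bv y3) = 0 ∧
        psi1 α (q + 3) χ lam hl A B (bv y4) = 0 := fun hB => by
      simp only [psi1, lc_bv, hB, mul_zero, zero_smul, neg_zero, and_self]
    obtain ⟨m, k | ⟨hs, -⟩ | ⟨hs, c, k⟩ | ⟨hs, c, k⟩ | ⟨hs, c, k⟩⟩ := hc.classify hp hα hd.2
      (hc.coc_psi1c hp hα) (hc.coc_psi2c hp hα) (hc.coc_psi3c hp hα) (hc.coc_psi4c hp hα)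
    · exact absurd (mem_Ider_of_inner hp hd.1 k) h.2
    · exact hs
    · simp only [sgn_zero_mul_smul] at k
      obtain ⟨k0, k1, k2, kh, ke⟩ := psi1_values₂ (hl := hl) hp hs A B
      obtain rfl := hc.psi2c_coeff_eq_zero hp hs
        (ψ := fun b => psi1 α (q + 3) χ lam hl A B (bv b)) k0 k2 k1 kh ky ke k
      refine absurd (mem_Ider_of_inner hp hd.1 (m := m) fun b => ?_) h.2
      rw [sgn_zero_mul_smul, k]
      cases b <;> simp [psi2c]
    · simp only [sgn_zero_mul_smul] at k
      obtain ⟨k0, k1, k2, kh, ke⟩ := psi1_values₃ (hl := hl) hp hs A B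
      obtain rfl := hc.psi3c_coeff_eq_zero hp hs
        (ψ := fun b => psi1 α (q + 3) χ lam hl A B (bv b)) k0 k1 k2 kh ky ke k
      refine absurd (mem_Ider_of_inner hp hd.1 (m := m) fun b => ?_) h.2
      rw [sgn_zero_mul_smul, k]
      cases b <;> simp [psi3c]
    · rcases mem_Ider_of_plain hp hd.1 (psi4_mem_zPart c) (m := m) (fun b => by
        rw [k, psi4_bv (two_ne_zero_of_charP hp) hs]) with h' | h'
      · exact absurd h' h.2
      · exact absurd h'.1 (by decide)
  · by_contra h0
    push Not at h0
    obtain ⟨rfl, rfl⟩ := h0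
    refine h.2 ?_
    rw [psi1_eq_zero (A := 0) (B := 0) (fun _ => rfl) fun _ => rfl]
    exact Submodule.zero_mem _

end Outer

end D21

end

theorem proposition3p5 {F : Type*} [Field F] [IsAlgClosed F] (p : ℕ) [Fact p.Prime] [CharP F p]
    (hp : 3 < p) (α : F) (hα0 : α ≠ 0) (hα1 : α ≠ -1)
    (χ : Module.Dual F (D21.gPart F 0)) (lam : Module.Dual F (D21.cartan F))
    (hl : D21.Admissible p χ lam) (hf : D21.chiF χ 0 ^ p = 0) :
    -- the decomposition of superderivations of weight zero
    (∀ φ ∈ D21.Der α p χ lam hl, D21.WeightZero α p χ lam hl φ →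
      ∃ φ₁ ∈ D21.Ider α p χ lam hl, D21.WeightZero α p χ lam hl φ₁ ∧
        ∃ φ₂ ∈ Submodule.span F (D21.psiFamily α p χ lam hl), φ = φ₁ + φ₂) ∧
    -- for the special weights the maps are homogeneous superderivations of weight zero
    (D21.Special p χ lam ![2 * p + 2, 2 * p - 2, 2 * p - 2] → ∀ a b,
      D21.IsHomDer α p χ lam hl 0 (D21.psi1 α p χ lam hl a b) ∧
        D21.WeightZero α p χ lam hl (D21.psi1 α p χ lam hl a b)) ∧
    (D21.Special p χ lam ![2 * p + 2, 2 * p - 2, 2 * p] → ∀ c,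
      D21.IsHomDer α p χ lam hl 0 (D21.psi2 α p χ lam hl c) ∧
        D21.WeightZero α p χ lam hl (D21.psi2 α p χ lam hl c)) ∧
    (D21.Special p χ lam ![2 * p + 2, 2 * p, 2 * p - 2] → ∀ c,
      D21.IsHomDer α p χ lam hl 0 (D21.psi3 α p χ lam hl c) ∧
        D21.WeightZero α p χ lam hl (D21.psi3 α p χ lam hl c)) ∧
    (D21.Special p χ lam ![2 * p + 3, 2 * p - 3, 2 * p - 3] → ∀ c,
      D21.IsHomDer α p χ lam hl 1 (D21.psi4 α p χ lam hl c) ∧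
        D21.WeightZero α p χ lam hl (D21.psi4 α p χ lam hl c)) ∧
    -- the maps are outer exactly for the special weights and nonzero parameters
    (∀ a b, D21.IsOuter α p χ lam hl (D21.psi1 α p χ lam hl a b) ↔
      D21.Special p χ lam ![2 * p + 2, 2 * p - 2, 2 * p - 2] ∧ (a ≠ 0 ∨ b ≠ 0)) ∧
    (∀ c, D21.IsOuter α p χ lam hl (D21.psi2 α p χ lam hl c) ↔
      D21.Special p χ lam ![2 * p + 2, 2 * p - 2, 2 * p] ∧ c ≠ 0) ∧
    (∀ c, D21.IsOuter α p χ lam hl (D21.psi3 α p χ lam hl c) ↔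
      D21.Special p χ lam ![2 * p + 2, 2 * p, 2 * p - 2] ∧ c ≠ 0) ∧
    (∀ c, D21.IsOuter α p χ lam hl (D21.psi4 α p χ lam hl c) ↔
      D21.Special p χ lam ![2 * p + 3, 2 * p - 3, 2 * p - 3] ∧ c ≠ 0) := by
  -- The explicit formulas involve the exponents p - 1, p - 2 and, in intermediate steps, p - 3;
  -- writing p = q + 3 avoids truncated subtraction.
  obtain ⟨q, rfl⟩ : ∃ q, p = q + 3 := ⟨p - 3, by omega⟩
  have hα : 1 + α ≠ 0 := fun h => hα1 (eq_neg_of_add_eq_zero_right h)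
  have h2 : (2 : F) ≠ 0 := D21.two_ne_zero_of_charP hp
  obtain ⟨s1, s2, s3, s4⟩ := D21.special_iffs (p := q + 3) χ lam
  have hder := fun hχ => D21.isHomDer_psi (α := α) (hl := hl) hp hα hχ
  rw [s1, s2, s3, s4]
  refine ⟨fun φ hφ hw => D21.exists_decomposition hp hα hφ hw, fun h A B => ?_, fun h c => ?_,
    fun h c => ?_, fun h c => ?_, fun A B => ⟨fun h => ?_, fun h => ?_⟩,
    fun c => ⟨fun h => ?_, fun h => ?_⟩, fun c => ⟨fun h => ?_, fun h => ?_⟩,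
    fun c => ⟨fun h => ?_, fun h => ?_⟩⟩
  · exact ⟨(hder h.2).1 h.1 A B, D21.weightZero_of_isWt (D21.isWt_psi1 h2 A B)⟩
  · exact ⟨(hder h.2).2.1 h.1 c, D21.weightZero_of_isWt (D21.isWt_psi2 h2 c)⟩
  · exact ⟨(hder h.2).2.2.1 h.1 c, D21.weightZero_of_isWt (D21.isWt_psi3 h2 c)⟩
  · exact ⟨(hder h.2).2.2.2 h.1 c, D21.weightZero_of_isWt (D21.isWt_psi4 h2 c)⟩
  · have k := D21.isOuter_psi1 hp hα h
    exact ⟨⟨k.1, D21.chiF_pow_of_isOuter hp h⟩, k.2⟩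
  · exact ⟨Submodule.subset_span ⟨0, (hder h.1.2).1 h.1.1 A B⟩,
      D21.not_mem_Ider_psi1 hp h.1.2 h.1.1 h.2⟩
  · have k := D21.isOuter_psi2 hp hα h
    exact ⟨⟨k.1, D21.chiF_pow_of_isOuter hp h⟩, k.2⟩
  · exact ⟨Submodule.subset_span ⟨0, (hder h.1.2).2.1 h.1.1 c⟩,
      D21.not_mem_Ider_psi2 hp h.1.2 h.1.1 h.2⟩
  · have k := D21.isOuter_psi3 hp hα h
    exact ⟨⟨k.1, D21.chiF_pow_of_isOuter hp h⟩, k.2⟩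
  · exact ⟨Submodule.subset_span ⟨0, (hder h.1.2).2.2.1 h.1.1 c⟩,
      D21.not_mem_Ider_psi3 hp h.1.2 h.1.1 h.2⟩
  · have k := D21.isOuter_psi4 hp hα h
    exact ⟨⟨k.1, D21.chiF_pow_of_isOuter hp h⟩, k.2⟩
  · exact ⟨Submodule.subset_span ⟨1, (hder h.1.2).2.2.2 h.1.1 c⟩,
      D21.not_mem_Ider_psi4 hp h.1.2 h.1.1 h.2⟩
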